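/- Conventions. Let $M$ be a complex manifold of complex dimension $n$ with complex structure $J$. A vector $v$ and a covector $\xi$ act on differential forms by $(v+\xi)\cdot\varphi=i_v\varphi+\xi\wedge\varphi$; put $\langle v+\xi,u+\eta\rangle=\tfrac12(\xi(u)+\eta(v))$ and $\langle\alpha,\beta\rangle_s=(\alpha\wedge\sigma\beta)_{[2n]}$, where $\sigma=+1$ in degrees $\equiv 0,1$ and $\sigma=-1$ in degrees $\equiv 2,3 \pmod 4$. A generalized complex structure is a smooth orthogonal endomorphism $\mathcal J$ of $T\oplus T^*$ with $\mathcal J^2=-1$ whose $(-\sqrt{-1})$-eigenbundle $E_{\mathcal J}\subset(T\oplus T^*)\otimes\mathbb C$ is involutive for the Courant bracket. A complex form $\varphi$ induces $\mathcal J$ if $E_{\mathcal J}=\{e : e\cdot\varphi=0\}$; such $\varphi$ are the local generators of the canonical line bundle $K_{\mathcal J}$. Put $\mathcal J_J(v+\xi)=Jv-\xi\circ J$. A generalized Kähler structure is a pair of commuting generalized complex structures $\mathcal J_1,\mathcal J_2$ such that $\langle-\mathcal J_1\mathcal J_2\,\cdot,\cdot\rangle$ is positive definite. For $\psi=e^{b+\sqrt{-1}\omega}$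 with $b,\omega$ real closed 2-forms, inducing $\mathcal J_\psi$ such that $(\mathcal J,\mathcal J_\psi)$ is generalized Kähler, the generalized Ricci form is $\mathrm{GRic}=-P$, where $P,Q$ are the real 2-forms with $$d\big((-2\mathcal J\eta+\mathcal J\,d\log\rho)\cdot\overline\psi\big)=(P-\sqrt{-1}\,Q)\wedge\overline\psi$$ for every smooth local generator $\varphi$ of $K_{\mathcal J}$, with $\eta$ the real section of $T\oplus T^*$ such that $d\varphi=\eta\cdot\varphi$ and $\rho>0$ the function such that $\langle\varphi,\overline\varphi\rangle_s=\rho\,\langle\psi,\overline\psi\rangle_s$. The pair $(\mathcal J,\psi)$ is generalized Kähler–Einstein if $\mathrm{GRic}=\lambda\omega$ for a constant $\lambda$. Proposition. Let $(M,J,\omega)$ be a Kähler manifold with metric $g$ and Kähler form $\omega(u,v)=g(u,Jv)$, and suppose it is Kähler–Einstein, $\mathrm{Ric}=\kappa g$ with $\kappa\in\mathbb R$. Let the real torus $T^m$ ($m\ge2$) act smoothly on $M$ preserving $J$ and $\omega$, with a moment map $\mu$, i.e. $i_{V_\zeta}\omega=d\langle\mu,\zeta\rangle$ for every $\zeta$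 in the Lie algebra $\mathfrak t^m$, where $V_\zeta$ is the vector field generated by $\zeta$. Let $V_1,\dots,V_m$ be the real vector fields generated by a basis of $\mathfrak t^m$, let $\lambda_{ij}\in\mathbb R$, and suppose that $\beta_{\mathbb R}=\sum_{i,j}\lambda_{ij}V_i\wedge V_j$ (acting on forms by $\sum\lambda_{ij}\,i_{V_i}i_{V_j}$) is not identically zero. Let $\beta=\sum_{i,j}\lambda_{ij}V_i^{1,0}\wedge V_j^{1,0}$, where $V_i^{1,0}=\frac12(V_i-\sqrt{-1}JV_i)$, and for $t\in\mathbb R$ put $$\mathcal J_{\beta t}=e^{\beta_{\mathbb R}t}\,\mathcal J_J\,e^{-\beta_{\mathbb R}t},\qquad \psi_t=e^{\beta_{\mathbb R}t}\cdot e^{\sqrt{-1}\omega}.$$ Then $\beta$ is a holomorphic Poisson structure, and $(\mathcal J_{\beta 0},\psi_0)=(\mathcal J_J,e^{\sqrt{-1}\omega})$. For every $t\in\mathbb R$, $\mathcal J_{\beta t}$ is the Poisson deformation of $\mathcal J_J$ by $\beta t$, that is, at every point $e^{\beta t}\cdot\Omega$ induces $\mathcal J_{\beta t}$ whenever $\Omega$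 induces $\mathcal J_J$ there; moreover $\psi_t=e^{b_t+\sqrt{-1}\omega}$ for a real closed 2-form $b_t$, $d\psi_t=0$, $(\mathcal J_{\beta t},\mathcal J_{\psi_t})$ is a generalized Kähler structure, and $(\mathcal J_{\beta t},\psi_t)$ is generalized Kähler–Einstein with $$\mathrm{GRic}=2\kappa\,\omega .$$ The deformations are nontrivial: for every $t\ne0$, $\mathcal J_{\beta t}$ is not equivalent, under the action of a diffeomorphism of $M$ and a closed real 2-form ($b$-field), to $\mathcal J_{J'}$ for any almost complex structure $J'$ on $M$ (in particular not to $\mathcal J_J$). -/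

import Mathlib

open scoped Manifold ContDiff TensorProduct

/-! Make instance search find the standard charted space structure of a model space directly. -/

attribute [instance 2000] chartedSpaceSelf

noncomputable section

namespace GKE

/-! ### Linear algebra of one tangent space

A complex `n`-dimensional manifold is modelled on `ℂⁿ = Fin n → ℂ`; in Mathlib every tangent space
`T_x M` is (a copy of) the model space, and the complex structure `J` is multiplication by `i`. -/

/-- The model of the tangent spaces. -/
abbrev Cn (n : ℕ) : Type := Fin n → ℂ

/-- Real covectors. -/
abbrev Cov (n : ℕ) : Type := Cn n →L[ℝ] ℝ

/-- The fibre of `T ⊕ T*`; the element `(v, ξ)` is `v + ξ`. -/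
abbrev GT (n : ℕ) : Type := Cn n × Cov n

/-- The fibre of the bundle of real differential forms (of mixed degree). -/
abbrev RForm (n : ℕ) : Type := ExteriorAlgebra ℝ (Module.Dual ℝ (Cn n))

/-- The fibre of the bundle of complex differential forms (of mixed degree). -/
abbrev CForm (n : ℕ) : Type := ℂ ⊗[ℝ] RForm n

/-- Real forms of degree `k`. -/
abbrev degreePart (n k : ℕ) : Submodule ℝ (RForm n) := ⋀[ℝ]^k (Module.Dual ℝ (Cn n))

/-- A real form regarded as a complex form. -/
def toC {n : ℕ} : RForm n →ₐ[ℝ] CForm n := Algebra.TensorProduct.includeRight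

/-- Complex conjugation of forms. -/
def conjF {n : ℕ} : CForm n →ₐ[ℝ] CForm n :=
  Algebra.TensorProduct.map Complex.conjAe.toAlgHom (AlgHom.id ℝ (RForm n))

/-- Interior product `i_v` on real forms. -/
def rint {n : ℕ} (v : Cn n) : RForm n →ₗ[ℝ] RForm n :=
  CliffordAlgebra.contractLeft (Q := (0 : QuadraticForm ℝ (Module.Dual ℝ (Cn n))))
    (Module.Dual.eval ℝ (Cn n) v)

/-- Interior product `i_v` on complex forms. -/
def cint {n : ℕ} (v : Cn n) : Module.End ℂ (CForm n) := (rint v).baseChange ℂ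

/-- Exterior multiplication by a real covector. -/
def wedgeCov {n : ℕ} (ξ : Cov n) : Module.End ℂ (CForm n) :=
  LinearMap.mulLeft ℂ (toC (ExteriorAlgebra.ι ℝ (ξ : Module.Dual ℝ (Cn n))))

/-- The spin representation: `(v + ξ) · φ = i_v φ + ξ ∧ φ`. -/
def cliff {n : ℕ} (a : GT n) : Module.End ℂ (CForm n) := cint a.1 + wedgeCov a.2

/-- The covector `i_u ω` of a real 2-form `ω`: its value at `v` is the scalar `i_v i_u ω`. -/
def contr {n : ℕ} (ω₀ : RForm n) (u : Cn n) : Cov n :=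
  LinearMap.toContinuousLinearMap
    { toFun := fun v => ExteriorAlgebra.algebraMapInv (rint v (rint u ω₀))
      map_add' := fun v w => by simp [rint]
      map_smul' := fun c v => by simp [rint] }

/-- The value `ω(u, v)` of a real 2-form. -/
def eval2 {n : ℕ} (ω₀ : RForm n) (u v : Cn n) : ℝ := contr ω₀ u v

/-- The Clifford involution `σ` (reversal of products of covectors): the sign is `+` in degrees
`0, 1` and `-` in degrees `2, 3` modulo `4`. -/
def sigma {n : ℕ} : CForm n →ₗ[ℂ] CForm n :=
  (CliffordAlgebra.reverse (Q := (0 : QuadraticForm ℝ (Module.Dual ℝ (Cn n))))).baseChange ℂ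

/-- The component of degree `2n` of a form. -/
def topPart {n : ℕ} : CForm n →ₗ[ℂ] CForm n :=
  (GradedAlgebra.proj (degreePart n) (2 * n)).baseChange ℂ

/-- The pairing `⟨α, β⟩_s = (α ∧ σ β)_[2n]` of the spin representation. -/
def mukai {n : ℕ} (α β : CForm n) : CForm n := topPart (α * sigma β)

/-- `exp a = ∑ aᵏ / k!`, summed up to `k = n`. It is applied only to 2-forms and to bivectors
acting on forms in real dimension `2n`, whose `(n+1)`-st powers vanish. -/
def nexp (n : ℕ) {A : Type*} [Ring A] [Algebra ℂ A] (a : A) : A :=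
  ∑ k ∈ Finset.range (n + 1), ((Nat.factorial k : ℂ)⁻¹) • a ^ k

/-- The bilinear form `⟨v + ξ, u + η⟩ = (ξ(u) + η(v)) / 2` on `T ⊕ T*`. -/
def pair {n : ℕ} (a b : GT n) : ℝ := (a.2 b.1 + b.2 a.1) / 2

/-- `a + i b` (with `a`, `b` real) lies in `E_𝒥`, the eigenspace of `𝒥` on `(T ⊕ T*) ⊗ ℂ` for the
eigenvalue `-i`, that is, `𝒥 (a + i b) = -i (a + i b)`. -/
def InE {n : ℕ} (𝒥 : GT n →ₗ[ℝ] GT n) (a b : GT n) : Prop := 𝒥 a = b ∧ 𝒥 b = -a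

/-- The spinor `φ` induces `𝒥`: the annihilator `{e ∈ (T ⊕ T*) ⊗ ℂ | e · φ = 0}` is `E_𝒥`. -/
def Induces {n : ℕ} (φ : CForm n) (𝒥 : GT n →ₗ[ℝ] GT n) : Prop :=
  ∀ a b : GT n, cliff a φ + Complex.I • cliff b φ = 0 ↔ InE 𝒥 a b

/-- The complex structure `J` of a complex manifold on a tangent space. -/
def stdJ (n : ℕ) : Cn n →L[ℝ] Cn n := Complex.I • ContinuousLinearMap.id ℝ (Cn n)

/-- `𝒥_J (v + ξ) = J v - J* ξ`, where `(J* ξ)(v) = ξ (J v)`. -/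
def ofComplex {n : ℕ} (J : Cn n →L[ℝ] Cn n) : GT n →ₗ[ℝ] GT n where
  toFun a := (J a.1, -(a.2.comp J))
  map_add' a b := by ext <;> simp [add_comm]
  map_smul' c a := by ext <;> simp

/-- The contraction of covectors with the real bivector `β = ∑ λ_ij v_i ∧ v_j`:
`ξ ↦ ∑ λ_ij (ξ(v_j) v_i - ξ(v_i) v_j)`. This is the commutator `[β, ξ]` in the Clifford algebra. -/
def bivSharp {n m : ℕ} (lam : Fin m → Fin m → ℝ) (v : Fin m → Cn n) : Cov n →ₗ[ℝ] Cn n where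
  toFun ξ := ∑ i, ∑ j, lam i j • (ξ (v j) • v i - ξ (v i) • v j)
  map_add' ξ η := by
    simp only [← Finset.sum_add_distrib]
    refine Finset.sum_congr rfl fun i _ => Finset.sum_congr rfl fun j _ => ?_
    simp only [add_apply]
    module
  map_smul' c ξ := by
    simp only [Finset.smul_sum]
    refine Finset.sum_congr rfl fun i _ => Finset.sum_congr rfl fun j _ => ?_
    simp only [smul_apply, smul_eq_mul, RingHom.id_apply]
    module

/-- The adjoint action `v + ξ ↦ e^{tβ} (v + ξ) e^{-tβ} = v + ξ + t [β, ξ]` on `T ⊕ T*`. -/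
def adBiv {n m : ℕ} (lam : Fin m → Fin m → ℝ) (v : Fin m → Cn n) (t : ℝ) : GT n →ₗ[ℝ] GT n :=
  (LinearMap.fst ℝ (Cn n) (Cov n) + t • (bivSharp lam v ∘ₗ LinearMap.snd ℝ (Cn n) (Cov n))).prod
    (LinearMap.snd ℝ (Cn n) (Cov n))

/-- The Clifford action `∑ λ_ij i_{v_i} i_{v_j}` of the real bivector `∑ λ_ij v_i ∧ v_j`. -/
def bivAct {n m : ℕ} (lam : Fin m → Fin m → ℝ) (v : Fin m → Cn n) : Module.End ℂ (CForm n) :=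
  ∑ i, ∑ j, (lam i j : ℂ) • (cint (v i) * cint (v j))

/-- Interior product with the `(1,0)`-part `v^{1,0} = (v - i J v) / 2` of a real vector. -/
def cint10 {n : ℕ} (v : Cn n) : Module.End ℂ (CForm n) :=
  (1 / 2 : ℂ) • (cint v - Complex.I • cint (stdJ n v))

/-- The Clifford action of the complex bivector `∑ λ_ij v_i^{1,0} ∧ v_j^{1,0}`. -/
def bivAct10 {n m : ℕ} (lam : Fin m → Fin m → ℝ) (v : Fin m → Cn n) : Module.End ℂ (CForm n) :=
  ∑ i, ∑ j, (lam i j : ℂ) • (cint10 (v i) * cint10 (v j))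

/-! ### Calculus of forms on open subsets of `ℂⁿ` -/

/-- Coordinates of complex forms with respect to a constant basis of the exterior algebra. -/
def formCoords (n : ℕ) :
    CForm n ≃ₗ[ℂ] (Finset (Fin (Module.finrank ℝ (Module.Dual ℝ (Cn n)))) → ℂ) :=
  (Algebra.TensorProduct.basis ℂ
    (Module.finBasis ℝ (Module.Dual ℝ (Cn n))).ExteriorAlgebra).equivFun

/-- The derivative at `y` in the direction `v` of a form on `ℂⁿ`, coefficient by coefficient. -/
def dirDeriv {n : ℕ} (s : Cn n → CForm n) (y v : Cn n) : CForm n :=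
  (formCoords n).symm (fderiv ℝ (fun z => formCoords n (s z)) y v)

/-- The covectors `dx_j` and `dy_j`, where `z_j = x_j + i y_j`. -/
def dxCov {n : ℕ} (j : Fin n) : Cov n := Complex.reCLM.comp (ContinuousLinearMap.proj (R := ℝ) j)

/-- See `dxCov`. -/
def dyCov {n : ℕ} (j : Fin n) : Cov n := Complex.imCLM.comp (ContinuousLinearMap.proj (R := ℝ) j)

/-- The exterior derivative `d s = ∑_j (dx_j ∧ ∂s/∂x_j + dy_j ∧ ∂s/∂y_j)` of forms on `ℂⁿ`. -/
def flatD {n : ℕ} (s : Cn n → CForm n) (y : Cn n) : CForm n :=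
  ∑ j : Fin n, (wedgeCov (dxCov j) (dirDeriv s y (Pi.single j 1)) +
    wedgeCov (dyCov j) (dirDeriv s y (Pi.single j Complex.I)))

/-- The Courant bracket on `ℂⁿ`,
`[u + ξ, v + η] = [u, v] + L_u η - L_v ξ - (d i_u η - d i_v ξ) / 2`,
where `(L_u η)(w) = (D_u η)(w) + η (D_w u)`. -/
def flatCourant {n : ℕ} (a b : Cn n → GT n) (y : Cn n) : GT n :=
  let u := fun z => (a z).1
  let ξ := fun z => (a z).2
  let v := fun z => (b z).1
  let η := fun z => (b z).2
  (VectorField.lieBracket ℝ u v y,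
    (fderiv ℝ η y (u y) + (η y).comp (fderiv ℝ u y))
      - (fderiv ℝ ξ y (v y) + (ξ y).comp (fderiv ℝ v y))
      - (1 / 2 : ℝ) • (fderiv ℝ (fun z => η z (u z)) y - fderiv ℝ (fun z => ξ z (v z)) y))

/-! ### Sections over a complex manifold

Sections of a bundle are functions to the fibre, the value at `x` being expressed in the preferred
chart at `x` (this is Mathlib's convention for tangent vectors). -/

section Manifold

variable {n : ℕ} {M : Type*} [TopologicalSpace M] [ChartedSpace (Cn n) M]

/-- The chart at `x₀`, as a partial map `M → ℂⁿ`. -/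
abbrev chartC (x₀ : M) : PartialEquiv M (Cn n) := extChartAt 𝓘(ℝ, Cn n) x₀

/-- The derivative at `x` of the chart at `x₀`. -/
def dChart (x₀ x : M) : Cn n →L[ℝ] Cn n := mfderiv 𝓘(ℝ, Cn n) 𝓘(ℝ, Cn n) (chartC (n := n) x₀) x

/-- The derivative at `y` of the inverse of the chart at `x₀`. -/
def dChartSymm (x₀ : M) (y : Cn n) : Cn n →L[ℝ] Cn n :=
  mfderiv 𝓘(ℝ, Cn n) 𝓘(ℝ, Cn n) (chartC (n := n) x₀).symm y

/-- Pull-back of complex forms under a linear map. -/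
def pullC (A : Cn n →L[ℝ] Cn n) : CForm n →ₐ[ℂ] CForm n :=
  Algebra.TensorProduct.map (AlgHom.id ℂ ℂ)
    (ExteriorAlgebra.map (LinearMap.dualMap (A : Cn n →ₗ[ℝ] Cn n)))

/-- The expression of a form in the chart at `x₀`. -/
def formRep (x₀ : M) (s : M → CForm n) (y : Cn n) : CForm n :=
  pullC (dChartSymm x₀ y) (s ((chartC (n := n) x₀).symm y))

/-- The expression of a section of `T ⊕ T*` in the chart at `x₀`. -/
def gtRep (x₀ : M) (a : M → GT n) (y : Cn n) : GT n :=
  let x := (chartC (n := n) x₀).symm y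
  (dChart x₀ x (a x).1, (a x).2.comp (dChartSymm x₀ y))

/-- Smoothness of a form on `U`. -/
def SmoothForm (s : M → CForm n) (U : Set M) : Prop :=
  ∀ x₀ : M, ContDiffOn ℝ ∞ (fun y => formCoords n (formRep x₀ s y))
    ((chartC (n := n) x₀).target ∩ (chartC (n := n) x₀).symm ⁻¹' U)

/-- Smoothness of a section of `T ⊕ T*` on `U`. -/
def SmoothGT (a : M → GT n) (U : Set M) : Prop :=
  ∀ x₀ : M, ContDiffOn ℝ ∞ (gtRep x₀ a)
    ((chartC (n := n) x₀).target ∩ (chartC (n := n) x₀).symm ⁻¹' U)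

/-- The exterior derivative of a form on `M`, computed at each point in the chart at the point. -/
def dForm (s : M → CForm n) (x : M) : CForm n := flatD (formRep x s) (chartC (n := n) x x)

/-- The Courant bracket, computed at each point in the chart at the point. -/
def courant (a b : M → GT n) (x : M) : GT n :=
  flatCourant (gtRep x a) (gtRep x b) (chartC (n := n) x x)

/-- The differential of a real function, as a covector. -/
def dReal (f : M → ℝ) (x : M) : Cov n := mfderiv 𝓘(ℝ, Cn n) 𝓘(ℝ, ℝ) f x

/-- The differential of a complex function that is holomorphic near `x`. -/
def dHol (f : M → ℂ) (x : M) : Cn n →L[ℂ] ℂ := mfderiv 𝓘(ℂ, Cn n) 𝓘(ℂ, ℂ) f x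

/-- A smooth real 2-form with vanishing exterior derivative. -/
structure IsClosedTwoForm (b : M → RForm n) : Prop where
  degree : ∀ x, b x ∈ degreePart n 2
  smooth : SmoothForm (fun x => toC (b x)) Set.univ
  closed : ∀ x, dForm (fun x => toC (b x)) x = 0

/-! ### Generalized complex and generalized Kähler structures -/

/-- A generalized complex structure: a smooth orthogonal `𝒥` on `T ⊕ T*` with `𝒥² = -1` such that
the sections of `E_𝒥` are closed under the (complex bilinear) Courant bracket. -/
structure IsGenComplex (𝒥 : M → GT n →ₗ[ℝ] GT n) : Prop where
  smooth : ∀ U : Set M, IsOpen U → ∀ a : M → GT n, SmoothGT a U → SmoothGT (fun x => 𝒥 x (a x)) U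
  sq : ∀ x a, 𝒥 x (𝒥 x a) = -a
  orthogonal : ∀ x a b, pair (𝒥 x a) (𝒥 x b) = pair a b
  involutive : ∀ U : Set M, IsOpen U → ∀ a₁ b₁ a₂ b₂ : M → GT n,
    SmoothGT a₁ U → SmoothGT b₁ U → SmoothGT a₂ U → SmoothGT b₂ U →
    (∀ x ∈ U, InE (𝒥 x) (a₁ x) (b₁ x)) → (∀ x ∈ U, InE (𝒥 x) (a₂ x) (b₂ x)) →
    ∀ x ∈ U, InE (𝒥 x) (courant a₁ a₂ x - courant b₁ b₂ x) (courant a₁ b₂ x + courant b₁ a₂ x)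

/-- A generalized Kähler structure: two commuting generalized complex structures such that
`⟨-𝒥₁ 𝒥₂ a, a⟩` is positive definite. -/
structure IsGenKahler (𝒥₁ 𝒥₂ : M → GT n →ₗ[ℝ] GT n) : Prop where
  left : IsGenComplex 𝒥₁
  right : IsGenComplex 𝒥₂
  comm : ∀ x a, 𝒥₁ x (𝒥₂ x a) = 𝒥₂ x (𝒥₁ x a)
  pos : ∀ x a, a ≠ 0 → 0 < pair (-(𝒥₁ x (𝒥₂ x a))) a

/-- A local trivialization of the canonical bundle `K_𝒥` of a generalized complex structure over the
open set `U`: a smooth spinor `φ` inducing `𝒥`, together with the real section `η` of `T ⊕ T*` such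
that `dφ = η · φ`, and the function `ρ` such that `⟨φ, φ̄⟩_s = ρ ⟨ψ, ψ̄⟩_s`. -/
structure IsTrivialization (𝒥 : M → GT n →ₗ[ℝ] GT n) (ψ : M → CForm n) (U : Set M)
    (φ : M → CForm n) (η : M → GT n) (ρ : M → ℝ) : Prop where
  isOpen : IsOpen U
  smooth : SmoothForm φ U
  induces : ∀ x ∈ U, Induces (φ x) (𝒥 x)
  eta_smooth : SmoothGT η U
  d_eq : ∀ x ∈ U, dForm φ x = cliff (η x) (φ x)
  rho_pos : ∀ x ∈ U, 0 < ρ x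
  rho_eq : ∀ x ∈ U, mukai (φ x) (conjF (φ x)) = (ρ x : ℂ) • mukai (ψ x) (conjF (ψ x))

/-- The form `(-2 𝒥 η + 𝒥 d log ρ) · ψ̄`. -/
def ricciPotential (𝒥 : M → GT n →ₗ[ℝ] GT n) (ψ : M → CForm n) (η : M → GT n) (ρ : M → ℝ)
    (x : M) : CForm n :=
  cliff (-((2 : ℝ) • 𝒥 x (η x)) + 𝒥 x (0, dReal (fun y => Real.log (ρ y)) x)) (conjF (ψ x))

/-- `R` is the generalized Ricci form of `(𝒥, ψ)`: it is a real 2-form, `K_𝒥` is locally trivial, and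
for every local trivialization `d ((-2 𝒥 η + 𝒥 d log ρ) · ψ̄) = (P - i Q) ∧ ψ̄` with `P = -R` and
a real 2-form `Q`. -/
structure IsGenRicciForm (𝒥 : M → GT n →ₗ[ℝ] GT n) (ψ : M → CForm n) (R : M → RForm n) :
    Prop where
  degree : ∀ x, R x ∈ degreePart n 2
  exists_trivialization : ∀ x : M, ∃ U φ η ρ, x ∈ U ∧ IsTrivialization 𝒥 ψ U φ η ρ
  eq : ∀ U φ η ρ, IsTrivialization 𝒥 ψ U φ η ρ → ∃ Q : M → RForm n, ∀ x ∈ U,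
    Q x ∈ degreePart n 2 ∧
    dForm (ricciPotential 𝒥 ψ η ρ) x = (toC (-R x) - Complex.I • toC (Q x)) * conjF (ψ x)

/-- `(𝒥, ψ)` with `ψ = e^{b + iω}` is a generalized Kähler structure of symplectic type which is
generalized Kähler–Einstein: `GRic = l ω`. -/
structure IsGenKahlerEinstein (𝒥 : M → GT n →ₗ[ℝ] GT n) (ψ : M → CForm n) (ω₀ : M → RForm n)
    (l : ℝ) : Prop where
  exp_form : ∃ b : M → RForm n, IsClosedTwoForm b ∧
    ∀ x, ψ x = nexp n (toC (b x) + Complex.I • toC (ω₀ x))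
  symplectic : IsClosedTwoForm ω₀
  closed : ∀ x, dForm ψ x = 0
  kahler : ∃ 𝒥ψ : M → GT n →ₗ[ℝ] GT n, (∀ x, Induces (ψ x) (𝒥ψ x)) ∧ IsGenKahler 𝒥 𝒥ψ
  einstein : IsGenRicciForm 𝒥 ψ (fun x => l • ω₀ x)

/-- The action on `T ⊕ T*` of a diffeomorphism `F` followed by a `b`-field, from the fibre over `x`
to the fibre over `F x`: `v + ξ ↦ F_* v + (F⁻¹)^* ξ + i_{F_* v} b`. -/
def gtMap (F : M ≃ₘ^∞⟮𝓘(ℝ, Cn n), 𝓘(ℝ, Cn n)⟯ M) (b : M → RForm n) (x : M) (a : GT n) : GT n :=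
  let A : Cn n →L[ℝ] Cn n := mfderiv 𝓘(ℝ, Cn n) 𝓘(ℝ, Cn n) F x
  let B : Cn n →L[ℝ] Cn n := mfderiv 𝓘(ℝ, Cn n) 𝓘(ℝ, Cn n) F.symm (F x)
  (A a.1, a.2.comp B + contr (b (F x)) (A a.1))

/-- Two almost generalized complex structures on `M` are equivalent if they are related by a
diffeomorphism and a closed `b`-field. -/
def GenEquivalent (𝒥 𝒥' : M → GT n →ₗ[ℝ] GT n) : Prop :=
  ∃ (F : M ≃ₘ^∞⟮𝓘(ℝ, Cn n), 𝓘(ℝ, Cn n)⟯ M) (b : M → RForm n), IsClosedTwoForm b ∧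
    ∀ x a, 𝒥' (F x) (gtMap F b x a) = gtMap F b x (𝒥 x a)

/-! ### Kähler–Einstein manifolds -/

/-- `ω` is the Kähler form of a Kähler metric `g` on the complex manifold `M`, with the convention
`ω(u, v) = g(u, J v)`, that is, `g(u, v) = ω(J u, v)`. -/
structure IsKahler (ω₀ : M → RForm n) : Prop where
  closed : IsClosedTwoForm ω₀
  invariant : ∀ x u v, eval2 (ω₀ x) (stdJ n u) (stdJ n v) = eval2 (ω₀ x) u v
  pos : ∀ x u, u ≠ 0 → 0 < eval2 (ω₀ x) (stdJ n u) u

/-- The Kähler metric. -/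
def metric (ω₀ : M → RForm n) (x : M) (u v : Cn n) : ℝ := eval2 (ω₀ x) (stdJ n u) v

/-- The matrix of the Hermitian metric `h(u, v) = g(u, v) - i g(J u, v)` in the holomorphic
coordinates given by the chart at `x₀`. -/
def hermMatrix (ω₀ : M → RForm n) (x₀ : M) (y : Cn n) : Matrix (Fin n) (Fin n) ℂ :=
  Matrix.of fun j k =>
    let x := (chartC (n := n) x₀).symm y
    let u : Cn n := dChartSymm x₀ y (Pi.single j 1)
    let v : Cn n := dChartSymm x₀ y (Pi.single k 1)
    (metric ω₀ x u v : ℂ) - Complex.I * (metric ω₀ x (stdJ n u) v : ℂ)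

/-- The logarithm of the determinant of the Hermitian metric in the chart at `x₀`. -/
def logDet (ω₀ : M → RForm n) (x₀ : M) (y : Cn n) : ℝ :=
  Real.log (hermMatrix ω₀ x₀ y).det.re

/-- The second derivative of `log det h` at `x`, in the chart at `x`. -/
def hessLogDet (ω₀ : M → RForm n) (x : M) (u v : Cn n) : ℝ :=
  fderiv ℝ (fun z => fderiv ℝ (logDet ω₀ x) z v) (chartC (n := n) x x) u

/-- The Ricci tensor of a Kähler metric, `Ric_{j k̄} = -∂_j ∂_{k̄} log det h` in holomorphic
coordinates; in real terms `Ric(u, v) = -(D²f(u, v) + D²f(J u, J v)) / 2` with `f = log det h`. -/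
def ricci (ω₀ : M → RForm n) (x : M) (u v : Cn n) : ℝ :=
  -((hessLogDet ω₀ x u v + hessLogDet ω₀ x (stdJ n u) (stdJ n v)) / 2)

/-- The Kähler metric is Einstein: `Ric = κ g`. -/
def IsEinstein (ω₀ : M → RForm n) (κ : ℝ) : Prop :=
  ∀ x u v, ricci ω₀ x u v = κ * metric ω₀ x u v

/-! ### Torus actions and Poisson structures -/

variable {m : ℕ}

/-- The exponential map of the torus `T^m` (the product of `m` circles) with Lie algebra `ℝ^m`. -/
def torusExp (ζ : Fin m → ℝ) : Fin m → Circle := fun i => Circle.exp (ζ i)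

variable [MulAction (Fin m → Circle) M]

/-- The derivative of the action of a torus element. -/
def dAct (g : Fin m → Circle) (x : M) : Cn n →L[ℝ] Cn n :=
  mfderiv 𝓘(ℝ, Cn n) 𝓘(ℝ, Cn n) (fun x : M => g • x) x

/-- A smooth action of `T^m` preserving the Kähler structure `(J, ω)`. Smoothness is expressed
through the covering `ℝ^m → T^m`. -/
structure IsKahlerTorusAction (ω₀ : M → RForm n) : Prop where
  smooth : ContMDiff (𝓘(ℝ, Fin m → ℝ).prod 𝓘(ℝ, Cn n)) 𝓘(ℝ, Cn n) ∞
    (fun p : (Fin m → ℝ) × M => torusExp p.1 • p.2)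
  preserves_J : ∀ (g : Fin m → Circle) (x : M) (u : Cn n),
    dAct g x (stdJ n u) = stdJ n (dAct g x u)
  preserves_form : ∀ (g : Fin m → Circle) (x : M) (u v : Cn n),
    eval2 (ω₀ (g • x)) (dAct g x u) (dAct g x v) = eval2 (ω₀ x) u v

/-- The vector field on `M` generated by the element `ζ` of the Lie algebra of `T^m`. -/
def fundField (ζ : Fin m → ℝ) (x : M) : Cn n :=
  (mfderiv 𝓘(ℝ, ℝ) 𝓘(ℝ, Cn n) (fun s : ℝ => torusExp (s • ζ) • x) 0 : ℝ →L[ℝ] Cn n) 1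

/-- `μ` is a moment map: `i_{V_ζ} ω = d ⟨μ, ζ⟩` for every `ζ` in the Lie algebra. -/
structure IsMomentMap (ω₀ : M → RForm n) (μ : M → Module.Dual ℝ (Fin m → ℝ)) : Prop where
  smooth : ∀ ζ, ContMDiff 𝓘(ℝ, Cn n) 𝓘(ℝ, ℝ) ∞ (fun x => μ x ζ)
  d_eq : ∀ ζ x, contr (ω₀ x) (fundField ζ x) = dReal (fun y => μ y ζ) x

end Manifold

section Deformation

variable {n m : ℕ} {M : Type*} [TopologicalSpace M] [ChartedSpace (Cn n) M]

/-- The bracket `{f, g} = β(df, dg)` of holomorphic functions defined by the bivector field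
`β = ∑ λ_ij V_i^{1,0} ∧ V_j^{1,0}`, where `df (V^{1,0}) = df (V)` for holomorphic `f`. -/
def holBracket (lam : Fin m → Fin m → ℝ) (V : Fin m → M → Cn n) (f g : M → ℂ) (x : M) : ℂ :=
  ∑ i, ∑ j, (lam i j : ℂ) *
    (dHol (n := n) f x (V i x) * dHol (n := n) g x (V j x)
      - dHol (n := n) f x (V j x) * dHol (n := n) g x (V i x))

/-- `β = ∑ λ_ij V_i^{1,0} ∧ V_j^{1,0}` is a holomorphic Poisson structure: on each open set, the
bracket of two holomorphic functions is holomorphic, and the Jacobi identity holds. -/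
def IsHolPoisson (lam : Fin m → Fin m → ℝ) (V : Fin m → M → Cn n) : Prop :=
  ∀ U : Set M, IsOpen U → ∀ f g h : M → ℂ,
    MDifferentiableOn 𝓘(ℂ, Cn n) 𝓘(ℂ, ℂ) f U → MDifferentiableOn 𝓘(ℂ, Cn n) 𝓘(ℂ, ℂ) g U →
    MDifferentiableOn 𝓘(ℂ, Cn n) 𝓘(ℂ, ℂ) h U →
    MDifferentiableOn 𝓘(ℂ, Cn n) 𝓘(ℂ, ℂ) (holBracket lam V f g) U ∧
    ∀ x ∈ U, holBracket lam V f (holBracket lam V g h) x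
      + holBracket lam V g (holBracket lam V h f) x
      + holBracket lam V h (holBracket lam V f g) x = 0

/-- `𝒥_{βt} = e^{t β_ℝ} 𝒥_J e^{-t β_ℝ}` with `β_ℝ = ∑ λ_ij V_i ∧ V_j`. -/
def deformedJ (lam : Fin m → Fin m → ℝ) (V : Fin m → M → Cn n) (t : ℝ) (x : M) :
    GT n →ₗ[ℝ] GT n :=
  adBiv lam (fun i => V i x) t ∘ₗ ofComplex (stdJ n) ∘ₗ adBiv lam (fun i => V i x) (-t)

/-- `ψ_t = e^{t β_ℝ} · e^{iω}`. -/
def deformedPsi (ω₀ : M → RForm n) (lam : Fin m → Fin m → ℝ) (V : Fin m → M → Cn n) (t : ℝ)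
    (x : M) : CForm n :=
  nexp n ((t : ℂ) • bivAct lam (fun i => V i x)) (nexp n (Complex.I • toC (ω₀ x)))

/-- `𝒥` is the Poisson deformation of `𝒥_J` at time `t` by `β = ∑ λ_ij V_i^{1,0} ∧ V_j^{1,0}`: if a
spinor `Ω` induces `𝒥_J` at `x` (a nonzero form of type `(n,0)`), then `e^{tβ} · Ω` induces `𝒥`. -/
def IsPoissonDeformation (lam : Fin m → Fin m → ℝ) (V : Fin m → M → Cn n) (t : ℝ)
    (𝒥 : M → GT n →ₗ[ℝ] GT n) : Prop :=
  ∀ (x : M) (Ω : CForm n), Induces Ω (ofComplex (stdJ n)) →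
    Induces (nexp n ((t : ℂ) • bivAct10 lam (fun i => V i x)) Ω) (𝒥 x)

end Deformation

end GKE

end

open GKE
open scoped Manifold ContDiff

/-! # Generalized Kähler–Einstein structures from toric Poisson deformations

Everything is read off from pure spinors. The exponential `e^{tβ}` of the real bivector acts on forms
and, compatibly with the Clifford action, as an orthogonal transformation of `T ⊕ T*`
(`expBiv_cliff`). Hence a spinor inducing `𝒥` is moved to one inducing `e^{tβ} 𝒥 e^{-tβ}`
(`induces_expBiv`), and commutation and positivity of a pair of structures are preserved pointwise.
On a spinor of `𝒥_J` only the `(2,0)` part of the bivector acts, which gives the comparison with the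
holomorphic Poisson deformation (`exp_bivAct10_eq`).

*The spinor `ψ_t`.* The form `ω(V_ζ, V_ζ')` is the derivative of a moment map component along an orbit
and is constant on that orbit; periodicity forces it to vanish, so the torus orbits are isotropic
(`isotropic`). On an isotropic span `e^{tβ} · e^{iω} = e^{b + iω}` (`expBiv_nexp`), where
`b = t ∑ λ_ij dμ_j ∧ dμ_i` is visibly closed.

*Integrability.* In holomorphic coordinates the fundamental fields are commuting and holomorphic, and
then `d (e^{tβ} Ω) = t i_W (e^{tβ} Ω)` for `Ω = dz_1 ∧ ⋯ ∧ dz_n`, where `W` is built from the complex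
divergences of the `V_i`; the terms of second order in `t` cancel because the fields commute
(`flatD_expBiv_hvol`). Since the Courant bracket is a derived bracket, the annihilator of a spinor
with `dφ = η · φ` is involutive (`flatCourant_involutive`).

*The Einstein equation.* The pairing of spinors is invariant under `e^{tβ}` (`mukai_expBiv`). So for
the generator `φ = c e^{tβ} Ω` the function `ρ` is `|c|² / det h`, up to a constant
(`rho_eq_normSq`). The flow of `V_i` preserves the volume, whence `V_i (log det h) = -2 Re div V_i`
(`fderiv_logDet_fieldRep`); with this `-2 𝒥 η + 𝒥 d log ρ` becomes a real combination of the `V_i`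
plus the covector `d log det h ∘ J` plus an exact covector that depends on the choice of `c`
(`potential_eq`, `eta_smul`). The `V_i` are killed by `b` and contribute only to `Q`, so that
`P = d (d log det h ∘ J) = -2κ ω` by the Einstein equation (`hess_eq_of_isEinstein`,
`dForm_ricciPotential`).

*The Poisson structure.* A bivector with constant coefficients in commuting holomorphic fields
satisfies the Jacobi identity (`jacobi_of_commute`). Second derivatives of holomorphic functions of
several variables exist by Cauchy's integral formula (`differentiableAt_fderiv_apply`).

*Nontriviality.* Each `𝒥_{J'}` preserves `T*`, and diffeomorphisms and `b`-fields respect `T*`. If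
`𝒥_{βt}` were equivalent to some `𝒥_{J'}` with `t ≠ 0`, then `J β + β J* = 0`, so the image of `β`
would be `J`-invariant; but it lies in the span of the `V_i`, which is isotropic for `ω` and contains
no complex line. Hence `β = 0` (`bivSharp_eq_zero_of_anticomm`, `not_genEquivalent`). -/

noncomputable section

namespace GKE

variable {n m : ℕ}

/-! ### Algebra of complex forms -/

/-- Induction for complex forms: a property that is stable under complex linear combinations and
holds for real forms holds for all forms. -/
theorem cform_induction {P : CForm n → Prop} (hr : ∀ x, P (toC x))
    (hadd : ∀ X Y, P X → P Y → P (X + Y)) (hsmul : ∀ (c : ℂ) X, P X → P (c • X)) (X : CForm n) :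
    P X := by
  induction X using TensorProduct.induction_on with
  | zero => simpa using hr 0
  | tmul z x =>
    have : z ⊗ₜ[ℝ] x = z • toC x := by
      simp [toC, TensorProduct.smul_tmul']
    rw [this]; exact hsmul _ _ (hr x)
  | add X Y hX hY => exact hadd _ _ hX hY

/-- A real covector as a complex form of degree one. -/
def ιc : Cov n →ₗ[ℝ] CForm n :=
  (toC (n := n)).toLinearMap ∘ₗ ExteriorAlgebra.ι ℝ ∘ₗ
    ((LinearMap.toContinuousLinearMap (𝕜 := ℝ) (E := Cn n) (F' := ℝ)).symm : Cov n →ₗ[ℝ] _)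

theorem ιc_apply (ξ : Cov n) :
    ιc ξ = toC (ExteriorAlgebra.ι ℝ (ξ : Module.Dual ℝ (Cn n))) := rfl

theorem real_smul_eq (r : ℝ) (X : CForm n) : r • X = (r : ℂ) • X := by
  rw [← algebraMap_smul ℂ r X]; rfl

theorem toC_smul (r : ℝ) (x : RForm n) : toC (r • x) = (r : ℂ) • toC x := by
  rw [map_smul, real_smul_eq]

theorem toC_ι (ξ : Module.Dual ℝ (Cn n)) :
    toC (ExteriorAlgebra.ι ℝ ξ) = ιc (LinearMap.toContinuousLinearMap ξ) := rfl

theorem ιc_smul (r : ℝ) (ξ : Cov n) : ιc (r • ξ) = (r : ℂ) • ιc ξ := by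
  rw [map_smul, real_smul_eq]

/-- Every complex form is obtained from `1` by linear combinations and exterior multiplication by
covectors. -/
theorem cform_left_induction {P : CForm n → Prop} (h1 : P 1)
    (hadd : ∀ X Y, P X → P Y → P (X + Y)) (hsmul : ∀ (c : ℂ) X, P X → P (c • X))
    (hmul : ∀ (ξ : Cov n) X, P X → P (ιc ξ * X)) (X : CForm n) : P X := by
  refine cform_induction (fun x => ?_) hadd hsmul X
  induction x using CliffordAlgebra.left_induction with
  | algebraMap r =>
    have : toC (algebraMap ℝ (RForm n) r) = (r : ℂ) • (1 : CForm n) := by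
      rw [AlgHom.commutes, Algebra.algebraMap_eq_smul_one, real_smul_eq]
    erw [this]; exact hsmul _ _ h1
  | add x y hx hy => rw [map_add]; exact hadd _ _ hx hy
  | ι_mul x m hx => rw [map_mul]; exact hmul (LinearMap.toContinuousLinearMap m) _ hx

theorem cneg_mul (X Y : CForm n) : -X * Y = -(X * Y) := by
  rw [eq_neg_iff_add_eq_zero, ← add_mul, neg_add_cancel, zero_mul]

theorem cmul_neg (X Y : CForm n) : X * -Y = -(X * Y) := by
  rw [eq_neg_iff_add_eq_zero, ← mul_add, neg_add_cancel, mul_zero]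

theorem neg_one_csmul (X : CForm n) : (-1 : ℂ) • X = -X := by
  rw [neg_smul, one_smul]

theorem clin_ext {F : Type*} [AddCommGroup F] [Module ℂ F] {f g : CForm n →ₗ[ℂ] F}
    (h : ∀ x, f (toC x) = g (toC x)) : f = g := by
  refine LinearMap.ext fun X => ?_
  induction X using cform_induction with
  | hr x => exact h x
  | hadd X Y hX hY => rw [map_add, map_add, hX, hY]
  | hsmul c X hX => rw [map_smul, map_smul, hX]

/-- A complex-valued real-linear form on the tangent space, as a complex form of degree one. -/
def ιz : (Cn n →L[ℝ] ℂ) →ₗ[ℂ] CForm n where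
  toFun ζ := ιc (Complex.reCLM.comp ζ) + Complex.I • ιc (Complex.imCLM.comp ζ)
  map_add' ζ ζ' := by
    simp only [ContinuousLinearMap.comp_add, map_add, smul_add]; abel
  map_smul' c ζ := by
    have h1 : Complex.reCLM.comp (c • ζ) =
        c.re • Complex.reCLM.comp ζ - c.im • Complex.imCLM.comp ζ := by
      ext v; simp
    have h2 : Complex.imCLM.comp (c • ζ) =
        c.re • Complex.imCLM.comp ζ + c.im • Complex.reCLM.comp ζ := by
      ext v; simp
    simp only [h1, h2, map_sub, map_add, ιc_smul, RingHom.id_apply, smul_add, smul_smul]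
    conv_rhs => rw [← Complex.re_add_im c]
    generalize ιc (Complex.reCLM.comp ζ) = X
    generalize ιc (Complex.imCLM.comp ζ) = Y
    have hI' : ((c.im : ℂ) • Y) = -((c.im * Complex.I * Complex.I) • Y) := by
      rw [mul_assoc, Complex.I_mul_I]; simp
    rw [hI']
    module

theorem ιz_apply (ζ : Cn n →L[ℝ] ℂ) :
    ιz ζ = ιc (Complex.reCLM.comp ζ) + Complex.I • ιc (Complex.imCLM.comp ζ) := rfl

theorem ιc_eq_ιz (ξ : Cov n) : ιc ξ = ιz (Complex.ofRealCLM.comp ξ) := by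
  rw [ιz_apply]
  have h1 : Complex.reCLM.comp (Complex.ofRealCLM.comp ξ) = ξ := by ext v; simp
  have h2 : Complex.imCLM.comp (Complex.ofRealCLM.comp ξ) = 0 := by ext v; simp
  rw [h1, h2]; simp

/-! #### Interior products -/

theorem cint_toC (v : Cn n) (x : RForm n) : cint v (toC x) = toC (rint v x) := by
  simp [cint, toC]

theorem cint_add (u v : Cn n) : cint (u + v) = cint u + cint v := by
  refine clin_ext fun x => ?_
  simp [cint_toC, rint]

theorem cint_smul (r : ℝ) (v : Cn n) : cint (r • v) = (r : ℂ) • cint v := by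
  refine clin_ext fun x => ?_
  simp only [cint_toC, LinearMap.smul_apply, ← toC_smul]
  simp [rint]

theorem cint_zero : cint (0 : Cn n) = 0 := by
  simpa using cint_smul (0 : ℝ) (0 : Cn n)

theorem cint_neg (v : Cn n) : cint (-v) = -cint v := by
  refine LinearMap.ext fun X => ?_
  have := cint_smul (-1 : ℝ) v
  rw [neg_one_smul] at this
  rw [this, LinearMap.smul_apply, Complex.ofReal_neg, Complex.ofReal_one, neg_one_csmul,
    LinearMap.neg_apply]

theorem cint_sub (u v : Cn n) : cint (u - v) = cint u - cint v := by
  rw [sub_eq_add_neg, cint_add, cint_neg, sub_eq_add_neg]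

/-- The interior product as a real-linear map of the vector. -/
def cintL : Cn n →ₗ[ℝ] Module.End ℂ (CForm n) where
  toFun := cint
  map_add' := cint_add
  map_smul' r v := by
    rw [cint_smul]
    refine LinearMap.ext fun X => ?_
    simp only [LinearMap.smul_apply, RingHom.id_apply, real_smul_eq]

theorem cint_sum {ι : Type*} (s : Finset ι) (f : ι → Cn n) :
    cint (∑ i ∈ s, f i) = ∑ i ∈ s, cint (f i) := map_sum cintL f s

theorem cint_one (v : Cn n) : cint v (1 : CForm n) = 0 := by
  rw [← map_one (toC (n := n)), cint_toC]
  simp only [rint]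
  erw [CliffordAlgebra.contractLeft_one]; simp

theorem cint_ιc_mul (v : Cn n) (ξ : Cov n) (X : CForm n) :
    cint v (ιc ξ * X) = (ξ v : ℂ) • X - ιc ξ * cint v X := by
  induction X using cform_induction with
  | hr x =>
    rw [ιc_apply, ← map_mul, cint_toC, cint_toC, rint]
    erw [CliffordAlgebra.contractLeft_ι_mul]
    rw [map_sub, toC_smul, map_mul]; rfl
  | hadd X Y hX hY =>
    rw [mul_add, map_add, hX, hY, map_add, mul_add, smul_add]; abel
  | hsmul c X hX =>
    rw [mul_smul_comm, map_smul, hX, map_smul, mul_smul_comm, smul_sub, smul_comm]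

theorem cint_ιz_mul (v : Cn n) (ζ : Cn n →L[ℝ] ℂ) (X : CForm n) :
    cint v (ιz ζ * X) = ζ v • X - ιz ζ * cint v X := by
  rw [ιz_apply, add_mul, map_add, smul_mul_assoc, map_smul, cint_ιc_mul, cint_ιc_mul]
  conv_rhs => rw [← Complex.re_add_im (ζ v)]
  simp only [add_mul, smul_mul_assoc, smul_sub, add_smul, ContinuousLinearMap.comp_apply,
    Complex.reCLM_apply, Complex.imCLM_apply, smul_smul, mul_comm Complex.I]
  abel

theorem cint_ιz (v : Cn n) (ζ : Cn n →L[ℝ] ℂ) : cint v (ιz ζ) = ζ v • 1 := by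
  have := cint_ιz_mul v ζ 1
  rwa [mul_one, cint_one, mul_zero, sub_zero] at this

theorem cint_ιc (v : Cn n) (ξ : Cov n) : cint v (ιc ξ) = (ξ v : ℂ) • 1 := by
  rw [ιc_eq_ιz, cint_ιz]; rfl

theorem cint_comm (u v : Cn n) (X : CForm n) : cint u (cint v X) = -cint v (cint u X) := by
  induction X using cform_induction with
  | hr x =>
    simp only [cint_toC, rint]
    erw [CliffordAlgebra.contractLeft_comm]
    rw [map_neg]
  | hadd X Y hX hY =>
    simp only [map_add, hX, hY]; abel
  | hsmul c X hX =>
    simp only [map_smul, hX, smul_neg]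

theorem ιc_mul_ιc (ξ ξ' : Cov n) : ιc ξ * ιc ξ' = -(ιc ξ' * ιc ξ) := by
  rw [ιc_apply, ιc_apply, ← map_mul toC, ← map_mul toC, ← map_neg]
  congr 1
  exact eq_neg_of_add_eq_zero_left (ExteriorAlgebra.ι_add_mul_swap _ _)

theorem ιz_mul_ιz (ζ ζ' : Cn n →L[ℝ] ℂ) : ιz ζ * ιz ζ' = -(ιz ζ' * ιz ζ) := by
  simp only [ιz_apply, add_mul, mul_add, smul_mul_assoc, mul_smul_comm, neg_add]
  rw [ιc_mul_ιc (Complex.reCLM.comp ζ) (Complex.reCLM.comp ζ'),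
    ιc_mul_ιc (Complex.reCLM.comp ζ) (Complex.imCLM.comp ζ'),
    ιc_mul_ιc (Complex.imCLM.comp ζ) (Complex.reCLM.comp ζ'),
    ιc_mul_ιc (Complex.imCLM.comp ζ) (Complex.imCLM.comp ζ')]
  module

theorem ιz_mul_self (ζ : Cn n →L[ℝ] ℂ) : ιz ζ * ιz ζ = 0 := by
  have h := ιz_mul_ιz ζ ζ
  have h2 : (2 : ℂ) • (ιz ζ * ιz ζ) = 0 := by
    rw [two_smul]; nth_rewrite 1 [h]; simp
  exact (smul_eq_zero.mp h2).resolve_left two_ne_zero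

/-! #### The grading involution -/

/-- The grading involution: the sign `(-1)^k` in degree `k`. -/
def eps : CForm n →ₐ[ℂ] CForm n :=
  Algebra.TensorProduct.map (AlgHom.id ℂ ℂ)
    (CliffordAlgebra.involute (Q := (0 : QuadraticForm ℝ (Module.Dual ℝ (Cn n)))))

theorem eps_ιc (ξ : Cov n) : eps (ιc ξ) = -ιc ξ := by
  rw [ιc_apply, eps, toC]
  simp only [Algebra.TensorProduct.includeRight_apply, Algebra.TensorProduct.map_tmul, map_one]
  erw [CliffordAlgebra.involute_ι]
  rw [TensorProduct.tmul_neg]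

theorem eps_ιz (ζ : Cn n →L[ℝ] ℂ) : eps (ιz ζ) = -ιz ζ := by
  rw [ιz_apply, map_add, map_smul, eps_ιc, eps_ιc]; module

theorem ιc_mul_eq (ξ : Cov n) (X : CForm n) : ιc ξ * X = eps X * ιc ξ := by
  induction X using cform_left_induction with
  | h1 =>
    simp
  | hadd X Y hX hY =>
    rw [mul_add, hX, hY, map_add, add_mul]
  | hsmul c X hX =>
    rw [mul_smul_comm, hX, map_smul, smul_mul_assoc]
  | hmul ξ' X hX =>
    rw [← mul_assoc, ιc_mul_ιc, map_mul, eps_ιc, cneg_mul, cneg_mul, cneg_mul, mul_assoc, hX,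
      mul_assoc]

theorem eps_eps (X : CForm n) : eps (eps X) = X := by
  induction X using cform_left_induction with
  | h1 =>
    simp
  | hadd X Y hX hY =>
    rw [map_add, map_add, hX, hY]
  | hsmul c X hX =>
    rw [map_smul, map_smul, hX]
  | hmul ξ' X hX =>
    rw [map_mul, map_mul, hX, eps_ιc, map_neg, eps_ιc, neg_neg]

theorem cint_eps (v : Cn n) (X : CForm n) : cint v (eps X) = -eps (cint v X) := by
  induction X using cform_left_induction with
  | h1 =>
    simp [cint_one]
  | hadd X Y hX hY =>
    simp only [map_add, hX, hY, neg_add]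
  | hsmul c X hX =>
    simp only [map_smul, hX, smul_neg]
  | hmul ξ' X hX =>
    rw [map_mul, eps_ιc, cneg_mul, map_neg, cint_ιc_mul, cint_ιc_mul, hX, map_sub, map_smul,
      map_mul, eps_ιc, cneg_mul, cmul_neg]

/-- The interior product is a graded derivation. -/
theorem cint_mul (v : Cn n) (X Y : CForm n) :
    cint v (X * Y) = cint v X * Y + eps X * cint v Y := by
  induction X using cform_left_induction with
  | h1 =>
    simp [cint_one]
  | hadd X Z hX hY =>
    simp only [map_add, add_mul, hX, hY]; abel
  | hsmul c X hX =>
    simp only [map_smul, smul_mul_assoc, hX, smul_add]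
  | hmul ξ' X hX =>
    rw [mul_assoc, cint_ιc_mul, hX, cint_ιc_mul, map_mul, eps_ιc]
    simp only [sub_mul, mul_add, smul_mul_assoc, cneg_mul, mul_assoc]
    abel

/-! #### Complex conjugation and reversal -/

theorem conjF_toC (x : RForm n) : conjF (toC x) = toC x := by
  simp [conjF, toC]

theorem conjF_smul (c : ℂ) (X : CForm n) :
    conjF (c • X) = (starRingEnd ℂ) c • conjF X := by
  induction X using TensorProduct.induction_on with
  | zero => simp
  | tmul z x => simp [conjF, TensorProduct.smul_tmul']
  | add X Y hX hY => rw [smul_add, map_add, hX, hY, map_add, smul_add]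

theorem conjF_ιc (ξ : Cov n) : conjF (ιc ξ) = ιc ξ := conjF_toC _

theorem conjF_cint (v : Cn n) (X : CForm n) : conjF (cint v X) = cint v (conjF X) := by
  induction X using cform_induction with
  | hr x =>
    rw [cint_toC, conjF_toC, conjF_toC, cint_toC]
  | hadd X Y hX hY =>
    simp only [map_add, hX, hY]
  | hsmul c X hX =>
    rw [map_smul, conjF_smul, conjF_smul, map_smul, hX]

theorem conjF_conjF (X : CForm n) : conjF (conjF X) = X := by
  induction X using cform_induction with
  | hr x =>
    rw [conjF_toC, conjF_toC]
  | hadd X Y hX hY =>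
    simp only [map_add, hX, hY]
  | hsmul c X hX =>
    rw [conjF_smul, conjF_smul, hX, Complex.conj_conj]

theorem sigma_toC (x : RForm n) : sigma (toC x) =
    toC (CliffordAlgebra.reverse (Q := (0 : QuadraticForm ℝ (Module.Dual ℝ (Cn n)))) x) := by
  simp [sigma, toC]

theorem sigma_one : sigma (1 : CForm n) = 1 := by
  rw [← map_one (toC (n := n)), sigma_toC]
  erw [CliffordAlgebra.reverse.map_one]

theorem sigma_ιc (ξ : Cov n) : sigma (ιc ξ) = ιc ξ := by
  rw [ιc_apply, sigma_toC]
  erw [CliffordAlgebra.reverse_ι]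

theorem sigma_mul (X Y : CForm n) : sigma (X * Y) = sigma Y * sigma X := by
  induction X using cform_induction with
  | hr x =>
    induction Y using cform_induction with
    | hr y =>
      rw [← map_mul, sigma_toC, sigma_toC, sigma_toC, ← map_mul]
      erw [CliffordAlgebra.reverse.map_mul]
    | hadd X Z hX hY =>
      simp only [mul_add, map_add, hX, hY, add_mul]
    | hsmul c X hX =>
      simp only [mul_smul_comm, map_smul, hX, smul_mul_assoc]
  | hadd X Z hX hY =>
    simp only [add_mul, map_add, hX, hY, mul_add]
  | hsmul c X hX =>
    simp only [smul_mul_assoc, map_smul, hX, mul_smul_comm]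

theorem sigma_ιz (ζ : Cn n →L[ℝ] ℂ) : sigma (ιz ζ) = ιz ζ := by
  rw [ιz_apply, map_add, map_smul, sigma_ιc, sigma_ιc]

theorem sigma_cint (v : Cn n) (X : CForm n) : sigma (cint v X) = eps (cint v (sigma X)) := by
  induction X using cform_left_induction with
  | h1 =>
    simp [sigma_one, cint_one]
  | hadd X Y hX hY =>
    simp only [map_add, hX, hY]
  | hsmul c X hX =>
    simp only [map_smul, hX]
  | hmul ξ' X hX =>
    rw [cint_ιc_mul, map_sub, map_smul, sigma_mul, sigma_mul, hX, cint_mul, sigma_ιc, cint_ιc]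
    simp only [map_add, map_mul, eps_ιc, eps_eps, map_smul, mul_smul_comm, mul_one,
      cmul_neg]
    abel

/-! #### Pull-back -/

theorem pullC_ιc (A : Cn n →L[ℝ] Cn n) (ξ : Cov n) : pullC A (ιc ξ) = ιc (ξ.comp A) := by
  simp only [ιc_apply, pullC, toC, Algebra.TensorProduct.includeRight_apply,
    Algebra.TensorProduct.map_tmul, map_one, ExteriorAlgebra.map_apply_ι]
  rfl

/-- Pull-back of real forms under a linear map. -/
def pullR (A : Cn n →L[ℝ] Cn n) : RForm n →ₐ[ℝ] RForm n :=
  ExteriorAlgebra.map (LinearMap.dualMap (A : Cn n →ₗ[ℝ] Cn n))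

theorem pullC_toC (A : Cn n →L[ℝ] Cn n) (x : RForm n) : pullC A (toC x) = toC (pullR A x) := by
  simp [pullC, toC, pullR]

theorem pullC_ιz (A : Cn n →L[ℝ] Cn n) (ζ : Cn n →L[ℝ] ℂ) :
    pullC A (ιz ζ) = ιz (ζ.comp A) := by
  rw [ιz_apply, map_add, map_smul, pullC_ιc, pullC_ιc]; rfl

theorem cint_pullC (A : Cn n →L[ℝ] Cn n) (v : Cn n) (X : CForm n) :
    cint v (pullC A X) = pullC A (cint (A v) X) := by
  induction X using cform_left_induction with
  | h1 =>
    simp [cint_one]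
  | hadd X Y hX hY =>
    simp only [map_add, hX, hY]
  | hsmul c X hX =>
    simp only [map_smul, hX]
  | hmul ξ' X hX =>
    rw [map_mul, pullC_ιc, cint_ιc_mul, cint_ιc_mul, hX, map_sub, map_smul, map_mul, pullC_ιc]
    rfl

theorem pullC_pullC (A B : Cn n →L[ℝ] Cn n) (X : CForm n) :
    pullC A (pullC B X) = pullC (B.comp A) X := by
  induction X using cform_left_induction with
  | h1 =>
    simp
  | hadd X Y hX hY =>
    simp only [map_add, hX, hY]
  | hsmul c X hX =>
    simp only [map_smul, hX]
  | hmul ξ' X hX =>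
    rw [map_mul, map_mul, map_mul, hX, pullC_ιc, pullC_ιc, pullC_ιc]; rfl

theorem pullC_id (X : CForm n) : pullC (ContinuousLinearMap.id ℝ (Cn n)) X = X := by
  induction X using cform_left_induction with
  | h1 =>
    simp
  | hadd X Y hX hY =>
    simp only [map_add, hX, hY]
  | hsmul c X hX =>
    simp only [map_smul, hX]
  | hmul ξ' X hX =>
    rw [map_mul, hX, pullC_ιc]; rfl

theorem conjF_pullC (A : Cn n →L[ℝ] Cn n) (X : CForm n) :
    conjF (pullC A X) = pullC A (conjF X) := by
  induction X using cform_induction with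
  | hr x =>
    simp only [pullC_toC, conjF_toC]
  | hadd X Y hX hY =>
    simp only [map_add, hX, hY]
  | hsmul c X hX =>
    simp only [map_smul, conjF_smul, hX]

theorem cliff_apply (a : GT n) (X : CForm n) : cliff a X = cint a.1 X + ιc a.2 * X := rfl

theorem cliff_add (a b : GT n) (X : CForm n) : cliff (a + b) X = cliff a X + cliff b X := by
  simp only [cliff_apply, Prod.fst_add, Prod.snd_add, cint_add, map_add, LinearMap.add_apply,
    add_mul]
  abel

theorem cliff_smul (r : ℝ) (a : GT n) (X : CForm n) : cliff (r • a) X = (r : ℂ) • cliff a X := by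
  simp only [cliff_apply, Prod.smul_fst, Prod.smul_snd, cint_smul, ιc_smul, LinearMap.smul_apply,
    smul_mul_assoc, smul_add]

theorem cliff_neg (a : GT n) (X : CForm n) : cliff (-a) X = -cliff a X := by
  have := cliff_smul (-1) a X
  have h : (-1 : ℝ) • a = -a := by ext <;> simp
  rwa [h, Complex.ofReal_neg, Complex.ofReal_one, neg_one_csmul] at this

theorem cliff_sub (a b : GT n) (X : CForm n) : cliff (a - b) X = cliff a X - cliff b X := by
  rw [sub_eq_add_neg, cliff_add, cliff_neg, sub_eq_add_neg]

/-- The Clifford relation. -/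
theorem cliff_cliff (a b : GT n) (X : CForm n) :
    cliff a (cliff b X) + cliff b (cliff a X) = ((2 * pair a b : ℝ) : ℂ) • X := by
  simp only [cliff_apply, map_add, cint_ιc_mul, pair]
  rw [cint_comm a.1 b.1, ← mul_assoc, ← mul_assoc, ιc_mul_ιc a.2 b.2, cneg_mul]
  push_cast
  have : (2 * (((a.2 b.1 : ℝ) : ℂ) + ((b.2 a.1 : ℝ) : ℂ)) / 2) =
    ((a.2 b.1 : ℝ) : ℂ) + ((b.2 a.1 : ℝ) : ℂ) := by ring
  rw [← mul_div_assoc, this, add_smul]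
  abel

theorem pullC_cliff (A : Cn n →L[ℝ] Cn n) (v : Cn n) (ξ : Cov n) (X : CForm n) :
    pullC A (cliff (A v, ξ) X) = cliff (v, ξ.comp A) (pullC A X) := by
  simp only [cliff_apply, map_add, map_mul, pullC_ιc, cint_pullC]

/-! #### Contraction of a linear family of forms with the coordinate covectors -/

/-- For a linear map `D` from tangent vectors to forms, the form `∑ e^a ∧ D(e_a)`; the exterior
derivative of a form is obtained from its total derivative in this way. -/
def altD (D : Cn n → CForm n) : CForm n :=
  ∑ j : Fin n, (ιc (dxCov j) * D (Pi.single j 1) + ιc (dyCov j) * D (Pi.single j Complex.I))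

theorem vec_expand (w : Cn n) :
    w = ∑ j : Fin n,
      ((w j).re • (Pi.single j 1 : Cn n) + (w j).im • (Pi.single j Complex.I : Cn n)) := by
  ext k
  simp [Finset.sum_apply, Pi.single_apply, Finset.sum_add_distrib, Complex.re_add_im]

theorem lin_expand {F : Type*} [AddCommGroup F] [Module ℝ F] (D : Cn n →ₗ[ℝ] F) (w : Cn n) :
    D w = ∑ j : Fin n, ((w j).re • D (Pi.single j 1) + (w j).im • D (Pi.single j Complex.I)) := by
  conv_lhs => rw [vec_expand w]
  simp only [map_sum, map_add, map_smul]

theorem cov_expand (ξ : Cov n) : ξ = ∑ j : Fin n,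
    (ξ (Pi.single j 1) • dxCov j + ξ (Pi.single j Complex.I) • dyCov j) := by
  ext w
  have := lin_expand (ξ : Cn n →ₗ[ℝ] ℝ) w
  simp only [ContinuousLinearMap.coe_coe] at this
  rw [this]
  simp [dxCov, dyCov, mul_comm]

theorem altD_real (ξ : Cov n) (X : CForm n) : altD (fun w => (ξ w : ℂ) • X) = ιc ξ * X := by
  conv_rhs => rw [cov_expand ξ]
  simp only [altD, map_sum, map_add, ιc_smul, Finset.sum_mul, add_mul, smul_mul_assoc,
    mul_smul_comm]

theorem altD_add (D D' : Cn n → CForm n) : altD (fun w => D w + D' w) = altD D + altD D' := by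
  simp only [altD, mul_add, ← Finset.sum_add_distrib]
  exact Finset.sum_congr rfl fun j _ => by abel

theorem altD_smul (c : ℂ) (D : Cn n → CForm n) : altD (fun w => c • D w) = c • altD D := by
  simp only [altD, mul_smul_comm, Finset.smul_sum, smul_add]

theorem altD_zero : altD (fun _ : Cn n => (0 : CForm n)) = 0 := by simp [altD]

theorem altD_sub (D D' : Cn n → CForm n) : altD (fun w => D w - D' w) = altD D - altD D' := by
  simp only [altD, mul_sub, ← Finset.sum_sub_distrib]
  exact Finset.sum_congr rfl fun j _ => by abel

theorem altD_sum {ι : Type*} (s : Finset ι) (D : ι → Cn n → CForm n) :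
    altD (fun w => ∑ i ∈ s, D i w) = ∑ i ∈ s, altD (D i) := by
  simp only [altD, Finset.mul_sum, ← Finset.sum_add_distrib]
  rw [Finset.sum_comm]

theorem altD_complex (ζ : Cn n →L[ℝ] ℂ) (X : CForm n) : altD (fun w => ζ w • X) = ιz ζ * X := by
  have h : (fun w => ζ w • X) = fun w => (((Complex.reCLM.comp ζ : Cov n) w : ℝ) : ℂ) • X +
      Complex.I • ((((Complex.imCLM.comp ζ : Cov n) w : ℝ) : ℂ) • X) := by
    funext w
    conv_lhs => rw [← Complex.re_add_im (ζ w)]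
    rw [add_smul, mul_comm, mul_smul]; rfl
  rw [h, altD_add, altD_smul, altD_real, altD_real, ιz_apply, add_mul, smul_mul_assoc]

theorem altD_mul_right (D : Cn n → CForm n) (Y : CForm n) :
    altD (fun w => D w * Y) = altD D * Y := by
  simp only [altD, Finset.sum_mul, add_mul, mul_assoc]

theorem altD_mul_left (D : Cn n → CForm n) (X : CForm n) :
    altD (fun w => X * D w) = eps X * altD D := by
  simp only [altD, Finset.mul_sum, mul_add, ← mul_assoc]
  simp only [ιc_mul_eq _ X]

theorem cint_altD (v : Cn n) (D : Cn n →ₗ[ℝ] CForm n) :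
    cint v (altD D) = D v - altD (fun w => cint v (D w)) := by
  rw [lin_expand D v]
  simp only [altD, map_sum, map_add, cint_ιc_mul, ← Finset.sum_sub_distrib, real_smul_eq]
  refine Finset.sum_congr rfl fun j _ => ?_
  simp only [dxCov, dyCov, ContinuousLinearMap.comp_apply, ContinuousLinearMap.proj_apply,
    Complex.reCLM_apply, Complex.imCLM_apply]
  abel

theorem conjF_altD (D : Cn n → CForm n) : conjF (altD D) = altD (fun w => conjF (D w)) := by
  simp only [altD, map_sum, map_add, map_mul, conjF_ιc]

/-- The derivation of the algebra of forms that maps a covector `ξ` to `ξ ∘ A`. -/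
def lieOp (A : Cn n →L[ℝ] Cn n) : Module.End ℂ (CForm n) where
  toFun X := altD (fun w => cint (A w) X)
  map_add' X Y := by simp only [map_add, altD_add]
  map_smul' c X := by simp only [map_smul, altD_smul, RingHom.id_apply]

theorem lieOp_apply (A : Cn n →L[ℝ] Cn n) (X : CForm n) :
    lieOp A X = altD (fun w => cint (A w) X) := rfl

theorem lieOp_mul (A : Cn n →L[ℝ] Cn n) (X Y : CForm n) :
    lieOp A (X * Y) = lieOp A X * Y + X * lieOp A Y := by
  simp only [lieOp_apply, cint_mul]
  rw [altD_add, altD_mul_right, altD_mul_left, eps_eps]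

theorem lieOp_one (A : Cn n →L[ℝ] Cn n) : lieOp A 1 = 0 := by
  simp only [lieOp_apply, cint_one, altD_zero]

theorem lieOp_ιz (A : Cn n →L[ℝ] Cn n) (ζ : Cn n →L[ℝ] ℂ) :
    lieOp A (ιz ζ) = ιz (ζ.comp A) := by
  simp only [lieOp_apply, cint_ιz]
  rw [← mul_one (ιz (ζ.comp A)), ← altD_complex]; rfl

theorem lieOp_ιc (A : Cn n →L[ℝ] Cn n) (ξ : Cov n) : lieOp A (ιc ξ) = ιc (ξ.comp A) := by
  rw [ιc_eq_ιz, lieOp_ιz, ιc_eq_ιz]; rfl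

theorem conjF_lieOp (A : Cn n →L[ℝ] Cn n) (X : CForm n) :
    conjF (lieOp A X) = lieOp A (conjF X) := by
  simp only [lieOp_apply, conjF_altD, conjF_cint]

theorem sigma_lieOp (A : Cn n →L[ℝ] Cn n) (X : CForm n) :
    sigma (lieOp A X) = lieOp A (sigma X) := by
  induction X using cform_left_induction with
  | h1 =>
    simp [sigma_one, lieOp_one]
  | hadd X Y hX hY =>
    simp only [map_add, hX, hY]
  | hsmul c X hX =>
    simp only [map_smul, hX]
  | hmul ξ' X hX =>
    rw [lieOp_mul, map_add, sigma_mul, sigma_mul, sigma_mul, hX, lieOp_mul, lieOp_ιc, sigma_ιc,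
      sigma_ιc, lieOp_ιc]
    abel

/-- `[L_A, i_v] = -i_{Av}`. -/
theorem lieOp_cint (A : Cn n →L[ℝ] Cn n) (v : Cn n) (X : CForm n) :
    lieOp A (cint v X) = cint v (lieOp A X) - cint (A v) X := by
  let D : Cn n →ₗ[ℝ] CForm n :=
    { toFun := fun w => cint (A w) X
      map_add' := fun u w => by simp [cint_add]
      map_smul' := fun r w => by simp [cint_smul, real_smul_eq] }
  have h := cint_altD v D
  have h2 : altD (fun w => cint (A w) (cint v X)) = -altD (fun w => cint v (D w)) := by
    rw [← neg_one_smul ℂ, ← altD_smul]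
    congr 1; funext w; rw [cint_comm]; simp [D]
  rw [lieOp_apply, h2, lieOp_apply]
  change _ = cint v (altD D) - D v
  rw [h]; abel

/-! ### Spinors and their annihilators -/

theorem pair_comm (a b : GT n) : pair a b = pair b a := by
  simp only [pair]; ring

theorem pair_add_left (a b c : GT n) : pair (a + b) c = pair a c + pair b c := by
  simp only [pair, Prod.fst_add, Prod.snd_add, add_apply, map_add]; ring

theorem pair_neg_left (a c : GT n) : pair (-a) c = -pair a c := by
  simp only [pair, Prod.fst_neg, Prod.snd_neg, neg_apply, map_neg]; ring

theorem eq_zero_of_pair {a : GT n} (h : ∀ c, pair a c = 0) : a = 0 := by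
  have h2 : a.2 = 0 := by
    ext v
    have := h (v, 0)
    simp only [pair, zero_apply, add_zero] at this
    simpa using this
  have h1 : a.1 = 0 := by
    by_contra hne
    obtain ⟨j, hj⟩ := Function.ne_iff.mp hne
    have hr := h (0, dxCov j)
    have hi := h (0, dyCov j)
    simp only [pair, map_zero, zero_add, dxCov, dyCov, ContinuousLinearMap.comp_apply,
      ContinuousLinearMap.proj_apply, Complex.reCLM_apply, Complex.imCLM_apply] at hr hi
    exact hj (Complex.ext (by simpa using hr) (by simpa using hi))
  exact Prod.ext h1 h2

/-- A nonzero spinor annihilated by `E_𝒥` induces `𝒥`: a vector outside the maximal isotropic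
subspace `E_𝒥` pairs nontrivially with it, so by the Clifford relation it cannot annihilate the
spinor. -/
theorem induces_of_annihilates {φ : CForm n} {𝒥 : GT n →ₗ[ℝ] GT n} (hsq : ∀ a, 𝒥 (𝒥 a) = -a)
    (horth : ∀ a b, pair (𝒥 a) (𝒥 b) = pair a b) (hφ : φ ≠ 0)
    (h : ∀ c, cliff c φ + Complex.I • cliff (𝒥 c) φ = 0) : Induces φ 𝒥 := by
  intro a b
  constructor
  · intro H
    -- the Clifford relation is applied to `a + i b` and the elements `c + i 𝒥 c` of `E_𝒥`
    have key : ∀ c, pair (a + 𝒥 b) c = 0 := by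
      intro c
      have e1 := congrArg (fun X => cliff c X + Complex.I • cliff (𝒥 c) X) H
      have e2 := congrArg (fun X => cliff a X + Complex.I • cliff b X) (h c)
      simp only [map_add, map_smul, map_zero, smul_zero, add_zero] at e1 e2
      have e3 := congrArg₂ (· + ·) e1 e2
      simp only [smul_add, smul_smul, Complex.I_mul_I] at e3
      have c1 := cliff_cliff c a φ
      have c2 := cliff_cliff c b φ
      have c3 := cliff_cliff (𝒥 c) a φ
      have c4 := cliff_cliff (𝒥 c) b φ
      have e4 : (((2 * pair c a : ℝ) : ℂ) + Complex.I * ((2 * pair c b : ℝ) : ℂ) +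
          Complex.I * ((2 * pair (𝒥 c) a : ℝ) : ℂ) - ((2 * pair (𝒥 c) b : ℝ) : ℂ)) • φ = 0 := by
        rw [sub_smul, add_smul, add_smul, mul_smul, mul_smul, ← c1, ← c2, ← c3, ← c4]
        rw [add_zero] at e3
        rw [← e3]
        simp only [smul_add, neg_smul, one_smul]
        abel
      have e5 := (smul_eq_zero.mp e4).resolve_right hφ
      have e6 := congrArg Complex.re e5
      simp at e6
      have e7 : pair (𝒥 c) b = -pair c (𝒥 b) := by
        have := horth c (𝒥 b)
        rw [hsq] at this
        rw [← this, pair_comm _ (-b), pair_neg_left, pair_comm b]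
        ring
      rw [pair_add_left, pair_comm a, pair_comm (𝒥 b)]
      linarith
    have hab : a = -𝒥 b := eq_neg_of_add_eq_zero_left (eq_zero_of_pair key)
    refine ⟨?_, ?_⟩
    · rw [hab, map_neg, hsq, neg_neg]
    · rw [hab, neg_neg]
  · rintro ⟨h1, -⟩
    rw [← h1]; exact h a

theorem Induces.annihilates {φ : CForm n} {𝒥 : GT n →ₗ[ℝ] GT n} (hφ : Induces φ 𝒥)
    (hsq : ∀ a, 𝒥 (𝒥 a) = -a) (c : GT n) : cliff c φ + Complex.I • cliff (𝒥 c) φ = 0 :=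
  (hφ c (𝒥 c)).mpr ⟨rfl, hsq c⟩

/-! ### Degrees of complex forms -/

/-- `X` has degree `k`: it is an eigenvector with eigenvalue `k` of the derivation that extends the
identity on covectors. Integral `k` make the degree of an interior product meaningful. -/
def IsHom (k : ℤ) (X : CForm n) : Prop := lieOp (ContinuousLinearMap.id ℝ (Cn n)) X = (k : ℂ) • X

theorem IsHom.mul {j k : ℤ} {X Y : CForm n} (hX : IsHom j X) (hY : IsHom k Y) :
    IsHom (j + k) (X * Y) := by
  unfold IsHom at *
  rw [lieOp_mul, hX, hY, smul_mul_assoc, mul_smul_comm, ← add_smul]; push_cast; rfl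

theorem IsHom.add {k : ℤ} {X Y : CForm n} (hX : IsHom k X) (hY : IsHom k Y) :
    IsHom k (X + Y) := by
  unfold IsHom at *
  rw [map_add, hX, hY, smul_add]

theorem IsHom.smul {k : ℤ} {X : CForm n} (c : ℂ) (hX : IsHom k X) : IsHom k (c • X) := by
  unfold IsHom at *
  rw [map_smul, hX, smul_comm]

theorem isHom_zero {k : ℤ} : IsHom k (0 : CForm n) := by simp [IsHom]

theorem IsHom.sub {k : ℤ} {X Y : CForm n} (hX : IsHom k X) (hY : IsHom k Y) :
    IsHom k (X - Y) := by
  unfold IsHom at *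
  rw [map_sub, hX, hY, smul_sub]

theorem isHom_one : IsHom 0 (1 : CForm n) := by simp [IsHom, lieOp_one]

theorem isHom_sum {ι : Type*} {k : ℤ} (s : Finset ι) {X : ι → CForm n} (h : ∀ i ∈ s, IsHom k (X i)) :
    IsHom k (∑ i ∈ s, X i) := by
  classical
  induction s using Finset.induction_on with
  | empty => simpa using isHom_zero
  | insert a s ha ih =>
    rw [Finset.sum_insert ha]
    exact (h a (Finset.mem_insert_self a s)).add (ih fun i hi => h i (Finset.mem_insert_of_mem hi))

theorem IsHom.pow {k : ℤ} {X : CForm n} (hX : IsHom k X) (m : ℕ) : IsHom (m * k) (X ^ m) := by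
  induction m with
  | zero => simpa using isHom_one
  | succ m ih =>
    rw [pow_succ]
    have := ih.mul hX
    convert this using 1
    push_cast; ring

theorem isHom_ιz (ζ : Cn n →L[ℝ] ℂ) : IsHom 1 (ιz ζ) := by
  unfold IsHom; rw [lieOp_ιz]; simp

theorem isHom_ιc (ξ : Cov n) : IsHom 1 (ιc ξ) := by
  rw [ιc_eq_ιz]; exact isHom_ιz _

theorem IsHom.cint {k : ℤ} {X : CForm n} (hX : IsHom k X) (v : Cn n) :
    IsHom (k - 1) (cint v X) := by
  unfold IsHom at *
  rw [lieOp_cint, hX, map_smul]; push_cast; rw [sub_smul, one_smul]; rfl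

theorem isHom_toC {k : ℕ} {x : RForm n} (hx : x ∈ degreePart n k) : IsHom k (toC x) := by
  induction hx using Submodule.pow_induction_on_left' with
  | algebraMap r =>
    rw [AlgHom.commutes, Algebra.algebraMap_eq_smul_one, real_smul_eq]
    exact isHom_one.smul _
  | add x y i hx hy h1 h2 => rw [map_add]; exact h1.add h2
  | mem_mul m hm i x hx ih =>
    obtain ⟨ξ, rfl⟩ := hm
    rw [map_mul, toC_ι]
    have := (isHom_ιc (LinearMap.toContinuousLinearMap ξ)).mul ih
    convert this using 1
    push_cast; ring

/-- The projection of complex forms to degree `k`. -/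
def projC (k : ℕ) : CForm n →ₗ[ℂ] CForm n :=
  (GradedAlgebra.proj (degreePart n) k).baseChange ℂ

theorem projC_toC (k : ℕ) (x : RForm n) :
    projC k (toC x) = toC (GradedAlgebra.proj (degreePart n) k x) := by
  simp [projC, toC]

theorem topPart_eq : topPart (n := n) = projC (2 * n) := rfl

theorem isHom_projC (k : ℕ) (X : CForm n) : IsHom k (projC k X) := by
  induction X using cform_induction with
  | hr x => rw [projC_toC]; exact isHom_toC (by simp [GradedAlgebra.proj])
  | hadd X Y hX hY => rw [map_add]; exact hX.add hY
  | hsmul c X hX => rw [map_smul]; exact hX.smul c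

theorem finrank_dual : Module.finrank ℝ (Module.Dual ℝ (Cn n)) = 2 * n := by
  rw [Subspace.dual_finrank_eq, finrank_real_of_complex, Module.finrank_fin_fun]

theorem degreePart_eq_bot {k : ℕ} (hk : 2 * n < k) : degreePart n k = ⊥ := by
  apply Submodule.finrank_eq_zero.mp
  rw [exteriorPower.finrank_eq, finrank_dual, Nat.choose_eq_zero_of_lt hk]

open Classical in
theorem sum_projC (X : CForm n) : ∑ k ∈ Finset.range (2 * n + 1), projC k X = X := by
  induction X using cform_induction with
  | hr x =>
    simp only [projC_toC, ← map_sum]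
    congr 1
    conv_rhs => rw [← DirectSum.sum_support_decompose (degreePart n) x]
    symm
    apply Finset.sum_subset_zero_on_sdiff
    · intro k hk
      rw [Finset.mem_range]
      by_contra hlt
      rw [DFinsupp.mem_support_iff] at hk
      apply hk
      have := (DirectSum.decompose (degreePart n) x k).2
      exact Subtype.ext ((Submodule.mem_bot ℝ).mp
        ((degreePart_eq_bot (n := n) (k := k) (by omega)).le this))
    · intro k hk
      rw [Finset.mem_sdiff, DFinsupp.mem_support_iff, not_not] at hk
      simp [GradedAlgebra.proj, hk.2]
    · intro k _
      rfl
  | hadd X Y hX hY => simp only [map_add, Finset.sum_add_distrib, hX, hY]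
  | hsmul c X hX => simp only [map_smul, ← Finset.smul_sum, hX]

theorem projC_projC (j k : ℕ) (X : CForm n) :
    projC j (projC k X) = if j = k then projC k X else 0 := by
  induction X using cform_induction with
  | hr x =>
    rw [projC_toC, projC_toC]
    have hm : GradedAlgebra.proj (degreePart n) k x ∈ degreePart n k := by simp [GradedAlgebra.proj]
    split_ifs with h
    · subst h
      congr 1
      rw [GradedAlgebra.proj_apply, DirectSum.decompose_of_mem_same _ hm]
    · rw [GradedAlgebra.proj_apply, DirectSum.decompose_of_mem_ne _ hm (Ne.symm h), map_zero]
  | hadd X Y hX hY => rw [map_add, map_add, hX, hY]; split_ifs <;> simp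
  | hsmul c X hX => rw [map_smul, map_smul, hX]; split_ifs <;> simp

theorem projC_of_isHom {k : ℤ} {X : CForm n} (hX : IsHom k X) {j : ℕ} (hj : (j : ℤ) ≠ k) :
    projC j X = 0 := by
  by_cases hjn : j < 2 * n + 1
  · have h1 : ∑ i ∈ Finset.range (2 * n + 1), (i : ℂ) • projC i X = (k : ℂ) • X := by
      rw [← hX]
      conv_rhs => rw [← sum_projC X, map_sum]
      refine Finset.sum_congr rfl fun i _ => ?_
      have := isHom_projC i X
      unfold IsHom at this
      rw [this]; push_cast; rfl
    have h2 := congrArg (projC j) h1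
    simp only [map_sum, map_smul, projC_projC, smul_ite, smul_zero] at h2
    rw [Finset.sum_ite_eq, if_pos (Finset.mem_range.mpr hjn), ← sub_eq_zero, ← sub_smul] at h2
    refine (smul_eq_zero.mp h2).resolve_left ?_
    exact sub_ne_zero.mpr (by exact_mod_cast hj)
  · have : projC j (n := n) = 0 := by
      refine clin_ext fun x => ?_
      rw [projC_toC]
      have hm : GradedAlgebra.proj (degreePart n) j x ∈ degreePart n j := by
        simp [GradedAlgebra.proj]
      rw [degreePart_eq_bot (by omega)] at hm
      rw [(Submodule.mem_bot ℝ).mp hm]; simp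
    rw [this]; rfl

theorem IsHom.eq_zero {k : ℤ} {X : CForm n} (hX : IsHom k X) (hk : k < 0 ∨ 2 * n < k) : X = 0 := by
  rw [← sum_projC X]
  refine Finset.sum_eq_zero fun j hj => projC_of_isHom hX ?_
  rw [Finset.mem_range] at hj
  omega

theorem topPart_of_ne {k : ℤ} {X : CForm n} (hX : IsHom k X) (hk : k ≠ 2 * n) : topPart X = 0 :=
  projC_of_isHom hX (by push_cast; exact hk.symm)

theorem topPart_of_isHom {X : CForm n} (hX : IsHom (2 * n) X) : topPart X = X := by
  conv_rhs => rw [← sum_projC X]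
  rw [topPart_eq, Finset.sum_eq_single (2 * n)]
  · intro j _ hj
    exact projC_of_isHom hX (by exact_mod_cast hj)
  · intro h; simp at h

theorem topPart_cint (v : Cn n) (X : CForm n) : topPart (cint v X) = 0 := by
  rw [← sum_projC X, map_sum, map_sum]
  refine Finset.sum_eq_zero fun k hk => topPart_of_ne ((isHom_projC k X).cint v) ?_
  rw [Finset.mem_range] at hk
  omega

/-- The degree zero part of a complex form, as a scalar. -/
def scalarPart : CForm n →ₐ[ℂ] ℂ :=
  Algebra.TensorProduct.lift (AlgHom.id ℂ ℂ)
    (Complex.ofRealAm.comp (ExteriorAlgebra.algebraMapInv (R := ℝ) (M := Module.Dual ℝ (Cn n))))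
    (fun _ _ => Commute.all _ _)

theorem scalarPart_toC (x : RForm n) :
    scalarPart (toC x) = ((ExteriorAlgebra.algebraMapInv x : ℝ) : ℂ) := by
  simp [scalarPart, toC]

open Classical in
theorem projC_zero (X : CForm n) : projC 0 X = scalarPart X • 1 := by
  induction X using cform_induction with
  | hr x =>
    rw [projC_toC, scalarPart_toC]
    have hm : ∀ y ∈ degreePart n 0, y = algebraMap ℝ _ (ExteriorAlgebra.algebraMapInv y) := by
      intro y hy
      change y ∈ (LinearMap.range (ExteriorAlgebra.ι ℝ (M := Module.Dual ℝ (Cn n)))) ^ 0 at hy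
      rw [pow_zero] at hy
      obtain ⟨r, rfl⟩ := Submodule.mem_one.mp hy
      rw [ExteriorAlgebra.algebraMap_leftInverse]
    have h1 := hm (GradedAlgebra.proj (degreePart n) 0 x) (DirectSum.decompose (degreePart n) x 0).2
    have h2 : ∀ k : ℕ, ∀ y ∈ degreePart n k, k ≠ 0 → ExteriorAlgebra.algebraMapInv y = 0 := by
      intro k y hy hk
      obtain ⟨k, rfl⟩ := Nat.exists_eq_succ_of_ne_zero hk
      change y ∈ (LinearMap.range (ExteriorAlgebra.ι ℝ (M := Module.Dual ℝ (Cn n)))) ^ (k + 1) at hy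
      rw [pow_succ] at hy
      induction hy using Submodule.mul_induction_on' with
      | mem_mul_mem a _ b hb =>
        obtain ⟨ξ, rfl⟩ := hb
        rw [map_mul]
        simp [ExteriorAlgebra.algebraMapInv]
      | add a _ b _ ha hb => rw [map_add, ha, hb, add_zero]
    have h3 : ExteriorAlgebra.algebraMapInv (GradedAlgebra.proj (degreePart n) 0 x) =
        ExteriorAlgebra.algebraMapInv x := by
      conv_rhs => rw [← DirectSum.sum_support_decompose (degreePart n) x]
      rw [map_sum]
      by_cases h0 : 0 ∈ (DirectSum.decompose (degreePart n) x).support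
      · rw [Finset.sum_eq_single_of_mem 0 h0]
        · rfl
        · intro k _ hk
          exact h2 k _ (DirectSum.decompose (degreePart n) x k).2 hk
      · rw [Finset.sum_eq_zero]
        · rw [DFinsupp.mem_support_iff, not_not] at h0
          rw [GradedAlgebra.proj_apply, h0]; simp
        · intro k hk
          exact h2 k _ (DirectSum.decompose (degreePart n) x k).2 (fun h => h0 (h ▸ hk))
    rw [h1, h3, AlgHom.commutes, Algebra.algebraMap_eq_smul_one, real_smul_eq]
  | hadd X Y hX hY => rw [map_add, map_add, hX, hY, add_smul]
  | hsmul c X hX => rw [map_smul, map_smul, hX, smul_eq_mul, mul_smul]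

/-- A form annihilated by all interior products is a scalar. -/
theorem eq_scalar_of_cint {X : CForm n} (h : ∀ v, cint v X = 0) : X = scalarPart X • 1 := by
  have h0 : IsHom 0 X := by
    unfold IsHom; rw [lieOp_apply]; simp [h, altD_zero]
  conv_lhs => rw [← sum_projC X]
  rw [← projC_zero, Finset.sum_eq_single 0]
  · intro j _ hj
    exact projC_of_isHom h0 (by exact_mod_cast hj)
  · intro h; simp at h

/-! ### Two-forms -/

theorem cint_two_form {ω₀ : RForm n} (hω : ω₀ ∈ degreePart n 2) (u : Cn n) :
    cint u (toC ω₀) = ιc (contr ω₀ u) := by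
  have key : toC (rint u ω₀) = toC (ExteriorAlgebra.ι ℝ ((contr ω₀ u : Cov n) : Module.Dual ℝ (Cn n))) := by
    congr 1
    have hω' : ω₀ ∈ (LinearMap.range (ExteriorAlgebra.ι ℝ (M := Module.Dual ℝ (Cn n)))) ^ 2 := hω
    rw [pow_two] at hω'
    induction hω' using Submodule.mul_induction_on' with
    | mem_mul_mem a ha b hb =>
      obtain ⟨ξ, rfl⟩ := ha
      obtain ⟨η, rfl⟩ := hb
      have e : ∀ w : Cn n, rint w (ExteriorAlgebra.ι ℝ ξ * ExteriorAlgebra.ι ℝ η) =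
          ξ w • ExteriorAlgebra.ι ℝ η - η w • ExteriorAlgebra.ι ℝ ξ := by
        intro w
        simp only [rint]
        erw [CliffordAlgebra.contractLeft_ι_mul, CliffordAlgebra.contractLeft_ι]
        rw [Algebra.algebraMap_eq_smul_one, mul_smul_comm, mul_one]; rfl
      have e1 : ∀ (w : Cn n) (θ : Module.Dual ℝ (Cn n)), rint w (ExteriorAlgebra.ι ℝ θ) =
          algebraMap ℝ _ (θ w) := by
        intro w θ
        simp only [rint]
        erw [CliffordAlgebra.contractLeft_ι]; rfl
      have e2 : ((contr (ExteriorAlgebra.ι ℝ ξ * ExteriorAlgebra.ι ℝ η) u : Cov n) :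
          Module.Dual ℝ (Cn n)) = ξ u • η - η u • ξ := by
        refine LinearMap.ext fun w => ?_
        change ExteriorAlgebra.algebraMapInv (rint w (rint u _)) = _
        rw [e, map_sub, map_smul, map_smul, e1, e1]
        simp only [map_sub, map_smul, ExteriorAlgebra.algebraMap_leftInverse _ _]
        rfl
      rw [e, e2, map_sub, map_smul, map_smul]
    | add a ha b hb h1 h2 =>
      have e3 : contr (a + b) u = contr a u + contr b u := by
        refine ContinuousLinearMap.ext fun w => ?_
        change ExteriorAlgebra.algebraMapInv (rint w (rint u (a + b))) =
          ExteriorAlgebra.algebraMapInv (rint w (rint u a)) +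
            ExteriorAlgebra.algebraMapInv (rint w (rint u b))
        simp only [map_add]
      rw [map_add, h1 ((pow_two (LinearMap.range (ExteriorAlgebra.ι ℝ (M := Module.Dual ℝ (Cn n))))).ge ha),
        h2 ((pow_two (LinearMap.range (ExteriorAlgebra.ι ℝ (M := Module.Dual ℝ (Cn n))))).ge hb), e3,
        ContinuousLinearMap.toLinearMap_add, map_add]
  rw [cint_toC, key]; rfl

theorem cint_cint_two_form {ω₀ : RForm n} (hω : ω₀ ∈ degreePart n 2) (u v : Cn n) :
    cint v (cint u (toC ω₀)) = (eval2 ω₀ u v : ℂ) • 1 := by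
  rw [cint_two_form hω, cint_ιc]; rfl

theorem isHom_eq_zero_of_cint {k : ℤ} (hk : k ≠ 0) {X : CForm n} (hX : IsHom k X)
    (h : ∀ v, cint v X = 0) : X = 0 := by
  unfold IsHom at hX
  rw [lieOp_apply] at hX
  simp only [h, altD_zero] at hX
  exact (smul_eq_zero.mp hX.symm).resolve_left (by exact_mod_cast hk)

theorem one_form_ext {X Y : CForm n} (hX : IsHom 1 X) (hY : IsHom 1 Y)
    (h : ∀ v, cint v X = cint v Y) : X = Y :=
  sub_eq_zero.mp <| isHom_eq_zero_of_cint one_ne_zero (hX.sub hY) fun v => by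
    rw [map_sub, h, sub_self]

/-- Two-forms are determined by their values on pairs of vectors. -/
theorem two_form_ext {X Y : CForm n} (hX : IsHom 2 X) (hY : IsHom 2 Y)
    (h : ∀ u v, cint v (cint u X) = cint v (cint u Y)) : X = Y :=
  sub_eq_zero.mp <| isHom_eq_zero_of_cint two_ne_zero (hX.sub hY) fun u => by
    rw [map_sub, sub_eq_zero]
    refine one_form_ext ?_ ?_ fun v => h u v
    · simpa using hX.cint u
    · simpa using hY.cint u

theorem one_smul_inj {a b : ℂ} (h : a • (1 : CForm n) = b • 1) : a = b := by
  have := congrArg scalarPart h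
  simpa using this

theorem eval2_antisymm {ω₀ : RForm n} (hω : ω₀ ∈ degreePart n 2) (u v : Cn n) :
    eval2 ω₀ u v = -eval2 ω₀ v u := by
  have h1 := cint_cint_two_form hω u v
  have h2 := cint_cint_two_form hω v u
  rw [cint_comm, h2, ← neg_smul] at h1
  have := one_smul_inj h1
  exact_mod_cast this.symm

theorem contr_pullR {ω₀ : RForm n} (hω : ω₀ ∈ degreePart n 2) (A : Cn n →L[ℝ] Cn n)
    (hω' : pullR A ω₀ ∈ degreePart n 2) (u : Cn n) :
    contr (pullR A ω₀) u = (contr ω₀ (A u)).comp A := by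
  have h := cint_two_form hω' u
  rw [← pullC_toC, cint_pullC, cint_two_form hω, pullC_ιc] at h
  ext v
  have h2 := congrArg (cint v) h
  rw [cint_ιc, cint_ιc] at h2
  exact_mod_cast (one_smul_inj h2).symm

theorem pullR_mem {k : ℕ} {ω₀ : RForm n} (hω : ω₀ ∈ degreePart n k) (A : Cn n →L[ℝ] Cn n) :
    pullR A ω₀ ∈ degreePart n k := by
  have h : (degreePart n k).map (pullR A).toLinearMap ≤ degreePart n k := by
    change Submodule.map _ ((LinearMap.range (ExteriorAlgebra.ι ℝ (M := Module.Dual ℝ (Cn n)))) ^ k) ≤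
      (LinearMap.range (ExteriorAlgebra.ι ℝ (M := Module.Dual ℝ (Cn n)))) ^ k
    rw [Submodule.map_pow]
    exact pow_le_pow_left' (by
      rintro _ ⟨_, ⟨x, rfl⟩, rfl⟩
      exact ⟨_, (ExteriorAlgebra.map_apply_ι _ _).symm⟩) k
  exact h (Submodule.mem_map_of_mem hω)

/-! ### Truncated exponentials -/

theorem nexp_eq_exp {A : Type*} [Ring A] [Algebra ℂ A] [Module ℚ A] {a : A} (h : a ^ (n + 1) = 0) :
    nexp n a = IsNilpotent.exp a := by
  rw [IsNilpotent.exp_eq_sum h, nexp]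
  refine Finset.sum_congr rfl fun k _ => ?_
  have : ((k.factorial : ℚ)⁻¹) • a ^ k = ((k.factorial : ℂ)⁻¹) • a ^ k := by
    rw [inv_natCast_smul_eq (R := ℚ) (S := ℂ)]
  exact this.symm

theorem nexp_add {A : Type*} [Ring A] [Algebra ℂ A] {a b : A} (hab : Commute a b)
    (ha : a ^ (n + 1) = 0) (hb : b ^ (n + 1) = 0) (h : (a + b) ^ (n + 1) = 0) :
    nexp n (a + b) = nexp n a * nexp n b := by
  let : Module ℚ A := Module.compHom A (algebraMap ℚ ℂ)
  rw [nexp_eq_exp ha, nexp_eq_exp hb, nexp_eq_exp h]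
  exact IsNilpotent.exp_add_of_commute hab ⟨_, ha⟩ ⟨_, hb⟩

theorem nexp_zero {A : Type*} [Ring A] [Algebra ℂ A] : nexp n (0 : A) = 1 := by
  rw [nexp, Finset.sum_eq_single 0]
  · simp
  · intro k _ hk; simp [hk]
  · intro h; simp at h

theorem nexp_mul_neg {A : Type*} [Ring A] [Algebra ℂ A] {a : A} (ha : a ^ (n + 1) = 0) :
    nexp n a * nexp n (-a) = 1 := by
  have hb : (-a) ^ (n + 1) = 0 := by rw [neg_pow, ha, mul_zero]
  rw [← nexp_add (Commute.neg_right (Commute.refl a)) ha hb (by simp), add_neg_cancel, nexp_zero]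

theorem nexp_smul_apply {F : Type*} [AddCommGroup F] [Module ℂ F] (t : ℂ) (B : Module.End ℂ F)
    (X : F) : nexp n (t • B) X =
      ∑ k ∈ Finset.range (n + 1), ((k.factorial : ℂ)⁻¹ * t ^ k) • (B ^ k) X := by
  simp only [nexp, LinearMap.sum_apply, smul_pow, smul_smul, LinearMap.smul_apply]

theorem factorial_inv_mul (k : ℕ) :
    (((k + 1).factorial : ℂ)⁻¹) * ((k + 1 : ℕ) : ℂ) = ((k.factorial : ℂ))⁻¹ := by
  rw [Nat.factorial_succ]
  have h1 : ((k + 1 : ℕ) : ℂ) ≠ 0 := by exact_mod_cast Nat.succ_ne_zero k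
  have h2 : (k.factorial : ℂ) ≠ 0 := by exact_mod_cast Nat.factorial_ne_zero k
  push_cast at h1 ⊢
  field_simp

/-- Termwise differentiation of an exponential: if `D k = k • C (B ^ (k-1) X)` and the last term
`C (B ^ n X)` vanishes, then `∑ tᵏ/k! D k = t • C (exp (tB) X)`. -/
theorem sum_exp_deriv {F : Type*} [AddCommGroup F] [Module ℂ F] (t : ℂ) (B C : Module.End ℂ F)
    (X : F) (D : ℕ → F) (hD : ∀ k, D (k + 1) = ((k + 1 : ℕ) : ℂ) • C ((B ^ k) X)) (h0 : D 0 = 0)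
    (hn : C ((B ^ n) X) = 0) :
    ∑ k ∈ Finset.range (n + 1), ((k.factorial : ℂ)⁻¹ * t ^ k) • D k =
      t • C (nexp n (t • B) X) := by
  rw [nexp_smul_apply, Finset.sum_range_succ', h0, smul_zero, add_zero, map_sum,
    Finset.sum_range_succ, map_smul, hn, smul_zero, add_zero, Finset.smul_sum]
  refine Finset.sum_congr rfl fun k _ => ?_
  rw [hD, map_smul, smul_smul, smul_smul, pow_succ]
  congr 1
  rw [← factorial_inv_mul k]; ring

/-! ### The action of bivectors on forms -/

theorem bivAct_apply (lam : Fin m → Fin m → ℝ) (v : Fin m → Cn n) (X : CForm n) :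
    bivAct lam v X = ∑ i, ∑ j, (lam i j : ℂ) • cint (v i) (cint (v j) X) := by
  simp [bivAct, LinearMap.sum_apply]

theorem bivAct_cint (lam : Fin m → Fin m → ℝ) (v : Fin m → Cn n) (u : Cn n) (X : CForm n) :
    bivAct lam v (cint u X) = cint u (bivAct lam v X) := by
  simp only [bivAct_apply, map_sum, map_smul]
  refine Finset.sum_congr rfl fun i _ => Finset.sum_congr rfl fun j _ => ?_
  rw [cint_comm (v j) u, map_neg, cint_comm (v i) u, neg_neg]

theorem bivAct_pow_cint (lam : Fin m → Fin m → ℝ) (v : Fin m → Cn n) (u : Cn n) (k : ℕ)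
    (X : CForm n) : (bivAct lam v ^ k) (cint u X) = cint u ((bivAct lam v ^ k) X) := by
  induction k with
  | zero => rfl
  | succ k ih => rw [pow_succ', Module.End.mul_apply, ih, bivAct_cint,
      ← Module.End.mul_apply (bivAct lam v), ← pow_succ']

theorem bivAct_ιc_mul (lam : Fin m → Fin m → ℝ) (v : Fin m → Cn n) (ξ : Cov n) (X : CForm n) :
    bivAct lam v (ιc ξ * X) = ιc ξ * bivAct lam v X + cint (bivSharp lam v ξ) X := by
  have hs : bivSharp lam v ξ = ∑ i, ∑ j, lam i j • (ξ (v j) • v i - ξ (v i) • v j) := rfl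
  rw [hs]
  simp only [bivAct_apply, cint_sum, LinearMap.sum_apply, Finset.mul_sum, ← Finset.sum_add_distrib]
  refine Finset.sum_congr rfl fun i _ => Finset.sum_congr rfl fun j _ => ?_
  simp only [cint_ιc_mul, map_sub, map_smul, cint_smul, cint_sub, LinearMap.smul_apply,
    LinearMap.sub_apply, mul_smul_comm]
  module

theorem bivAct_isHom (lam : Fin m → Fin m → ℝ) (v : Fin m → Cn n) {k : ℤ} {X : CForm n}
    (hX : IsHom k X) : IsHom (k - 2) (bivAct lam v X) := by
  rw [bivAct_apply]
  refine isHom_sum _ fun i _ => isHom_sum _ fun j _ => IsHom.smul _ ?_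
  have := (hX.cint (v j)).cint (v i)
  convert this using 1
  ring

theorem bivAct_pow_isHom (lam : Fin m → Fin m → ℝ) (v : Fin m → Cn n) {k : ℤ} {X : CForm n}
    (hX : IsHom k X) (p : ℕ) : IsHom (k - 2 * p) ((bivAct lam v ^ p) X) := by
  induction p with
  | zero => simpa using hX
  | succ p ih =>
    rw [pow_succ', Module.End.mul_apply]
    have := bivAct_isHom lam v ih
    convert this using 1
    push_cast; ring

theorem bivAct_pow_eq_zero (lam : Fin m → Fin m → ℝ) (v : Fin m → Cn n) :
    bivAct lam v ^ (n + 1) = 0 := by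
  refine LinearMap.ext fun X => ?_
  rw [← sum_projC X, map_sum, LinearMap.zero_apply]
  refine Finset.sum_eq_zero fun k hk => ?_
  rw [Finset.mem_range] at hk
  exact (bivAct_pow_isHom lam v (isHom_projC k X) (n + 1)).eq_zero (Or.inl (by push_cast; omega))

theorem cint_bivAct_pow_eq_zero (lam : Fin m → Fin m → ℝ) (v : Fin m → Cn n) (u : Cn n)
    (X : CForm n) : cint u ((bivAct lam v ^ n) X) = 0 := by
  rw [← sum_projC X, map_sum, map_sum]
  refine Finset.sum_eq_zero fun k hk => ?_
  rw [Finset.mem_range] at hk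
  exact ((bivAct_pow_isHom lam v (isHom_projC k X) n).cint u).eq_zero (Or.inl (by omega))

/-- `e^{tβ}` acting on forms, for a real bivector `β`. -/
def expBiv (lam : Fin m → Fin m → ℝ) (v : Fin m → Cn n) (t : ℝ) : Module.End ℂ (CForm n) :=
  nexp n ((t : ℂ) • bivAct lam v)

theorem smul_bivAct_pow_eq_zero (lam : Fin m → Fin m → ℝ) (v : Fin m → Cn n) (t : ℂ) :
    (t • bivAct lam v) ^ (n + 1) = 0 := by
  rw [smul_pow, bivAct_pow_eq_zero, smul_zero]

theorem expBiv_neg_cancel (lam : Fin m → Fin m → ℝ) (v : Fin m → Cn n) (t : ℝ) (X : CForm n) :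
    expBiv lam v t (expBiv lam v (-t) X) = X := by
  have h := nexp_mul_neg (n := n) (smul_bivAct_pow_eq_zero lam v (t : ℂ))
  have h2 := LinearMap.congr_fun h X
  rw [Module.End.mul_apply, Module.End.one_apply] at h2
  have h3 : -((t : ℂ) • bivAct lam v) = ((-t : ℝ) : ℂ) • bivAct lam v := by
    refine LinearMap.ext fun Y => ?_
    rw [LinearMap.neg_apply, LinearMap.smul_apply, LinearMap.smul_apply]
    push_cast; rw [neg_smul]
  rw [h3] at h2
  exact h2

theorem expBiv_cancel_neg (lam : Fin m → Fin m → ℝ) (v : Fin m → Cn n) (t : ℝ) (X : CForm n) :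
    expBiv lam v (-t) (expBiv lam v t X) = X := by
  have := expBiv_neg_cancel lam v (-t) X
  rwa [neg_neg] at this

theorem expBiv_apply (lam : Fin m → Fin m → ℝ) (v : Fin m → Cn n) (t : ℝ) (X : CForm n) :
    expBiv lam v t X =
      ∑ k ∈ Finset.range (n + 1), ((k.factorial : ℂ)⁻¹ * (t : ℂ) ^ k) • (bivAct lam v ^ k) X :=
  nexp_smul_apply _ _ _

theorem expBiv_cint (lam : Fin m → Fin m → ℝ) (v : Fin m → Cn n) (t : ℝ) (u : Cn n) (X : CForm n) :
    expBiv lam v t (cint u X) = cint u (expBiv lam v t X) := by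
  simp only [expBiv_apply, bivAct_pow_cint, map_sum, map_smul]

theorem bivAct_pow_ιc_mul (lam : Fin m → Fin m → ℝ) (v : Fin m → Cn n) (ξ : Cov n) (X : CForm n)
    (k : ℕ) : (bivAct lam v ^ (k + 1)) (ιc ξ * X) = ιc ξ * (bivAct lam v ^ (k + 1)) X +
      ((k + 1 : ℕ) : ℂ) • cint (bivSharp lam v ξ) ((bivAct lam v ^ k) X) := by
  induction k with
  | zero => simp [bivAct_ιc_mul]
  | succ k ih =>
    rw [pow_succ', Module.End.mul_apply, ih, map_add, bivAct_ιc_mul, map_smul, bivAct_cint,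
      ← Module.End.mul_apply (bivAct lam v), ← pow_succ',
      ← Module.End.mul_apply (bivAct lam v), ← pow_succ', add_assoc]
    congr 1
    push_cast
    module

/-- `e^{tβ} a e^{-tβ} = a + t [β, a]` in the Clifford algebra. -/
theorem expBiv_cliff (lam : Fin m → Fin m → ℝ) (v : Fin m → Cn n) (t : ℝ) (a : GT n)
    (X : CForm n) :
    expBiv lam v t (cliff a X) = cliff (adBiv lam v t a) (expBiv lam v t X) := by
  have had : adBiv lam v t a = (a.1 + t • bivSharp lam v a.2, a.2) := rfl
  rw [had, cliff_apply, cliff_apply, map_add, expBiv_cint]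
  have h := sum_exp_deriv (n := n) (t : ℂ) (bivAct lam v) (cint (bivSharp lam v a.2)) X
    (fun k => (bivAct lam v ^ k) (ιc a.2 * X) - ιc a.2 * (bivAct lam v ^ k) X)
    (fun k => by rw [bivAct_pow_ιc_mul]; abel) (by simp) (cint_bivAct_pow_eq_zero lam v _ X)
  have h2 : expBiv lam v t (ιc a.2 * X) - ιc a.2 * expBiv lam v t X =
      (t : ℂ) • cint (bivSharp lam v a.2) (expBiv lam v t X) := by
    rw [expBiv, ← h, nexp_smul_apply, nexp_smul_apply, Finset.mul_sum, ← Finset.sum_sub_distrib]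
    refine Finset.sum_congr rfl fun k _ => ?_
    rw [mul_smul_comm, smul_sub]
  rw [sub_eq_iff_eq_add] at h2
  rw [h2, cint_add, cint_smul]
  simp only [LinearMap.add_apply, LinearMap.smul_apply]
  abel

theorem adBiv_apply (lam : Fin m → Fin m → ℝ) (v : Fin m → Cn n) (t : ℝ) (a : GT n) :
    adBiv lam v t a = (a.1 + t • bivSharp lam v a.2, a.2) := rfl

theorem adBiv_neg_cancel (lam : Fin m → Fin m → ℝ) (v : Fin m → Cn n) (t : ℝ) (a : GT n) :
    adBiv lam v t (adBiv lam v (-t) a) = a := by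
  simp [adBiv_apply]

theorem adBiv_cancel_neg (lam : Fin m → Fin m → ℝ) (v : Fin m → Cn n) (t : ℝ) (a : GT n) :
    adBiv lam v (-t) (adBiv lam v t a) = a := by
  simp [adBiv_apply]

theorem bivSharp_skew (lam : Fin m → Fin m → ℝ) (v : Fin m → Cn n) (ξ η : Cov n) :
    η (bivSharp lam v ξ) = -ξ (bivSharp lam v η) := by
  have hs : ∀ ξ : Cov n,
    bivSharp lam v ξ = ∑ i, ∑ j, lam i j • (ξ (v j) • v i - ξ (v i) • v j) := fun _ => rfl
  simp only [hs, map_sum, map_smul, map_sub, ← Finset.sum_neg_distrib, smul_eq_mul]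
  refine Finset.sum_congr rfl fun i _ => Finset.sum_congr rfl fun j _ => ?_
  ring

theorem pair_adBiv (lam : Fin m → Fin m → ℝ) (v : Fin m → Cn n) (t : ℝ) (a b : GT n) :
    pair (adBiv lam v t a) (adBiv lam v t b) = pair a b := by
  simp only [pair, adBiv_apply, map_add, map_smul, smul_eq_mul]
  rw [bivSharp_skew lam v b.2 a.2]
  ring

/-- Conjugation of an endomorphism of `T ⊕ T*` by `e^{tβ}`. -/
def adConj (lam : Fin m → Fin m → ℝ) (v : Fin m → Cn n) (t : ℝ) (𝒥 : GT n →ₗ[ℝ] GT n) :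
    GT n →ₗ[ℝ] GT n := adBiv lam v t ∘ₗ 𝒥 ∘ₗ adBiv lam v (-t)

theorem adConj_apply (lam : Fin m → Fin m → ℝ) (v : Fin m → Cn n) (t : ℝ) (𝒥 : GT n →ₗ[ℝ] GT n)
    (a : GT n) : adConj lam v t 𝒥 a = adBiv lam v t (𝒥 (adBiv lam v (-t) a)) := rfl

theorem adConj_sq {lam : Fin m → Fin m → ℝ} {v : Fin m → Cn n} {t : ℝ} {𝒥 : GT n →ₗ[ℝ] GT n}
    (h : ∀ a, 𝒥 (𝒥 a) = -a) (a : GT n) : adConj lam v t 𝒥 (adConj lam v t 𝒥 a) = -a := by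
  rw [adConj_apply, adConj_apply, adBiv_cancel_neg, h, map_neg, adBiv_neg_cancel]

theorem adConj_orth {lam : Fin m → Fin m → ℝ} {v : Fin m → Cn n} {t : ℝ} {𝒥 : GT n →ₗ[ℝ] GT n}
    (h : ∀ a b, pair (𝒥 a) (𝒥 b) = pair a b) (a b : GT n) :
    pair (adConj lam v t 𝒥 a) (adConj lam v t 𝒥 b) = pair a b := by
  rw [adConj_apply, adConj_apply, pair_adBiv, h, pair_adBiv]

theorem expBiv_ne_zero {lam : Fin m → Fin m → ℝ} {v : Fin m → Cn n} {t : ℝ} {φ : CForm n}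
    (hφ : φ ≠ 0) : expBiv lam v t φ ≠ 0 := by
  intro h
  apply hφ
  rw [← expBiv_cancel_neg lam v t φ, h, map_zero]

theorem induces_expBiv {lam : Fin m → Fin m → ℝ} {v : Fin m → Cn n} {t : ℝ} {φ : CForm n}
    {𝒥 : GT n →ₗ[ℝ] GT n} (h : Induces φ 𝒥) :
    Induces (expBiv lam v t φ) (adConj lam v t 𝒥) := by
  intro a b
  have hc : ∀ a, cliff a (expBiv lam v t φ) = expBiv lam v t (cliff (adBiv lam v (-t) a) φ) := by
    intro a
    rw [expBiv_cliff, adBiv_neg_cancel]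
  rw [hc, hc, ← map_smul, ← map_add]
  have h0 : ∀ Y, expBiv lam v t Y = 0 ↔ Y = 0 := fun Y =>
    ⟨fun hY => by rw [← expBiv_cancel_neg lam v t Y, hY, map_zero], fun hY => by rw [hY, map_zero]⟩
  rw [h0, h]
  unfold InE
  rw [adConj_apply, adConj_apply]
  constructor
  · rintro ⟨h1, h2⟩
    rw [h1, h2, map_neg, adBiv_neg_cancel, adBiv_neg_cancel]; exact ⟨rfl, rfl⟩
  · rintro ⟨h1, h2⟩
    constructor
    · rw [← h1, adBiv_cancel_neg]
    · rw [← map_neg, ← h2, adBiv_cancel_neg]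

/-! ### The pairing of spinors -/

theorem topPart_cint_cint (u v : Cn n) (X Y : CForm n) :
    topPart (cint u (cint v X) * Y) = topPart (X * cint u (cint v Y)) := by
  have h1 := topPart_cint u (cint v X * Y)
  have h2 := topPart_cint v (eps X * cint u Y)
  rw [cint_mul, map_add] at h1 h2
  rw [cint_eps, cneg_mul, map_neg, eps_eps, cint_comm v u, cmul_neg, map_neg] at h2
  have h3 := congrArg₂ (· + ·) h1 h2
  simp only [add_zero] at h3
  rw [← sub_eq_zero, ← h3]
  abel

theorem mukai_cint_cint (u v : Cn n) (X Y : CForm n) :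
    mukai (cint u (cint v X)) Y = -mukai X (cint u (cint v Y)) := by
  rw [mukai, mukai, topPart_cint_cint, sigma_cint, sigma_cint, cint_eps, map_neg, eps_eps, cmul_neg,
    map_neg, neg_neg]

theorem mukai_smul_left (c : ℂ) (X Y : CForm n) : mukai (c • X) Y = c • mukai X Y := by
  simp only [mukai, smul_mul_assoc, map_smul]

theorem mukai_smul_right (c : ℂ) (X Y : CForm n) : mukai X (c • Y) = c • mukai X Y := by
  simp only [mukai, map_smul, mul_smul_comm]

theorem mukai_sum_left {ι : Type*} (s : Finset ι) (X : ι → CForm n) (Y : CForm n) :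
    mukai (∑ i ∈ s, X i) Y = ∑ i ∈ s, mukai (X i) Y := by
  simp only [mukai, Finset.sum_mul, map_sum]

theorem mukai_sum_right {ι : Type*} (s : Finset ι) (X : CForm n) (Y : ι → CForm n) :
    mukai X (∑ i ∈ s, Y i) = ∑ i ∈ s, mukai X (Y i) := by
  simp only [mukai, Finset.mul_sum, map_sum]

theorem mukai_bivAct (lam : Fin m → Fin m → ℝ) (v : Fin m → Cn n) (X Y : CForm n) :
    mukai (bivAct lam v X) Y = -mukai X (bivAct lam v Y) := by
  simp only [bivAct_apply, mukai_sum_left, mukai_sum_right, mukai_smul_left, mukai_smul_right,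
    mukai_cint_cint, smul_neg, Finset.sum_neg_distrib]

theorem mukai_bivAct_pow (lam : Fin m → Fin m → ℝ) (v : Fin m → Cn n) (k : ℕ) (X Y : CForm n) :
    mukai ((bivAct lam v ^ k) X) Y = (-1 : ℂ) ^ k • mukai X ((bivAct lam v ^ k) Y) := by
  induction k generalizing X Y with
  | zero => simp
  | succ k ih =>
    rw [pow_succ (bivAct lam v), Module.End.mul_apply, ih, mukai_bivAct, ← Module.End.mul_apply,
      ← pow_succ', pow_succ (bivAct lam v), pow_succ, mul_smul, neg_one_csmul]

/-- The spin invariance of the pairing. -/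
theorem mukai_expBiv (lam : Fin m → Fin m → ℝ) (v : Fin m → Cn n) (t : ℝ) (X Y : CForm n) :
    mukai (expBiv lam v t X) (expBiv lam v t Y) = mukai X Y := by
  have h : ∀ Z, mukai (expBiv lam v t X) Z = mukai X (expBiv lam v (-t) Z) := by
    intro Z
    simp only [expBiv_apply, mukai_sum_left, mukai_sum_right, mukai_smul_left, mukai_smul_right,
      mukai_bivAct_pow, smul_smul]
    refine Finset.sum_congr rfl fun k _ => ?_
    congr 1
    push_cast
    rw [neg_pow (t : ℂ)]; ring
  rw [h, expBiv_cancel_neg]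

theorem conjF_bivAct (lam : Fin m → Fin m → ℝ) (v : Fin m → Cn n) (X : CForm n) :
    conjF (bivAct lam v X) = bivAct lam v (conjF X) := by
  simp only [bivAct_apply, map_sum, conjF_smul, conjF_cint, Complex.conj_ofReal]

theorem conjF_expBiv (lam : Fin m → Fin m → ℝ) (v : Fin m → Cn n) (t : ℝ) (X : CForm n) :
    conjF (expBiv lam v t X) = expBiv lam v t (conjF X) := by
  have hp : ∀ (k : ℕ) (X : CForm n), conjF ((bivAct lam v ^ k) X) = (bivAct lam v ^ k) (conjF X) := by
    intro k
    induction k with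
    | zero => intro X; rfl
    | succ k ih =>
      intro X
      rw [pow_succ', Module.End.mul_apply, conjF_bivAct, ih, ← Module.End.mul_apply]
  simp only [expBiv_apply, map_sum, conjF_smul, hp]
  refine Finset.sum_congr rfl fun k _ => ?_
  simp

/-! ### The spinor of a complex structure -/

theorem ofComplex_apply (J : Cn n →L[ℝ] Cn n) (a : GT n) :
    ofComplex J a = (J a.1, -(a.2.comp J)) := rfl

theorem stdJ_apply (v : Cn n) : stdJ n v = Complex.I • v := rfl

theorem stdJ_stdJ (v : Cn n) : stdJ n (stdJ n v) = -v := by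
  rw [stdJ_apply, stdJ_apply, smul_smul, Complex.I_mul_I, neg_one_smul]

theorem ofComplex_sq (a : GT n) : ofComplex (stdJ n) (ofComplex (stdJ n) a) = -a := by
  simp only [ofComplex_apply]
  refine Prod.ext (stdJ_stdJ _) (ContinuousLinearMap.ext fun v => ?_)
  simp [stdJ_stdJ]

theorem ofComplex_orth (a b : GT n) :
    pair (ofComplex (stdJ n) a) (ofComplex (stdJ n) b) = pair a b := by
  simp [pair, ofComplex_apply, stdJ_stdJ]

/-- On a spinor inducing a complex structure, `i_{Jv} = i · i_v`. -/
theorem cint_stdJ {Ω : CForm n} (h : Induces Ω (ofComplex (stdJ n))) (v : Cn n) :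
    cint (stdJ n v) Ω = Complex.I • cint v Ω := by
  have h1 := h.annihilates ofComplex_sq (v, 0)
  simp only [cliff_apply, ofComplex_apply, ContinuousLinearMap.zero_comp, neg_zero, map_zero,
    zero_mul, add_zero] at h1
  have h2 := congrArg (fun X => Complex.I • X) h1
  simp only [smul_add, smul_smul, Complex.I_mul_I, smul_zero, neg_one_csmul] at h2
  rw [← sub_eq_zero, ← neg_eq_zero, ← h2]
  abel

theorem cint10_eq {Ω : CForm n} (h : Induces Ω (ofComplex (stdJ n))) (v : Cn n) :
    cint10 v Ω = cint v Ω := by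
  simp only [cint10, LinearMap.smul_apply, LinearMap.sub_apply, cint_stdJ h, smul_smul,
    Complex.I_mul_I, neg_one_csmul, sub_neg_eq_add]
  rw [← two_smul ℂ, smul_smul]
  norm_num

theorem cint10_cint (u v : Cn n) (X : CForm n) : cint10 u (cint v X) = -cint v (cint10 u X) := by
  simp only [cint10, LinearMap.smul_apply, LinearMap.sub_apply, cint_comm _ v, map_smul, map_sub,
    smul_neg]
  module

theorem bivAct10_eq (lam : Fin m → Fin m → ℝ) (v : Fin m → Cn n) {Ω : CForm n}
    (h : Induces Ω (ofComplex (stdJ n))) : bivAct10 lam v Ω = bivAct lam v Ω := by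
  rw [bivAct_apply]
  simp only [bivAct10, LinearMap.sum_apply, LinearMap.smul_apply, Module.End.mul_apply]
  refine Finset.sum_congr rfl fun i _ => Finset.sum_congr rfl fun j _ => ?_
  rw [cint10_eq h, cint10_cint, cint10_eq h, cint_comm (v i)]

theorem bivAct10_bivAct (lam : Fin m → Fin m → ℝ) (v : Fin m → Cn n) (X : CForm n) :
    bivAct10 lam v (bivAct lam v X) = bivAct lam v (bivAct10 lam v X) := by
  have hc : ∀ u w : Cn n, ∀ X, cint10 u (cint10 w (bivAct lam v X)) =
      bivAct lam v (cint10 u (cint10 w X)) := by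
    have h1 : ∀ (u : Cn n) (X), cint10 u (bivAct lam v X) = bivAct lam v (cint10 u X) := by
      intro u X
      simp only [cint10, LinearMap.smul_apply, LinearMap.sub_apply, map_smul, map_sub, bivAct_cint]
    intro u w X
    rw [h1, h1]
  simp only [bivAct10, LinearMap.sum_apply, LinearMap.smul_apply, Module.End.mul_apply, hc, map_sum,
    map_smul]

/-- The complex bivector `β` and its real counterpart have the same exponential on the spinor of a
complex structure. -/
theorem exp_bivAct10_eq (lam : Fin m → Fin m → ℝ) (v : Fin m → Cn n) (t : ℝ) {Ω : CForm n}
    (h : Induces Ω (ofComplex (stdJ n))) :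
    nexp n ((t : ℂ) • bivAct10 lam v) Ω = expBiv lam v t Ω := by
  rw [nexp_smul_apply, expBiv_apply]
  refine Finset.sum_congr rfl fun k hk => ?_
  clear hk
  congr 1
  have hc : ∀ k : ℕ, bivAct10 lam v ((bivAct lam v ^ k) Ω) = (bivAct lam v ^ k) (bivAct10 lam v Ω) := by
    intro k
    induction k with
    | zero => rfl
    | succ k ih => rw [pow_succ', Module.End.mul_apply, bivAct10_bivAct, ih, ← Module.End.mul_apply]
  induction k with
  | zero => rfl
  | succ k ih =>
    rw [pow_succ', Module.End.mul_apply, ih, hc, bivAct10_eq lam v h, ← Module.End.mul_apply,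
      ← pow_succ]

/-! ### The holomorphic volume form and the volume of a Hermitian metric -/

/-- The product `a_{k₁} ⋯ a_{k_r}` of a family of one-forms along a list of indices. -/
def frameProd {κ : Type*} (a : κ → CForm n) (l : List κ) : CForm n := (l.map a).prod

/-- The composition `c_{k_r} ⋯ c_{k₁}` of a family of contractions along a list of indices. -/
def frameContr {κ : Type*} (c : κ → Module.End ℂ (CForm n)) : List κ → Module.End ℂ (CForm n)
  | [] => 1
  | k :: l => frameContr c l * c k

/-- A form annihilated by the covectors of a list is divisible by their product; the quotient is
obtained by contraction with dual vectors. -/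
theorem eq_frameProd_mul {κ : Type*} [DecidableEq κ] {a : κ → CForm n}
    {c : κ → Module.End ℂ (CForm n)}
    (hac : ∀ j k X, c k (a j * X) = (if k = j then 1 else 0 : ℂ) • X - a j * c k X)
    {l : List κ} (hl : l.Nodup) {φ : CForm n} (h : ∀ k ∈ l, a k * φ = 0) :
    φ = frameProd a l * frameContr c l φ := by
  induction l generalizing φ with
  | nil => simp [frameProd, frameContr]
  | cons k l ih =>
    rw [List.nodup_cons] at hl
    have h1 := ih hl.2 (φ := c k φ) (fun j hj => by
      have hjk : k ≠ j := fun e => hl.1 (e ▸ hj)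
      have := hac j k φ
      rw [h j (List.mem_cons_of_mem _ hj), map_zero, if_neg hjk, zero_smul, zero_sub] at this
      exact neg_eq_zero.mp this.symm)
    have h2 := hac k k φ
    rw [h k List.mem_cons_self, map_zero, if_pos rfl, one_smul] at h2
    have h3 := (sub_eq_zero.mp h2.symm)
    conv_lhs => rw [h3, h1]
    simp only [frameProd, frameContr, List.map_cons, List.prod_cons, mul_assoc,
      Module.End.mul_apply]

theorem frameContr_frameProd_mul {κ : Type*} [DecidableEq κ] {a : κ → CForm n}
    {c : κ → Module.End ℂ (CForm n)}
    (hac : ∀ j k X, c k (a j * X) = (if k = j then 1 else 0 : ℂ) • X - a j * c k X)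
    {l : List κ} (hl : l.Nodup) {φ : CForm n} (h : ∀ k, c k φ = 0) :
    frameContr c l (frameProd a l * φ) = φ := by
  have h0 : ∀ (k : κ) (l : List κ), k ∉ l → c k (frameProd a l * φ) = 0 := by
    intro k l
    induction l with
    | nil => intro _; simpa [frameProd] using h k
    | cons j l ih =>
      intro hk
      rw [List.mem_cons, not_or] at hk
      have := ih hk.2
      simp only [frameProd, List.map_cons, List.prod_cons, mul_assoc] at this ⊢
      rw [hac, if_neg hk.1, zero_smul, this, mul_zero, sub_zero]
  induction l with
  | nil => simp [frameProd, frameContr]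
  | cons k l ih =>
    rw [List.nodup_cons] at hl
    have h1 := h0 k l hl.1
    have h2 := ih hl.2
    simp only [frameProd, frameContr, List.map_cons, List.prod_cons, mul_assoc,
      Module.End.mul_apply] at h1 h2 ⊢
    rw [hac, if_pos rfl, one_smul, h1, mul_zero, sub_zero, h2]

theorem mul_frameProd_of_mem {κ : Type*} {ζ : κ → (Cn n →L[ℝ] ℂ)} {l : List κ} {k : κ} (hk : k ∈ l) :
    ιz (ζ k) * frameProd (fun j => ιz (ζ j)) l = 0 := by
  induction l with
  | nil => simp at hk
  | cons j l ih =>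
    simp only [frameProd, List.map_cons, List.prod_cons] at ih ⊢
    rcases List.mem_cons.mp hk with rfl | hk
    · rw [← mul_assoc, ιz_mul_self, zero_mul]
    · rw [← mul_assoc, ιz_mul_ιz, cneg_mul, mul_assoc, ih hk, mul_zero, neg_zero]

/-- The coordinate functions `z_j` as complex covectors. -/
def dz (j : Fin n) : Cn n →L[ℝ] ℂ := ContinuousLinearMap.proj (R := ℝ) j

/-- The conjugate coordinate functions `z̄_j` as complex covectors. -/
def dzbar (j : Fin n) : Cn n →L[ℝ] ℂ := (Complex.conjCLE : ℂ →L[ℝ] ℂ).comp (dz j)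

/-- The constant holomorphic volume form `dz_1 ∧ ⋯ ∧ dz_n`. -/
def hvol (n : ℕ) : CForm n := frameProd (fun j => ιz (dz j)) (List.finRange n)

/-- Interior product with the `(0,1)`-part of a real vector. -/
def cint01 (v : Cn n) : Module.End ℂ (CForm n) :=
  (1 / 2 : ℂ) • (cint v + Complex.I • cint (stdJ n v))

theorem cint10_add_cint01 (v : Cn n) (X : CForm n) : cint10 v X + cint01 v X = cint v X := by
  simp only [cint10, cint01, LinearMap.smul_apply, LinearMap.sub_apply, LinearMap.add_apply]
  module

theorem cint10_ιz_mul (v : Cn n) (ζ : Cn n →L[ℝ] ℂ) (X : CForm n) :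
    cint10 v (ιz ζ * X) =
      ((1 / 2 : ℂ) * (ζ v - Complex.I * ζ (stdJ n v))) • X - ιz ζ * cint10 v X := by
  simp only [cint10, LinearMap.smul_apply, LinearMap.sub_apply, cint_ιz_mul, mul_smul_comm, mul_sub]
  module

theorem cint01_ιz_mul (v : Cn n) (ζ : Cn n →L[ℝ] ℂ) (X : CForm n) :
    cint01 v (ιz ζ * X) =
      ((1 / 2 : ℂ) * (ζ v + Complex.I * ζ (stdJ n v))) • X - ιz ζ * cint01 v X := by
  simp only [cint01, LinearMap.smul_apply, LinearMap.add_apply, cint_ιz_mul, mul_smul_comm, mul_add]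
  module

theorem dz_stdJ (j : Fin n) (v : Cn n) : dz j (stdJ n v) = Complex.I * dz j v := by
  simp [dz, stdJ_apply]

theorem cint01_dz_mul (v : Cn n) (j : Fin n) (X : CForm n) :
    cint01 v (ιz (dz j) * X) = -(ιz (dz j) * cint01 v X) := by
  rw [cint01_ιz_mul, dz_stdJ, ← mul_assoc, Complex.I_mul_I]
  simp

theorem cint10_dz_mul (j k : Fin n) (X : CForm n) :
    cint10 (Pi.single k 1) (ιz (dz j) * X) =
      (if k = j then 1 else 0 : ℂ) • X - ιz (dz j) * cint10 (Pi.single k 1) X := by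
  rw [cint10_ιz_mul, dz_stdJ, ← mul_assoc, Complex.I_mul_I]
  congr 2
  simp only [dz, ContinuousLinearMap.proj_apply, Pi.single_apply]
  by_cases h : k = j
  · simp [h]; norm_num
  · simp [h, Ne.symm h]

theorem cint10_one (v : Cn n) : cint10 v (1 : CForm n) = 0 := by
  simp [cint10, cint_one]

theorem cint01_one (v : Cn n) : cint01 v (1 : CForm n) = 0 := by
  simp [cint01, cint_one]

theorem hvol_ne_zero : hvol n ≠ 0 := by
  intro h
  have := frameContr_frameProd_mul (fun j k X => cint10_dz_mul j k X) (List.nodup_finRange n)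
    (φ := 1) (fun k => cint10_one _)
  rw [mul_one] at this
  change frameContr _ _ (hvol n) = 1 at this
  rw [h, map_zero] at this
  have := congrArg scalarPart this
  simp at this

theorem dz_mul_hvol (j : Fin n) : ιz (dz j) * hvol n = 0 :=
  mul_frameProd_of_mem (List.mem_finRange j)

theorem cint01_hvol (v : Cn n) : cint01 v (hvol n) = 0 := by
  have : ∀ l : List (Fin n), cint01 v (frameProd (fun j => ιz (dz j)) l) = 0 := by
    intro l
    induction l with
    | nil => simp [frameProd, cint01_one]
    | cons j l ih =>
      simp only [frameProd, List.map_cons, List.prod_cons] at ih ⊢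
      rw [cint01_dz_mul, ih, mul_zero, neg_zero]
  exact this _

theorem single_I (j : Fin n) : (Pi.single j Complex.I : Cn n) = stdJ n (Pi.single j 1) := by
  rw [stdJ_apply, ← Pi.single_smul, smul_eq_mul, mul_one]

theorem clinear_expand {F : Type*} [AddCommGroup F] [Module ℂ F] [Module ℝ F] [IsScalarTower ℝ ℂ F]
    (D : Cn n →ₗ[ℝ] F) (hD : ∀ v, D (stdJ n v) = Complex.I • D v) (v : Cn n) :
    D v = ∑ j, v j • D (Pi.single j 1) := by
  rw [lin_expand D v]
  refine Finset.sum_congr rfl fun j _ => ?_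
  rw [single_I, hD]
  conv_rhs => rw [← Complex.re_add_im (v j)]
  rw [add_smul, mul_smul]
  congr 1
  · exact (algebraMap_smul ℂ _ _).symm
  · exact (algebraMap_smul ℂ _ _).symm

theorem antilinear_expand {F : Type*} [AddCommGroup F] [Module ℂ F] [Module ℝ F]
    [IsScalarTower ℝ ℂ F] (D : Cn n →ₗ[ℝ] F) (hD : ∀ v, D (stdJ n v) = -(Complex.I • D v))
    (v : Cn n) : D v = ∑ j, (starRingEnd ℂ) (v j) • D (Pi.single j 1) := by
  rw [lin_expand D v]
  refine Finset.sum_congr rfl fun j _ => ?_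
  rw [single_I, hD]
  have : (starRingEnd ℂ) (v j) = ((v j).re : ℂ) + ((v j).im : ℂ) * (-Complex.I) := by
    apply Complex.ext <;> simp
  rw [this, add_smul, mul_smul, neg_smul]
  congr 1
  · exact (algebraMap_smul ℂ _ _).symm
  · exact (algebraMap_smul ℂ _ _).symm

theorem ιz_mul_hvol {ζ : Cn n →L[ℝ] ℂ} (hζ : ∀ v, ζ (stdJ n v) = Complex.I • ζ v) :
    ιz ζ * hvol n = 0 := by
  have h : ζ = ∑ j, ζ (Pi.single j 1) • dz j := by
    ext1 v
    have := clinear_expand (ζ : Cn n →ₗ[ℝ] ℂ) hζ v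
    simp only [ContinuousLinearMap.coe_coe] at this
    rw [this]
    simp [dz, mul_comm]
  rw [h, map_sum, Finset.sum_mul]
  refine Finset.sum_eq_zero fun j _ => ?_
  rw [map_smul, smul_mul_assoc, dz_mul_hvol, smul_zero]

theorem induces_hvol : Induces (hvol n) (ofComplex (stdJ n)) := by
  refine induces_of_annihilates ofComplex_sq ofComplex_orth hvol_ne_zero fun c => ?_
  have h1 := cint01_hvol c.1
  simp only [cint01, LinearMap.smul_apply, LinearMap.add_apply] at h1
  have h1' := (smul_eq_zero.mp h1).resolve_left (by norm_num)
  have h2 : ιz (Complex.ofRealCLM.comp c.2 - Complex.I • Complex.ofRealCLM.comp (c.2.comp (stdJ n)))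
      * hvol n = 0 := by
    refine ιz_mul_hvol fun v => ?_
    simp only [sub_apply, smul_apply,
      ContinuousLinearMap.comp_apply, stdJ_stdJ, map_neg, smul_eq_mul, mul_sub, ← mul_assoc,
      Complex.I_mul_I]
    ring
  rw [map_sub, map_smul, ← ιc_eq_ιz, ← ιc_eq_ιz, sub_mul, smul_mul_assoc] at h2
  simp only [cliff_apply, ofComplex_apply, map_neg, cneg_mul, smul_add, smul_neg]
  rw [add_add_add_comm, h1', zero_add, ← sub_eq_add_neg, h2]

/-- The coefficient of a multiple of the holomorphic volume form. -/
def hcoef : CForm n →ₗ[ℂ] ℂ :=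
  scalarPart.toLinearMap ∘ₗ
    frameContr (fun k => cint10 (Pi.single k 1)) (List.finRange n)

theorem cint10_comm (u v : Cn n) (X : CForm n) : cint10 u (cint10 v X) = -cint10 v (cint10 u X) := by
  simp only [cint10, LinearMap.smul_apply, LinearMap.sub_apply, map_smul, map_sub]
  rw [cint_comm u v, cint_comm (stdJ n u) v, cint_comm u (stdJ n v),
    cint_comm (stdJ n u) (stdJ n v)]
  module

theorem cint10_self (u : Cn n) (X : CForm n) : cint10 u (cint10 u X) = 0 := by
  have h := cint10_comm u u X
  have h2 : (2 : ℂ) • cint10 u (cint10 u X) = 0 := by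
    rw [two_smul]; nth_rewrite 1 [h]; simp
  exact (smul_eq_zero.mp h2).resolve_left two_ne_zero

theorem cint01_cint10 (u v : Cn n) (X : CForm n) :
    cint01 u (cint10 v X) = -cint10 v (cint01 u X) := by
  simp only [cint10, cint01, LinearMap.smul_apply, LinearMap.sub_apply, LinearMap.add_apply,
    map_smul, map_sub, map_add]
  rw [cint_comm u v, cint_comm (stdJ n u) v, cint_comm u (stdJ n v),
    cint_comm (stdJ n u) (stdJ n v)]
  module

theorem cint10_stdJ (v : Cn n) (X : CForm n) : cint10 (stdJ n v) X = Complex.I • cint10 v X := by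
  simp only [cint10, LinearMap.smul_apply, LinearMap.sub_apply, stdJ_stdJ, cint_neg,
    LinearMap.neg_apply, smul_sub, smul_neg, smul_smul]
  have : (Complex.I * ((1 / 2 : ℂ) * Complex.I)) = -(1 / 2 : ℂ) := by
    rw [mul_left_comm, Complex.I_mul_I]; ring
  rw [this]
  module

theorem frameContr_anti {κ : Type*} {c : κ → Module.End ℂ (CForm n)} (f : Module.End ℂ (CForm n))
    (hf : ∀ k X, f (c k X) = -c k (f X)) (l : List κ) {X : CForm n} (hX : f X = 0) :
    f (frameContr c l X) = 0 := by
  induction l generalizing X with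
  | nil => simpa [frameContr] using hX
  | cons k l ih =>
    simp only [frameContr, Module.End.mul_apply]
    exact ih (by rw [hf, hX, map_zero, neg_zero])

theorem frameContr_mem {κ : Type*} {c : κ → Module.End ℂ (CForm n)}
    (hc : ∀ j k X, c j (c k X) = -c k (c j X)) (hs : ∀ k X, c k (c k X) = 0) (l : List κ) {k : κ}
    (hk : k ∈ l) (X : CForm n) : c k (frameContr c l X) = 0 := by
  induction l generalizing X with
  | nil => simp at hk
  | cons j l ih =>
    simp only [frameContr, Module.End.mul_apply]
    rcases List.mem_cons.mp hk with rfl | hk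
    · exact frameContr_anti _ (fun i X => hc k i X) l (hs k X)
    · exact ih hk _

/-- A form annihilated by the covectors `dz_j` and by the vectors of type `(0,1)` is a multiple of
the holomorphic volume form. -/
theorem eq_hcoef_smul_hvol {φ : CForm n} (h1 : ∀ j, ιz (dz j) * φ = 0) (h2 : ∀ v, cint01 v φ = 0) :
    φ = hcoef φ • hvol n := by
  set χ := frameContr (fun k => cint10 (Pi.single k 1)) (List.finRange n) φ with hχ
  have e1 : φ = hvol n * χ := eq_frameProd_mul (fun j k X => cint10_dz_mul j k X)
    (List.nodup_finRange n) (fun k _ => h1 k)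
  have e2 : ∀ k : Fin n, cint10 (Pi.single k 1) χ = 0 := fun k =>
    frameContr_mem (fun j k X => cint10_comm _ _ X) (fun k X => cint10_self _ X) _
      (List.mem_finRange k) φ
  have e3 : ∀ v : Cn n, cint01 v χ = 0 := fun v =>
    frameContr_anti _ (fun k X => cint01_cint10 _ _ X) _ (h2 v)
  have e4 : ∀ v : Cn n, cint10 v χ = 0 := by
    intro v
    let D : Cn n →ₗ[ℝ] CForm n :=
      { toFun := fun v => cint10 v χ
        map_add' := fun u v => by
          simp only [cint10, map_add, cint_add, LinearMap.smul_apply, LinearMap.sub_apply,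
            LinearMap.add_apply]
          module
        map_smul' := fun r v => by
          simp only [cint10, map_smul, cint_smul, LinearMap.smul_apply, LinearMap.sub_apply,
            RingHom.id_apply, real_smul_eq]
          module }
    have := clinear_expand D (fun v => cint10_stdJ v χ) v
    change cint10 v χ = _ at this
    rw [this]
    exact Finset.sum_eq_zero fun j _ => by
      change v j • cint10 (Pi.single j 1) χ = 0
      rw [e2, smul_zero]
  have e5 : χ = scalarPart χ • 1 := eq_scalar_of_cint fun v => by
    rw [← cint10_add_cint01, e3, e4, add_zero]
  rw [e1, e5]
  rw [mul_smul_comm, mul_one]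
  congr 1
  rw [hcoef, LinearMap.comp_apply, ← mul_one (hvol n), ← mul_smul_comm, ← e5, ← e1]
  rfl

/-- The complex divergence (trace) of a complex linear endomorphism, as the eigenvalue of the
corresponding derivation on the holomorphic volume form. -/
def cdiv (A : Cn n →L[ℝ] Cn n) : ℂ := hcoef (lieOp A (hvol n))

theorem lieOp_hvol {A : Cn n →L[ℝ] Cn n} (hA : ∀ v, A (stdJ n v) = stdJ n (A v)) :
    lieOp A (hvol n) = cdiv A • hvol n := by
  refine eq_hcoef_smul_hvol (fun j => ?_) (fun v => ?_)
  · have h := lieOp_mul A (ιz (dz j)) (hvol n)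
    rw [dz_mul_hvol, map_zero, lieOp_ιz, ιz_mul_hvol, zero_add] at h
    · exact h.symm
    · intro v
      simp only [ContinuousLinearMap.comp_apply, hA, dz_stdJ, smul_eq_mul]
  · have h : ∀ u X, cint u (lieOp A X) = lieOp A (cint u X) + cint (A u) X := by
      intro u X; rw [lieOp_cint]; abel
    have h1 := cint01_hvol v
    have h2 := cint01_hvol (A v)
    simp only [cint01, LinearMap.smul_apply, LinearMap.add_apply, h, hA] at h1 h2 ⊢
    have h3 := congrArg (lieOp A) h1
    rw [map_zero, map_smul, map_add, map_smul] at h3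
    have h4 := congrArg₂ (· + ·) h3 h2
    simp only [add_zero] at h4
    rw [← h4]
    module

/-! #### The volume of a Hermitian metric -/

/-- The matrix of the Hermitian metric of a real two-form of type `(1,1)`. -/
def hmat (ω₀ : RForm n) : Matrix (Fin n) (Fin n) ℂ :=
  Matrix.of fun j k => (eval2 ω₀ (stdJ n (Pi.single j 1)) (Pi.single k 1) : ℂ) -
    Complex.I * (eval2 ω₀ (stdJ n (stdJ n (Pi.single j 1))) (Pi.single k 1) : ℂ)

theorem contr_add (ω₀ : RForm n) (u v : Cn n) : contr ω₀ (u + v) = contr ω₀ u + contr ω₀ v := by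
  refine ContinuousLinearMap.ext fun w => ?_
  change ExteriorAlgebra.algebraMapInv (rint w (rint (u + v) ω₀)) =
    ExteriorAlgebra.algebraMapInv (rint w (rint u ω₀)) +
      ExteriorAlgebra.algebraMapInv (rint w (rint v ω₀))
  simp [rint]

theorem contr_smul (ω₀ : RForm n) (r : ℝ) (u : Cn n) : contr ω₀ (r • u) = r • contr ω₀ u := by
  refine ContinuousLinearMap.ext fun w => ?_
  change ExteriorAlgebra.algebraMapInv (rint w (rint (r • u) ω₀)) =
    r * ExteriorAlgebra.algebraMapInv (rint w (rint u ω₀))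
  simp [rint]

/-- Contraction with a two-form as a linear map. -/
def contrL (ω₀ : RForm n) : Cn n →ₗ[ℝ] Cov n where
  toFun := contr ω₀
  map_add' := contr_add ω₀
  map_smul' := contr_smul ω₀

theorem contr_neg (ω₀ : RForm n) (u : Cn n) : contr ω₀ (-u) = -contr ω₀ u :=
  map_neg (contrL ω₀) u

theorem eval2_neg_left (ω₀ : RForm n) (u v : Cn n) : eval2 ω₀ (-u) v = -eval2 ω₀ u v := by
  rw [eval2, contr_neg]; rfl

theorem hform_expand {ω₀ : RForm n}
    (hJ : ∀ u v, eval2 ω₀ (stdJ n u) (stdJ n v) = eval2 ω₀ u v) (u v : Cn n) :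
    (eval2 ω₀ (stdJ n u) v : ℂ) - Complex.I * (eval2 ω₀ (stdJ n (stdJ n u)) v : ℂ) =
      ∑ j, ∑ k, hmat ω₀ j k * (u j * (starRingEnd ℂ) (v k)) := by
  let D1 (v : Cn n) : Cn n →ₗ[ℝ] ℂ :=
    { toFun := fun u => (eval2 ω₀ (stdJ n u) v : ℂ) -
        Complex.I * (eval2 ω₀ (stdJ n (stdJ n u)) v : ℂ)
      map_add' := fun u w => by
        simp only [eval2, map_add, contr_add, add_apply]; push_cast; ring
      map_smul' := fun r u => by
        simp only [eval2, map_smul, contr_smul, smul_apply, smul_eq_mul, RingHom.id_apply,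
          Complex.real_smul]
        push_cast; ring }
  let D2 (u : Cn n) : Cn n →ₗ[ℝ] ℂ :=
    { toFun := fun v => D1 v u
      map_add' := fun v w => by
        simp only [D1, LinearMap.coe_mk, AddHom.coe_mk, eval2, map_add]; push_cast; ring
      map_smul' := fun r v => by
        simp only [D1, LinearMap.coe_mk, AddHom.coe_mk, eval2, map_smul, smul_eq_mul,
          RingHom.id_apply, Complex.real_smul]
        push_cast; ring }
  have h1 : ∀ v u, D1 v (stdJ n u) = Complex.I • D1 v u := by
    intro v u
    simp only [D1, LinearMap.coe_mk, AddHom.coe_mk, stdJ_stdJ u, map_neg, eval2_neg_left,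
      smul_eq_mul, mul_sub, ← mul_assoc, Complex.I_mul_I]
    push_cast; ring
  have h2 : ∀ u v, D2 u (stdJ n v) = -(Complex.I • D2 u v) := by
    intro u v
    have e1 : eval2 ω₀ (stdJ n (stdJ n u)) (stdJ n v) = eval2 ω₀ (stdJ n u) v := hJ _ _
    have e2 : eval2 ω₀ (stdJ n u) (stdJ n v) = -eval2 ω₀ (stdJ n (stdJ n u)) v := by
      rw [hJ, stdJ_stdJ, eval2_neg_left, neg_neg]
    simp only [D2, D1, LinearMap.coe_mk, AddHom.coe_mk, e1, e2, smul_eq_mul, mul_sub, ← mul_assoc,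
      Complex.I_mul_I]
    push_cast; ring
  have h3 := clinear_expand (D1 v) (h1 v) u
  change D1 v u = _
  rw [h3]
  refine Finset.sum_congr rfl fun j _ => ?_
  have h4 := antilinear_expand (D2 (Pi.single j 1)) (h2 _) v
  change u j • D2 (Pi.single j 1) v = _
  rw [h4, Finset.smul_sum]
  refine Finset.sum_congr rfl fun k _ => ?_
  simp only [smul_eq_mul]
  change _ * (_ * hmat ω₀ j k) = _
  ring

theorem cint_cint_ιz_mul (ζ ζ' : Cn n →L[ℝ] ℂ) (u v : Cn n) :
    cint v (cint u (ιz ζ * ιz ζ')) = (ζ u * ζ' v - ζ' u * ζ v) • 1 := by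
  rw [cint_ιz_mul, cint_ιz, map_sub, map_smul, cint_ιz, mul_smul_comm, mul_one, map_smul, cint_ιz,
    smul_smul, smul_smul, sub_smul]

theorem hrow_apply (ω₀ : RForm n) (j : Fin n) (v : Cn n) :
    (∑ k, hmat ω₀ j k • dzbar k) v = ∑ k, hmat ω₀ j k * (starRingEnd ℂ) (v k) := by
  rw [sum_apply]
  rfl

/-- `2iω = ∑ h_jk dz_j ∧ dz̄_k`. -/
theorem two_I_omega {ω₀ : RForm n} (hω : ω₀ ∈ degreePart n 2)
    (hJ : ∀ u v, eval2 ω₀ (stdJ n u) (stdJ n v) = eval2 ω₀ u v) :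
    (2 * Complex.I) • toC ω₀ =
      ∑ j, ιz (dz j) * ιz (∑ k, hmat ω₀ j k • dzbar k) := by
  refine two_form_ext ?_ ?_ fun u v => ?_
  · exact (isHom_toC hω).smul _
  · refine isHom_sum _ fun j _ => ?_
    exact IsHom.mul (j := 1) (k := 1) (isHom_ιz _) (isHom_ιz _)
  · have e1 := hform_expand hJ u v
    have e2 := hform_expand hJ v u
    have e3 : eval2 ω₀ (stdJ n v) u = eval2 ω₀ (stdJ n u) v := by
      rw [← hJ, stdJ_stdJ, eval2_neg_left, eval2_antisymm hω, neg_neg]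
    have e4 : 2 * Complex.I * (eval2 ω₀ u v : ℂ) =
        ((eval2 ω₀ (stdJ n u) v : ℂ) - Complex.I * (eval2 ω₀ (stdJ n (stdJ n u)) v : ℂ)) -
        ((eval2 ω₀ (stdJ n v) u : ℂ) - Complex.I * (eval2 ω₀ (stdJ n (stdJ n v)) u : ℂ)) := by
      rw [e3, stdJ_stdJ, stdJ_stdJ, eval2_neg_left, eval2_neg_left, eval2_antisymm hω v u]
      push_cast; ring
    have e5 : 2 * Complex.I * (eval2 ω₀ u v : ℂ) = ∑ j, (u j * (∑ k, hmat ω₀ j k • dzbar k) v -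
        (∑ k, hmat ω₀ j k • dzbar k) u * v j) := by
      rw [e4, e1, e2, ← Finset.sum_sub_distrib]
      refine Finset.sum_congr rfl fun j _ => ?_
      rw [hrow_apply, hrow_apply, Finset.mul_sum, Finset.sum_mul, ← Finset.sum_sub_distrib,
        ← Finset.sum_sub_distrib]
      refine Finset.sum_congr rfl fun k _ => ?_
      ring
    rw [map_smul, map_smul, cint_cint_two_form hω, smul_smul, e5, Finset.sum_smul, map_sum, map_sum]
    refine Finset.sum_congr rfl fun j _ => ?_
    rw [cint_cint_ιz_mul]
    rfl

theorem add_pow_of_sq_zero {A : Type*} [Ring A] {s x : A} (h : Commute s x) (hx : x * x = 0)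
    (k : ℕ) : (x + s) ^ (k + 1) = s ^ (k + 1) + ((k + 1 : ℕ) : A) * (x * s ^ k) := by
  induction k with
  | zero => simp [add_comm]
  | succ k ih =>
    rw [pow_succ' (x + s), ih]
    have h1 : s * ((k + 1 : ℕ) : A) = ((k + 1 : ℕ) : A) * s := (Nat.cast_commute _ _).eq.symm
    have h2 : x * ((k + 1 : ℕ) : A) = ((k + 1 : ℕ) : A) * x := (Nat.cast_commute _ _).eq.symm
    rw [add_mul, mul_add, mul_add, ← mul_assoc x, h2, mul_assoc _ x, ← mul_assoc x x, hx, zero_mul,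
      mul_zero, add_zero, ← mul_assoc s, h1, mul_assoc _ s, ← mul_assoc s x, h.eq, mul_assoc x s,
      ← pow_succ', ← pow_succ']
    push_cast
    noncomm_ring

theorem sum_pow_of_sq_zero {A : Type*} [Ring A] (l : List A) (hs : ∀ x ∈ l, x * x = 0)
    (hc : ∀ x ∈ l, ∀ y ∈ l, Commute x y) :
    l.sum ^ l.length = (l.length.factorial : A) * l.prod ∧ l.sum ^ (l.length + 1) = 0 := by
  induction l with
  | nil => simp
  | cons x l ih =>
    have ih' := ih (fun y hy => hs y (List.mem_cons_of_mem _ hy))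
      (fun y hy z hz => hc y (List.mem_cons_of_mem _ hy) z (List.mem_cons_of_mem _ hz))
    have hcom : Commute l.sum x := by
      clear ih ih' hs
      have : ∀ y ∈ l, Commute y x := fun y hy =>
        hc y (List.mem_cons_of_mem _ hy) x List.mem_cons_self
      clear hc
      induction l with
      | nil => simp
      | cons y l ih =>
        rw [List.sum_cons]
        exact (this y List.mem_cons_self).add_left (ih fun z hz => this z (List.mem_cons_of_mem _ hz))
    have hx := hs x List.mem_cons_self
    rw [List.sum_cons, List.length_cons, add_pow_of_sq_zero hcom hx, add_pow_of_sq_zero hcom hx,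
      pow_succ _ (l.length + 1), ih'.2, ih'.1]
    constructor
    · rw [zero_add, List.prod_cons, Nat.factorial_succ, Nat.cast_mul, mul_assoc, ← mul_assoc x,
        (Nat.cast_commute l.length.factorial x).eq.symm, mul_assoc]
    · simp

/-- Complex one-forms generate an exterior algebra. -/
theorem prod_matrix (A : Matrix (Fin n) (Fin n) ℂ) (ζ : Fin n → (Cn n →L[ℝ] ℂ)) :
    frameProd (fun j => ιz (∑ k, A j k • ζ k)) (List.finRange n) =
      A.det • frameProd (fun j => ιz (ζ j)) (List.finRange n) := by
  let g : ExteriorAlgebra ℂ (Cn n →L[ℝ] ℂ) →ₐ[ℂ] CForm n :=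
    ExteriorAlgebra.lift ℂ ⟨ιz, ιz_mul_self⟩
  let L : (Fin n → ℂ) →ₗ[ℂ] (Cn n →L[ℝ] ℂ) :=
    { toFun := fun c => ∑ k, c k • ζ k
      map_add' := fun c d => by
        rw [← Finset.sum_add_distrib]
        exact Finset.sum_congr rfl fun k _ => by ext v; simp [add_mul]
      map_smul' := fun r c => by
        simp only [Pi.smul_apply, smul_eq_mul, mul_smul, Finset.smul_sum, RingHom.id_apply] }
  let f : (Fin n → ℂ) [⋀^Fin n]→ₗ[ℂ] CForm n :=
    (g.toLinearMap.compAlternatingMap (ExteriorAlgebra.ιMulti ℂ n)).compLinearMap L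
  have hf : ∀ c : Fin n → (Fin n → ℂ), f c = frameProd (fun j => ιz (L (c j))) (List.finRange n) := by
    intro c
    simp only [f, AlternatingMap.compLinearMap_apply, LinearMap.compAlternatingMap_apply,
      ExteriorAlgebra.ιMulti_apply, frameProd]
    change g _ = _
    rw [map_list_prod, List.map_ofFn, List.ofFn_eq_map]
    congr 2
    funext j
    simp [g]
  let f' : (Fin n → ℂ) [⋀^Fin n]→ₗ[ℂ] CForm n :=
    (LinearMap.toSpanSingleton ℂ (CForm n) (f (Pi.basisFun ℂ (Fin n)))).compAlternatingMap
      Matrix.detRowAlternating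
  -- both sides are alternating in the rows of the matrix, so it suffices to compare them on a basis
  have h1 : f = f' := by
    refine Module.Basis.ext_alternating (Pi.basisFun ℂ (Fin n)) fun v hv => ?_
    let σ : Equiv.Perm (Fin n) := Equiv.ofBijective v (Finite.injective_iff_bijective.mp hv)
    have e : (fun i => Pi.basisFun ℂ (Fin n) (v i)) = (Pi.basisFun ℂ (Fin n)) ∘ σ := rfl
    rw [e, AlternatingMap.map_perm, AlternatingMap.map_perm]
    congr 1
    have e2 : (Matrix.detRowAlternating (R := ℂ) (n := Fin n)) (Pi.basisFun ℂ (Fin n)) = 1 := by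
      rw [← Pi.basisFun_det, Module.Basis.det_self]
    simp only [f', LinearMap.compAlternatingMap_apply, LinearMap.toSpanSingleton_apply, e2,
      one_smul]
  have h2 := hf A
  rw [h1] at h2
  change A.det • f (Pi.basisFun ℂ (Fin n)) = _ at h2
  rw [hf] at h2
  have e3 : ∀ j, L (Pi.basisFun ℂ (Fin n) j) = ζ j := by
    intro j
    change ∑ k, (Pi.basisFun ℂ (Fin n) j) k • ζ k = ζ j
    rw [Finset.sum_eq_single j]
    · simp
    · intro k _ hk; ext v; simp [hk]
    · simp
  simp only [e3] at h2
  exact h2.symm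

theorem conjF_ιz (ζ : Cn n →L[ℝ] ℂ) :
    conjF (ιz ζ) = ιz ((Complex.conjCLE : ℂ →L[ℝ] ℂ).comp ζ) := by
  rw [ιz_apply, ιz_apply, map_add, conjF_smul, conjF_ιc, conjF_ιc, Complex.conj_I]
  have h1 : Complex.reCLM.comp ((Complex.conjCLE : ℂ →L[ℝ] ℂ).comp ζ) = Complex.reCLM.comp ζ := by
    ext v; simp
  have h2 : Complex.imCLM.comp ((Complex.conjCLE : ℂ →L[ℝ] ℂ).comp ζ) =
      -Complex.imCLM.comp ζ := by
    ext v; simp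
  rw [h1, h2, map_neg]
  module

theorem conjF_hvol : conjF (hvol n) = frameProd (fun j => ιz (dzbar j)) (List.finRange n) := by
  rw [hvol, frameProd, frameProd, map_list_prod, List.map_map]
  congr 2
  funext j
  exact conjF_ιz _

/-- `∏ (a_j ∧ w_j) = (∏ a_j) ∧ σ (∏ w_j)`. -/
theorem prod_pairs (ζ η : Fin n → (Cn n →L[ℝ] ℂ)) (l : List (Fin n)) :
    frameProd (fun j => ιz (ζ j) * ιz (η j)) l =
      frameProd (fun j => ιz (ζ j)) l * sigma (frameProd (fun j => ιz (η j)) l) := by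
  have heps : ∀ l : List (Fin n), eps (frameProd (fun j => ιz (ζ j) * ιz (η j)) l) =
      frameProd (fun j => ιz (ζ j) * ιz (η j)) l := by
    intro l
    rw [frameProd, map_list_prod, List.map_map]
    congr 2
    funext j
    change eps (ιz (ζ j) * ιz (η j)) = _
    rw [map_mul, eps_ιz, eps_ιz, cneg_mul, cmul_neg, neg_neg]
  have hcomm : ∀ (η : Cn n →L[ℝ] ℂ) (X : CForm n), ιz η * X = eps X * ιz η := by
    intro η X
    rw [ιz_apply, add_mul, smul_mul_assoc, ιc_mul_eq, ιc_mul_eq, mul_add, mul_smul_comm]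
  induction l with
  | nil => simp [frameProd, sigma_one]
  | cons k l ih =>
    have h1 := heps l
    simp only [frameProd, List.map_cons, List.prod_cons, sigma_mul, sigma_ιz] at ih h1 ⊢
    rw [mul_assoc, hcomm (η k), h1, ih]
    simp only [mul_assoc]

/-- The volume formula `(2iω)ⁿ = n! det h · Ω ∧ σ(Ω̄)`. -/
theorem two_I_omega_pow {ω₀ : RForm n} (hω : ω₀ ∈ degreePart n 2)
    (hJ : ∀ u v, eval2 ω₀ (stdJ n u) (stdJ n v) = eval2 ω₀ u v) :
    ((2 * Complex.I) • toC ω₀) ^ n =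
      (n.factorial : ℂ) • (hmat ω₀).det • (hvol n * sigma (conjF (hvol n))) := by
  have h := (sum_pow_of_sq_zero
    ((List.finRange n).map fun j => ιz (dz j) * ιz (∑ k, hmat ω₀ j k • dzbar k)) ?_ ?_).1
  · rw [List.length_map, List.length_finRange] at h
    have hsum : ((List.finRange n).map fun j => ιz (dz j) * ιz (∑ k, hmat ω₀ j k • dzbar k)).sum =
        (2 * Complex.I) • toC ω₀ := by
      rw [two_I_omega hω hJ, ← List.ofFn_eq_map, List.sum_ofFn]
    have hprod := prod_pairs (fun j => dz j) (fun j => ∑ k, hmat ω₀ j k • dzbar k) (List.finRange n)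
    rw [prod_matrix, ← conjF_hvol, map_smul, mul_smul_comm] at hprod
    rw [hsum] at h
    rw [h]
    change _ * frameProd _ _ = _
    rw [hprod]
    change _ = (n.factorial : ℂ) • (hmat ω₀).det • (frameProd (fun j => ιz (dz j)) _ * _)
    rw [← nsmul_eq_mul, ← Nat.cast_smul_eq_nsmul ℂ]
  · intro x hx
    obtain ⟨j, -, rfl⟩ := List.mem_map.mp hx
    rw [mul_assoc, ← mul_assoc (ιz (∑ k, hmat ω₀ j k • dzbar k)), ιz_mul_ιz (∑ k, _) (dz j), cneg_mul,
      cmul_neg, mul_assoc, ιz_mul_self, mul_zero, mul_zero, neg_zero]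
  · intro x hx y hy
    obtain ⟨j, -, rfl⟩ := List.mem_map.mp hx
    obtain ⟨k, -, rfl⟩ := List.mem_map.mp hy
    have key : ∀ a b c d : Cn n →L[ℝ] ℂ, (ιz a * ιz b) * (ιz c * ιz d) =
        (ιz c * ιz d) * (ιz a * ιz b) := by
      intro a b c d
      rw [mul_assoc, ← mul_assoc (ιz b), ιz_mul_ιz b c, cneg_mul, cmul_neg, mul_assoc, ιz_mul_ιz b d,
        cmul_neg, cmul_neg, neg_neg, ← mul_assoc, ιz_mul_ιz a c, cneg_mul, mul_assoc, ← mul_assoc (ιz a),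
        ιz_mul_ιz a d, cneg_mul, cmul_neg, neg_neg, mul_assoc, mul_assoc]
    exact key _ _ _ _

open scoped ComplexOrder in
/-- The determinant of a positive definite Hermitian metric is positive. -/
theorem hmat_det_pos {ω₀ : RForm n} (hω : ω₀ ∈ degreePart n 2)
    (hJ : ∀ u v, eval2 ω₀ (stdJ n u) (stdJ n v) = eval2 ω₀ u v)
    (hpos : ∀ u, u ≠ 0 → 0 < eval2 ω₀ (stdJ n u) u) :
    0 < (hmat ω₀).det.re ∧ (hmat ω₀).det.im = 0 := by
  have e3 : ∀ u v, eval2 ω₀ (stdJ n v) u = eval2 ω₀ (stdJ n u) v := by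
    intro u v
    rw [← hJ, stdJ_stdJ, eval2_neg_left, eval2_antisymm hω, neg_neg]
  have hpd : (hmat ω₀).PosDef := by
    refine Matrix.PosDef.of_dotProduct_mulVec_pos ?_ fun x hx => ?_
    · ext j k
      simp only [hmat, Matrix.conjTranspose_apply, Matrix.of_apply, star_sub, star_mul', RCLike.star_def,
        Complex.conj_ofReal, Complex.conj_I, stdJ_stdJ, eval2_neg_left]
      rw [e3 (Pi.single j 1) (Pi.single k 1),
        eval2_antisymm hω (Pi.single k 1) (Pi.single j 1)]
      push_cast; ring
    · have h := hform_expand hJ (star x) (star x)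
      have h0 : eval2 ω₀ (stdJ n (stdJ n (star x))) (star x) = 0 := by
        rw [stdJ_stdJ, eval2_neg_left]
        have := eval2_antisymm hω (star x) (star x)
        linarith
      rw [h0] at h
      have h2 : star x ⬝ᵥ (hmat ω₀).mulVec x = (eval2 ω₀ (stdJ n (star x)) (star x) : ℂ) := by
        rw [Complex.ofReal_zero, mul_zero, sub_zero] at h
        rw [h]
        simp only [dotProduct, Matrix.mulVec, Finset.mul_sum]
        refine Finset.sum_congr rfl fun j _ => Finset.sum_congr rfl fun k _ => ?_
        simp
        ring
      rw [h2]
      have := hpos (star x) (by simpa using hx)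
      exact_mod_cast this
  have := hpd.det_pos
  rw [Complex.lt_def] at this
  exact ⟨by simpa using this.1, by simpa using this.2.symm⟩

/-! ### Exponentials of two-forms -/

theorem eps_altD (D : Cn n → CForm n) : eps (altD D) = -altD (fun w => eps (D w)) := by
  simp only [altD, map_sum, map_add, map_mul, eps_ιc, cneg_mul, ← Finset.sum_neg_distrib, neg_add]

theorem lieOp_eps (A : Cn n →L[ℝ] Cn n) (X : CForm n) : lieOp A (eps X) = eps (lieOp A X) := by
  rw [lieOp_apply, lieOp_apply, eps_altD, ← neg_one_csmul, ← altD_smul]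
  congr 1
  funext w
  rw [cint_eps, neg_one_csmul]

theorem eps_one_smul (c : ℂ) : eps (c • (1 : CForm n)) = c • 1 := by rw [map_smul, map_one]

theorem eps_two_form {ω₀ : RForm n} (hω : ω₀ ∈ degreePart n 2) : eps (toC ω₀) = toC ω₀ := by
  have h2 := isHom_toC hω
  refine two_form_ext ?_ h2 fun u v => ?_
  · unfold IsHom at h2 ⊢
    rw [lieOp_eps, h2, map_smul]; rfl
  · rw [cint_eps, map_neg, cint_eps, neg_neg, cint_cint_two_form hω, eps_one_smul]

theorem sigma_two_form {ω₀ : RForm n} (hω : ω₀ ∈ degreePart n 2) : sigma (toC ω₀) = -toC ω₀ := by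
  have h2 := isHom_toC hω
  refine two_form_ext ?_ ?_ fun u v => ?_
  · unfold IsHom at h2 ⊢
    rw [← sigma_lieOp, h2, map_smul]; rfl
  · rw [← neg_one_csmul]; exact h2.smul _
  · have h := sigma_cint v (cint u (toC ω₀))
    rw [cint_cint_two_form hω, map_smul, sigma_one, sigma_cint u, cint_eps, map_neg, eps_eps] at h
    rw [map_neg, map_neg, cint_cint_two_form hω, h, neg_neg]

/-- A form of even degree is central. -/
theorem commute_of_eps {X : CForm n} (hX : eps X = X) (Y : CForm n) : Commute X Y := by
  change X * Y = Y * X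
  induction Y using cform_left_induction with
  | h1 => simp
  | hadd Y Z hY hZ => rw [mul_add, hY, hZ, add_mul]
  | hsmul c Y hY => rw [mul_smul_comm, hY, smul_mul_assoc]
  | hmul ξ Y hY =>
    have := ιc_mul_eq ξ X
    rw [hX] at this
    rw [← mul_assoc, ← this, mul_assoc, hY, mul_assoc]

theorem two_form_pow_eq_zero {X : CForm n} (hX : IsHom 2 X) : X ^ (n + 1) = 0 :=
  (hX.pow (n + 1)).eq_zero (Or.inr (by push_cast; omega))

theorem cint_pow {X : CForm n} (hX : eps X = X) (v : Cn n) (k : ℕ) :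
    cint v (X ^ (k + 1)) = ((k + 1 : ℕ) : ℂ) • (cint v X * X ^ k) := by
  induction k with
  | zero => simp
  | succ k ih =>
    rw [pow_succ', cint_mul, ih, hX, mul_smul_comm, ← mul_assoc,
      (commute_of_eps hX (cint v X)).eq, mul_assoc, ← pow_succ']
    push_cast
    module

theorem nexp_form (X : CForm n) :
    nexp n X = ∑ k ∈ Finset.range (n + 1), ((k.factorial : ℂ)⁻¹) • X ^ k := rfl

/-- A graded derivation acts on exponentials by the chain rule. -/
theorem sum_form_exp_deriv {X Y : CForm n} (D : ℕ → CForm n)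
    (hD : ∀ k, D (k + 1) = ((k + 1 : ℕ) : ℂ) • (Y * X ^ k)) (h0 : D 0 = 0) (hn : Y * X ^ n = 0) :
    ∑ k ∈ Finset.range (n + 1), ((k.factorial : ℂ)⁻¹) • D k = Y * nexp n X := by
  rw [nexp_form, Finset.sum_range_succ', h0, smul_zero, add_zero, Finset.mul_sum,
    Finset.sum_range_succ, mul_smul_comm, hn, smul_zero, add_zero]
  refine Finset.sum_congr rfl fun k _ => ?_
  rw [hD, smul_smul, factorial_inv_mul, mul_smul_comm]

theorem cint_nexp {X : CForm n} (hX : eps X = X) (h2 : IsHom 2 X) (v : Cn n) :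
    cint v (nexp n X) = cint v X * nexp n X := by
  rw [← sum_form_exp_deriv (fun k => cint v (X ^ k)) (cint_pow hX v) (by simp [cint_one]),
    nexp_form, map_sum]
  · refine Finset.sum_congr rfl fun k _ => ?_
    rw [map_smul]
  · exact ((h2.cint v).mul (h2.pow n)).eq_zero (Or.inr (by omega))

theorem nexp_mul_nexp_neg {X : CForm n} (h2 : IsHom 2 X) : nexp n X * nexp n (-X) = 1 :=
  nexp_mul_neg (two_form_pow_eq_zero h2)

theorem eq_zero_of_mul_nexp {X Y : CForm n} (h2 : IsHom 2 X) (h : Y * nexp n X = 0) : Y = 0 := by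
  have := congrArg (· * nexp n (-X)) h
  simpa only [mul_assoc, nexp_mul_nexp_neg h2, mul_one, zero_mul] using this

theorem nexp_ne_zero (X : CForm n) (h2 : IsHom 2 X) : nexp n X ≠ 0 := by
  intro h
  have := eq_zero_of_mul_nexp h2 (Y := 1) (by rw [h, mul_zero])
  exact one_ne_zero this

theorem conjF_nexp (X : CForm n) : conjF (nexp n X) = nexp n (conjF X) := by
  rw [nexp_form, nexp_form, map_sum]
  refine Finset.sum_congr rfl fun k _ => ?_
  rw [conjF_smul, map_pow]; simp

theorem pullC_nexp (A : Cn n →L[ℝ] Cn n) (X : CForm n) :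
    pullC A (nexp n X) = nexp n (pullC A X) := by
  rw [nexp_form, nexp_form, map_sum]
  refine Finset.sum_congr rfl fun k _ => ?_
  rw [map_smul, map_pow]

theorem sigma_nexp {X : CForm n} : sigma (nexp n X) = nexp n (sigma X) := by
  rw [nexp_form, nexp_form, map_sum]
  refine Finset.sum_congr rfl fun k hk => ?_
  clear hk
  rw [map_smul]
  congr 1
  induction k with
  | zero => simp [sigma_one]
  | succ k ih => rw [pow_succ, sigma_mul, ih, ← pow_succ']

/-- The complex two-form `b + iω`. -/
def cplx2 (b ω₀ : RForm n) : CForm n := toC b + Complex.I • toC ω₀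

theorem conjF_cplx2 (b ω₀ : RForm n) : conjF (cplx2 b ω₀) = cplx2 b (-ω₀) := by
  rw [cplx2, map_add, conjF_smul, conjF_toC, conjF_toC, Complex.conj_I, cplx2, map_neg]
  module

theorem isHom_cplx2 {b ω₀ : RForm n} (hb : b ∈ degreePart n 2) (hω : ω₀ ∈ degreePart n 2) :
    IsHom 2 (cplx2 b ω₀) := (isHom_toC hb).add ((isHom_toC hω).smul _)

theorem eps_cplx2 {b ω₀ : RForm n} (hb : b ∈ degreePart n 2) (hω : ω₀ ∈ degreePart n 2) :
    eps (cplx2 b ω₀) = cplx2 b ω₀ := by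
  rw [cplx2, map_add, map_smul, eps_two_form hb, eps_two_form hω]

theorem cint_cplx2 {b ω₀ : RForm n} (hb : b ∈ degreePart n 2) (hω : ω₀ ∈ degreePart n 2)
    (v : Cn n) : cint v (cplx2 b ω₀) = ιc (contr b v) + Complex.I • ιc (contr ω₀ v) := by
  rw [cplx2, map_add, map_smul, cint_two_form hb, cint_two_form hω]

theorem cliff_nexp {b ω₀ : RForm n} (hb : b ∈ degreePart n 2) (hω : ω₀ ∈ degreePart n 2)
    (a : GT n) : cliff a (nexp n (cplx2 b ω₀)) =
      (ιc (contr b a.1 + a.2) + Complex.I • ιc (contr ω₀ a.1)) * nexp n (cplx2 b ω₀) := by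
  rw [cliff_apply, cint_nexp (eps_cplx2 hb hω) (isHom_cplx2 hb hω), cint_cplx2 hb hω, map_add,
    ← add_mul]
  congr 1
  abel

theorem mukai_nexp {b ω₀ : RForm n} (hb : b ∈ degreePart n 2) (hω : ω₀ ∈ degreePart n 2) :
    mukai (nexp n (cplx2 b ω₀)) (conjF (nexp n (cplx2 b ω₀))) =
      ((n.factorial : ℂ)⁻¹) • ((2 * Complex.I) • toC ω₀) ^ n := by
  have hω2 : -ω₀ ∈ degreePart n 2 := Submodule.neg_mem _ hω
  have e1 : sigma (cplx2 b (-ω₀)) = cplx2 (-b) ω₀ := by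
    rw [cplx2, map_add, map_smul, sigma_two_form hb, sigma_two_form hω2, cplx2, map_neg, map_neg,
      neg_neg]
  have e2 : cplx2 b ω₀ + cplx2 (-b) ω₀ = (2 * Complex.I) • toC ω₀ := by
    rw [cplx2, cplx2, map_neg]; module
  have h2 : IsHom 2 ((2 * Complex.I) • toC ω₀) := (isHom_toC hω).smul _
  rw [mukai, conjF_nexp, conjF_cplx2, sigma_nexp, e1, ← nexp_add, e2, nexp_form, map_sum,
    Finset.sum_eq_single n]
  · rw [map_smul, topPart_of_isHom]
    have := h2.pow n
    rwa [mul_comm] at this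
  · intro k hk hkn
    refine topPart_of_ne ((h2.pow k).smul _) ?_
    omega
  · intro h; simp at h
  · exact commute_of_eps (eps_cplx2 hb hω) _
  · exact two_form_pow_eq_zero (isHom_cplx2 hb hω)
  · exact two_form_pow_eq_zero (isHom_cplx2 (Submodule.neg_mem _ hb) hω)
  · rw [e2]; exact two_form_pow_eq_zero h2

/-! ### The deformed symplectic spinor -/

/-- The two-form `∑ λ_ij i_{v_j}ω ∧ i_{v_i}ω`. -/
def bivForm (ω₀ : RForm n) (lam : Fin m → Fin m → ℝ) (v : Fin m → Cn n) : RForm n :=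
  ∑ i, ∑ j, lam i j • (ExteriorAlgebra.ι ℝ (contr ω₀ (v j) : Module.Dual ℝ (Cn n)) *
    ExteriorAlgebra.ι ℝ (contr ω₀ (v i) : Module.Dual ℝ (Cn n)))

theorem ι_mul_ι_mem (ξ η : Module.Dual ℝ (Cn n)) :
    ExteriorAlgebra.ι ℝ ξ * ExteriorAlgebra.ι ℝ η ∈ degreePart n 2 := by
  change _ ∈ (LinearMap.range (ExteriorAlgebra.ι ℝ (M := Module.Dual ℝ (Cn n)))) ^ 2
  rw [pow_two]
  exact Submodule.mul_mem_mul ⟨_, rfl⟩ ⟨_, rfl⟩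

theorem bivForm_mem (ω₀ : RForm n) (lam : Fin m → Fin m → ℝ) (v : Fin m → Cn n) :
    bivForm ω₀ lam v ∈ degreePart n 2 :=
  Submodule.sum_mem _ fun _ _ => Submodule.sum_mem _ fun _ _ =>
    Submodule.smul_mem _ _ (ι_mul_ι_mem _ _)

theorem toC_bivForm (ω₀ : RForm n) (lam : Fin m → Fin m → ℝ) (v : Fin m → Cn n) :
    toC (bivForm ω₀ lam v) =
      ∑ i, ∑ j, (lam i j : ℂ) • (ιc (contr ω₀ (v j)) * ιc (contr ω₀ (v i))) := by
  simp only [bivForm, map_sum, toC_smul, map_mul]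
  rfl

theorem cint_bivForm {ω₀ : RForm n} {lam : Fin m → Fin m → ℝ} {v : Fin m → Cn n}
    (hiso : ∀ i j, eval2 ω₀ (v i) (v j) = 0) (k : Fin m) :
    cint (v k) (toC (bivForm ω₀ lam v)) = 0 := by
  have h : ∀ i, (contr ω₀ (v i)) (v k) = 0 := fun i => hiso i k
  rw [toC_bivForm, map_sum]
  refine Finset.sum_eq_zero fun i _ => ?_
  rw [map_sum]
  refine Finset.sum_eq_zero fun j _ => ?_
  rw [map_smul, cint_ιc_mul, cint_ιc, h, h]
  simp

theorem contr_bivForm {ω₀ : RForm n} {lam : Fin m → Fin m → ℝ} {v : Fin m → Cn n}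
    (hiso : ∀ i j, eval2 ω₀ (v i) (v j) = 0) (k : Fin m) :
    contr (bivForm ω₀ lam v) (v k) = 0 := by
  have h := cint_bivForm (lam := lam) hiso k
  rw [cint_two_form (bivForm_mem _ _ _)] at h
  ext w
  have h2 := congrArg (cint w) h
  rw [cint_ιc, map_zero, ← zero_smul ℂ (1 : CForm n)] at h2
  exact_mod_cast one_smul_inj h2

/-- If the vectors `v_i` span an isotropic subspace, then
`e^{tβ} · e^{iω} = e^{tτ + iω}` with `τ = ∑ λ_ij i_{v_j}ω ∧ i_{v_i}ω`. -/
theorem expBiv_nexp {ω₀ : RForm n} (hω : ω₀ ∈ degreePart n 2) {lam : Fin m → Fin m → ℝ}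
    {v : Fin m → Cn n} (hiso : ∀ i j, eval2 ω₀ (v i) (v j) = 0) (t : ℝ) :
    expBiv lam v t (nexp n (Complex.I • toC ω₀)) =
      nexp n (cplx2 (t • bivForm ω₀ lam v) ω₀) := by
  set X : CForm n := Complex.I • toC ω₀ with hX
  have hX2 : IsHom 2 X := (isHom_toC hω).smul _
  have hXe : eps X = X := by rw [hX, map_smul, eps_two_form hω]
  set τ := toC (bivForm ω₀ lam v) with hτ
  have hτ2 : IsHom 2 τ := isHom_toC (bivForm_mem _ _ _)
  have hτe : eps τ = τ := eps_two_form (bivForm_mem _ _ _)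
  have hB : bivAct lam v (nexp n X) = τ * nexp n X := by
    rw [bivAct_apply, hτ, toC_bivForm, Finset.sum_mul]
    refine Finset.sum_congr rfl fun i _ => ?_
    rw [Finset.sum_mul]
    refine Finset.sum_congr rfl fun j _ => ?_
    rw [smul_mul_assoc]
    congr 1
    have h0 : cint (v i) (cint (v j) X) = 0 := by
      rw [hX, map_smul, map_smul, cint_cint_two_form hω, hiso]; simp
    have h1 : ∀ u, cint u X = Complex.I • ιc (contr ω₀ u) := fun u => by
      rw [hX, map_smul, cint_two_form hω]
    rw [cint_nexp hXe hX2, cint_mul, h0, zero_mul, zero_add, cint_nexp hXe hX2, h1, h1, map_smul,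
      eps_ιc, ← mul_assoc, smul_mul_assoc, mul_smul_comm, smul_smul, Complex.I_mul_I, cneg_mul,
      neg_one_csmul, neg_neg]
  have hBτ : ∀ Y, bivAct lam v (τ * Y) = τ * bivAct lam v Y := by
    intro Y
    have hc : ∀ k, cint (v k) τ = 0 := cint_bivForm hiso
    simp only [bivAct_apply, cint_mul, hc, zero_mul, zero_add, hτe,
      Finset.mul_sum, mul_smul_comm]
  have hpow : ∀ k : ℕ, (bivAct lam v ^ k) (nexp n X) = τ ^ k * nexp n X := by
    intro k
    induction k with
    | zero => simp
    | succ k ih =>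
      have : ∀ k : ℕ, bivAct lam v (τ ^ k * nexp n X) = τ ^ k * bivAct lam v (nexp n X) := by
        intro k
        induction k with
        | zero => simp
        | succ k ih => rw [pow_succ', mul_assoc, hBτ, ih, mul_assoc]
      rw [pow_succ', Module.End.mul_apply, ih, this, hB, ← mul_assoc, ← pow_succ]
  have e1 : cplx2 (t • bivForm ω₀ lam v) ω₀ = (t : ℂ) • τ + X := by
    rw [cplx2, toC_smul]
  have hadd : nexp n ((t : ℂ) • τ + X) = nexp n ((t : ℂ) • τ) * nexp n X :=
    nexp_add (commute_of_eps (by rw [map_smul, hτe]) _) (two_form_pow_eq_zero (hτ2.smul _))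
      (two_form_pow_eq_zero hX2) (two_form_pow_eq_zero ((hτ2.smul _).add hX2))
  rw [e1, hadd, expBiv_apply, nexp_form ((t : ℂ) • τ), Finset.sum_mul]
  refine Finset.sum_congr rfl fun k _ => ?_
  rw [hpow, smul_pow, smul_smul, smul_mul_assoc]

/-! ### The generalized complex structure of a symplectic form -/

/-- Contraction with a two-form as a continuous linear map. -/
def contrC (ω₀ : RForm n) : Cn n →L[ℝ] Cov n := LinearMap.toContinuousLinearMap (contrL ω₀)

theorem contrC_apply (ω₀ : RForm n) (u : Cn n) : contrC ω₀ u = contr ω₀ u := rfl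

theorem contrC_isInvertible {ω₀ : RForm n} (hpos : ∀ u, u ≠ 0 → 0 < eval2 ω₀ (stdJ n u) u) :
    (contrC ω₀).IsInvertible := by
  have hinj : Function.Injective (contrC ω₀) := by
    refine (injective_iff_map_eq_zero (contrC ω₀)).mpr fun u hu => ?_
    by_contra hne
    have h1 := hpos (-(stdJ n u)) (by
      intro h
      apply hne
      have := congrArg (stdJ n) h
      rwa [map_neg, stdJ_stdJ, neg_neg, map_zero] at this)
    rw [map_neg, stdJ_stdJ, neg_neg, eval2] at h1
    rw [contrC_apply] at hu
    rw [hu] at h1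
    simp at h1
  have hfr : Module.finrank ℝ (Cn n) = Module.finrank ℝ (Cov n) := by
    rw [← LinearEquiv.finrank_eq (LinearMap.toContinuousLinearMap (𝕜 := ℝ) (E := Cn n) (F' := ℝ))]
    exact (Subspace.dual_finrank_eq).symm
  let e := LinearEquiv.ofInjectiveOfFinrankEq (contrC ω₀ : Cn n →ₗ[ℝ] Cov n) hinj hfr
  exact ⟨e.toContinuousLinearEquiv, by ext u; rfl⟩

/-- The inverse of the contraction with a symplectic form. -/
def sympInv (ω₀ : RForm n) : Cov n →L[ℝ] Cn n := (contrC ω₀).inverse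

theorem contr_sympInv {ω₀ : RForm n} (h : (contrC ω₀).IsInvertible) (ξ : Cov n) :
    contr ω₀ (sympInv ω₀ ξ) = ξ :=
  ContinuousLinearMap.IsInvertible.self_apply_inverse h ξ

theorem sympInv_contr {ω₀ : RForm n} (h : (contrC ω₀).IsInvertible) (u : Cn n) :
    sympInv ω₀ (contr ω₀ u) = u :=
  ContinuousLinearMap.IsInvertible.inverse_apply_self h u

/-- The endomorphism `v + ξ ↦ ω⁻¹ ξ - i_v ω` of `T ⊕ T*`. -/
def symplJ (ω₀ : RForm n) : GT n →ₗ[ℝ] GT n :=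
  ((sympInv ω₀ : Cov n →ₗ[ℝ] Cn n) ∘ₗ LinearMap.snd ℝ (Cn n) (Cov n)).prod
    (-(contrL ω₀ ∘ₗ LinearMap.fst ℝ (Cn n) (Cov n)))

theorem symplJ_apply (ω₀ : RForm n) (a : GT n) :
    symplJ ω₀ a = (sympInv ω₀ a.2, -contr ω₀ a.1) := rfl

theorem symplJ_sq {ω₀ : RForm n} (h : (contrC ω₀).IsInvertible) (a : GT n) :
    symplJ ω₀ (symplJ ω₀ a) = -a := by
  rw [symplJ_apply, symplJ_apply]
  refine Prod.ext ?_ ?_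
  · simp only [map_neg, sympInv_contr h]; rfl
  · simp only [contr_sympInv h]; rfl

theorem symplJ_orth {ω₀ : RForm n} (hω : ω₀ ∈ degreePart n 2) (h : (contrC ω₀).IsInvertible)
    (a b : GT n) : pair (symplJ ω₀ a) (symplJ ω₀ b) = pair a b := by
  have key : ∀ a b : GT n, -(contr ω₀ a.1) (sympInv ω₀ b.2) = b.2 a.1 := by
    intro a b
    have := eval2_antisymm hω a.1 (sympInv ω₀ b.2)
    rw [eval2, eval2, contr_sympInv h] at this
    rw [this, neg_neg]
  simp only [pair, symplJ_apply, neg_apply, key]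
  ring

theorem induces_symplJ {ω₀ : RForm n} (hω : ω₀ ∈ degreePart n 2) (h : (contrC ω₀).IsInvertible) :
    Induces (nexp n (Complex.I • toC ω₀)) (symplJ ω₀) := by
  have e : Complex.I • toC ω₀ = cplx2 0 ω₀ := by rw [cplx2, map_zero, zero_add]
  have h0 : (0 : RForm n) ∈ degreePart n 2 := Submodule.zero_mem _
  rw [e]
  refine induces_of_annihilates (symplJ_sq h) (symplJ_orth hω h)
    (nexp_ne_zero _ (isHom_cplx2 h0 hω)) fun c => ?_
  have hz : ∀ u, contr (0 : RForm n) u = 0 := fun u => by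
    ext w
    change ExteriorAlgebra.algebraMapInv (rint w (rint u 0)) = 0
    simp
  rw [cliff_nexp h0 hω, cliff_nexp h0 hω, ← smul_mul_assoc, ← add_mul, symplJ_apply]
  simp only [hz, zero_add, contr_sympInv h, map_neg]
  rw [smul_add, smul_smul, Complex.I_mul_I]
  have : ιc c.2 + Complex.I • ιc (contr ω₀ c.1) +
      (Complex.I • -ιc (contr ω₀ c.1) + (-1 : ℂ) • ιc c.2) = 0 := by module
  rw [this, zero_mul]

theorem symplJ_comm {ω₀ : RForm n} (h : (contrC ω₀).IsInvertible)
    (hJ : ∀ u v, eval2 ω₀ (stdJ n u) (stdJ n v) = eval2 ω₀ u v) (a : GT n) :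
    ofComplex (stdJ n) (symplJ ω₀ a) = symplJ ω₀ (ofComplex (stdJ n) a) := by
  have hc : ∀ u, contr ω₀ (stdJ n u) = -(contr ω₀ u).comp (stdJ n) := by
    intro u
    ext w
    have := hJ u (-(stdJ n w))
    rw [map_neg, stdJ_stdJ, neg_neg] at this
    simp only [eval2, map_neg] at this
    simpa using this
  rw [symplJ_apply, symplJ_apply, ofComplex_apply, ofComplex_apply]
  refine Prod.ext ?_ ?_
  · have : contr ω₀ (stdJ n (sympInv ω₀ a.2)) = -(a.2.comp (stdJ n)) := by
      rw [hc, contr_sympInv h]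
    rw [← this, sympInv_contr h]
  · change -((-contr ω₀ a.1).comp (stdJ n)) = -contr ω₀ (stdJ n a.1)
    rw [hc, ContinuousLinearMap.neg_comp]

theorem symplJ_pos {ω₀ : RForm n} (hω : ω₀ ∈ degreePart n 2) (h : (contrC ω₀).IsInvertible)
    (hpos : ∀ u, u ≠ 0 → 0 < eval2 ω₀ (stdJ n u) u) {a : GT n} (ha : a ≠ 0) :
    0 < pair (-(ofComplex (stdJ n) (symplJ ω₀ a))) a := by
  set w := sympInv ω₀ a.2 with hw
  have h2 : a.2 = contr ω₀ w := by rw [hw, contr_sympInv h]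
  have key : pair (-(ofComplex (stdJ n) (symplJ ω₀ a))) a =
      (eval2 ω₀ (stdJ n a.1) a.1 + eval2 ω₀ (stdJ n w) w) / 2 := by
    rw [pair_neg_left, symplJ_apply, ofComplex_apply, pair, ← hw,
      eval2_antisymm hω (stdJ n a.1), eval2_antisymm hω (stdJ n w)]
    simp only [eval2, h2]
    simp only [neg_apply, ContinuousLinearMap.comp_apply, neg_neg]
    ring
  have hnn : ∀ u, 0 ≤ eval2 ω₀ (stdJ n u) u := fun u => by
    by_cases hu : u = 0
    · rw [hu, map_zero, eval2, ← contrC_apply, map_zero]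
    · exact (hpos u hu).le
  rw [key]
  by_cases h1 : a.1 = 0
  · have hw0 : w ≠ 0 := by
      intro h0
      apply ha
      refine Prod.ext h1 ?_
      rw [h2, h0, ← contrC_apply, map_zero]; rfl
    have := hpos w hw0
    have := hnn a.1
    linarith
  · have := hpos a.1 h1
    have := hnn w
    linarith

/-! ### Calculus of forms on `ℂⁿ` -/

/-- The norm on forms carried over from `formCoords`. -/
instance : NormedAddCommGroup (CForm n) :=
  NormedAddCommGroup.induced (CForm n) _ (formCoords n) (formCoords n).injective

instance : NormedSpace ℝ (CForm n) :=
  NormedSpace.induced ℝ (CForm n) _ ((formCoords n).restrictScalars ℝ)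

instance : FiniteDimensional ℝ (CForm n) :=
  Module.Finite.equiv ((formCoords n).restrictScalars ℝ).symm

/-- `formCoords` as a homeomorphism. -/
def formCoordsL (n : ℕ) :
    CForm n ≃L[ℝ] (Finset (Fin (Module.finrank ℝ (Module.Dual ℝ (Cn n)))) → ℂ) :=
  ((formCoords n).restrictScalars ℝ).toContinuousLinearEquiv

theorem formCoordsL_symm_apply (z) : (formCoordsL n).symm z = (formCoords n).symm z := rfl

theorem dirDeriv_eq (s : Cn n → CForm n) (y v : Cn n) : dirDeriv s y v = fderiv ℝ s y v := by
  have : fderiv ℝ (fun z => formCoords n (s z)) y =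
      ((formCoordsL n : CForm n →L[ℝ] _)).comp (fderiv ℝ s y) :=
    (formCoordsL n).comp_fderiv
  rw [dirDeriv, this, ← formCoordsL_symm_apply]
  exact (formCoordsL n).symm_apply_apply _

theorem flatD_eq (s : Cn n → CForm n) (y : Cn n) : flatD s y = altD (fderiv ℝ s y) := by
  simp only [flatD, dirDeriv_eq]; rfl

theorem contDiffOn_formCoords {k : WithTop ℕ∞} {s : Cn n → CForm n} {S : Set (Cn n)} :
    ContDiffOn ℝ k (fun y => formCoords n (s y)) S ↔ ContDiffOn ℝ k s S :=
  (formCoordsL n).comp_contDiffOn_iff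

section Bilinear

variable {X E F G : Type*} [NormedAddCommGroup X] [NormedSpace ℝ X]
  [NormedAddCommGroup E] [NormedSpace ℝ E] [FiniteDimensional ℝ E]
  [NormedAddCommGroup F] [NormedSpace ℝ F] [FiniteDimensional ℝ F]
  [NormedAddCommGroup G] [NormedSpace ℝ G] 

theorem contDiffAt_lin {k : WithTop ℕ∞} (L : E →ₗ[ℝ] G) {f : X → E} {x : X}
    (hf : ContDiffAt ℝ k f x) : ContDiffAt ℝ k (fun y => L (f y)) x :=
  (LinearMap.toContinuousLinearMap L).contDiff.contDiffAt.comp x hf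

theorem fderiv_lin (L : E →ₗ[ℝ] G) {f : X → E} {x : X} (hf : DifferentiableAt ℝ f x) (v : X) :
    fderiv ℝ (fun y => L (f y)) x v = L (fderiv ℝ f x v) := by
  have := ((LinearMap.toContinuousLinearMap L).hasFDerivAt.comp x hf.hasFDerivAt).fderiv
  have h2 := congrArg (fun T => T v) this
  exact h2

theorem contDiffAt_bilin {k : WithTop ℕ∞} (B : E →ₗ[ℝ] F →ₗ[ℝ] G) {f : X → E} {g : X → F} {x : X}
    (hf : ContDiffAt ℝ k f x) (hg : ContDiffAt ℝ k g x) :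
    ContDiffAt ℝ k (fun y => B (f y) (g y)) x :=
  (LinearMap.toContinuousBilinearMap B).isBoundedBilinearMap.contDiff.contDiffAt.comp x
    (hf.prodMk hg)

theorem fderiv_bilin (B : E →ₗ[ℝ] F →ₗ[ℝ] G) {f : X → E} {g : X → F} {x : X}
    (hf : DifferentiableAt ℝ f x) (hg : DifferentiableAt ℝ g x) (v : X) :
    fderiv ℝ (fun y => B (f y) (g y)) x v = B (f x) (fderiv ℝ g x v) + B (fderiv ℝ f x v) (g x) := by
  have := (LinearMap.toContinuousBilinearMap B).fderiv_of_bilinear hf hg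
  have h2 := congrArg (fun T => T v) this
  exact h2

theorem hasDerivAt_lin (L : E →ₗ[ℝ] G) {f : ℝ → E} {f' : E} {r : ℝ} (hf : HasDerivAt f f' r) :
    HasDerivAt (fun y => L (f y)) (L f') r :=
  (LinearMap.toContinuousLinearMap L).hasFDerivAt.comp_hasDerivAt r hf

theorem hasDerivAt_bilin (B : E →ₗ[ℝ] F →ₗ[ℝ] G) {f : ℝ → E} {g : ℝ → F} {f' : E} {g' : F} {r : ℝ}
    (hf : HasDerivAt f f' r) (hg : HasDerivAt g g' r) :
    HasDerivAt (fun y => B (f y) (g y)) (B (f r) g' + B f' (g r)) r :=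
  ((LinearMap.toContinuousBilinearMap B).isBoundedBilinearMap.hasFDerivAt
    (f r, g r)).comp_hasDerivAt (f := fun y => (f y, g y)) r (hf.prodMk hg)

theorem differentiableAt_lin (L : E →ₗ[ℝ] G) {f : X → E} {x : X} (hf : DifferentiableAt ℝ f x) :
    DifferentiableAt ℝ (fun y => L (f y)) x :=
  (LinearMap.toContinuousLinearMap L).differentiableAt.comp x hf

theorem differentiableAt_bilin (B : E →ₗ[ℝ] F →ₗ[ℝ] G) {f : X → E} {g : X → F} {x : X}
    (hf : DifferentiableAt ℝ f x) (hg : DifferentiableAt ℝ g x) :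
    DifferentiableAt ℝ (fun y => B (f y) (g y)) x :=
  ((LinearMap.toContinuousBilinearMap B).isBoundedBilinearMap.differentiableAt _).comp x
    (hf.prodMk hg)

end Bilinear

/-- A coordinate of forms as a real linear map. -/
def coordL (j : Finset (Fin (Module.finrank ℝ (Module.Dual ℝ (Cn n))))) : CForm n →ₗ[ℝ] ℂ :=
  (LinearMap.proj j).comp ((formCoords n).restrictScalars ℝ).toLinearMap

/-- The product of forms as a real bilinear map. -/
def mulB : CForm n →ₗ[ℝ] CForm n →ₗ[ℝ] CForm n := LinearMap.mul ℝ (CForm n)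

/-- The interior product as a real bilinear map. -/
def cintB : Cn n →ₗ[ℝ] CForm n →ₗ[ℝ] CForm n :=
  LinearMap.mk₂ ℝ (fun v X => cint v X) (fun u v X => by rw [cint_add]; rfl)
    (fun c v X => by rw [cint_smul, real_smul_eq]; rfl) (fun v X Y => map_add _ _ _)
    (fun c v X => by rw [real_smul_eq, real_smul_eq, map_smul])

/-- The Clifford action as a real bilinear map. -/
def cliffB : GT n →ₗ[ℝ] CForm n →ₗ[ℝ] CForm n :=
  LinearMap.mk₂ ℝ (fun v X => cliff v X) (fun u v X => cliff_add _ _ _)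
    (fun c v X => by rw [cliff_smul, real_smul_eq]) (fun v X Y => map_add _ _ _)
    (fun c v X => by rw [real_smul_eq, real_smul_eq, map_smul])

/-- Complex scalar multiplication of forms as a real bilinear map. -/
def csmulB : ℂ →ₗ[ℝ] CForm n →ₗ[ℝ] CForm n :=
  LinearMap.mk₂ ℝ (fun c X => c • X) (fun u v X => add_smul _ _ _)
    (fun c v X => by rw [real_smul_eq, smul_smul]; rfl) (fun v X Y => smul_add _ _ _)
    (fun c v X => by rw [real_smul_eq, real_smul_eq, smul_smul, smul_smul, mul_comm])

section Rules

variable {X : Type*} [NormedAddCommGroup X] [NormedSpace ℝ X] {x : X} {k : WithTop ℕ∞}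

theorem contDiffAt_fmul {f g : X → CForm n} (hf : ContDiffAt ℝ k f x) (hg : ContDiffAt ℝ k g x) :
    ContDiffAt ℝ k (fun y => f y * g y) x := contDiffAt_bilin mulB hf hg

theorem fderiv_fmul {f g : X → CForm n} (hf : DifferentiableAt ℝ f x) (hg : DifferentiableAt ℝ g x)
    (v : X) : fderiv ℝ (fun y => f y * g y) x v = f x * fderiv ℝ g x v + fderiv ℝ f x v * g x :=
  fderiv_bilin mulB hf hg v

theorem contDiffAt_cint {f : X → Cn n} {g : X → CForm n} (hf : ContDiffAt ℝ k f x)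
    (hg : ContDiffAt ℝ k g x) : ContDiffAt ℝ k (fun y => cint (f y) (g y)) x :=
  contDiffAt_bilin cintB hf hg

theorem fderiv_cint {f : X → Cn n} {g : X → CForm n} (hf : DifferentiableAt ℝ f x)
    (hg : DifferentiableAt ℝ g x) (v : X) : fderiv ℝ (fun y => cint (f y) (g y)) x v =
      cint (f x) (fderiv ℝ g x v) + cint (fderiv ℝ f x v) (g x) :=
  fderiv_bilin cintB hf hg v

theorem fderiv_cliff {f : X → GT n} {g : X → CForm n} (hf : DifferentiableAt ℝ f x)
    (hg : DifferentiableAt ℝ g x) (v : X) : fderiv ℝ (fun y => cliff (f y) (g y)) x v =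
      cliff (f x) (fderiv ℝ g x v) + cliff (fderiv ℝ f x v) (g x) :=
  fderiv_bilin cliffB hf hg v

theorem contDiffAt_csmul {f : X → ℂ} {g : X → CForm n} (hf : ContDiffAt ℝ k f x)
    (hg : ContDiffAt ℝ k g x) : ContDiffAt ℝ k (fun y => f y • g y) x :=
  contDiffAt_bilin csmulB hf hg

theorem fderiv_csmul {f : X → ℂ} {g : X → CForm n} (hf : DifferentiableAt ℝ f x)
    (hg : DifferentiableAt ℝ g x) (v : X) : fderiv ℝ (fun y => f y • g y) x v =
      f x • fderiv ℝ g x v + fderiv ℝ f x v • g x :=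
  fderiv_bilin csmulB hf hg v

theorem fderiv_clin (L : CForm n →ₗ[ℂ] CForm n) {f : X → CForm n} (hf : DifferentiableAt ℝ f x)
    (v : X) : fderiv ℝ (fun y => L (f y)) x v = L (fderiv ℝ f x v) :=
  fderiv_lin (L.restrictScalars ℝ) hf v

theorem contDiffAt_csmul_const (c : ℂ) {f : X → CForm n} (hf : ContDiffAt ℝ k f x) :
    ContDiffAt ℝ k (fun y => c • f y) x := contDiffAt_csmul contDiffAt_const hf

theorem fderiv_csmul_const (c : ℂ) {f : X → CForm n} (hf : DifferentiableAt ℝ f x)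
    (v : X) : fderiv ℝ (fun y => c • f y) x v = c • fderiv ℝ f x v :=
  fderiv_lin (csmulB c) hf v

theorem contDiffAt_fsum {ι : Type*} (s : Finset ι) {f : ι → X → CForm n}
    (hf : ∀ i ∈ s, ContDiffAt ℝ k (f i) x) : ContDiffAt ℝ k (fun y => ∑ i ∈ s, f i y) x :=
  ContDiffAt.sum hf

theorem contDiffAt_fpow {f : X → CForm n} (hf : ContDiffAt ℝ k f x) (j : ℕ) :
    ContDiffAt ℝ k (fun y => f y ^ j) x := by
  induction j with
  | zero => simpa using contDiffAt_const
  | succ j ih => simpa only [pow_succ] using contDiffAt_fmul ih hf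

theorem differentiableAt_fmul {f g : X → CForm n} (hf : DifferentiableAt ℝ f x)
    (hg : DifferentiableAt ℝ g x) : DifferentiableAt ℝ (fun y => f y * g y) x :=
  differentiableAt_bilin mulB hf hg

theorem differentiableAt_csmul {f : X → ℂ} {g : X → CForm n} (hf : DifferentiableAt ℝ f x)
    (hg : DifferentiableAt ℝ g x) : DifferentiableAt ℝ (fun y => f y • g y) x :=
  differentiableAt_bilin csmulB hf hg

theorem differentiableAt_csmul_const (c : ℂ) {f : X → CForm n} (hf : DifferentiableAt ℝ f x) :
    DifferentiableAt ℝ (fun y => c • f y) x := differentiableAt_lin (csmulB c) hf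

theorem differentiableAt_cliff {f : X → GT n} {g : X → CForm n} (hf : DifferentiableAt ℝ f x)
    (hg : DifferentiableAt ℝ g x) : DifferentiableAt ℝ (fun y => cliff (f y) (g y)) x :=
  differentiableAt_bilin cliffB hf hg

theorem differentiableAt_cint {f : X → Cn n} {g : X → CForm n} (hf : DifferentiableAt ℝ f x)
    (hg : DifferentiableAt ℝ g x) : DifferentiableAt ℝ (fun y => cint (f y) (g y)) x :=
  differentiableAt_bilin cintB hf hg

theorem contDiffAt_nexp {f : X → CForm n} (hf : ContDiffAt ℝ k f x) :
    ContDiffAt ℝ k (fun y => nexp n (f y)) x := by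
  simp only [nexp_form]
  exact contDiffAt_fsum _ fun i _ => contDiffAt_csmul_const _ (contDiffAt_fpow hf i)

end Rules

/-! #### The exterior derivative -/

section Ext

variable {y : Cn n}

theorem flatD_congr {s r : Cn n → CForm n} (h : s =ᶠ[nhds y] r) : flatD s y = flatD r y := by
  rw [flatD_eq, flatD_eq, h.fderiv_eq]

theorem flatD_const (X : CForm n) : flatD (fun _ => X) y = 0 := by
  rw [flatD_eq, fderiv_fun_const]; exact altD_zero

theorem flatD_add {s r : Cn n → CForm n} (hs : DifferentiableAt ℝ s y)
    (hr : DifferentiableAt ℝ r y) : flatD (fun z => s z + r z) y = flatD s y + flatD r y := by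
  rw [flatD_eq, flatD_eq, flatD_eq, ← altD_add, fderiv_fun_add hs hr]; rfl

theorem flatD_csmul_const (c : ℂ) {s : Cn n → CForm n} (hs : DifferentiableAt ℝ s y) :
    flatD (fun z => c • s z) y = c • flatD s y := by
  rw [flatD_eq, flatD_eq, ← altD_smul]
  congr 1; funext v; exact fderiv_csmul_const c hs v

theorem flatD_sum {ι : Type*} (S : Finset ι) {s : ι → Cn n → CForm n}
    (hs : ∀ i ∈ S, DifferentiableAt ℝ (s i) y) :
    flatD (fun z => ∑ i ∈ S, s i z) y = ∑ i ∈ S, flatD (s i) y := by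
  simp only [flatD_eq]
  rw [← altD_sum, fderiv_fun_sum hs]
  congr 1; funext v; simp

theorem flatD_mul {s r : Cn n → CForm n} (hs : DifferentiableAt ℝ s y)
    (hr : DifferentiableAt ℝ r y) :
    flatD (fun z => s z * r z) y = flatD s y * r y + eps (s y) * flatD r y := by
  simp only [flatD_eq]
  rw [← altD_mul_right, ← altD_mul_left, ← altD_add]
  congr 1; funext v; rw [fderiv_fmul hs hr, add_comm]

theorem flatD_smul {f : Cn n → ℂ} {s : Cn n → CForm n} (hf : DifferentiableAt ℝ f y)
    (hs : DifferentiableAt ℝ s y) :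
    flatD (fun z => f z • s z) y = ιz (fderiv ℝ f y) * s y + f y • flatD s y := by
  simp only [flatD_eq]
  rw [← altD_complex, ← altD_smul, ← altD_add]
  congr 1; funext v; rw [fderiv_csmul hf hs, add_comm]

end Ext

/-! #### Pull-back -/

theorem form_expand (X : CForm n) :
    X = ∑ k, formCoords n X k • (formCoords n).symm (Pi.single k 1) := by
  apply (formCoords n).injective
  simp only [map_sum, map_smul, LinearEquiv.apply_symm_apply]
  funext j
  simp [Finset.sum_apply, Pi.single_apply]

section

variable {X : Type*} [NormedAddCommGroup X] [NormedSpace ℝ X] {x : X} {k : WithTop ℕ∞}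

theorem contDiffAt_ιc {ξ : X → Cov n} (hξ : ContDiffAt ℝ k ξ x) :
    ContDiffAt ℝ k (fun y => ιc (ξ y)) x := contDiffAt_lin ιc hξ

theorem fderiv_ιc {ξ : X → Cov n} (hξ : DifferentiableAt ℝ ξ x) (v : X) :
    fderiv ℝ (fun y => ιc (ξ y)) x v = ιc (fderiv ℝ ξ x v) := fderiv_lin ιc hξ v

theorem contDiffAt_coord {s : X → CForm n} (hs : ContDiffAt ℝ k s x) (j) :
    ContDiffAt ℝ k (fun y => formCoords n (s y) j) x :=
  contDiffAt_lin (coordL j) hs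

theorem contDiffAt_pullC_const {A : X → Cn n →L[ℝ] Cn n} (hA : ContDiffAt ℝ k A x) (Y : CForm n) :
    ContDiffAt ℝ k (fun y => pullC (A y) Y) x := by
  induction Y using cform_left_induction with
  | h1 => simpa using contDiffAt_const
  | hadd Y Z hY hZ => simpa only [map_add] using hY.add hZ
  | hsmul c Y hY => simpa only [map_smul] using contDiffAt_csmul_const c hY
  | hmul ξ Y hY =>
    simp only [map_mul, pullC_ιc]
    exact contDiffAt_fmul (contDiffAt_ιc (contDiffAt_const.clm_comp hA)) hY

theorem contDiffAt_pullC {A : X → Cn n →L[ℝ] Cn n} (hA : ContDiffAt ℝ k A x) {s : X → CForm n}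
    (hs : ContDiffAt ℝ k s x) : ContDiffAt ℝ k (fun y => pullC (A y) (s y)) x := by
  have : (fun y => pullC (A y) (s y)) = fun y => ∑ j, formCoords n (s y) j •
      pullC (A y) ((formCoords n).symm (Pi.single j 1)) := by
    funext y
    conv_lhs => rw [form_expand (s y)]
    simp only [map_sum, map_smul]
  rw [this]
  exact contDiffAt_fsum _ fun j _ =>
    contDiffAt_csmul (contDiffAt_coord hs j) (contDiffAt_pullC_const hA _)

/-- The infinitesimal action of `GL` on forms. -/
theorem hasDerivAt_pullC_const {A : ℝ → Cn n →L[ℝ] Cn n} {A' : Cn n →L[ℝ] Cn n} {r : ℝ}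
    (hA : HasDerivAt A A' r) (h1 : A r = ContinuousLinearMap.id ℝ (Cn n)) (Y : CForm n) :
    HasDerivAt (fun s => pullC (A s) Y) (lieOp A' Y) r := by
  induction Y using cform_left_induction with
  | h1 => simpa [lieOp_one] using hasDerivAt_const r (1 : CForm n)
  | hadd Y Z hY hZ => simp only [map_add]; exact hY.fun_add hZ
  | hsmul c Y hY =>
    simp only [map_smul]
    exact hasDerivAt_lin (csmulB c) hY
  | hmul ξ Y hY =>
    have h2 : HasDerivAt (fun s => ιc (ξ.comp (A s))) (ιc (ξ.comp A')) r := by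
      have h0 : HasDerivAt (fun s => ξ.comp (A s)) (ξ.comp A') r :=
        (ContinuousLinearMap.compL ℝ (Cn n) (Cn n) ℝ ξ).hasFDerivAt.comp_hasDerivAt r hA
      exact hasDerivAt_lin ιc h0
    have h3 := hasDerivAt_bilin mulB h2 hY
    have e : lieOp A' (ιc ξ * Y) =
        mulB (ιc (ξ.comp (A r))) (lieOp A' Y) + mulB (ιc (ξ.comp A')) (pullC (A r) Y) := by
      rw [lieOp_mul, lieOp_ιc, h1, pullC_id, add_comm]; rfl
    simp only [map_mul, pullC_ιc]
    rw [e]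
    exact h3

theorem hasDerivAt_pullC {A : ℝ → Cn n →L[ℝ] Cn n} {A' : Cn n →L[ℝ] Cn n} {r : ℝ}
    (hA : HasDerivAt A A' r) (h1 : A r = ContinuousLinearMap.id ℝ (Cn n)) {s : ℝ → CForm n}
    {s' : CForm n} (hs : HasDerivAt s s' r) :
    HasDerivAt (fun t => pullC (A t) (s t)) (lieOp A' (s r) + s') r := by
  have : (fun y => pullC (A y) (s y)) = fun y => ∑ j, csmulB (formCoords n (s y) j)
      (pullC (A y) ((formCoords n).symm (Pi.single j 1))) := by
    funext y
    conv_lhs => rw [form_expand (s y)]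
    simp only [map_sum, map_smul]
    rfl
  rw [this]
  have hc : ∀ j, HasDerivAt (fun y => formCoords n (s y) j) (formCoords n s' j) r := fun j =>
    hasDerivAt_lin (coordL j) hs
  have h3 := HasDerivAt.fun_sum (u := Finset.univ) fun j _ =>
    hasDerivAt_bilin csmulB (hc j)
      (hasDerivAt_pullC_const hA h1 ((formCoords n).symm (Pi.single j 1)))
  refine h3.congr_deriv ?_
  simp only [Finset.sum_add_distrib, h1, pullC_id]
  congr 1
  · conv_rhs => rw [form_expand (s r)]
    simp only [map_sum, map_smul]; rfl
  · exact (form_expand s').symm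

end

section Closed

variable {y : Cn n}

/-- The real two-form `∑ e^a ∧ D(e_a)` of a bilinear form `D`. -/
def altR (D : Cn n → Cov n) : RForm n :=
  ∑ j : Fin n, (ExteriorAlgebra.ι ℝ (dxCov j : Module.Dual ℝ (Cn n)) *
      ExteriorAlgebra.ι ℝ (D (Pi.single j 1) : Module.Dual ℝ (Cn n)) +
    ExteriorAlgebra.ι ℝ (dyCov j : Module.Dual ℝ (Cn n)) *
      ExteriorAlgebra.ι ℝ (D (Pi.single j Complex.I) : Module.Dual ℝ (Cn n)))

theorem altR_mem (D : Cn n → Cov n) : altR D ∈ degreePart n 2 :=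
  Submodule.sum_mem _ fun _ _ => Submodule.add_mem _ (ι_mul_ι_mem _ _) (ι_mul_ι_mem _ _)

theorem toC_altR (D : Cn n → Cov n) : toC (altR D) = altD (fun w => ιc (D w)) := by
  simp only [altR, altD, map_sum, map_add, map_mul, ιc_apply]

theorem cint_altR (D : Cn n →ₗ[ℝ] Cov n) (u v : Cn n) :
    cint v (cint u (toC (altR D))) = ((D u v - D v u : ℝ) : ℂ) • 1 := by
  rw [toC_altR]
  have h1 := cint_altD u (ιc ∘ₗ D)
  simp only [LinearMap.comp_apply] at h1
  have h2 : (fun w => cint u (ιc (D w))) = fun w =>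
      (((LinearMap.toContinuousLinearMap ((LinearMap.applyₗ u) ∘ₗ
        (ContinuousLinearMap.coeLM ℝ : (Cn n →L[ℝ] ℝ) →ₗ[ℝ] _) ∘ₗ D) : Cov n) w : ℝ) : ℂ)
        • (1 : CForm n) := by
    funext w; rw [cint_ιc]; rfl
  have h1' : cint u (altD fun w => ιc (D w)) = ιc (D u) - altD fun w => cint u (ιc (D w)) := h1
  rw [h1', h2, altD_real, mul_one, map_sub, cint_ιc, cint_ιc]
  push_cast
  rw [sub_smul]
  rfl

theorem flatD_ιc {ξ : Cn n → Cov n} (hξ : DifferentiableAt ℝ ξ y) :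
    flatD (fun z => ιc (ξ z)) y = toC (altR (fderiv ℝ ξ y)) := by
  rw [flatD_eq, toC_altR]
  congr 1; funext v; exact fderiv_ιc hξ v

theorem flatD_ιc_eq_zero {ξ : Cn n → Cov n} (hξ : DifferentiableAt ℝ ξ y)
    (hsymm : ∀ u v, fderiv ℝ ξ y u v = fderiv ℝ ξ y v u) : flatD (fun z => ιc (ξ z)) y = 0 := by
  rw [flatD_ιc hξ]
  refine two_form_ext (isHom_toC (altR_mem _)) isHom_zero fun u v => ?_
  have := cint_altR (fderiv ℝ ξ y : Cn n →ₗ[ℝ] Cov n) u v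
  rw [map_zero, map_zero]
  refine this.trans ?_
  simp [hsymm u v]

theorem flatD_pullC_const {A : Cn n → Cn n →L[ℝ] Cn n} (hA : ContDiffAt ℝ 1 A y)
    (hsymm : ∀ u v, fderiv ℝ A y u v = fderiv ℝ A y v u) (Y : CForm n) :
    flatD (fun z => pullC (A z) Y) y = 0 := by
  have hd : ∀ Y, DifferentiableAt ℝ (fun z => pullC (A z) Y) y := fun Y =>
    (contDiffAt_pullC_const hA Y).differentiableAt one_ne_zero
  induction Y using cform_left_induction with
  | h1 => simpa using flatD_const (y := y) (1 : CForm n)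
  | hadd Y Z hY hZ => simp only [map_add]; rw [flatD_add (hd _) (hd _), hY, hZ, add_zero]
  | hsmul c Y hY => simp only [map_smul]; rw [flatD_csmul_const _ (hd _), hY, smul_zero]
  | hmul ξ Y hY =>
    have hA1 : DifferentiableAt ℝ A y := hA.differentiableAt one_ne_zero
    have h1 : DifferentiableAt ℝ (fun z => ξ.comp (A z)) y :=
      (differentiableAt_const ξ).clm_comp hA1
    have h2 : DifferentiableAt ℝ (fun z => ιc (ξ.comp (A z))) y :=
      (contDiffAt_ιc (contDiffAt_const.clm_comp hA)).differentiableAt one_ne_zero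
    simp only [map_mul, pullC_ιc]
    rw [flatD_mul h2 (hd _), hY, mul_zero, add_zero, flatD_ιc_eq_zero h1, zero_mul]
    intro u v
    have := fderiv_clm_comp (differentiableAt_const ξ) hA1
    rw [this]
    simp [hsymm u v]

/-- The exterior derivative commutes with pull-back. -/
theorem flatD_pullC {τ : Cn n → Cn n} (hτ : ContDiffAt ℝ 2 τ y) {s : Cn n → CForm n}
    (hs : DifferentiableAt ℝ s (τ y)) :
    flatD (fun z => pullC (fderiv ℝ τ z) (s (τ z))) y = pullC (fderiv ℝ τ y) (flatD s (τ y)) := by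
  have hA : ContDiffAt ℝ 1 (fderiv ℝ τ) y := hτ.fderiv_right (by norm_num)
  have hsymm : ∀ u v, fderiv ℝ (fderiv ℝ τ) y u v = fderiv ℝ (fderiv ℝ τ) y v u := fun u v =>
    (hτ.isSymmSndFDerivAt (by simp)).eq u v
  have hτ1 : DifferentiableAt ℝ τ y := hτ.differentiableAt two_ne_zero
  have hc : ∀ j, DifferentiableAt ℝ (fun z => formCoords n (s z) j) (τ y) := fun j =>
    differentiableAt_lin (coordL j) hs
  have hp : ∀ Y, DifferentiableAt ℝ (fun z => pullC (fderiv ℝ τ z) Y) y := fun Y =>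
    (contDiffAt_pullC_const hA Y).differentiableAt one_ne_zero
  have e1 : (fun y => pullC (fderiv ℝ τ y) (s (τ y))) = fun y => ∑ j, formCoords n (s (τ y)) j •
      pullC (fderiv ℝ τ y) ((formCoords n).symm (Pi.single j 1)) := by
    funext y
    conv_lhs => rw [form_expand (s (τ y))]
    simp only [map_sum, map_smul]
  have e2 : s = fun y => ∑ j, formCoords n (s y) j • (formCoords n).symm (Pi.single j 1) :=
    funext fun y => form_expand (s y)
  have hcc : ∀ j, DifferentiableAt ℝ (fun z => formCoords n (s (τ z)) j) y := fun j =>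
    (hc j).comp y hτ1
  have hsm : ∀ {f : Cn n → ℂ} {g : Cn n → CForm n} {y}, DifferentiableAt ℝ f y →
      DifferentiableAt ℝ g y → DifferentiableAt ℝ (fun z => f z • g z) y := fun hf hg =>
    differentiableAt_csmul hf hg
  rw [e1, flatD_sum _ fun j _ => hsm (hcc j) (hp _)]
  conv_rhs => rw [e2]
  rw [flatD_sum _ fun j _ => hsm (hc j) (differentiableAt_const _), map_sum]
  refine Finset.sum_congr rfl fun j _ => ?_
  rw [flatD_smul (hcc j) (hp _), flatD_smul (hc j) (differentiableAt_const _), flatD_const,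
    flatD_pullC_const hA hsymm, smul_zero, add_zero, add_zero, map_mul, pullC_ιz]
  congr 2
  exact fderiv_comp y (hc j) hτ1

/-- The exponential of a form `X` of degree two satisfies `d e^X = dX ∧ e^X`. -/
theorem flatD_nexp {X : Cn n → CForm n} (hX : DifferentiableAt ℝ X y) (he : ∀ z, eps (X z) = X z)
    (h2 : ∀ z, IsHom 2 (X z)) : flatD (fun z => nexp n (X z)) y = flatD (X) y * nexp n (X y) := by
  have hp : ∀ k : ℕ, DifferentiableAt ℝ (fun z => X z ^ k) y := fun k => by
    induction k with
    | zero => simp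
    | succ k ih =>
      simp only [pow_succ]
      exact differentiableAt_fmul ih hX
  simp only [nexp_form]
  rw [flatD_sum _ fun k _ => differentiableAt_csmul_const _ (hp k)]
  rw [← nexp_form]
  have hk : ∀ k, flatD (fun z => X z ^ (k + 1)) y =
      ((k + 1 : ℕ) : ℂ) • (flatD X y * X y ^ k) := fun k => by
    induction k with
    | zero => simp
    | succ k ih =>
      have : (fun z => X z ^ (k + 1 + 1)) = fun z => X z ^ (k + 1) * X z := funext fun z => pow_succ _ _
      rw [this, flatD_mul (hp _) hX, ih, map_pow, he, (commute_of_eps (by rw [map_pow, he]) _ :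
        Commute (X y ^ (k + 1)) _).eq, smul_mul_assoc, mul_assoc, ← pow_succ, Nat.cast_succ (k + 1),
        add_smul, one_smul]
  rw [← sum_form_exp_deriv (fun k => flatD (fun z => X z ^ k) y) hk]
  · exact Finset.sum_congr rfl fun k _ => flatD_csmul_const _ (hp k)
  · simpa using flatD_const (y := y) (1 : CForm n)
  · have h3 : flatD X y * X y ^ n = altD (fun v => fderiv ℝ X y v * X y ^ n) := by
      rw [flatD_eq, altD_mul_right]
    have h4 : ∀ v, IsHom 2 (fderiv ℝ X y v) := fun v => by
      have e : (fun z => lieOp (ContinuousLinearMap.id ℝ (Cn n)) (X z)) =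
          fun z => (2 : ℂ) • X z := funext fun z => by simpa [IsHom] using h2 z
      have := fderiv_clin (lieOp (ContinuousLinearMap.id ℝ (Cn n))) hX v
      rw [e, fderiv_csmul_const _ hX] at this
      rw [IsHom, ← this]; simp
    have h5 : ∀ v, fderiv ℝ X y v * X y ^ n = 0 := fun v =>
      ((h4 v).mul ((h2 y).pow n)).eq_zero (Or.inr (by omega))
    rw [h3]; simp only [h5, altD_zero]

end Closed

/-! ### The exponential of a bivector field -/

/-- The derivative of the Clifford action of a bivector when the vectors `v i` move in the
directions `v' i`. -/
def bivDeriv (lam : Fin m → Fin m → ℝ) (v v' : Fin m → Cn n) (X : CForm n) : CForm n :=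
  ∑ i, ∑ j, (lam i j : ℂ) • (cint (v' i) (cint (v j) X) + cint (v i) (cint (v' j) X))

/-- `bivDeriv` as a linear map. -/
def bivDerivL (lam : Fin m → Fin m → ℝ) (v v' : Fin m → Cn n) : Module.End ℂ (CForm n) :=
  ∑ i, ∑ j, (lam i j : ℂ) • (cint (v' i) * cint (v j) + cint (v i) * cint (v' j))

theorem bivDerivL_apply (lam : Fin m → Fin m → ℝ) (v v' : Fin m → Cn n) (X : CForm n) :
    bivDerivL lam v v' X = bivDeriv lam v v' X := by
  simp only [bivDerivL, bivDeriv, LinearMap.sum_apply]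
  rfl

theorem bivAct_bivDeriv (lam : Fin m → Fin m → ℝ) (v v' : Fin m → Cn n) (X : CForm n) :
    bivAct lam v (bivDeriv lam v v' X) = bivDeriv lam v v' (bivAct lam v X) := by
  simp only [bivDeriv, map_sum, map_smul, map_add, bivAct_cint]

theorem bivDeriv_pow_eq_zero (lam : Fin m → Fin m → ℝ) (v v' : Fin m → Cn n) (X : CForm n) :
    bivDeriv lam v v' ((bivAct lam v ^ n) X) = 0 := by
  simp only [bivDeriv, cint_bivAct_pow_eq_zero, map_zero, add_zero, smul_zero,
    Finset.sum_const_zero]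

theorem lieOp_bivAct (A : Cn n →L[ℝ] Cn n) (lam : Fin m → Fin m → ℝ) (v : Fin m → Cn n)
    (X : CForm n) : lieOp A (bivAct lam v X) =
      bivAct lam v (lieOp A X) - bivDeriv lam v (fun i => A (v i)) X := by
  simp only [bivAct_apply, bivDeriv, map_sum, map_smul, ← Finset.sum_sub_distrib]
  refine Finset.sum_congr rfl fun i _ => Finset.sum_congr rfl fun j _ => ?_
  rw [lieOp_cint, lieOp_cint, map_sub]
  module

theorem lieOp_expBiv (A : Cn n →L[ℝ] Cn n) (lam : Fin m → Fin m → ℝ) (v : Fin m → Cn n) (t : ℝ)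
    (X : CForm n) : lieOp A (expBiv lam v t X) = expBiv lam v t (lieOp A X)
      - (t : ℂ) • bivDeriv lam v (fun i => A (v i)) (expBiv lam v t X) := by
  have hk : ∀ k : ℕ, (bivAct lam v ^ (k + 1)) (lieOp A X) - lieOp A ((bivAct lam v ^ (k + 1)) X) =
      ((k + 1 : ℕ) : ℂ) • bivDerivL lam v (fun i => A (v i)) ((bivAct lam v ^ k) X) := by
    intro k
    induction k with
    | zero => simp [lieOp_bivAct, bivDerivL_apply]
    | succ k ih =>
      rw [bivDerivL_apply] at ih ⊢
      rw [pow_succ' _ (k + 1), Module.End.mul_apply, Module.End.mul_apply, lieOp_bivAct,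
        sub_eq_iff_eq_add.mp ih, map_add, map_smul, bivAct_bivDeriv,
        ← Module.End.mul_apply (bivAct lam v) (bivAct lam v ^ k), ← pow_succ', Nat.cast_succ (k + 1)]
      module
  have h := sum_exp_deriv (n := n) (t : ℂ) (bivAct lam v) (bivDerivL lam v (fun i => A (v i))) X
    (fun k => (bivAct lam v ^ k) (lieOp A X) - lieOp A ((bivAct lam v ^ k) X)) hk (by simp)
    (by rw [bivDerivL_apply, bivDeriv_pow_eq_zero])
  rw [bivDerivL_apply] at h
  change _ = (t : ℂ) • bivDeriv lam v _ (expBiv lam v t X) at h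
  rw [← h, expBiv_apply, expBiv_apply, map_sum, ← Finset.sum_sub_distrib]
  refine Finset.sum_congr rfl fun k _ => ?_
  rw [map_smul]; module

section

variable {X : Type*} [NormedAddCommGroup X] [NormedSpace ℝ X] {x : X} {k : WithTop ℕ∞}

theorem contDiffAt_bivAct (lam : Fin m → Fin m → ℝ) {v : Fin m → X → Cn n} {s : X → CForm n}
    (hv : ∀ i, ContDiffAt ℝ k (v i) x) (hs : ContDiffAt ℝ k s x) :
    ContDiffAt ℝ k (fun y => bivAct lam (fun i => v i y) (s y)) x := by
  simp only [bivAct_apply]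
  exact contDiffAt_fsum _ fun i _ => contDiffAt_fsum _ fun j _ =>
    contDiffAt_csmul_const _ (contDiffAt_cint (hv i) (contDiffAt_cint (hv j) hs))

theorem contDiffAt_bivAct_pow (lam : Fin m → Fin m → ℝ) {v : Fin m → X → Cn n} {s : X → CForm n}
    (hv : ∀ i, ContDiffAt ℝ k (v i) x) (hs : ContDiffAt ℝ k s x) (j : ℕ) :
    ContDiffAt ℝ k (fun y => (bivAct lam (fun i => v i y) ^ j) (s y)) x := by
  induction j with
  | zero => simpa using hs
  | succ j ih =>
    simp only [pow_succ', Module.End.mul_apply]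
    exact contDiffAt_bivAct lam hv ih

theorem contDiffAt_expBiv (lam : Fin m → Fin m → ℝ) {v : Fin m → X → Cn n} {s : X → CForm n}
    (t : ℝ) (hv : ∀ i, ContDiffAt ℝ k (v i) x) (hs : ContDiffAt ℝ k s x) :
    ContDiffAt ℝ k (fun y => expBiv lam (fun i => v i y) t (s y)) x := by
  simp only [expBiv_apply]
  exact contDiffAt_fsum _ fun j _ => contDiffAt_csmul_const _ (contDiffAt_bivAct_pow lam hv hs j)

theorem fderiv_fsum {ι : Type*} (S : Finset ι) {f : ι → X → CForm n}
    (hf : ∀ i ∈ S, DifferentiableAt ℝ (f i) x) (w : X) :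
    fderiv ℝ (fun y => ∑ i ∈ S, f i y) x w = ∑ i ∈ S, fderiv ℝ (f i) x w := by
  rw [fderiv_fun_sum hf]; simp

theorem fderiv_bivAct (lam : Fin m → Fin m → ℝ) {v : Fin m → X → Cn n} {s : X → CForm n}
    (hv : ∀ i, DifferentiableAt ℝ (v i) x) (hs : DifferentiableAt ℝ s x) (w : X) :
    fderiv ℝ (fun y => bivAct lam (fun i => v i y) (s y)) x w =
      bivAct lam (fun i => v i x) (fderiv ℝ s x w) +
        bivDeriv lam (fun i => v i x) (fun i => fderiv ℝ (v i) x w) (s x) := by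
  have h1 : ∀ j, DifferentiableAt ℝ (fun y => cint (v j y) (s y)) x := fun j =>
    differentiableAt_cint (hv j) hs
  have h2 : ∀ i j, DifferentiableAt ℝ (fun y => cint (v i y) (cint (v j y) (s y))) x := fun i j =>
    differentiableAt_cint (hv i) (h1 j)
  simp only [bivAct_apply]
  rw [fderiv_fsum _ fun i _ => DifferentiableAt.fun_sum fun j _ =>
    differentiableAt_csmul_const _ (h2 i j)]
  rw [bivDeriv, ← Finset.sum_add_distrib]
  refine Finset.sum_congr rfl fun i _ => ?_
  rw [fderiv_fsum _ fun j _ => differentiableAt_csmul_const _ (h2 i j), ← Finset.sum_add_distrib]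
  refine Finset.sum_congr rfl fun j _ => ?_
  rw [fderiv_csmul_const _ (h2 i j), fderiv_cint (hv i) (h1 j), fderiv_cint (hv j) hs, map_add]
  module

theorem fderiv_expBiv_const (lam : Fin m → Fin m → ℝ) {v : Fin m → X → Cn n} (t : ℝ)
    (hv : ∀ i, ContDiffAt ℝ 1 (v i) x) (Y : CForm n) (w : X) :
    fderiv ℝ (fun y => expBiv lam (fun i => v i y) t Y) x w =
      (t : ℂ) • bivDeriv lam (fun i => v i x) (fun i => fderiv ℝ (v i) x w)
        (expBiv lam (fun i => v i x) t Y) := by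
  have hd : ∀ k : ℕ, DifferentiableAt ℝ (fun y => (bivAct lam (fun i => v i y) ^ k) Y) x := fun k =>
    (contDiffAt_bivAct_pow lam hv contDiffAt_const k).differentiableAt one_ne_zero
  have hk : ∀ k : ℕ, fderiv ℝ (fun y => (bivAct lam (fun i => v i y) ^ (k + 1)) Y) x w =
      ((k + 1 : ℕ) : ℂ) • bivDerivL lam (fun i => v i x) (fun i => fderiv ℝ (v i) x w)
        ((bivAct lam (fun i => v i x) ^ k) Y) := by
    intro k
    induction k with
    | zero =>
      have := fderiv_bivAct lam (fun i => (hv i).differentiableAt one_ne_zero)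
        (differentiableAt_const Y) w
      simp only [zero_add, pow_one, bivDerivL_apply]
      rw [this]; simp
    | succ k ih =>
      have := fderiv_bivAct lam (fun i => (hv i).differentiableAt one_ne_zero) (hd (k + 1)) w
      simp only [pow_succ' _ (k + 1), Module.End.mul_apply]
      rw [this, ih, bivDerivL_apply, bivDerivL_apply, map_smul, bivAct_bivDeriv,
        ← Module.End.mul_apply (bivAct lam _) (bivAct lam _ ^ k), ← pow_succ', Nat.cast_succ (k + 1)]
      module
  have h := sum_exp_deriv (n := n) (t : ℂ) (bivAct lam fun i => v i x)
    (bivDerivL lam (fun i => v i x) (fun i => fderiv ℝ (v i) x w)) Y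
    (fun k => fderiv ℝ (fun y => (bivAct lam (fun i => v i y) ^ k) Y) x w) hk (by simp)
    (by rw [bivDerivL_apply, bivDeriv_pow_eq_zero])
  rw [bivDerivL_apply] at h
  refine Eq.trans ?_ h
  simp only [expBiv_apply]
  rw [fderiv_fsum _ fun k _ => differentiableAt_csmul_const _ (hd k)]
  exact Finset.sum_congr rfl fun k _ => fderiv_csmul_const _ (hd k) w

end

/-- The components of the modular vector field: `∑ λ_ij (c_i v_j - c_j v_i)`. -/
def modVec (lam : Fin m → Fin m → ℝ) (v : Fin m → Cn n) (c : Fin m → ℂ) : Cn n :=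
  ∑ i, ∑ j, lam i j • (c i • v j - c j • v i)

theorem sum_sum_eq_zero {ι : Type*} [Fintype ι] {G : ι → ι → CForm n}
    (hG : ∀ p q, G q p = -G p q) : ∑ p, ∑ q, G p q = 0 := by
  have e2 : ∑ p, ∑ q, G p q = -∑ p, ∑ q, G p q := by
    conv_lhs => rw [Finset.sum_comm]
    simp only [← Finset.sum_neg_distrib]
    exact Finset.sum_congr rfl fun p _ => Finset.sum_congr rfl fun q _ => hG p q
  have e3 : ∑ p, ∑ q, G p q = (1 / 2 : ℂ) • (∑ p, ∑ q, G p q + ∑ p, ∑ q, G p q) := by module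
  rw [e3]
  nth_rewrite 2 [e2]
  rw [add_neg_cancel, smul_zero]

/-- For commuting vector fields the quadratic terms in the derivative of `e^{tβ}` cancel. -/
theorem bivDeriv_swap (lam : Fin m → Fin m → ℝ) (v : Fin m → Cn n) (A : Fin m → Cn n →L[ℝ] Cn n)
    (hA : ∀ i j, A i (v j) = A j (v i)) (X : CForm n) :
    ∑ i, ∑ j, (lam i j : ℂ) • (cint (v j) (bivDeriv lam v (fun k => A i (v k)) X)
      - cint (v i) (bivDeriv lam v (fun k => A j (v k)) X)) = 0 := by
  set T : Fin m → Fin m → Fin m → Fin m → CForm n := fun i j k l =>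
    cint (v j) (cint (A i (v k)) (cint (v l) X)) with hT
  have hTs : ∀ i j k l, T k l i j = -T i j k l := by
    intro i j k l
    simp only [hT]
    rw [hA k i, cint_comm (v l), cint_comm (v l), map_neg, neg_neg, cint_comm (A i (v k))]
  have e : ∀ i j, cint (v j) (bivDeriv lam v (fun k => A i (v k)) X) =
      ∑ k, ∑ l, (lam k l : ℂ) • (T i j k l - T i j l k) := by
    intro i j
    simp only [bivDeriv, map_sum, map_smul, map_add, hT]
    refine Finset.sum_congr rfl fun k _ => Finset.sum_congr rfl fun l _ => ?_
    rw [cint_comm (v k) (A i (v l)), map_neg, ← sub_eq_add_neg]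
  simp only [e]
  -- the summand changes sign under the exchange of the two pairs of indices
  have h := sum_sum_eq_zero (ι := Fin m × Fin m)
    (G := fun p q => ((lam p.1 p.2 : ℂ) * (lam q.1 q.2 : ℂ)) •
      (T p.1 p.2 q.1 q.2 - T p.1 p.2 q.2 q.1 - T p.2 p.1 q.1 q.2 + T p.2 p.1 q.2 q.1))
    (fun p q => by
      rw [hTs p.1 p.2 q.1 q.2, hTs p.2 p.1 q.1 q.2, hTs p.1 p.2 q.2 q.1, hTs p.2 p.1 q.2 q.1]
      module)
  simp only [Fintype.sum_prod_type] at h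
  rw [← h]
  refine Finset.sum_congr rfl fun i _ => Finset.sum_congr rfl fun j _ => ?_
  rw [← Finset.sum_sub_distrib, Finset.smul_sum]
  refine Finset.sum_congr rfl fun k _ => ?_
  rw [← Finset.sum_sub_distrib, Finset.smul_sum]
  refine Finset.sum_congr rfl fun l _ => ?_
  module

/-- `d (e^{tβ} Ω) = t i_W e^{tβ} Ω`, where `W` is the modular vector field. -/
theorem flatD_expBiv_hvol (lam : Fin m → Fin m → ℝ) {v : Fin m → Cn n → Cn n} {y : Cn n} (t : ℝ)
    (hv : ∀ i, ContDiffAt ℝ 1 (v i) y)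
    (hhol : ∀ i w, fderiv ℝ (v i) y (stdJ n w) = stdJ n (fderiv ℝ (v i) y w))
    (hcomm : ∀ i j, fderiv ℝ (v i) y (v j y) = fderiv ℝ (v j) y (v i y)) :
    flatD (fun z => expBiv lam (fun i => v i z) t (hvol n)) y =
      (t : ℂ) • ∑ i, ∑ j, (lam i j : ℂ) • (cdiv (fderiv ℝ (v i) y) •
          cint (v j y) (expBiv lam (fun i => v i y) t (hvol n)) -
        cdiv (fderiv ℝ (v j) y) • cint (v i y) (expBiv lam (fun i => v i y) t (hvol n))) := by
  set Y := expBiv lam (fun i => v i y) t (hvol n) with hY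
  set A : Fin m → Cn n →L[ℝ] Cn n := fun i => fderiv ℝ (v i) y with hA
  have h0 : ∀ i, lieOp (A i) Y = cdiv (A i) • Y -
      (t : ℂ) • bivDeriv lam (fun i => v i y) (fun k => A i (v k y)) Y := fun i => by
    rw [hY, lieOp_expBiv, lieOp_hvol (hhol i), map_smul]
  rw [flatD_eq]
  have e1 : (fderiv ℝ (fun z => expBiv lam (fun i => v i z) t (hvol n)) y : Cn n → CForm n) =
      fun w => (t : ℂ) • ∑ i, ∑ j, (lam i j : ℂ) •
        (cint (A i w) (cint (v j y) Y) - cint (A j w) (cint (v i y) Y)) := by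
    funext w
    rw [fderiv_expBiv_const lam t hv]
    congr 1
    refine Finset.sum_congr rfl fun i _ => Finset.sum_congr rfl fun j _ => ?_
    rw [cint_comm (v i y) (A j w), ← sub_eq_add_neg]
  rw [e1, altD_smul, altD_sum]
  congr 1
  have e2 : ∀ i j, altD (fun w => (lam i j : ℂ) •
      (cint (A i w) (cint (v j y) Y) - cint (A j w) (cint (v i y) Y))) =
      (lam i j : ℂ) • (cdiv (A i) • cint (v j y) Y - cdiv (A j) • cint (v i y) Y) -
        (t : ℂ) • ((lam i j : ℂ) • (cint (v j y) (bivDeriv lam (fun i => v i y)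
          (fun k => A i (v k y)) Y) - cint (v i y) (bivDeriv lam (fun i => v i y)
          (fun k => A j (v k y)) Y))) := by
    intro i j
    rw [altD_smul, altD_sub, ← lieOp_apply, ← lieOp_apply, lieOp_cint, lieOp_cint, h0, h0, map_sub,
      map_sub, map_smul, map_smul, map_smul, map_smul, hcomm i j]
    module
  simp only [altD_sum, e2, Finset.sum_sub_distrib, ← Finset.smul_sum]
  have := bivDeriv_swap lam (fun i => v i y) A hcomm Y
  simp only [Finset.sum_sub_distrib, smul_sub] at this ⊢
  rw [← smul_sub, this, smul_zero, sub_zero]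

/-! ### The Courant bracket as a derived bracket -/

theorem cliff_altD (a : GT n) (D : Cn n →ₗ[ℝ] CForm n) :
    cliff a (altD D) = D a.1 - altD (fun w => cliff a (D w)) := by
  have h : (fun w => cliff a (D w)) = fun w => cint a.1 (D w) + ιc a.2 * D w := rfl
  rw [h, altD_add, altD_mul_left, eps_ιc, cliff_apply, cint_altD, cneg_mul]
  abel

section

variable {a b : Cn n → GT n} {y : Cn n}

theorem fderiv_pair (ha : DifferentiableAt ℝ a y) (hb : DifferentiableAt ℝ b y) (w : Cn n) :
    fderiv ℝ (fun z => pair (a z) (b z)) y w =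
      pair (fderiv ℝ a y w) (b y) + pair (a y) (fderiv ℝ b y w) := by
  have h1 := (ha.hasFDerivAt.snd.clm_apply hb.hasFDerivAt.fst)
  have h2 := (hb.hasFDerivAt.snd.clm_apply ha.hasFDerivAt.fst)
  have h3 : HasFDerivAt (fun z => pair (a z) (b z)) _ y := (h1.add h2).mul_const (2⁻¹ : ℝ)
  rw [h3.fderiv]
  simp [pair]
  ring

/-- The covector `w ↦ ⟨A w, q⟩ - ⟨p, B w⟩`. -/
def crossCov (A B : Cn n →L[ℝ] GT n) (p q : GT n) : Cov n :=
  LinearMap.toContinuousLinearMap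
    { toFun := fun w => pair (A w) q - pair p (B w)
      map_add' := fun u w => by simp [pair]; ring
      map_smul' := fun c w => by simp [pair]; ring }

theorem crossCov_apply (A B : Cn n →L[ℝ] GT n) (p q : GT n) (w : Cn n) :
    crossCov A B p q w = pair (A w) q - pair p (B w) := rfl

theorem flatCourant_eq (ha : DifferentiableAt ℝ a y) (hb : DifferentiableAt ℝ b y) :
    flatCourant a b y = fderiv ℝ b y (a y).1 - fderiv ℝ a y (b y).1 +
      (0, crossCov (fderiv ℝ a y) (fderiv ℝ b y) (a y) (b y)) := by
  have f1 : fderiv ℝ (fun z => (a z).1) y = (ContinuousLinearMap.fst ℝ _ _).comp (fderiv ℝ a y) :=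
    ha.hasFDerivAt.fst.fderiv
  have f2 : fderiv ℝ (fun z => (a z).2) y = (ContinuousLinearMap.snd ℝ _ _).comp (fderiv ℝ a y) :=
    ha.hasFDerivAt.snd.fderiv
  have f3 : fderiv ℝ (fun z => (b z).1) y = (ContinuousLinearMap.fst ℝ _ _).comp (fderiv ℝ b y) :=
    hb.hasFDerivAt.fst.fderiv
  have f4 : fderiv ℝ (fun z => (b z).2) y = (ContinuousLinearMap.snd ℝ _ _).comp (fderiv ℝ b y) :=
    hb.hasFDerivAt.snd.fderiv
  have f5 := (hb.hasFDerivAt.snd.clm_apply ha.hasFDerivAt.fst).fderiv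
  have f6 := (ha.hasFDerivAt.snd.clm_apply hb.hasFDerivAt.fst).fderiv
  simp only [flatCourant, VectorField.lieBracket, f1, f2, f3, f4, f5, f6]
  refine Prod.ext ?_ ?_
  · simp
  · refine ContinuousLinearMap.ext fun w => ?_
    simp [pair, crossCov_apply]
    ring

theorem altD_cliff_cliff (ha : DifferentiableAt ℝ a y) (hb : DifferentiableAt ℝ b y)
    (X : CForm n) :
    altD (fun w => cliff (fderiv ℝ a y w) (cliff (b y) X)) =
      ιc (fderiv ℝ (fun z => pair (a z) (b z)) y) * X +
        ιc (crossCov (fderiv ℝ a y) (fderiv ℝ b y) (a y) (b y)) * X -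
        altD (fun w => cliff (b y) (cliff (fderiv ℝ a y w) X)) := by
  rw [← altD_real, ← altD_real, ← altD_add, ← altD_sub]
  congr 1; funext w
  rw [eq_sub_of_add_eq (cliff_cliff (fderiv ℝ a y w) (b y) X), fderiv_pair ha hb, crossCov_apply]
  push_cast
  module

/-- `[a, b] · φ + d⟨a, b⟩ ∧ φ = [[d, a], b] φ` in terms of commutators of operators on forms. -/
theorem flatCourant_cliff (ha : DifferentiableAt ℝ a y) (hb : DifferentiableAt ℝ b y)
    {φ : Cn n → CForm n} (hφ : DifferentiableAt ℝ φ y) :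
    cliff (flatCourant a b y) (φ y) + ιc (fderiv ℝ (fun z => pair (a z) (b z)) y) * φ y =
      flatD (fun z => cliff (a z) (cliff (b z) (φ z))) y
        + cliff (a y) (flatD (fun z => cliff (b z) (φ z)) y)
        - cliff (b y) (flatD (fun z => cliff (a z) (φ z)) y)
        - cliff (b y) (cliff (a y) (flatD φ y)) := by
  set Da := fderiv ℝ a y with hDa
  set Db := fderiv ℝ b y with hDb
  set D := fderiv ℝ φ y with hD
  set X := φ y with hX
  let Lb : Cn n →ₗ[ℝ] CForm n := (cliffB (b y)) ∘ₗ D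
  let La : Cn n →ₗ[ℝ] CForm n := (cliffB (a y)) ∘ₗ D
  let Mb : Cn n →ₗ[ℝ] CForm n := (cliffB.flip X) ∘ₗ Db
  let Ma : Cn n →ₗ[ℝ] CForm n := (cliffB.flip X) ∘ₗ Da
  have e0 : flatD φ y = altD D := flatD_eq _ _
  have eb : flatD (fun z => cliff (b z) (φ z)) y = altD Lb + altD Mb := by
    rw [flatD_eq, ← altD_add]
    congr 1; funext w; exact fderiv_cliff hb hφ w
  have ea : flatD (fun z => cliff (a z) (φ z)) y = altD La + altD Ma := by
    rw [flatD_eq, ← altD_add]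
    congr 1; funext w; exact fderiv_cliff ha hφ w
  have eab : flatD (fun z => cliff (a z) (cliff (b z) (φ z))) y =
      altD (fun w => cliff (a y) (Lb w)) + altD (fun w => cliff (a y) (Mb w)) +
        altD (fun w => cliff (Da w) (cliff (b y) X)) := by
    rw [flatD_eq, ← altD_add, ← altD_add]
    congr 1; funext w
    rw [fderiv_cliff ha (differentiableAt_cliff hb hφ), fderiv_cliff hb hφ, map_add]
    rfl
  have e1 := altD_cliff_cliff ha hb X
  have hc := flatCourant_eq ha hb
  rw [hc, cliff_add, cliff_sub]
  have c0 : cliff (a y) (altD D) = D (a y).1 - altD La := cliff_altD (a y) D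
  have c0b : cliff (b y) (altD La) = La (b y).1 - altD (fun w => cliff (b y) (La w)) :=
    cliff_altD (b y) La
  have c1 := cliff_altD (a y) Lb
  have c2 := cliff_altD (a y) Mb
  have c4 : cliff (b y) (altD Ma) = Ma (b y).1 - altD (fun w => cliff (b y) (cliff (Da w) X)) :=
    cliff_altD (b y) Ma
  rw [eab, eb, ea, e0, e1, map_add, map_add, c0, map_sub, c0b, c1, c2, c4]
  have g1 : Lb (a y).1 = cliff (b y) (D (a y).1) := rfl
  have g3 : Mb (a y).1 = cliff (Db (a y).1) X := rfl
  have g4 : Ma (b y).1 = cliff (Da (b y).1) X := rfl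
  rw [g1, g3, g4, cliff_apply (0, _)]
  rw [cint_zero, LinearMap.zero_apply, zero_add]
  abel

end

/-- The Clifford action of the complex element `a + i b`. -/
def cliffC (a b : GT n) : Module.End ℂ (CForm n) := cliff a + Complex.I • cliff b

theorem cliffC_apply (a b : GT n) (X : CForm n) :
    cliffC a b X = cliff a X + Complex.I • cliff b X := rfl

theorem pairC_eq_zero {a₁ b₁ a₂ b₂ : GT n} {X : CForm n} (hX : X ≠ 0) (h₁ : cliffC a₁ b₁ X = 0)
    (h₂ : cliffC a₂ b₂ X = 0) :
    pair a₁ a₂ = pair b₁ b₂ ∧ pair a₁ b₂ = -pair b₁ a₂ := by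
  have h : ((2 * pair a₁ a₂ - 2 * pair b₁ b₂ : ℝ) + (2 * pair a₁ b₂ + 2 * pair b₁ a₂ : ℝ) *
      Complex.I : ℂ) • X = 0 := by
    have e : cliffC a₁ b₁ (cliffC a₂ b₂ X) + cliffC a₂ b₂ (cliffC a₁ b₁ X) =
        ((2 * pair a₁ a₂ - 2 * pair b₁ b₂ : ℝ) + (2 * pair a₁ b₂ + 2 * pair b₁ a₂ : ℝ) *
          Complex.I : ℂ) • X := by
      simp only [cliffC_apply, map_add, map_smul]
      have k1 := eq_sub_of_add_eq (cliff_cliff a₁ a₂ X)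
      have k2 := eq_sub_of_add_eq (cliff_cliff b₁ b₂ X)
      have k3 := eq_sub_of_add_eq (cliff_cliff a₁ b₂ X)
      have k4 := eq_sub_of_add_eq (cliff_cliff b₁ a₂ X)
      rw [k1, k2, k3, k4]
      push_cast
      simp only [smul_add, smul_smul, Complex.I_mul_I]
      module
    rw [← e, h₁, h₂, map_zero, map_zero, add_zero]
  have h0 := (smul_eq_zero.mp h).resolve_right hX
  have hre := congrArg Complex.re h0
  have him := congrArg Complex.im h0
  simp at hre him
  constructor <;> linarith

/-- Sections annihilating a spinor `φ` with `dφ = η · φ` are closed under the Courant bracket. -/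
theorem flatCourant_involutive {a₁ b₁ a₂ b₂ : Cn n → GT n} {y : Cn n}
    (ha₁ : DifferentiableAt ℝ a₁ y) (hb₁ : DifferentiableAt ℝ b₁ y)
    (ha₂ : DifferentiableAt ℝ a₂ y) (hb₂ : DifferentiableAt ℝ b₂ y)
    {φ : Cn n → CForm n} (hφ : DifferentiableAt ℝ φ y) (h0 : φ y ≠ 0) {η : GT n}
    (hη : flatD φ y = cliff η (φ y))
    (h₁ : ∀ᶠ z in nhds y, cliffC (a₁ z) (b₁ z) (φ z) = 0)
    (h₂ : ∀ᶠ z in nhds y, cliffC (a₂ z) (b₂ z) (φ z) = 0) :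
    cliffC (flatCourant a₁ a₂ y - flatCourant b₁ b₂ y)
      (flatCourant a₁ b₂ y + flatCourant b₁ a₂ y) (φ y) = 0 := by
  have hne : ∀ᶠ z in nhds y, φ z ≠ 0 := hφ.continuousAt.eventually_ne h0
  -- the annihilator of a spinor is isotropic, so the exact terms `d⟨·, ·⟩` of the brackets cancel
  have hp1 : (fun z => pair (a₁ z) (a₂ z)) =ᶠ[nhds y] fun z => pair (b₁ z) (b₂ z) := by
    filter_upwards [hne, h₁, h₂] with z hz k1 k2 using (pairC_eq_zero hz k1 k2).1
  have hp2 : (fun z => pair (a₁ z) (b₂ z)) =ᶠ[nhds y] fun z => -pair (b₁ z) (a₂ z) := by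
    filter_upwards [hne, h₁, h₂] with z hz k1 k2 using (pairC_eq_zero hz k1 k2).2
  have d1 := hp1.fderiv_eq (𝕜 := ℝ)
  have d2 := hp2.fderiv_eq (𝕜 := ℝ)
  rw [fderiv_fun_neg] at d2
  have c1 := flatCourant_cliff ha₁ ha₂ hφ
  have c2 := flatCourant_cliff hb₁ hb₂ hφ
  have c3 := flatCourant_cliff ha₁ hb₂ hφ
  have c4 := flatCourant_cliff hb₁ ha₂ hφ
  have D1 := differentiableAt_cliff ha₁ hφ
  have D2 := differentiableAt_cliff ha₂ hφ
  have E1 := differentiableAt_cliff hb₁ hφ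
  have E2 := differentiableAt_cliff hb₂ hφ
  have f1 : flatD (fun z => cliff (a₁ z) (φ z)) y + Complex.I • flatD (fun z => cliff (b₁ z) (φ z)) y
      = 0 := by
    rw [← flatD_csmul_const _ E1, ← flatD_add D1 (differentiableAt_csmul_const _ E1)]
    refine (flatD_congr (r := fun _ => 0) ?_).trans (flatD_const 0)
    exact h₁
  have f2 : flatD (fun z => cliff (a₂ z) (φ z)) y + Complex.I • flatD (fun z => cliff (b₂ z) (φ z)) y
      = 0 := by
    rw [← flatD_csmul_const _ E2, ← flatD_add D2 (differentiableAt_csmul_const _ E2)]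
    refine (flatD_congr (r := fun _ => 0) ?_).trans (flatD_const 0)
    exact h₂
  have g1 := differentiableAt_cliff ha₁ D2
  have g2 := differentiableAt_cliff ha₁ E2
  have g3 := differentiableAt_cliff hb₁ D2
  have g4 := differentiableAt_cliff hb₁ E2
  have f3 : flatD (fun z => cliff (a₁ z) (cliff (a₂ z) (φ z))) y +
      Complex.I • flatD (fun z => cliff (a₁ z) (cliff (b₂ z) (φ z))) y +
      (Complex.I • flatD (fun z => cliff (b₁ z) (cliff (a₂ z) (φ z))) y +
      Complex.I • Complex.I • flatD (fun z => cliff (b₁ z) (cliff (b₂ z) (φ z))) y) = 0 := by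
    rw [← flatD_csmul_const _ g2, ← flatD_csmul_const _ g3, ← flatD_csmul_const _ g4,
      ← flatD_csmul_const _ (differentiableAt_csmul_const _ g4),
      ← flatD_add g1 (differentiableAt_csmul_const _ g2), ← flatD_add
      (differentiableAt_csmul_const _ g3)
      (differentiableAt_csmul_const _ (differentiableAt_csmul_const _ g4)),
      ← flatD_add (g1.fun_add (differentiableAt_csmul_const _ g2))
      ((differentiableAt_csmul_const _ g3).fun_add
      (differentiableAt_csmul_const _ (differentiableAt_csmul_const _ g4))),
      flatD_congr (r := fun _ => 0) _, flatD_const]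
    filter_upwards [h₂] with z hz
    have e : cliffC (a₁ z) (b₁ z) (cliffC (a₂ z) (b₂ z) (φ z)) = 0 := by rw [hz, map_zero]
    rw [← e]
    simp only [cliffC_apply, map_add, map_smul, smul_add]
    abel
  have f4 : cliffC (a₂ y) (b₂ y) (cliffC (a₁ y) (b₁ y) (flatD φ y)) = 0 := by
    have k0 : cliffC (a₁ y) (b₁ y) (φ y) = 0 := h₁.self_of_nhds
    have k0' : cliffC (a₂ y) (b₂ y) (φ y) = 0 := h₂.self_of_nhds
    have k : cliffC (a₁ y) (b₁ y) (cliff η (φ y)) =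
        (((2 * pair (a₁ y) η : ℝ) : ℂ) + Complex.I * ((2 * pair (b₁ y) η : ℝ) : ℂ)) • φ y := by
      have k1 := eq_sub_of_add_eq (cliff_cliff (a₁ y) η (φ y))
      have k2 := eq_sub_of_add_eq (cliff_cliff (b₁ y) η (φ y))
      have k3 : cliff η (cliffC (a₁ y) (b₁ y) (φ y)) = 0 := by rw [k0, map_zero]
      rw [cliffC_apply, map_add, map_smul] at k3
      rw [cliffC_apply, k1, k2, add_smul, mul_smul, ← sub_zero ((_ • φ y) + _), ← k3]
      module
    rw [hη, k, map_smul, k0', smul_zero]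
  have f5 := congrArg (cliffC (a₁ y) (b₁ y)) f2
  have f6 := congrArg (cliffC (a₂ y) (b₂ y)) f1
  simp only [cliffC_apply, map_add, map_smul, smul_add, map_zero] at f4 f5 f6
  rw [d1] at c1
  rw [d2, map_neg, cneg_mul] at c3
  rw [cliffC_apply, cliff_sub, cliff_add]
  set P := ιc (fderiv ℝ (fun z => pair (b₁ z) (b₂ z)) y) * φ y
  set Q := ιc (fderiv ℝ (fun z => pair (b₁ z) (a₂ z)) y) * φ y
  rw [eq_sub_of_add_eq c1, eq_sub_of_add_eq c2, eq_sub_of_add_eq c3, eq_sub_of_add_eq c4]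
  simp only [smul_smul, Complex.I_mul_I] at f3 f4 f5 f6
  linear_combination (norm := module) f3 + f5 - f6 - f4

/-! ### Charts of a complex manifold -/

section Charts

variable {M : Type*} [TopologicalSpace M] [ChartedSpace (Cn n) M]

/-- A complex manifold is a real manifold. -/
theorem isManifold_real (M : Type*) [TopologicalSpace M] [ChartedSpace (Cn n) M]
    [h : IsManifold 𝓘(ℂ, Cn n) ∞ M] : IsManifold 𝓘(ℝ, Cn n) ∞ M := by
  refine isManifold_of_contDiffOn _ _ _ fun e e' he he' => ?_
  have h1 : e.symm ≫ₕ e' ∈ contDiffGroupoid ∞ 𝓘(ℂ, Cn n) := h.compatible he he'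
  rw [contDiffGroupoid, mem_groupoid_of_pregroupoid] at h1
  have h2 : ContDiffOn ℂ ∞ (𝓘(ℂ, Cn n) ∘ (e.symm ≫ₕ e') ∘ 𝓘(ℂ, Cn n).symm)
    (𝓘(ℂ, Cn n).symm ⁻¹' (e.symm ≫ₕ e').source ∩ Set.range 𝓘(ℂ, Cn n)) := h1.1
  exact h2.restrict_scalars ℝ

/-- The coordinate change from the chart at `x₀` to the chart at `x₁`. -/
def coordChange (x₀ x₁ : M) (y : Cn n) : Cn n := chartC x₁ ((chartC x₀).symm y)

/-- The domain of the coordinate change from the chart at `x₀` to the chart at `x₁`. -/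
def overlap (x₀ x₁ : M) : Set (Cn n) :=
  (chartC x₀).target ∩ (chartC x₀).symm ⁻¹' (chartC (n := n) x₁).source

theorem isOpen_inter_preimage_symm (x₀ : M) {U : Set M} (hU : IsOpen U) :
    IsOpen ((chartC (n := n) x₀).target ∩ (chartC x₀).symm ⁻¹' U) :=
  (continuousOn_extChartAt_symm x₀).isOpen_inter_preimage (isOpen_extChartAt_target x₀) hU

theorem isOpen_overlap (x₀ x₁ : M) : IsOpen (overlap (n := n) x₀ x₁) :=
  isOpen_inter_preimage_symm x₀ (isOpen_extChartAt_source x₁)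

theorem mem_overlap_self {x₀ : M} {y : Cn n} (hy : y ∈ (chartC x₀).target) :
    y ∈ overlap x₀ ((chartC x₀).symm y) := ⟨hy, mem_extChartAt_source _⟩

theorem mem_overlap_of_source {x₀ x : M} (hx : x ∈ (chartC (n := n) x₀).source) :
    chartC x x ∈ overlap (n := n) x x₀ :=
  ⟨mem_extChartAt_target x, by rw [Set.mem_preimage, extChartAt_to_inv]; exact hx⟩

theorem coordChange_mem_target {x₀ x₁ : M} {y : Cn n} (hy : y ∈ overlap x₀ x₁) :
    coordChange x₀ x₁ y ∈ (chartC x₁).target := (chartC x₁).map_source hy.2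

theorem symm_coordChange {x₀ x₁ : M} {y : Cn n} (hy : y ∈ overlap x₀ x₁) :
    (chartC x₁).symm (coordChange x₀ x₁ y) = (chartC x₀).symm y := (chartC x₁).left_inv hy.2

theorem fderiv_coordChange_self {x₀ : M} {y : Cn n} (hy : y ∈ (chartC x₀).target) :
    fderiv ℝ (coordChange x₀ x₀) y = ContinuousLinearMap.id ℝ (Cn n) := by
  rw [← fderiv_id (x := y)]
  refine Filter.EventuallyEq.fderiv_eq ?_
  filter_upwards [(isOpen_extChartAt_target x₀).mem_nhds hy] with z hz
  exact (chartC x₀).right_inv hz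

section

variable [hM : IsManifold 𝓘(ℂ, Cn n) ∞ M]

theorem contDiffAt_coordChange_complex {x₀ x₁ : M} {y : Cn n} (hy : y ∈ overlap x₀ x₁) :
    ContDiffAt ℂ ∞ (coordChange x₀ x₁) y :=
  (contDiffOn_ext_coord_change (I := 𝓘(ℂ, Cn n)) x₁ x₀).contDiffAt
    ((isOpen_overlap x₀ x₁).mem_nhds hy)

theorem contDiffAt_coordChange {x₀ x₁ : M} {y : Cn n} (hy : y ∈ overlap x₀ x₁) :
    ContDiffAt ℝ ∞ (coordChange x₀ x₁) y := (contDiffAt_coordChange_complex hy).restrict_scalars ℝ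

theorem fderiv_stdJ_of_complex {f : Cn n → Cn n} {y : Cn n} (hf : DifferentiableAt ℂ f y)
    (v : Cn n) : fderiv ℝ f y (stdJ n v) = stdJ n (fderiv ℝ f y v) := by
  rw [hf.fderiv_restrictScalars ℝ, ContinuousLinearMap.coe_restrictScalars', stdJ_apply, stdJ_apply,
    map_smul]

theorem fderiv_coordChange_stdJ {x₀ x₁ : M} {y : Cn n} (hy : y ∈ overlap x₀ x₁) (v : Cn n) :
    fderiv ℝ (coordChange x₀ x₁) y (stdJ n v) = stdJ n (fderiv ℝ (coordChange x₀ x₁) y v) :=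
  fderiv_stdJ_of_complex ((contDiffAt_coordChange_complex hy).differentiableAt (by simp)) v

theorem mdiff_chart {x₀ x : M} (hx : x ∈ (chartC (n := n) x₀).source) :
    MDifferentiableAt 𝓘(ℝ, Cn n) 𝓘(ℝ, Cn n) (chartC (n := n) x₀) x := by
  have := isManifold_real (n := n) M
  have : IsManifold 𝓘(ℝ, Cn n) 1 M := IsManifold.of_le (n := ∞) (by norm_cast)
  exact mdifferentiableAt_extChartAt (by rwa [extChartAt_source] at hx)

theorem mdiff_chart_symm {x₀ : M} {y : Cn n} (hy : y ∈ (chartC x₀).target) :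
    MDifferentiableAt 𝓘(ℝ, Cn n) 𝓘(ℝ, Cn n) (chartC (n := n) x₀).symm y := by
  have := isManifold_real (n := n) M
  have : IsManifold 𝓘(ℝ, Cn n) 1 M := IsManifold.of_le (n := ∞) (by norm_cast)
  have h := mdifferentiableWithinAt_extChartAt_symm (I := 𝓘(ℝ, Cn n)) hy
  rwa [modelWithCornersSelf_coe, Set.range_id, mdifferentiableWithinAt_univ] at h

theorem dChart_eq {x₀ x : M} (hx : x ∈ (chartC (n := n) x₀).source) :
    dChart x₀ x = fderiv ℝ (coordChange x x₀) (chartC (n := n) x x) := by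
  have h := (mdiff_chart hx).mfderiv
  rw [dChart, h, modelWithCornersSelf_coe, Set.range_id, fderivWithin_univ]
  rfl

theorem dChartSymm_eq {x₀ : M} {y : Cn n} (hy : y ∈ (chartC x₀).target) :
    dChartSymm x₀ y = fderiv ℝ (coordChange x₀ ((chartC x₀).symm y)) y := by
  have h := (mdiff_chart_symm hy).mfderiv
  rw [dChartSymm, h, modelWithCornersSelf_coe, Set.range_id, fderivWithin_univ]
  rfl

theorem fderiv_coordChange {x₀ x₁ x₂ : M} {y : Cn n} (h1 : y ∈ overlap x₀ x₁)
    (h2 : y ∈ overlap x₀ x₂) : fderiv ℝ (coordChange x₀ x₂) y =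
      (fderiv ℝ (coordChange x₁ x₂) (coordChange x₀ x₁ y)).comp (fderiv ℝ (coordChange x₀ x₁) y) := by
  have h3 : coordChange x₀ x₁ y ∈ overlap x₁ x₂ :=
    ⟨coordChange_mem_target h1, by rw [Set.mem_preimage, symm_coordChange h1]; exact h2.2⟩
  rw [← fderiv_comp y ((contDiffAt_coordChange h3).differentiableAt (by simp))
    ((contDiffAt_coordChange h1).differentiableAt (by simp))]
  refine Filter.EventuallyEq.fderiv_eq ?_
  filter_upwards [(isOpen_overlap x₀ x₁).mem_nhds h1] with z hz
  rw [Function.comp_apply, coordChange, coordChange, symm_coordChange hz]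

theorem dChart_comp_dChartSymm {x₀ x₁ : M} {y : Cn n} (hy : y ∈ overlap x₀ x₁) :
    (dChart x₁ ((chartC x₀).symm y)).comp (dChartSymm x₀ y) = fderiv ℝ (coordChange x₀ x₁) y := by
  rw [dChart_eq hy.2, dChartSymm_eq hy.1, fderiv_coordChange (mem_overlap_self hy.1) hy]
  rfl

theorem dChart_dChartSymm {x₀ : M} {y : Cn n} (hy : y ∈ (chartC x₀).target) (v : Cn n) :
    dChart x₀ ((chartC x₀).symm y) (dChartSymm x₀ y v) = v := by
  have := dChart_comp_dChartSymm (x₁ := x₀) ⟨hy, (chartC x₀).map_target hy⟩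
  rw [fderiv_coordChange_self hy] at this
  exact congrArg (fun T => T v) this

theorem dChart_self (x : M) : dChart (n := n) x x = ContinuousLinearMap.id ℝ (Cn n) := by
  rw [dChart_eq (mem_extChartAt_source x), fderiv_coordChange_self (mem_extChartAt_target x)]

theorem dChartSymm_self (x : M) :
    dChartSymm x (chartC (n := n) x x) = ContinuousLinearMap.id ℝ (Cn n) := by
  rw [dChartSymm_eq (mem_extChartAt_target x), extChartAt_to_inv,
    fderiv_coordChange_self (mem_extChartAt_target x)]

theorem dChartSymm_dChart {x₀ x : M} (hx : x ∈ (chartC (n := n) x₀).source) (v : Cn n) :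
    dChartSymm x₀ (chartC x₀ x) (dChart x₀ x v) = v := by
  have h2 : chartC (n := n) x₀ x ∈ (chartC x₀).target := (chartC x₀).map_source hx
  have h1 : (chartC (n := n) x₀).symm (chartC x₀ x) = x := (chartC x₀).left_inv hx
  rw [dChart_eq hx, dChartSymm_eq h2, h1]
  have h3 := fderiv_coordChange (mem_overlap_of_source hx) (mem_overlap_self (mem_extChartAt_target x))
  rw [extChartAt_to_inv, fderiv_coordChange_self (mem_extChartAt_target x)] at h3
  have h4 : coordChange x x₀ (chartC (n := n) x x) = chartC (n := n) x₀ x := by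
    rw [coordChange, extChartAt_to_inv]
  rw [h4] at h3
  exact (congrArg (fun T => T v) h3).symm

theorem dChart_stdJ {x₀ x : M} (hx : x ∈ (chartC (n := n) x₀).source) (v : Cn n) :
    dChart x₀ x (stdJ n v) = stdJ n (dChart x₀ x v) := by
  rw [dChart_eq hx, fderiv_coordChange_stdJ (mem_overlap_of_source hx)]

theorem dChartSymm_stdJ {x₀ : M} {y : Cn n} (hy : y ∈ (chartC x₀).target) (v : Cn n) :
    dChartSymm x₀ y (stdJ n v) = stdJ n (dChartSymm x₀ y v) := by
  rw [dChartSymm_eq hy, fderiv_coordChange_stdJ (mem_overlap_self hy)]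

/-- Transformation of the expression of a form under a change of coordinates. -/
theorem formRep_coordChange {x₀ x₁ : M} {y : Cn n} (hy : y ∈ overlap x₀ x₁) (s : M → CForm n) :
    formRep x₀ s y =
      pullC (fderiv ℝ (coordChange x₀ x₁) y) (formRep x₁ s (coordChange x₀ x₁ y)) := by
  have h : (dChartSymm x₁ (coordChange x₀ x₁ y)).comp (fderiv ℝ (coordChange x₀ x₁) y) =
      dChartSymm x₀ y := by
    rw [← dChart_comp_dChartSymm hy]
    refine ContinuousLinearMap.ext fun v => ?_
    exact dChartSymm_dChart hy.2 _
  rw [formRep, formRep, pullC_pullC, symm_coordChange hy, h]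

theorem flatD_formRep {x₀ x₁ : M} {y : Cn n} (hy : y ∈ overlap x₀ x₁) {s : M → CForm n}
    (hs : DifferentiableAt ℝ (formRep x₁ s) (coordChange x₀ x₁ y)) :
    flatD (formRep x₀ s) y =
      pullC (fderiv ℝ (coordChange x₀ x₁) y) (flatD (formRep x₁ s) (coordChange x₀ x₁ y)) := by
  rw [← flatD_pullC ((contDiffAt_coordChange hy).of_le (by norm_cast)) hs]
  refine flatD_congr ?_
  filter_upwards [(isOpen_overlap x₀ x₁).mem_nhds hy] with z hz using formRep_coordChange hz s

/-- The exterior derivative may be computed in any chart. -/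
theorem dForm_eq {x₀ x : M} (hx : x ∈ (chartC (n := n) x₀).source) {s : M → CForm n}
    (hs : DifferentiableAt ℝ (formRep x₀ s) (chartC x₀ x)) :
    dForm s x = pullC (dChart x₀ x) (flatD (formRep x₀ s) (chartC x₀ x)) := by
  have e : coordChange x x₀ (chartC (n := n) x x) = chartC (n := n) x₀ x := by
    rw [coordChange, extChartAt_to_inv]
  have h := flatD_formRep (s := s) (mem_overlap_of_source hx) (by rwa [e])
  rw [e, ← dChart_eq hx] at h
  exact h

theorem formRep_dForm {x₀ : M} {y : Cn n} (hy : y ∈ (chartC x₀).target) {s : M → CForm n}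
    (hs : DifferentiableAt ℝ (formRep x₀ s) y) :
    formRep x₀ (dForm s) y = flatD (formRep x₀ s) y := by
  have h1 : chartC (n := n) x₀ ((chartC x₀).symm y) = y := (chartC x₀).right_inv hy
  have h : (dChart x₀ ((chartC x₀).symm y)).comp (dChartSymm x₀ y) =
      ContinuousLinearMap.id ℝ (Cn n) := ContinuousLinearMap.ext fun v => dChart_dChartSymm hy v
  rw [formRep, dForm_eq ((chartC x₀).map_target hy) (by rwa [h1]), h1, pullC_pullC, h, pullC_id]

theorem formRep_self (x : M) (s : M → CForm n) : formRep x s (chartC (n := n) x x) = s x := by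
  rw [formRep, dChartSymm_self, pullC_id, extChartAt_to_inv]

theorem pullC_dChart_formRep {x₀ x : M} (hx : x ∈ (chartC (n := n) x₀).source) (s : M → CForm n) :
    pullC (dChart x₀ x) (formRep x₀ s (chartC x₀ x)) = s x := by
  have h : (dChartSymm x₀ (chartC (n := n) x₀ x)).comp (dChart x₀ x) =
    ContinuousLinearMap.id ℝ (Cn n) := ContinuousLinearMap.ext fun v => dChartSymm_dChart hx v
  rw [formRep, pullC_pullC, h, pullC_id, (chartC x₀).left_inv hx]

/-- The Clifford action in a chart. -/
theorem formRep_cliff {x₀ : M} {y : Cn n} (hy : y ∈ (chartC x₀).target) (a : M → GT n)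
    (s : M → CForm n) : formRep x₀ (fun x => cliff (a x) (s x)) y =
      cliff (gtRep x₀ a y) (formRep x₀ s y) := by
  set x := (chartC x₀).symm y with hx
  have h : dChartSymm x₀ y (dChart x₀ x (a x).1) = (a x).1 := by
    have := dChartSymm_dChart ((chartC x₀).map_target hy) (a x).1
    rwa [(chartC x₀).right_inv hy] at this
  have := pullC_cliff (dChartSymm x₀ y) (dChart x₀ x (a x).1) (a x).2 (s x)
  rw [h] at this
  exact this

end

theorem smoothForm_iff {s : M → CForm n} {U : Set M} (hU : IsOpen U) :
    SmoothForm s U ↔ ∀ x₀ : M, ∀ y ∈ (chartC (n := n) x₀).target, (chartC x₀).symm y ∈ U →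
      ContDiffAt ℝ ∞ (formRep x₀ s) y := by
  refine forall_congr' fun x₀ => ?_
  rw [contDiffOn_formCoords, (isOpen_inter_preimage_symm x₀ hU).contDiffOn_iff]
  exact ⟨fun h y h1 h2 => h ⟨h1, h2⟩, fun h y hy => h y hy.1 hy.2⟩

theorem smoothGT_iff {a : M → GT n} {U : Set M} (hU : IsOpen U) :
    SmoothGT a U ↔ ∀ x₀ : M, ∀ y ∈ (chartC (n := n) x₀).target, (chartC x₀).symm y ∈ U →
      ContDiffAt ℝ ∞ (gtRep x₀ a) y := by
  refine forall_congr' fun x₀ => ?_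
  rw [(isOpen_inter_preimage_symm x₀ hU).contDiffOn_iff]
  exact ⟨fun h y h1 h2 => h ⟨h1, h2⟩, fun h y hy => h y hy.1 hy.2⟩

/-- A form that is smooth in one chart is smooth on the domain of the chart. -/
theorem smoothForm_of_chart [IsManifold 𝓘(ℂ, Cn n) ∞ M] {s : M → CForm n} {U : Set M}
    (hU : IsOpen U) {x₁ : M} (hU1 : U ⊆ (chartC (n := n) x₁).source)
    (h : ∀ y ∈ (chartC (n := n) x₁).target, (chartC x₁).symm y ∈ U →
      ContDiffAt ℝ ∞ (formRep x₁ s) y) : SmoothForm s U := by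
  rw [smoothForm_iff hU]
  intro x₀ y hy hyU
  have hyo : y ∈ overlap x₀ x₁ := ⟨hy, hU1 hyU⟩
  have h1 : ContDiffAt ℝ ∞ (fun z => pullC (fderiv ℝ (coordChange x₀ x₁) z)
      (formRep x₁ s (coordChange x₀ x₁ z))) y := by
    refine contDiffAt_pullC ((contDiffAt_coordChange hyo).fderiv_right (by norm_cast)) ?_
    refine ContDiffAt.comp y (h _ (coordChange_mem_target hyo) ?_) (contDiffAt_coordChange hyo)
    rw [symm_coordChange hyo]; exact hyU
  refine h1.congr_of_eventuallyEq ?_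
  filter_upwards [(isOpen_overlap x₀ x₁).mem_nhds hyo] with z hz using formRep_coordChange hz s

end Charts

/-! ### Torus actions in charts -/

section Torus

theorem torusExp_add (s t : Fin m → ℝ) : torusExp (s + t) = torusExp s * torusExp t := by
  funext i; simp [torusExp, Circle.exp_add]

theorem torusExp_zero : torusExp (0 : Fin m → ℝ) = 1 := by
  funext i; simp [torusExp]

theorem torusExp_surjective : Function.Surjective (torusExp (m := m)) := fun g =>
  ⟨fun i => Complex.arg (g i), funext fun i => Circle.exp_arg (g i)⟩

theorem torusExp_two_pi (i : Fin m) : torusExp (Pi.single i (2 * Real.pi)) = 1 := by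
  funext j
  by_cases h : j = i
  · subst h; simp [torusExp]
  · simp [torusExp, h]

variable {M : Type*} [TopologicalSpace M] [ChartedSpace (Cn n) M]
  [MulAction (Fin m → Circle) M]

/-- The torus action (lifted to `ℝ^m`) in the chart at `x₀`. -/
def actRep (x₀ : M) (p : (Fin m → ℝ) × Cn n) : Cn n :=
  chartC x₀ (torusExp p.1 • (chartC (n := n) x₀).symm p.2)

/-- The fundamental vector field of `ζ` in the chart at `x₀`. -/
def fieldRep (x₀ : M) (ζ : Fin m → ℝ) (y : Cn n) : Cn n := fderiv ℝ (actRep x₀) (0, y) (ζ, 0)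

variable {ω₀ : M → RForm n}

theorem mdiff_act (hT : IsKahlerTorusAction (m := m) ω₀) (g : Fin m → Circle) (x : M) :
    MDifferentiableAt 𝓘(ℝ, Cn n) 𝓘(ℝ, Cn n) (fun x : M => g • x) x := by
  obtain ⟨s, rfl⟩ := torusExp_surjective g
  have h2 : ContMDiff 𝓘(ℝ, Cn n) (𝓘(ℝ, Fin m → ℝ).prod 𝓘(ℝ, Cn n)) ∞ (fun x : M => (s, x)) :=
    contMDiff_const.prodMk contMDiff_id
  exact ((hT.smooth.comp h2).mdifferentiable (by simp)) x

theorem continuous_orbit (hT : IsKahlerTorusAction (m := m) ω₀) (x : M) :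
    Continuous fun s : Fin m → ℝ => torusExp s • x :=
  hT.smooth.continuous.comp (continuous_id.prodMk continuous_const)

theorem contMDiff_curve (hT : IsKahlerTorusAction (m := m) ω₀) (ζ : Fin m → ℝ) (x : M) :
    ContMDiff 𝓘(ℝ, ℝ) 𝓘(ℝ, Cn n) ∞ (fun s : ℝ => torusExp (s • ζ) • x) := by
  have h2 : ContMDiff 𝓘(ℝ, ℝ) (𝓘(ℝ, Fin m → ℝ).prod 𝓘(ℝ, Cn n)) ∞
      (fun s : ℝ => ((s • ζ, x) : (Fin m → ℝ) × M)) :=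
    (contDiff_id.smul contDiff_const).contMDiff.prodMk contMDiff_const
  exact hT.smooth.comp h2

theorem zero_smul_mem_source {x₀ : M} {y : Cn n} (hy : y ∈ (chartC x₀).target) :
    torusExp (0 : Fin m → ℝ) • (chartC x₀).symm y ∈ (chartC (n := n) x₀).source := by
  rw [torusExp_zero, one_smul]; exact (chartC x₀).map_target hy

theorem eventually_mem_source (hT : IsKahlerTorusAction (m := m) ω₀) {x₀ : M} {y : Cn n}
    (hy : y ∈ (chartC x₀).target) : ∀ᶠ s : Fin m → ℝ in nhds 0,
      torusExp s • (chartC x₀).symm y ∈ (chartC (n := n) x₀).source :=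
  (continuous_orbit hT _).continuousAt.eventually_mem
    ((isOpen_extChartAt_source x₀).mem_nhds (zero_smul_mem_source hy))

theorem actRep_zero {x₀ : M} {y : Cn n} (hy : y ∈ (chartC x₀).target) :
    actRep x₀ ((0 : Fin m → ℝ), y) = y := by
  rw [actRep, torusExp_zero, one_smul, (chartC x₀).right_inv hy]

theorem actRep_mem_target {x₀ : M} {s : Fin m → ℝ} {y : Cn n}
    (hs : torusExp s • (chartC x₀).symm y ∈ (chartC (n := n) x₀).source) :
    actRep x₀ (s, y) ∈ (chartC (n := n) x₀).target := (chartC x₀).map_source hs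

theorem actRep_actRep {x₀ : M} {s t : Fin m → ℝ} {y : Cn n}
    (ht : torusExp t • (chartC x₀).symm y ∈ (chartC (n := n) x₀).source) :
    actRep x₀ (s, actRep x₀ (t, y)) = actRep x₀ (s + t, y) := by
  simp only [actRep]
  rw [(chartC x₀).left_inv ht, torusExp_add, mul_smul]

theorem hasFDerivAt_inl (c s : Fin m → ℝ) (y : Cn n) :
    HasFDerivAt (fun t : Fin m → ℝ => (c + t, y))
      (ContinuousLinearMap.inl ℝ (Fin m → ℝ) (Cn n)) s :=
  ((hasFDerivAt_id (𝕜 := ℝ) s).const_add c).prodMk (hasFDerivAt_const y s)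

theorem hasFDerivAt_inl_zero (s : Fin m → ℝ) (y : Cn n) :
    HasFDerivAt (fun t : Fin m → ℝ => (t, y)) (ContinuousLinearMap.inl ℝ (Fin m → ℝ) (Cn n)) s :=
  (hasFDerivAt_id (𝕜 := ℝ) s).prodMk (hasFDerivAt_const y s)

theorem hasFDerivAt_inr (s : Fin m → ℝ) (y : Cn n) :
    HasFDerivAt (fun z : Cn n => (s, z)) (ContinuousLinearMap.inr ℝ (Fin m → ℝ) (Cn n)) y :=
  (hasFDerivAt_const s y).prodMk (hasFDerivAt_id (𝕜 := ℝ) y)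

variable [hM : IsManifold 𝓘(ℂ, Cn n) ∞ M]

theorem contDiffAt_actRep (hT : IsKahlerTorusAction (m := m) ω₀) {x₀ : M} {s : Fin m → ℝ}
    {y : Cn n} (hy : y ∈ (chartC x₀).target)
    (hs : torusExp s • (chartC x₀).symm y ∈ (chartC (n := n) x₀).source) :
    ContDiffAt ℝ ∞ (actRep x₀) (s, y) := by
  have := isManifold_real (n := n) M
  rw [← contMDiffAt_iff_contDiffAt]
  have h1 : ContMDiffAt 𝓘(ℝ, (Fin m → ℝ) × Cn n) 𝓘(ℝ, Cn n) ∞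
      (fun p : (Fin m → ℝ) × Cn n => (chartC x₀).symm p.2) (s, y) :=
    ContMDiffAt.comp (s, y) ((contMDiffOn_extChartAt_symm x₀).contMDiffAt
      ((isOpen_extChartAt_target x₀).mem_nhds hy)) contDiff_snd.contMDiff.contMDiffAt
  have h2 : ContMDiffAt 𝓘(ℝ, (Fin m → ℝ) × Cn n) (𝓘(ℝ, Fin m → ℝ).prod 𝓘(ℝ, Cn n)) ∞
      (fun p : (Fin m → ℝ) × Cn n => (p.1, (chartC x₀).symm p.2)) (s, y) :=
    contDiff_fst.contMDiff.contMDiffAt.prodMk h1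
  have h3 := hT.smooth.contMDiffAt.comp (s, y) h2
  rw [extChartAt_source] at hs
  exact ContMDiffAt.comp (s, y) (contMDiffAt_extChartAt' hs) h3

theorem contDiffAt_actRep_zero (hT : IsKahlerTorusAction (m := m) ω₀) {x₀ : M} {y : Cn n}
    (hy : y ∈ (chartC x₀).target) :
    ContDiffAt ℝ ∞ (actRep x₀) ((0 : Fin m → ℝ), y) :=
  contDiffAt_actRep hT hy (zero_smul_mem_source hy)

theorem dChart_fundField (hT : IsKahlerTorusAction (m := m) ω₀) {x₀ : M} (ζ : Fin m → ℝ) {y : Cn n}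
    (hy : y ∈ (chartC x₀).target) :
    dChart x₀ ((chartC x₀).symm y) (fundField ζ ((chartC x₀).symm y)) = fieldRep x₀ ζ y := by
  set x := (chartC x₀).symm y with hx
  have h0 : torusExp ((0 : ℝ) • ζ) • x = x := by rw [zero_smul, torusExp_zero, one_smul]
  have hxs : torusExp ((0 : ℝ) • ζ) • x ∈ (chartC (n := n) x₀).source := by
    rw [h0]; exact (chartC x₀).map_target hy
  have h1 := mfderiv_comp (0 : ℝ) (mdiff_chart hxs)
    ((contMDiff_curve hT ζ x).mdifferentiable (by simp) (0 : ℝ))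
  rw [mfderiv_eq_fderiv] at h1
  have h2 : dChart x₀ x = dChart (n := n) x₀ (torusExp ((0 : ℝ) • ζ) • x) := by rw [h0]
  have h3 : fderiv ℝ (fun r : ℝ => actRep x₀ (r • ζ, y)) 0 1 = fieldRep x₀ ζ y := by
    have hF := (contDiffAt_actRep_zero hT hy).differentiableAt (by simp)
    have hc : HasFDerivAt (fun r : ℝ => ((r • ζ, y) : (Fin m → ℝ) × Cn n))
        (((ContinuousLinearMap.id ℝ ℝ).smulRight ζ).prod 0) 0 :=
      ((ContinuousLinearMap.id ℝ ℝ).smulRight ζ).hasFDerivAt.prodMk (hasFDerivAt_const y 0)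
    have hF' : HasFDerivAt (actRep x₀) (fderiv ℝ (actRep x₀) ((0 : Fin m → ℝ), y))
        ((0 : ℝ) • ζ, y) := by rw [zero_smul]; exact hF.hasFDerivAt
    have := (hF'.comp (0 : ℝ) hc).fderiv
    have h4 := congrArg (fun T => T 1) this
    refine Eq.trans h4 ?_
    simp [fieldRep]
  rw [h2, ← h3]
  exact (congrArg (fun T : ℝ →L[ℝ] Cn n => T 1) h1).symm

theorem contDiffAt_fieldRep (hT : IsKahlerTorusAction (m := m) ω₀) {x₀ : M} (ζ : Fin m → ℝ)
    {y : Cn n} (hy : y ∈ (chartC x₀).target) : ContDiffAt ℝ ∞ (fieldRep x₀ ζ) y := by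
  have h1 : ContDiffAt ℝ ∞ (fderiv ℝ (actRep x₀)) ((0 : Fin m → ℝ), y) :=
    (contDiffAt_actRep_zero hT hy).fderiv_right (by norm_cast)
  have h2 : ContDiffAt ℝ ∞ (fun z => fderiv ℝ (actRep x₀) ((0 : Fin m → ℝ), z)) y :=
    ContDiffAt.comp (f := fun z => ((0 : Fin m → ℝ), z)) y h1
      (contDiffAt_const.prodMk contDiffAt_id)
  exact h2.clm_apply contDiffAt_const

theorem fderiv_fieldRep (hT : IsKahlerTorusAction (m := m) ω₀) {x₀ : M} (ζ : Fin m → ℝ)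
    {y : Cn n} (hy : y ∈ (chartC x₀).target) (w : Cn n) : fderiv ℝ (fieldRep x₀ ζ) y w =
      fderiv ℝ (fderiv ℝ (actRep x₀)) ((0 : Fin m → ℝ), y) (ζ, 0) (0, w) := by
  have h0 := contDiffAt_actRep_zero hT hy
  have h1 : ContDiffAt ℝ ∞ (fderiv ℝ (actRep x₀)) ((0 : Fin m → ℝ), y) :=
    h0.fderiv_right (by norm_cast)
  have hsymm := (h0.isSymmSndFDerivAt (by simp; norm_cast)).eq (ζ, 0) (0, w)
  rw [hsymm]
  have h2 : HasFDerivAt (fun z => ((0 : Fin m → ℝ), z))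
      ((0 : Cn n →L[ℝ] (Fin m → ℝ)).prod (ContinuousLinearMap.id ℝ (Cn n))) y :=
    (hasFDerivAt_const _ _).prodMk (hasFDerivAt_id y)
  have h3 : HasFDerivAt (fun z => fderiv ℝ (actRep x₀) ((0 : Fin m → ℝ), z)) _ y :=
    HasFDerivAt.comp (f := fun z => ((0 : Fin m → ℝ), z)) y
      (h1.differentiableAt (by simp)).hasFDerivAt h2
  have h4 := (h3.clm_apply (hasFDerivAt_const ((ζ, 0) : (Fin m → ℝ) × Cn n) y)).fderiv
  have h5 := congrArg (fun T => T w) h4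
  refine Eq.trans h5 ?_
  simp

theorem fderiv_act_inr (hT : IsKahlerTorusAction (m := m) ω₀) {x₀ : M} {s : Fin m → ℝ}
    {y : Cn n} (hy : y ∈ (chartC x₀).target)
    (hs : torusExp s • (chartC x₀).symm y ∈ (chartC (n := n) x₀).source) :
    (fderiv ℝ (actRep x₀) (s, y)).comp (ContinuousLinearMap.inr ℝ (Fin m → ℝ) (Cn n)) =
      ((dChart x₀ (torusExp s • (chartC x₀).symm y)).comp
        (dAct (torusExp s) ((chartC x₀).symm y))).comp (dChartSymm x₀ y) := by
  have h1 := mfderiv_comp y (mdiff_act hT (torusExp s) ((chartC x₀).symm y)) (mdiff_chart_symm hy)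
  have h2 := mfderiv_comp y (mdiff_chart hs)
    ((mdiff_act hT (torusExp s) ((chartC x₀).symm y)).comp y (mdiff_chart_symm hy))
  rw [mfderiv_eq_fderiv, h1] at h2
  have h3 : HasFDerivAt (fun z => (s, z))
      (ContinuousLinearMap.inr ℝ (Fin m → ℝ) (Cn n)) y := hasFDerivAt_inr s y
  have h4 := HasFDerivAt.comp (f := fun z => (s, z)) y
    ((contDiffAt_actRep hT hy hs).differentiableAt (by simp)).hasFDerivAt h3
  exact h4.fderiv.symm.trans h2

theorem hasFDerivAt_fderiv_act (hT : IsKahlerTorusAction (m := m) ω₀) {x₀ : M}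
    {y : Cn n} (hy : y ∈ (chartC x₀).target) :
    HasFDerivAt (fun s : Fin m → ℝ => fderiv ℝ (actRep x₀) (s, y))
      ((fderiv ℝ (fderiv ℝ (actRep x₀)) ((0 : Fin m → ℝ), y)).comp
        (ContinuousLinearMap.inl ℝ (Fin m → ℝ) (Cn n))) 0 := by
  have h1 : ContDiffAt ℝ ∞ (fderiv ℝ (actRep x₀)) ((0 : Fin m → ℝ), y) :=
    (contDiffAt_actRep_zero hT hy).fderiv_right (by norm_cast)
  have h3 : HasFDerivAt (fun s : Fin m → ℝ => (s, y))
      (ContinuousLinearMap.inl ℝ (Fin m → ℝ) (Cn n)) 0 := hasFDerivAt_inl_zero 0 y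
  exact HasFDerivAt.comp (f := fun s : Fin m → ℝ => (s, y)) 0
    (h1.differentiableAt (by simp)).hasFDerivAt h3

/-- The fundamental vector fields are holomorphic. -/
theorem fderiv_fieldRep_stdJ (hT : IsKahlerTorusAction (m := m) ω₀) {x₀ : M} (ζ : Fin m → ℝ)
    {y : Cn n} (hy : y ∈ (chartC x₀).target) (w : Cn n) :
    fderiv ℝ (fieldRep x₀ ζ) y (stdJ n w) = stdJ n (fderiv ℝ (fieldRep x₀ ζ) y w) := by
  rw [fderiv_fieldRep hT ζ hy, fderiv_fieldRep hT ζ hy]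
  have h := hasFDerivAt_fderiv_act hT hy
  have h1 := (h.clm_apply (hasFDerivAt_const ((0, stdJ n w) : (Fin m → ℝ) × Cn n) 0))
  have h2 := (stdJ n).hasFDerivAt.comp (0 : Fin m → ℝ)
    (h.clm_apply (hasFDerivAt_const ((0, w) : (Fin m → ℝ) × Cn n) 0))
  have e : (fun s : Fin m → ℝ => fderiv ℝ (actRep x₀) (s, y) (0, stdJ n w)) =ᶠ[nhds 0]
      fun s => stdJ n (fderiv ℝ (actRep x₀) (s, y) (0, w)) := by
    filter_upwards [eventually_mem_source hT hy] with s hs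
    have k := fun v => congrArg (fun T => T v) (fderiv_act_inr hT hy hs)
    refine (k (stdJ n w)).trans (Eq.trans ?_ (congrArg (stdJ n) (k w)).symm)
    simp only [ContinuousLinearMap.comp_apply]
    rw [dChartSymm_stdJ hy, hT.preserves_J, dChart_stdJ hs]
  have h3 := (h1.congr_of_eventuallyEq e.symm).unique h2
  have h4 := congrArg (fun T => T ζ) h3
  simpa using h4

/-- The fundamental vector fields are invariant. -/
theorem fieldRep_actRep (hT : IsKahlerTorusAction (m := m) ω₀) {x₀ : M} (ζ : Fin m → ℝ)
    {s : Fin m → ℝ} {y : Cn n} (hy : y ∈ (chartC x₀).target)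
    (hs : torusExp s • (chartC x₀).symm y ∈ (chartC (n := n) x₀).source) :
    fieldRep x₀ ζ (actRep x₀ (s, y)) = fderiv ℝ (actRep x₀) (s, y) (0, fieldRep x₀ ζ y) := by
  have hF := ((contDiffAt_actRep hT hy hs).differentiableAt (by simp)).hasFDerivAt
  have hF0 := ((contDiffAt_actRep_zero hT hy).differentiableAt (by simp)).hasFDerivAt
  have hF1 := ((contDiffAt_actRep_zero hT (actRep_mem_target hs)).differentiableAt
    (by simp)).hasFDerivAt
  -- `t ↦ e^{s + t} y` is differentiated at zero as `e^t (e^s y)` and as `e^s (e^t y)`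
  have ha : HasFDerivAt (fun t : Fin m → ℝ => actRep x₀ (s + t, y))
      ((fderiv ℝ (actRep x₀) (s, y)).comp (ContinuousLinearMap.inl ℝ (Fin m → ℝ) (Cn n))) 0 := by
    have h1 : HasFDerivAt (fun t : Fin m → ℝ => (s + t, y))
        (ContinuousLinearMap.inl ℝ (Fin m → ℝ) (Cn n)) 0 := hasFDerivAt_inl s 0 y
    exact HasFDerivAt.comp (f := fun t : Fin m → ℝ => (s + t, y)) 0 (by rw [add_zero]; exact hF) h1
  have hb : HasFDerivAt (fun t : Fin m → ℝ => actRep x₀ (t, actRep x₀ (s, y)))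
      ((fderiv ℝ (actRep x₀) (0, actRep x₀ (s, y))).comp
        (ContinuousLinearMap.inl ℝ (Fin m → ℝ) (Cn n))) 0 :=
    HasFDerivAt.comp (f := fun t : Fin m → ℝ => (t, actRep x₀ (s, y))) 0 hF1 (hasFDerivAt_inl_zero 0 _)
  have hc : HasFDerivAt (fun t : Fin m → ℝ => actRep x₀ (s, actRep x₀ (t, y)))
      (((fderiv ℝ (actRep x₀) (s, y)).comp (ContinuousLinearMap.inr ℝ (Fin m → ℝ) (Cn n))).comp
        ((fderiv ℝ (actRep x₀) (0, y)).comp (ContinuousLinearMap.inl ℝ (Fin m → ℝ) (Cn n)))) 0 := by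
    have h1 : HasFDerivAt (fun t : Fin m → ℝ => actRep x₀ (t, y)) _ 0 :=
      HasFDerivAt.comp (f := fun t : Fin m → ℝ => (t, y)) 0 hF0 (hasFDerivAt_inl_zero 0 y)
    have h2 : HasFDerivAt (fun z => (s, z)) (ContinuousLinearMap.inr ℝ (Fin m → ℝ) (Cn n)) y :=
      hasFDerivAt_inr s y
    have h3 : HasFDerivAt (fun z => actRep x₀ (s, z)) _ y :=
      HasFDerivAt.comp (f := fun z => (s, z)) y hF h2
    have h4 : HasFDerivAt (fun z => actRep x₀ (s, z))
      ((fderiv ℝ (actRep x₀) (s, y)).comp (ContinuousLinearMap.inr ℝ (Fin m → ℝ) (Cn n)))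
        (actRep x₀ ((0 : Fin m → ℝ), y)) := by rw [actRep_zero hy]; exact h3
    exact HasFDerivAt.comp (f := fun t : Fin m → ℝ => actRep x₀ (t, y)) 0 h4 h1
  have e1 : (fun t : Fin m → ℝ => actRep x₀ (t, actRep x₀ (s, y))) =
      fun t : Fin m → ℝ => actRep x₀ (s + t, y) := by
    funext t; rw [actRep_actRep hs, add_comm]
  have e2 : (fun t : Fin m → ℝ => actRep x₀ (s, actRep x₀ (t, y))) =ᶠ[nhds 0]
      fun t : Fin m → ℝ => actRep x₀ (s + t, y) := by
    filter_upwards [eventually_mem_source hT hy] with t ht using actRep_actRep ht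
  rw [e1] at hb
  have h5 := congrArg (fun T => T ζ) (hb.unique ha)
  have h6 := congrArg (fun T => T ζ) ((ha.congr_of_eventuallyEq e2).unique hc)
  exact h5.trans h6

/-- The fundamental vector fields commute. -/
theorem fderiv_fieldRep_comm (hT : IsKahlerTorusAction (m := m) ω₀) {x₀ : M} (ζ ζ' : Fin m → ℝ)
    {y : Cn n} (hy : y ∈ (chartC x₀).target) :
    fderiv ℝ (fieldRep x₀ ζ) y (fieldRep x₀ ζ' y) =
      fderiv ℝ (fieldRep x₀ ζ') y (fieldRep x₀ ζ y) := by
  -- the invariance of the second field under the flow of the first is differentiated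
  have h := hasFDerivAt_fderiv_act hT hy
  have h1 := (h.clm_apply (hasFDerivAt_const ((0, fieldRep x₀ ζ' y) : (Fin m → ℝ) × Cn n) 0))
  have hF0 := ((contDiffAt_actRep_zero hT hy).differentiableAt (by simp)).hasFDerivAt
  have h2 : HasFDerivAt (fun t : Fin m → ℝ => actRep x₀ (t, y))
      ((fderiv ℝ (actRep x₀) (0, y)).comp (ContinuousLinearMap.inl ℝ (Fin m → ℝ) (Cn n))) 0 := by
    exact HasFDerivAt.comp (f := fun t : Fin m → ℝ => (t, y)) 0 hF0 (hasFDerivAt_inl_zero 0 y)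
  have h3 : HasFDerivAt (fieldRep x₀ ζ') (fderiv ℝ (fieldRep x₀ ζ') y)
      (actRep x₀ ((0 : Fin m → ℝ), y)) := by
    rw [actRep_zero hy]
    exact ((contDiffAt_fieldRep hT ζ' hy).differentiableAt (by simp)).hasFDerivAt
  have h4 := HasFDerivAt.comp (f := fun t : Fin m → ℝ => actRep x₀ (t, y)) 0 h3 h2
  have e : (fun t : Fin m → ℝ => fieldRep x₀ ζ' (actRep x₀ (t, y))) =ᶠ[nhds 0]
      fun t => fderiv ℝ (actRep x₀) (t, y) (0, fieldRep x₀ ζ' y) := by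
    filter_upwards [eventually_mem_source hT hy] with s hs using fieldRep_actRep hT ζ' hy hs
  have h5 := congrArg (fun T => T ζ) ((h1.congr_of_eventuallyEq e).unique h4)
  rw [fderiv_fieldRep hT ζ hy]
  simpa [fieldRep] using h5

theorem fundField_eq (hT : IsKahlerTorusAction (m := m) ω₀) (ζ : Fin m → ℝ) (x : M) :
    fundField ζ x = fieldRep x ζ (chartC (n := n) x x) := by
  rw [← dChart_fundField hT ζ (mem_extChartAt_target x), extChartAt_to_inv, dChart_self]; rfl

/-- The infinitesimal generator as a linear function on the Lie algebra. -/
def fundL (x : M) : (Fin m → ℝ) →ₗ[ℝ] Cn n :=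
  (fderiv ℝ (actRep x) ((0 : Fin m → ℝ), chartC (n := n) x x)).toLinearMap ∘ₗ
    LinearMap.inl ℝ (Fin m → ℝ) (Cn n)

theorem fundL_apply (hT : IsKahlerTorusAction (m := m) ω₀) (ζ : Fin m → ℝ) (x : M) :
    fundL x ζ = fundField (n := n) ζ x := (fundField_eq hT ζ x).symm

end Torus

/-! ### The Kähler form and the torus action -/

section TorusKahler

variable {M : Type*} [TopologicalSpace M] [ChartedSpace (Cn n) M]
  [MulAction (Fin m → Circle) M] {ω₀ : M → RForm n}

theorem toC_eq_of_eval2 {α β : RForm n} (hα : α ∈ degreePart n 2) (hβ : β ∈ degreePart n 2)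
    (h : ∀ u v, eval2 α u v = eval2 β u v) : toC α = toC β :=
  two_form_ext (isHom_toC hα) (isHom_toC hβ) fun u v => by
    rw [cint_cint_two_form hα, cint_cint_two_form hβ, h]

theorem eval2_pullR {α : RForm n} (hα : α ∈ degreePart n 2) (A : Cn n →L[ℝ] Cn n) (u v : Cn n) :
    eval2 (pullR A α) u v = eval2 α (A u) (A v) := by
  rw [eval2, contr_pullR hα _ (pullR_mem hα A)]; rfl

theorem formRep_toC (x₀ : M) (α : M → RForm n) (y : Cn n) :
    formRep x₀ (fun x => toC (α x)) y =
      toC (pullR (dChartSymm x₀ y) (α ((chartC x₀).symm y))) := by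
  rw [formRep, pullC_toC]

theorem dAct_fundField (hT : IsKahlerTorusAction (m := m) ω₀) (ζ s : Fin m → ℝ) (x : M) :
    dAct (torusExp s) x (fundField ζ x) = fundField (n := n) ζ (torusExp s • x) := by
  have h0 : torusExp ((0 : ℝ) • ζ) • x = x := by rw [zero_smul, torusExp_zero, one_smul]
  have e : (fun r : ℝ => torusExp (r • ζ) • torusExp s • x) =
      (fun x : M => torusExp s • x) ∘ fun r : ℝ => torusExp (r • ζ) • x := by
    funext r
    rw [Function.comp_apply, ← mul_smul, ← mul_smul, mul_comm]
  have h := mfderiv_comp (I := 𝓘(ℝ, ℝ)) (I' := 𝓘(ℝ, Cn n)) (I'' := 𝓘(ℝ, Cn n)) (0 : ℝ)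
    (mdiff_act hT (torusExp s) (torusExp ((0 : ℝ) • ζ) • x))
    ((contMDiff_curve hT ζ x).mdifferentiable (by simp) (0 : ℝ))
  have h1 : dAct (n := n) (torusExp s) x = dAct (torusExp s) (torusExp ((0 : ℝ) • ζ) • x) := by
    rw [h0]
  rw [h1, fundField, fundField, e]
  exact (congrArg (fun T : ℝ →L[ℝ] Cn n => T 1) h).symm

variable [hM : IsManifold 𝓘(ℂ, Cn n) ∞ M]

/-- Invariance of the Kähler form in a chart. -/
theorem pullC_act_form (hT : IsKahlerTorusAction (m := m) ω₀) (hω : ∀ x, ω₀ x ∈ degreePart n 2)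
    {x₀ : M} {s : Fin m → ℝ} {y : Cn n} (hy : y ∈ (chartC x₀).target)
    (hs : torusExp s • (chartC x₀).symm y ∈ (chartC (n := n) x₀).source) :
    pullC ((fderiv ℝ (actRep x₀) (s, y)).comp (ContinuousLinearMap.inr ℝ (Fin m → ℝ) (Cn n)))
      (formRep x₀ (fun x => toC (ω₀ x)) (actRep x₀ (s, y))) =
      formRep x₀ (fun x => toC (ω₀ x)) y := by
  set x := (chartC x₀).symm y with hx
  have h1 : (chartC x₀).symm (actRep x₀ (s, y)) = torusExp s • x := (chartC x₀).left_inv hs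
  have h2 : (dChartSymm x₀ (actRep x₀ (s, y))).comp (dChart x₀ (torusExp s • x)) =
      ContinuousLinearMap.id ℝ (Cn n) := ContinuousLinearMap.ext fun v => dChartSymm_dChart hs v
  rw [fderiv_act_inr hT hy hs, formRep, formRep, h1, pullC_pullC]
  have h3 : (dChartSymm x₀ (actRep x₀ (s, y))).comp
      (((dChart x₀ (torusExp s • x)).comp (dAct (torusExp s) x)).comp (dChartSymm x₀ y)) =
      (dAct (torusExp s) x).comp (dChartSymm x₀ y) := by
    rw [ContinuousLinearMap.comp_assoc, ← ContinuousLinearMap.comp_assoc, h2]; rfl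
  rw [h3, ← pullC_pullC, pullC_toC (dAct _ _)]
  congr 1
  refine toC_eq_of_eval2 (pullR_mem (hω _) _) (hω _) fun u v => ?_
  rw [eval2_pullR (hω _), hT.preserves_form]

/-- The Lie derivative of the Kähler form along a fundamental vector field vanishes. -/
theorem lie_form (hT : IsKahlerTorusAction (m := m) ω₀) (hω : IsClosedTwoForm ω₀) {x₀ : M}
    (ζ : Fin m → ℝ) {y : Cn n} (hy : y ∈ (chartC x₀).target) :
    fderiv ℝ (formRep x₀ fun x => toC (ω₀ x)) y (fieldRep x₀ ζ y) +
      lieOp (fderiv ℝ (fieldRep x₀ ζ) y) (formRep x₀ (fun x => toC (ω₀ x)) y) = 0 := by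
  set w := formRep x₀ fun x => toC (ω₀ x) with hw
  -- the invariance of `ω` under the flow in the direction `ζ` is differentiated at time zero
  have hr : HasDerivAt (fun r : ℝ => r • ζ) ζ 0 := by simpa using (hasDerivAt_id (0 : ℝ)).smul_const ζ
  have hF0 := ((contDiffAt_actRep_zero hT hy).differentiableAt (by simp)).hasFDerivAt
  have h1 : HasDerivAt (fun r : ℝ => actRep x₀ (r • ζ, y)) (fieldRep x₀ ζ y) 0 := by
    have hc : HasDerivAt (fun r : ℝ => ((r • ζ, y) : (Fin m → ℝ) × Cn n)) (ζ, 0) 0 :=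
      hr.prodMk (hasDerivAt_const 0 y)
    have h0 : HasFDerivAt (actRep x₀) (fderiv ℝ (actRep x₀) ((0 : Fin m → ℝ), y))
        ((0 : ℝ) • ζ, y) := by rw [zero_smul]; exact hF0
    exact h0.comp_hasDerivAt (f := fun r : ℝ => ((r • ζ, y) : (Fin m → ℝ) × Cn n)) 0 hc
  have hwd : DifferentiableAt ℝ w y :=
    ((smoothForm_iff isOpen_univ).1 hω.smooth x₀ y hy trivial).differentiableAt (by simp)
  have h2 : HasDerivAt (fun r : ℝ => w (actRep x₀ (r • ζ, y)))
      (fderiv ℝ w y (fieldRep x₀ ζ y)) 0 := by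
    have h0 : HasFDerivAt w (fderiv ℝ w y) (actRep x₀ ((0 : ℝ) • ζ, y)) := by
      rw [zero_smul, actRep_zero hy]; exact hwd.hasFDerivAt
    exact h0.comp_hasDerivAt (f := fun r : ℝ => actRep x₀ (r • ζ, y)) 0 h1
  set A : ℝ → Cn n →L[ℝ] Cn n := fun r => (fderiv ℝ (actRep x₀) (r • ζ, y)).comp
    (ContinuousLinearMap.inr ℝ (Fin m → ℝ) (Cn n)) with hA
  have h3 : HasDerivAt A (fderiv ℝ (fieldRep x₀ ζ) y) 0 := by
    have k1 : HasDerivAt (fun r : ℝ => fderiv ℝ (actRep x₀) (r • ζ, y))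
        (fderiv ℝ (fderiv ℝ (actRep x₀)) ((0 : Fin m → ℝ), y) (ζ, 0)) 0 := by
      have h0 : HasFDerivAt (fun s : Fin m → ℝ => fderiv ℝ (actRep x₀) (s, y))
          ((fderiv ℝ (fderiv ℝ (actRep x₀)) ((0 : Fin m → ℝ), y)).comp
            (ContinuousLinearMap.inl ℝ (Fin m → ℝ) (Cn n))) ((0 : ℝ) • ζ) := by
        rw [zero_smul]; exact hasFDerivAt_fderiv_act hT hy
      exact h0.comp_hasDerivAt (f := fun r : ℝ => r • ζ) 0 hr
    have k2 := (((ContinuousLinearMap.compL ℝ (Cn n) ((Fin m → ℝ) × Cn n) (Cn n)).flip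
      (ContinuousLinearMap.inr ℝ (Fin m → ℝ) (Cn n))).hasFDerivAt).comp_hasDerivAt (0 : ℝ) k1
    refine k2.congr_deriv ?_
    refine ContinuousLinearMap.ext fun v => ?_
    rw [fderiv_fieldRep hT ζ hy]; rfl
  have hA0 : A 0 = ContinuousLinearMap.id ℝ (Cn n) := by
    have e : (fun z => actRep x₀ ((0 : Fin m → ℝ), z)) =ᶠ[nhds y] id := by
      filter_upwards [(isOpen_extChartAt_target x₀).mem_nhds hy] with z hz using actRep_zero hz
    have h4 := HasFDerivAt.comp (f := fun z => ((0 : Fin m → ℝ), z)) y hF0 (hasFDerivAt_inr 0 y)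
    simp only [hA, zero_smul]
    rw [← h4.fderiv, ← fderiv_id (𝕜 := ℝ) (x := y)]
    exact e.fderiv_eq
  have h5 := hasDerivAt_pullC h3 hA0 h2
  have h6 : (fun r => pullC (A r) (w (actRep x₀ (r • ζ, y)))) =ᶠ[nhds 0] fun _ => w y := by
    have hc : Filter.Tendsto (fun r : ℝ => r • ζ) (nhds 0) (nhds 0) := by
      have := hr.continuousAt.tendsto
      rwa [zero_smul] at this
    filter_upwards [hc.eventually (eventually_mem_source hT hy)] with r hr'
    exact pullC_act_form hT hω.degree hy hr'
  have h7 := (h5.congr_of_eventuallyEq h6.symm).unique (hasDerivAt_const 0 (w y))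
  rw [zero_smul, actRep_zero hy] at h7
  rw [add_comm]; exact h7

/-- The orbits are isotropic: a function with constant derivative along a periodic orbit has zero
derivative. -/
theorem isotropic (hT : IsKahlerTorusAction (m := m) ω₀) {μ : M → Module.Dual ℝ (Fin m → ℝ)}
    (hμ : IsMomentMap ω₀ μ) (ζ ζ' : Fin m → ℝ) (x : M) :
    eval2 (ω₀ x) (fundField ζ x) (fundField ζ' x) = 0 := by
  have hd : ∀ (ζ' : Fin m → ℝ) (x : M), HasDerivAt (fun r : ℝ => μ (torusExp (r • ζ') • x) ζ)
      (eval2 (ω₀ x) (fundField ζ x) (fundField ζ' x)) 0 := by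
    intro ζ' x
    have h0 : torusExp ((0 : ℝ) • ζ') • x = x := by rw [zero_smul, torusExp_zero, one_smul]
    have hm := (hμ.smooth ζ).mdifferentiable (by simp) (torusExp ((0 : ℝ) • ζ') • x)
    have hc := (contMDiff_curve hT ζ' x).mdifferentiable (by simp) (0 : ℝ)
    have h1 := mfderiv_comp (0 : ℝ) hm hc
    rw [mfderiv_eq_fderiv] at h1
    have h2 : DifferentiableAt ℝ (fun r : ℝ => μ (torusExp (r • ζ') • x) ζ) 0 :=
      (MDifferentiableAt.comp (g := fun x => μ x ζ) (0 : ℝ) hm hc).differentiableAt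
    have h3 := h2.hasFDerivAt.hasDerivAt
    refine h3.congr_deriv ?_
    rw [eval2, hμ.d_eq]
    have h4 : dReal (n := n) (fun y => μ y ζ) x = dReal (fun y => μ y ζ)
      (torusExp ((0 : ℝ) • ζ') • x) := by rw [h0]
    rw [h4]
    exact congrArg (fun T : ℝ →L[ℝ] ℝ => T 1) h1
  have hinv : ∀ (ζ' s : Fin m → ℝ) (x : M),
      eval2 (ω₀ (torusExp s • x)) (fundField ζ (torusExp s • x)) (fundField ζ' (torusExp s • x)) =
        eval2 (ω₀ x) (fundField ζ x) (fundField ζ' x) := by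
    intro ζ' s x
    rw [← dAct_fundField hT, ← dAct_fundField hT, hT.preserves_form]
  -- it suffices to treat the standard basis of the Lie algebra, whose orbits have period `2π`
  have hbasis : ∀ i : Fin m,
      eval2 (ω₀ x) (fundField ζ x) (fundField (Pi.single i 1 : Fin m → ℝ) x) = 0 := by
    intro i
    set e : Fin m → ℝ := Pi.single i 1 with he
    set c := eval2 (ω₀ x) (fundField ζ x) (fundField e x) with hc
    have hder : ∀ s : ℝ, HasDerivAt (fun r : ℝ => μ (torusExp (r • e) • x) ζ) c s := by
      intro s
      have h1 := hd e (torusExp (s • e) • x)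
      rw [hinv] at h1
      have h2 : HasDerivAt (fun r : ℝ => r - s) 1 s := (hasDerivAt_id s).sub_const s
      have h3 := HasDerivAt.scomp (h := fun r : ℝ => r - s) s (by rw [sub_self]; exact h1) h2
      rw [one_smul] at h3
      refine h3.congr_of_eventuallyEq (Filter.Eventually.of_forall fun r => ?_)
      simp only [Function.comp_apply]
      rw [← mul_smul, ← torusExp_add, ← add_smul, sub_add_cancel]
    have hlin : ∀ s : ℝ, HasDerivAt (fun r : ℝ => μ (torusExp (r • e) • x) ζ - c * r) 0 s := by
      intro s
      exact ((hder s).fun_sub ((hasDerivAt_id s).const_mul c)).congr_deriv (by simp)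
    have hconst := is_const_of_deriv_eq_zero (fun s => (hlin s).differentiableAt)
      (fun s => (hlin s).deriv) (2 * Real.pi) 0
    have e1 : torusExp ((2 * Real.pi) • e) = 1 := by
      rw [← torusExp_two_pi i, he]
      congr 1
      rw [← Pi.single_smul, smul_eq_mul, mul_one]
    simp only [e1, zero_smul, torusExp_zero, mul_zero, sub_zero] at hconst
    have : c * (2 * Real.pi) = 0 := by linarith
    exact (mul_eq_zero.mp this).resolve_right (by positivity)
  have hz : ζ' = ∑ i, ζ' i • (Pi.single i 1 : Fin m → ℝ) := by
    funext j; simp [Finset.sum_apply, Pi.single_apply]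
  rw [← fundL_apply hT ζ', hz, map_sum, eval2, map_sum]
  refine Finset.sum_eq_zero fun i _ => ?_
  rw [map_smul, map_smul, fundL_apply hT]
  have := hbasis i
  rw [eval2] at this
  rw [this, smul_zero]

end TorusKahler

/-! ### Involutivity from a spinor -/

section Spinor

variable {M : Type*} [TopologicalSpace M] [ChartedSpace (Cn n) M]

theorem contDiffAt_of_smoothGT {a : M → GT n} {U : Set M} (hU : IsOpen U) (ha : SmoothGT a U) {x : M}
    (hx : x ∈ U) : ContDiffAt ℝ ∞ (gtRep x a) (chartC (n := n) x x) :=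
  (smoothGT_iff hU).mp ha x _ (mem_extChartAt_target x) (by rwa [extChartAt_to_inv])

theorem eventually_chart_symm {x : M} {p : M → Prop} (hp : ∀ᶠ x' in nhds x, p x') :
    ∀ᶠ y in nhds (chartC (n := n) x x), p ((chartC (n := n) x).symm y) := by
  have hc : Filter.Tendsto (chartC (n := n) x).symm (nhds (chartC (n := n) x x)) (nhds x) := by
    have := continuousAt_extChartAt_symm (I := 𝓘(ℝ, Cn n)) x
    rwa [ContinuousAt, extChartAt_to_inv] at this
  exact hc.eventually hp

theorem eventually_mem_target (x : M) : ∀ᶠ y in nhds (chartC (n := n) x x), y ∈ (chartC x).target :=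
  (isOpen_extChartAt_target x).mem_nhds (mem_extChartAt_target x)

variable [hM : IsManifold 𝓘(ℂ, Cn n) ∞ M]

theorem formRep_cliffC {x₀ : M} {y : Cn n} (hy : y ∈ (chartC x₀).target) (a b : M → GT n)
    (s : M → CForm n) : cliffC (gtRep x₀ a y) (gtRep x₀ b y) (formRep x₀ s y) =
      pullC (dChartSymm x₀ y) (cliffC (a ((chartC x₀).symm y)) (b ((chartC x₀).symm y))
        (s ((chartC x₀).symm y))) := by
  rw [cliffC_apply, ← formRep_cliff hy, ← formRep_cliff hy, cliffC_apply, map_add, map_smul]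
  rfl

/-- If, near `x`, a spinor field `φ` with `dφ = η · φ` at `x` induces `𝒥`, then `E_𝒥` is involutive
at `x`. -/
theorem involutive_of_spinor {𝒥 : M → GT n →ₗ[ℝ] GT n} {x : M} {φ : M → CForm n} {η : GT n}
    (hI : ∀ᶠ x' in nhds x, Induces (φ x') (𝒥 x'))
    (hφ : DifferentiableAt ℝ (formRep x φ) (chartC (n := n) x x)) (h0 : φ x ≠ 0)
    (hd : dForm φ x = cliff η (φ x)) {U : Set M} (hU : IsOpen U) {a₁ b₁ a₂ b₂ : M → GT n}
    (ha₁ : SmoothGT a₁ U) (hb₁ : SmoothGT b₁ U) (ha₂ : SmoothGT a₂ U) (hb₂ : SmoothGT b₂ U)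
    (h₁ : ∀ x ∈ U, InE (𝒥 x) (a₁ x) (b₁ x)) (h₂ : ∀ x ∈ U, InE (𝒥 x) (a₂ x) (b₂ x)) (hx : x ∈ U) :
    InE (𝒥 x) (courant a₁ a₂ x - courant b₁ b₂ x) (courant a₁ b₂ x + courant b₁ a₂ x) := by
  have key : ∀ a b : M → GT n, (∀ x ∈ U, InE (𝒥 x) (a x) (b x)) →
      ∀ᶠ z in nhds (chartC (n := n) x x), cliffC (gtRep x a z) (gtRep x b z) (formRep x φ z) = 0 := by
    intro a b hab
    filter_upwards [eventually_mem_target x, eventually_chart_symm hI,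
      eventually_chart_symm (hU.mem_nhds hx)] with z hz h1 h2
    have h3 : cliffC (a ((chartC x).symm z)) (b ((chartC x).symm z)) (φ ((chartC x).symm z)) = 0 := by
      rw [cliffC_apply]; exact (h1 _ _).mpr (hab _ h2)
    rw [formRep_cliffC hz, h3, map_zero]
  have hdiff : ∀ a : M → GT n, SmoothGT a U → DifferentiableAt ℝ (gtRep x a) (chartC (n := n) x x) :=
    fun a ha => (contDiffAt_of_smoothGT hU ha hx).differentiableAt (by simp)
  have h := flatCourant_involutive (hdiff _ ha₁) (hdiff _ hb₁) (hdiff _ ha₂) (hdiff _ hb₂) hφ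
    (by rwa [formRep_self]) (by rw [formRep_self]; exact hd) (key _ _ h₁) (key _ _ h₂)
  rw [formRep_self, cliffC_apply] at h
  exact (hI.self_of_nhds _ _).mp h

end Spinor

/-! ### Smoothness of the structures -/

theorem bivSharp_apply (lam : Fin m → Fin m → ℝ) (v : Fin m → Cn n) (ξ : Cov n) :
    bivSharp lam v ξ = ∑ i, ∑ j, lam i j • (ξ (v j) • v i - ξ (v i) • v j) := rfl

theorem map_bivSharp (A B : Cn n →L[ℝ] Cn n) (hBA : ∀ v, B (A v) = v) (lam : Fin m → Fin m → ℝ)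
    (v : Fin m → Cn n) (ξ : Cov n) :
    A (bivSharp lam v ξ) = bivSharp lam (fun i => A (v i)) (ξ.comp B) := by
  simp only [bivSharp_apply, map_sum, map_smul, map_sub, ContinuousLinearMap.comp_apply, hBA]

theorem pullR_pos {ω₀ : RForm n} (hω : ω₀ ∈ degreePart n 2)
    (hpos : ∀ u, u ≠ 0 → 0 < eval2 ω₀ (stdJ n u) u) (A B : Cn n →L[ℝ] Cn n)
    (hBA : ∀ v, B (A v) = v) (hA : ∀ v, A (stdJ n v) = stdJ n (A v)) (u : Cn n) (hu : u ≠ 0) :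
    0 < eval2 (pullR A ω₀) (stdJ n u) u := by
  rw [eval2_pullR hω, hA]
  refine hpos _ fun h => hu ?_
  rw [← hBA u, h, map_zero]

/-- The linear map taking a two-form to `u ↦ i_u ω`. -/
def contrLin (n : ℕ) : CForm n →ₗ[ℝ] (Cn n →L[ℝ] Cov n) where
  toFun X := LinearMap.toContinuousLinearMap
    { toFun := fun u => LinearMap.toContinuousLinearMap
        { toFun := fun v => (scalarPart (cint v (cint u X))).re
          map_add' := fun v w => by simp [cint_add]
          map_smul' := fun c v => by
            rw [cint_smul, LinearMap.smul_apply, map_smul, smul_eq_mul, Complex.re_ofReal_mul]; rfl }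
      map_add' := fun v w => by ext; simp [cint_add]
      map_smul' := fun c v => by
        refine ContinuousLinearMap.ext fun w => ?_
        change (scalarPart (cint w (cint (c • v) X))).re = c * (scalarPart (cint w (cint v X))).re
        rw [cint_smul, LinearMap.smul_apply, map_smul, map_smul, smul_eq_mul,
          Complex.re_ofReal_mul] }
  map_add' X Y := by ext; simp
  map_smul' c X := by
    refine ContinuousLinearMap.ext fun u => ContinuousLinearMap.ext fun v => ?_
    change (scalarPart (cint v (cint u (c • X)))).re = c * (scalarPart (cint v (cint u X))).re
    rw [real_smul_eq, map_smul, map_smul, map_smul]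
    simp

theorem contrLin_toC {ω₀ : RForm n} (hω : ω₀ ∈ degreePart n 2) :
    contrLin n (toC ω₀) = contrC ω₀ := by
  refine ContinuousLinearMap.ext fun u => ContinuousLinearMap.ext fun v => ?_
  change (scalarPart (cint v (cint u (toC ω₀)))).re = _
  rw [cint_cint_two_form hω, map_smul, map_one, smul_eq_mul, mul_one, Complex.ofReal_re]
  rfl

section

variable {X : Type*} [NormedAddCommGroup X] [NormedSpace ℝ X] {x : X} {k : WithTop ℕ∞}

theorem contDiffAt_adBiv (lam : Fin m → Fin m → ℝ) (t : ℝ) {v : X → Fin m → Cn n} {a : X → GT n}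
    (hv : ∀ i, ContDiffAt ℝ k (fun y => v y i) x) (ha : ContDiffAt ℝ k a x) :
    ContDiffAt ℝ k (fun y => adBiv lam (v y) t (a y)) x := by
  simp only [adBiv_apply, bivSharp_apply]
  have h1 : ContDiffAt ℝ k (fun y => (a y).1) x := ha.fst
  have h2 : ContDiffAt ℝ k (fun y => (a y).2) x := ha.snd
  refine (h1.add ((contDiffAt_const (c := t)).smul (ContDiffAt.sum fun i _ => ContDiffAt.sum fun j _ =>
    (contDiffAt_const (c := lam i j)).smul (ContDiffAt.sub ?_ ?_)))).prodMk h2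
  · exact (h2.clm_apply (hv j)).smul (hv i)
  · exact (h2.clm_apply (hv i)).smul (hv j)

theorem contDiffAt_symplJ {w : X → RForm n} {a : X → GT n} (hw : ∀ y, w y ∈ degreePart n 2)
    (hinv : (contrC (w x)).IsInvertible) (hws : ContDiffAt ℝ k (fun y => toC (w y)) x)
    (ha : ContDiffAt ℝ k a x) : ContDiffAt ℝ k (fun y => symplJ (w y) (a y)) x := by
  have h1 : ContDiffAt ℝ k (fun y => contrC (w y)) x := by
    have := contDiffAt_lin (G := Cn n →L[ℝ] Cov n) (contrLin n) hws
    simpa only [contrLin_toC (hw _)] using this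
  have h2 : ContDiffAt ℝ k (fun y => sympInv (w y)) x := by
    obtain ⟨e, he⟩ := hinv
    have h3 : ContDiffAt ℝ k ContinuousLinearMap.inverse (contrC (w x)) := by
      rw [← he]; exact contDiffAt_map_inverse e
    exact h3.comp x h1
  exact (h2.clm_apply ha.snd).prodMk (h1.clm_apply ha.fst).neg

end

section Smooth

variable {M : Type*} [TopologicalSpace M] [ChartedSpace (Cn n) M] [hM : IsManifold 𝓘(ℂ, Cn n) ∞ M]

theorem dChartSymm_dChart' {x₀ : M} {y : Cn n} (hy : y ∈ (chartC x₀).target) (v : Cn n) :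
    dChartSymm x₀ y (dChart x₀ ((chartC x₀).symm y) v) = v := by
  have := dChartSymm_dChart ((chartC x₀).map_target hy) v
  rwa [(chartC x₀).right_inv hy] at this

theorem gtRep_ofComplex {x₀ : M} {y : Cn n} (hy : y ∈ (chartC x₀).target) (a : M → GT n) :
    gtRep x₀ (fun x => ofComplex (stdJ n) (a x)) y = ofComplex (stdJ n) (gtRep x₀ a y) := by
  simp only [gtRep, ofComplex_apply]
  rw [dChart_stdJ ((chartC x₀).map_target hy)]
  refine Prod.ext rfl (ContinuousLinearMap.ext fun v => ?_)
  change -((a _).2 (stdJ n (dChartSymm x₀ y v))) = -((a _).2 (dChartSymm x₀ y (stdJ n v)))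
  rw [dChartSymm_stdJ hy]

theorem gtRep_symplJ {ω₀ : M → RForm n} (hω : ∀ x, ω₀ x ∈ degreePart n 2)
    (hpos : ∀ x u, u ≠ 0 → 0 < eval2 (ω₀ x) (stdJ n u) u) {x₀ : M} {y : Cn n}
    (hy : y ∈ (chartC x₀).target) (a : M → GT n) : gtRep x₀ (fun x => symplJ (ω₀ x) (a x)) y =
      symplJ (pullR (dChartSymm x₀ y) (ω₀ ((chartC x₀).symm y))) (gtRep x₀ a y) := by
  simp only [gtRep, symplJ_apply]
  set x := (chartC x₀).symm y
  have hinv : (contrC (pullR (dChartSymm x₀ y) (ω₀ x))).IsInvertible := contrC_isInvertible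
    (pullR_pos (hω x) (hpos x) _ (dChart x₀ x) (dChart_dChartSymm hy) (dChartSymm_stdJ hy))
  have hinv' : (contrC (ω₀ x)).IsInvertible := contrC_isInvertible (hpos x)
  refine Prod.ext ?_ ?_
  · change dChart x₀ x (sympInv (ω₀ x) (a x).2) = _
    rw [← sympInv_contr hinv (dChart x₀ x (sympInv (ω₀ x) (a x).2)), contr_pullR (hω x) _
      (pullR_mem (hω x) _), dChartSymm_dChart' hy, contr_sympInv hinv']
  · change (-contr (ω₀ x) (a x).1).comp (dChartSymm x₀ y) = -contr _ (dChart x₀ x (a x).1)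
    rw [contr_pullR (hω x) _ (pullR_mem (hω x) _), dChartSymm_dChart' hy,
      ContinuousLinearMap.neg_comp]

theorem smoothGT_ofComplex {U : Set M} (hU : IsOpen U) {a : M → GT n} (ha : SmoothGT a U) :
    SmoothGT (fun x => ofComplex (stdJ n) (a x)) U := by
  rw [smoothGT_iff hU] at ha ⊢
  intro x₀ y hy hyU
  refine (contDiffAt_lin (ofComplex (stdJ n)) (ha x₀ y hy hyU)).congr_of_eventuallyEq ?_
  filter_upwards [(isOpen_extChartAt_target x₀).mem_nhds hy] with z hz using gtRep_ofComplex hz a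

theorem smoothGT_symplJ {ω₀ : M → RForm n} (hω : IsClosedTwoForm ω₀)
    (hpos : ∀ x u, u ≠ 0 → 0 < eval2 (ω₀ x) (stdJ n u) u) {U : Set M} (hU : IsOpen U)
    {a : M → GT n} (ha : SmoothGT a U) : SmoothGT (fun x => symplJ (ω₀ x) (a x)) U := by
  rw [smoothGT_iff hU] at ha ⊢
  intro x₀ y hy hyU
  have h1 := (smoothForm_iff isOpen_univ).mp hω.smooth x₀ y hy (Set.mem_univ _)
  have h2 : ContDiffAt ℝ ∞ (fun z => symplJ (pullR (dChartSymm x₀ z) (ω₀ ((chartC x₀).symm z)))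
      (gtRep x₀ a z)) y := by
    refine contDiffAt_symplJ (fun z => pullR_mem (hω.degree _) _) (contrC_isInvertible
      (pullR_pos (hω.degree _) (hpos _) _ (dChart x₀ _) (dChart_dChartSymm hy)
        (dChartSymm_stdJ hy))) ?_ (ha x₀ y hy hyU)
    simpa only [funext fun z => formRep_toC x₀ ω₀ z] using h1
  refine h2.congr_of_eventuallyEq ?_
  filter_upwards [(isOpen_extChartAt_target x₀).mem_nhds hy] with z hz using
    gtRep_symplJ hω.degree hpos hz a

variable [MulAction (Fin m → Circle) M] {ω₀ : M → RForm n}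

theorem gtRep_adBiv (hT : IsKahlerTorusAction (m := m) ω₀) (lam : Fin m → Fin m → ℝ)
    (ζ : Fin m → Fin m → ℝ) (t : ℝ) {x₀ : M} {y : Cn n} (hy : y ∈ (chartC x₀).target)
    (a : M → GT n) : gtRep x₀ (fun x => adBiv lam (fun i => fundField (ζ i) x) t (a x)) y =
      adBiv lam (fun i => fieldRep x₀ (ζ i) y) t (gtRep x₀ a y) := by
  simp only [gtRep, adBiv_apply, map_add, map_smul]
  rw [map_bivSharp _ _ (dChartSymm_dChart' hy)]
  simp only [dChart_fundField hT _ hy]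

theorem smoothGT_adBiv (hT : IsKahlerTorusAction (m := m) ω₀) (lam : Fin m → Fin m → ℝ)
    (ζ : Fin m → Fin m → ℝ) (t : ℝ) {U : Set M} (hU : IsOpen U) {a : M → GT n}
    (ha : SmoothGT a U) :
    SmoothGT (fun x => adBiv lam (fun i => fundField (ζ i) x) t (a x)) U := by
  rw [smoothGT_iff hU] at ha ⊢
  intro x₀ y hy hyU
  refine (contDiffAt_adBiv lam t (fun i => contDiffAt_fieldRep hT (ζ i) hy)
    (ha x₀ y hy hyU)).congr_of_eventuallyEq ?_
  filter_upwards [(isOpen_extChartAt_target x₀).mem_nhds hy] with z hz using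
    gtRep_adBiv hT lam ζ t hz a

theorem smoothGT_adConj (hT : IsKahlerTorusAction (m := m) ω₀) (lam : Fin m → Fin m → ℝ)
    (ζ : Fin m → Fin m → ℝ) (t : ℝ) {𝒥 : M → GT n →ₗ[ℝ] GT n} {U : Set M} (hU : IsOpen U)
    (h𝒥 : ∀ a : M → GT n, SmoothGT a U → SmoothGT (fun x => 𝒥 x (a x)) U) {a : M → GT n}
    (ha : SmoothGT a U) :
    SmoothGT (fun x => adConj lam (fun i => fundField (ζ i) x) t (𝒥 x) (a x)) U :=
  smoothGT_adBiv hT lam ζ t hU (h𝒥 _ (smoothGT_adBiv hT lam ζ (-t) hU ha))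

end Smooth

/-! ### The pure spinors of the deformation -/

theorem pullC_expBiv (A : Cn n →L[ℝ] Cn n) (lam : Fin m → Fin m → ℝ) (v : Fin m → Cn n) (t : ℝ)
    (X : CForm n) : expBiv lam v t (pullC A X) = pullC A (expBiv lam (fun i => A (v i)) t X) := by
  have h1 : ∀ X, bivAct lam v (pullC A X) = pullC A (bivAct lam (fun i => A (v i)) X) := fun X => by
    simp only [bivAct_apply, cint_pullC, map_sum, map_smul]
  have h2 : ∀ (k : ℕ) (X), (bivAct lam v ^ k) (pullC A X) =
      pullC A ((bivAct lam (fun i => A (v i)) ^ k) X) := by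
    intro k
    induction k with
    | zero => intro X; rfl
    | succ k ih => intro X; rw [pow_succ, Module.End.mul_apply, h1, ih, pow_succ, Module.End.mul_apply]
  simp only [expBiv_apply, h2, map_sum, map_smul]

/-- Pull-back by an invertible complex linear map preserves the forms of type `(n,0)`. -/
theorem annihilates_pullC {A B : Cn n →L[ℝ] Cn n} (hAB : ∀ v, A (B v) = v)
    (hBA : ∀ v, B (A v) = v) (hA : ∀ v, A (stdJ n v) = stdJ n (A v)) {X : CForm n}
    (hX : ∀ c, cliff c X + Complex.I • cliff (ofComplex (stdJ n) c) X = 0) (c : GT n) :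
    cliff c (pullC A X) + Complex.I • cliff (ofComplex (stdJ n) c) (pullC A X) = 0 := by
  have h2 := congrArg (pullC A) (hX (A c.1, c.2.comp B))
  have e : ∀ ξ : Cov n, (ξ.comp B).comp A = ξ := fun ξ =>
    ContinuousLinearMap.ext fun v => congrArg ξ (hBA v)
  have hB : ∀ v, B (stdJ n v) = stdJ n (B v) := fun v => by
    rw [← hBA (stdJ n (B v)), hA, hAB]
  have e2 : -((c.2.comp B).comp (stdJ n)) = (-(c.2.comp (stdJ n))).comp B := by
    refine ContinuousLinearMap.ext fun v => ?_
    change -(c.2 (B (stdJ n v))) = -(c.2 (stdJ n (B v)))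
    rw [hB]
  rw [map_add, map_smul, map_zero, ofComplex_apply] at h2
  simp only [← hA] at h2
  rw [e2, pullC_cliff, pullC_cliff, e, e] at h2
  exact h2

theorem pullC_ne_zero {A B : Cn n →L[ℝ] Cn n} (hAB : ∀ v, A (B v) = v) {X : CForm n}
    (hX : X ≠ 0) : pullC A X ≠ 0 := by
  intro h
  have hAB' : A.comp B = ContinuousLinearMap.id ℝ (Cn n) := ContinuousLinearMap.ext hAB
  have := congrArg (pullC B) h
  rw [pullC_pullC, hAB', pullC_id, map_zero] at this
  exact hX this

theorem induces_pullC_hvol {A B : Cn n →L[ℝ] Cn n} (hAB : ∀ v, A (B v) = v)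
    (hBA : ∀ v, B (A v) = v) (hA : ∀ v, A (stdJ n v) = stdJ n (A v)) :
    Induces (pullC A (hvol n)) (ofComplex (stdJ n)) :=
  induces_of_annihilates ofComplex_sq ofComplex_orth (pullC_ne_zero hAB hvol_ne_zero)
    (annihilates_pullC hAB hBA hA (induces_hvol.annihilates ofComplex_sq))

theorem cint_complex_smul {X : CForm n} (hX : ∀ v, cint (stdJ n v) X = Complex.I • cint v X) (c : ℂ)
    (v : Cn n) : cint (c • v) X = c • cint v X := by
  have h : c • v = c.re • v + c.im • stdJ n v := by
    rw [stdJ_apply]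
    conv_lhs => rw [← Complex.re_add_im c]
    rw [add_smul, mul_smul]
    rfl
  rw [h, cint_add, cint_smul, cint_smul, LinearMap.add_apply, LinearMap.smul_apply,
    LinearMap.smul_apply, hX, smul_smul, ← add_smul, Complex.re_add_im]

theorem cint_stdJ_expBiv_hvol (lam : Fin m → Fin m → ℝ) (v : Fin m → Cn n) (t : ℝ) (w : Cn n) :
    cint (stdJ n w) (expBiv lam v t (hvol n)) =
      Complex.I • cint w (expBiv lam v t (hvol n)) := by
  rw [← expBiv_cint, ← expBiv_cint, cint_stdJ induces_hvol, map_smul]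

theorem cint_modVec (lam : Fin m → Fin m → ℝ) (v : Fin m → Cn n) (c : Fin m → ℂ) {X : CForm n}
    (hX : ∀ v, cint (stdJ n v) X = Complex.I • cint v X) :
    cint (modVec lam v c) X =
      ∑ i, ∑ j, (lam i j : ℂ) • (c i • cint (v j) X - c j • cint (v i) X) := by
  simp only [modVec, cint_sum, LinearMap.sum_apply, cint_smul, LinearMap.smul_apply, cint_sub,
    LinearMap.sub_apply, cint_complex_smul hX]

theorem map_modVec (A : Cn n →L[ℝ] Cn n) (hA : ∀ v, A (stdJ n v) = stdJ n (A v))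
    (lam : Fin m → Fin m → ℝ) (v : Fin m → Cn n) (c : Fin m → ℂ) :
    A (modVec lam v c) = modVec lam (fun i => A (v i)) c := by
  have h : ∀ (c : ℂ) v, A (c • v) = c • A v := by
    intro c v
    conv_lhs => rw [← Complex.re_add_im c]
    conv_rhs => rw [← Complex.re_add_im c]
    simp only [add_smul, mul_smul, map_add]
    rw [← stdJ_apply, ← stdJ_apply, ← hA]
    congr 1
    · exact map_smul A c.re v
    · exact map_smul A c.im _
  simp only [modVec, map_sum, map_smul, map_sub, h]

/-- The complex divergence as a linear function of the derivative. -/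
def cdivL (n : ℕ) : (Cn n →L[ℝ] Cn n) →ₗ[ℝ] ℂ where
  toFun := cdiv
  map_add' A B := by
    simp only [cdiv, lieOp_apply, ← map_add, ← altD_add]
    congr 2; funext w
    rw [add_apply, cint_add]; rfl
  map_smul' c A := by
    simp only [cdiv, lieOp_apply, RingHom.id_apply, Complex.real_smul, ← smul_eq_mul, ← map_smul,
      ← altD_smul]
    congr 2; funext w
    rw [smul_apply, cint_smul, map_smul]; rfl

section

variable {M : Type*} [TopologicalSpace M] [ChartedSpace (Cn n) M] [MulAction (Fin m → Circle) M]

/-- The spinor field `e^{tβ} · (dz_1 ∧ ⋯ ∧ dz_n)`, where `z` are the coordinates of the chart at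
`x₀`. -/
def stdSpinor (lam : Fin m → Fin m → ℝ) (ζ : Fin m → Fin m → ℝ) (t : ℝ) (x₀ x : M) : CForm n :=
  expBiv lam (fun i => fundField (ζ i) x) t (pullC (dChart x₀ x) (hvol n))

/-- The complex divergence of a fundamental vector field in the chart at `x₀`. -/
def fieldDiv (ζ : Fin m → ℝ) (x₀ x : M) : ℂ := cdiv (fderiv ℝ (fieldRep x₀ ζ) (chartC (n := n) x₀ x))

/-- The section `η` of `T ⊕ T*` with `dφ = η · φ` for `φ = e^{tβ} · (dz_1 ∧ ⋯ ∧ dz_n)`. -/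
def stdEta (lam : Fin m → Fin m → ℝ) (ζ : Fin m → Fin m → ℝ) (t : ℝ) (x₀ x : M) : GT n :=
  (t • modVec lam (fun i => fundField (ζ i) x) (fun i => fieldDiv (n := n) (ζ i) x₀ x), 0)

variable [hM : IsManifold 𝓘(ℂ, Cn n) ∞ M] {ω₀ : M → RForm n}

theorem formRep_stdSpinor (hT : IsKahlerTorusAction (m := m) ω₀) (lam : Fin m → Fin m → ℝ)
    (ζ : Fin m → Fin m → ℝ) (t : ℝ) {x₀ : M} {y : Cn n} (hy : y ∈ (chartC x₀).target) :
    formRep x₀ (stdSpinor lam ζ t x₀) y = expBiv lam (fun i => fieldRep x₀ (ζ i) y) t (hvol n) := by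
  have h : (dChart x₀ ((chartC x₀).symm y)).comp (dChartSymm x₀ y) =
      ContinuousLinearMap.id ℝ (Cn n) := ContinuousLinearMap.ext fun v => dChart_dChartSymm hy v
  rw [formRep, stdSpinor, pullC_expBiv, pullC_pullC, h, pullC_id]
  simp only [dChart_fundField hT _ hy]

theorem contDiffAt_formRep_stdSpinor (hT : IsKahlerTorusAction (m := m) ω₀)
    (lam : Fin m → Fin m → ℝ) (ζ : Fin m → Fin m → ℝ) (t : ℝ) {x₀ : M} {y : Cn n}
    (hy : y ∈ (chartC x₀).target) : ContDiffAt ℝ ∞ (formRep x₀ (stdSpinor lam ζ t x₀)) y := by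
  refine (contDiffAt_expBiv lam t (fun i => contDiffAt_fieldRep hT (ζ i) hy)
    (contDiffAt_const (c := hvol n))).congr_of_eventuallyEq ?_
  filter_upwards [(isOpen_extChartAt_target x₀).mem_nhds hy] with z hz using
    formRep_stdSpinor hT lam ζ t hz

theorem smoothForm_stdSpinor (hT : IsKahlerTorusAction (m := m) ω₀)
    (lam : Fin m → Fin m → ℝ) (ζ : Fin m → Fin m → ℝ) (t : ℝ) (x₀ : M) :
    SmoothForm (n := n) (stdSpinor lam ζ t x₀) (chartC (n := n) x₀).source :=
  smoothForm_of_chart (isOpen_extChartAt_source x₀) subset_rfl fun _ hy _ =>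
    contDiffAt_formRep_stdSpinor hT lam ζ t hy

theorem induces_dChart_hvol {x₀ x : M} (hx : x ∈ (chartC (n := n) x₀).source) :
    Induces (pullC (dChart x₀ x) (hvol n)) (ofComplex (stdJ n)) := by
  refine induces_pullC_hvol (B := dChartSymm x₀ (chartC x₀ x)) (fun v => ?_) (dChartSymm_dChart hx)
    (dChart_stdJ hx)
  have := dChart_dChartSymm ((chartC x₀).map_source hx) v
  rwa [(chartC x₀).left_inv hx] at this

theorem induces_stdSpinor (lam : Fin m → Fin m → ℝ) (ζ : Fin m → Fin m → ℝ) (t : ℝ) {x₀ x : M}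
    (hx : x ∈ (chartC (n := n) x₀).source) : Induces (stdSpinor lam ζ t x₀ x)
      (adConj lam (fun i => fundField (ζ i) x) t (ofComplex (stdJ n))) :=
  induces_expBiv (induces_dChart_hvol hx)

/-- In the chart, `d (e^{tβ} Ω) = t i_W e^{tβ} Ω` for the modular vector field `W`. -/
theorem flatD_stdSpinor (hT : IsKahlerTorusAction (m := m) ω₀) (lam : Fin m → Fin m → ℝ)
    (ζ : Fin m → Fin m → ℝ) (t : ℝ) {x₀ : M} {y : Cn n} (hy : y ∈ (chartC x₀).target) :
    flatD (fun z => expBiv lam (fun i => fieldRep x₀ (ζ i) z) t (hvol n)) y =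
      cliff (t • modVec lam (fun i => fieldRep x₀ (ζ i) y)
        (fun i => cdiv (fderiv ℝ (fieldRep x₀ (ζ i)) y)), 0)
        (expBiv lam (fun i => fieldRep x₀ (ζ i) y) t (hvol n)) := by
  rw [flatD_expBiv_hvol lam t (fun i => (contDiffAt_fieldRep hT (ζ i) hy).of_le (by norm_cast))
      (fun i w => fderiv_fieldRep_stdJ hT (ζ i) hy w)
      (fun i j => fderiv_fieldRep_comm hT (ζ i) (ζ j) hy),
    ← cint_modVec lam _ _ (cint_stdJ_expBiv_hvol lam _ t), cliff_apply]
  simp only [map_zero, zero_mul, add_zero]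
  rw [cint_smul, LinearMap.smul_apply]

theorem dForm_stdSpinor (hT : IsKahlerTorusAction (m := m) ω₀) (lam : Fin m → Fin m → ℝ)
    (ζ : Fin m → Fin m → ℝ) (t : ℝ) {x₀ x : M} (hx : x ∈ (chartC (n := n) x₀).source) :
    dForm (n := n) (stdSpinor lam ζ t x₀) x =
      cliff (stdEta lam ζ t x₀ x) (stdSpinor lam ζ t x₀ x) := by
  have hy : chartC (n := n) x₀ x ∈ (chartC x₀).target := (chartC x₀).map_source hx
  have hxy : (chartC (n := n) x₀).symm (chartC x₀ x) = x := (chartC x₀).left_inv hx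
  have hf : ∀ i, dChart x₀ x (fundField (ζ i) x) = fieldRep x₀ (ζ i) (chartC (n := n) x₀ x) := by
    intro i
    have := dChart_fundField hT (ζ i) hy
    rwa [hxy] at this
  have hc : flatD (formRep x₀ (stdSpinor lam ζ t x₀)) (chartC x₀ x) =
      flatD (fun z => expBiv lam (fun i => fieldRep x₀ (ζ i) z) t (hvol n)) (chartC x₀ x) := by
    refine flatD_congr ?_
    filter_upwards [(isOpen_extChartAt_target x₀).mem_nhds hy] with z hz using
      formRep_stdSpinor hT lam ζ t hz
  rw [dForm_eq hx ((contDiffAt_formRep_stdSpinor hT lam ζ t hy).differentiableAt (by simp)), hc,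
    flatD_stdSpinor hT lam ζ t hy, cliff_apply, cliff_apply, stdEta, stdSpinor]
  simp only [map_zero, zero_mul, add_zero]
  rw [pullC_expBiv, cint_pullC, map_smul, map_modVec _ (dChart_stdJ hx)]
  simp only [hf]
  rfl

theorem contDiffAt_fieldDiv (hT : IsKahlerTorusAction (m := m) ω₀) (ζ : Fin m → ℝ) {x₀ x₁ : M}
    {y : Cn n} (hy : y ∈ overlap x₁ x₀) :
    ContDiffAt ℝ ∞ (fun z => fieldDiv (n := n) ζ x₀ ((chartC (n := n) x₁).symm z)) y := by
  have h1 : ContDiffAt ℝ ∞ (fderiv ℝ (fieldRep x₀ ζ)) (coordChange x₁ x₀ y) :=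
    (contDiffAt_fieldRep hT ζ (coordChange_mem_target hy)).fderiv_right (by norm_cast)
  have h2 := contDiffAt_lin (cdivL n) (h1.comp y (contDiffAt_coordChange hy))
  exact h2

theorem smoothGT_stdEta (hT : IsKahlerTorusAction (m := m) ω₀) (lam : Fin m → Fin m → ℝ)
    (ζ : Fin m → Fin m → ℝ) (t : ℝ) (x₀ : M) :
    SmoothGT (n := n) (stdEta lam ζ t x₀) (chartC (n := n) x₀).source := by
  rw [smoothGT_iff (isOpen_extChartAt_source x₀)]
  intro x₁ y hy hyU
  have hyo : y ∈ overlap x₁ x₀ := ⟨hy, hyU⟩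
  have h : ContDiffAt ℝ ∞ (fun z => ((t • modVec lam (fun i => fieldRep x₁ (ζ i) z)
      (fun i => fieldDiv (n := n) (ζ i) x₀ ((chartC x₁).symm z)), 0) : GT n)) y := by
    refine ContDiffAt.prodMk ((contDiffAt_const (c := t)).smul ?_) contDiffAt_const
    have hv := fun i => contDiffAt_fieldRep hT (ζ i) hy
    have hd := fun i => contDiffAt_fieldDiv hT (ζ i) hyo
    exact ContDiffAt.sum fun i _ => ContDiffAt.sum fun j _ => (contDiffAt_const (c := lam i j)).smul
      (((hd i).smul (hv j)).sub ((hd j).smul (hv i)))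
  refine h.congr_of_eventuallyEq ?_
  filter_upwards [(isOpen_overlap x₁ x₀).mem_nhds hyo] with z hz
  simp only [gtRep, stdEta, map_smul]
  rw [map_modVec _ (dChart_stdJ ((chartC x₁).map_target hz.1))]
  simp only [dChart_fundField hT _ hz.1]
  rfl

end

/-! ### The generalized Kähler structure -/

section

variable {M : Type*} [TopologicalSpace M] [ChartedSpace (Cn n) M] [MulAction (Fin m → Circle) M]
  {ω₀ : M → RForm n} {μ : M → Module.Dual ℝ (Fin m → ℝ)}

/-- A component of the moment map in the chart at `x₀`. -/
def momentRep (μ : M → Module.Dual ℝ (Fin m → ℝ)) (x₀ : M) (ζ : Fin m → ℝ) (y : Cn n) : ℝ :=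
  μ ((chartC x₀).symm y) ζ

/-- The real closed two-form `b_t` with `ψ_t = e^{b_t + iω}`. -/
def bField (ω₀ : M → RForm n) (lam : Fin m → Fin m → ℝ) (ζ : Fin m → Fin m → ℝ) (t : ℝ) (x : M) :
    RForm n := t • bivForm (ω₀ x) lam (fun i => fundField (ζ i) x)

theorem bField_mem (ω₀ : M → RForm n) (lam : Fin m → Fin m → ℝ) (ζ : Fin m → Fin m → ℝ) (t : ℝ)
    (x : M) : bField ω₀ lam ζ t x ∈ degreePart n 2 := Submodule.smul_mem _ _ (bivForm_mem _ _ _)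

/-- The exponential of a closed complex two-form is smooth. -/
theorem contDiffAt_formRep_nexp {b : M → RForm n} (hb : IsClosedTwoForm b) (hω : IsClosedTwoForm ω₀)
    {x₀ : M} {y : Cn n} (hy : y ∈ (chartC x₀).target) :
    ContDiffAt ℝ ∞ (formRep x₀ fun x => nexp n (cplx2 (b x) (ω₀ x))) y := by
  have hb' := (smoothForm_iff isOpen_univ).mp hb.smooth x₀ y hy (Set.mem_univ _)
  have hω' := (smoothForm_iff isOpen_univ).mp hω.smooth x₀ y hy (Set.mem_univ _)
  have e : (formRep x₀ fun x => nexp n (cplx2 (b x) (ω₀ x))) = fun z => nexp n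
      (formRep x₀ (fun x => toC (b x)) z + Complex.I • formRep x₀ (fun x => toC (ω₀ x)) z) := by
    funext z
    rw [formRep, pullC_nexp, cplx2, map_add, map_smul]
    rfl
  rw [e]
  exact contDiffAt_nexp (hb'.add (contDiffAt_csmul_const _ hω'))

theorem dForm_nexp {b : M → RForm n} (hb : IsClosedTwoForm b) (hω : IsClosedTwoForm ω₀) (x : M) :
    dForm (fun x => nexp n (cplx2 (b x) (ω₀ x))) x = 0 := by
  have hy := mem_extChartAt_target (I := 𝓘(ℝ, Cn n)) x
  have hb' := ((smoothForm_iff isOpen_univ).mp hb.smooth x _ hy (Set.mem_univ _)).differentiableAt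
    (by simp)
  have hω' := ((smoothForm_iff isOpen_univ).mp hω.smooth x _ hy (Set.mem_univ _)).differentiableAt
    (by simp)
  have e : (formRep x fun x => nexp n (cplx2 (b x) (ω₀ x))) = fun z => nexp n
      (formRep x (fun x => toC (b x)) z + Complex.I • formRep x (fun x => toC (ω₀ x)) z) := by
    funext z
    rw [formRep, pullC_nexp, cplx2, map_add, map_smul]
    rfl
  have hx : ∀ z, formRep x (fun x => toC (b x)) z + Complex.I • formRep x (fun x => toC (ω₀ x)) z =
      cplx2 (pullR (dChartSymm x z) (b ((chartC x).symm z)))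
        (pullR (dChartSymm x z) (ω₀ ((chartC x).symm z))) := fun z => by
    rw [formRep_toC, formRep_toC, cplx2]
  have h1 : flatD (formRep x fun x => toC (b x)) (chartC (n := n) x x) = 0 := hb.closed x
  have h2 : flatD (formRep x fun x => toC (ω₀ x)) (chartC (n := n) x x) = 0 := hω.closed x
  rw [dForm, e, flatD_nexp (hb'.fun_add (differentiableAt_csmul_const _ hω'))
    (fun z => by rw [hx, eps_cplx2 (pullR_mem (hb.degree _) _) (pullR_mem (hω.degree _) _)])
    (fun z => by rw [hx]; exact isHom_cplx2 (pullR_mem (hb.degree _) _) (pullR_mem (hω.degree _) _)),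
    flatD_add hb' (differentiableAt_csmul_const _ hω'), flatD_csmul_const _ hω', h1, h2, smul_zero,
    add_zero, zero_mul]

theorem induces_deformedPsi (hω : IsKahler ω₀) (lam : Fin m → Fin m → ℝ)
    (ζ : Fin m → Fin m → ℝ) (t : ℝ) (x : M) :
    Induces (deformedPsi ω₀ lam (fun i => fundField (ζ i)) t x)
      (adConj lam (fun i => fundField (ζ i) x) t (symplJ (ω₀ x))) :=
  induces_expBiv (induces_symplJ (hω.closed.degree x) (contrC_isInvertible (hω.pos x)))

theorem isPoissonDeformation_deformedJ (lam : Fin m → Fin m → ℝ) (ζ : Fin m → Fin m → ℝ) (t : ℝ) :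
    IsPoissonDeformation (n := n) (M := M) lam (fun i => fundField (ζ i)) t
      (deformedJ (n := n) lam (fun i => fundField (ζ i)) t) := by
  intro x Ω hΩ
  rw [exp_bivAct10_eq lam _ t hΩ]
  exact induces_expBiv hΩ

variable [hM : IsManifold 𝓘(ℂ, Cn n) ∞ M]

theorem contDiffAt_momentRep (hμ : IsMomentMap ω₀ μ) {x₀ : M} {y : Cn n} (ζ : Fin m → ℝ)
    (hy : y ∈ (chartC x₀).target) : ContDiffAt ℝ ∞ (momentRep μ x₀ ζ) y := by
  have := isManifold_real (n := n) M
  have h1 : ContMDiffAt 𝓘(ℝ, Cn n) 𝓘(ℝ, Cn n) ∞ (chartC (n := n) x₀).symm y :=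
    (contMDiffOn_extChartAt_symm x₀).contMDiffAt ((isOpen_extChartAt_target x₀).mem_nhds hy)
  exact ((hμ.smooth ζ).contMDiffAt.comp y h1).contDiffAt

theorem fderiv_momentRep (hμ : IsMomentMap ω₀ μ) {x₀ : M} {y : Cn n} (ζ : Fin m → ℝ)
    (hy : y ∈ (chartC x₀).target) : fderiv ℝ (momentRep μ x₀ ζ) y =
      (contr (ω₀ ((chartC x₀).symm y)) (fundField ζ ((chartC x₀).symm y))).comp
        (dChartSymm x₀ y) := by
  rw [hμ.d_eq]
  have h := mfderiv_comp y ((hμ.smooth ζ).mdifferentiableAt (by simp)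
    (x := (chartC (n := n) x₀).symm y)) (mdiff_chart_symm hy)
  rw [← mfderiv_eq_fderiv]
  exact h

theorem formRep_bField (hμ : IsMomentMap ω₀ μ) (lam : Fin m → Fin m → ℝ) (ζ : Fin m → Fin m → ℝ)
    (t : ℝ) {x₀ : M} {y : Cn n} (hy : y ∈ (chartC x₀).target) :
    formRep x₀ (fun x => toC (bField ω₀ lam ζ t x)) y = (t : ℂ) • ∑ i, ∑ j, (lam i j : ℂ) •
      (ιc (fderiv ℝ (momentRep μ x₀ (ζ j)) y) * ιc (fderiv ℝ (momentRep μ x₀ (ζ i)) y)) := by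
  rw [formRep, bField, toC_smul, toC_bivForm]
  simp only [map_smul, map_sum, map_mul, pullC_ιc, fderiv_momentRep hμ _ hy]

theorem contDiffAt_fderiv_momentRep (hμ : IsMomentMap ω₀ μ) {x₀ : M} {y : Cn n} (ζ : Fin m → ℝ)
    (hy : y ∈ (chartC x₀).target) : ContDiffAt ℝ ∞ (fderiv ℝ (momentRep μ x₀ ζ)) y :=
  (contDiffAt_momentRep hμ ζ hy).fderiv_right (by norm_cast)

theorem isClosedTwoForm_bField (hμ : IsMomentMap ω₀ μ) (lam : Fin m → Fin m → ℝ)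
    (ζ : Fin m → Fin m → ℝ) (t : ℝ) : IsClosedTwoForm (bField ω₀ lam ζ t) where
  degree := bField_mem ω₀ lam ζ t
  smooth := by
    rw [smoothForm_iff isOpen_univ]
    intro x₀ y hy _
    refine ContDiffAt.congr_of_eventuallyEq (contDiffAt_csmul_const (t : ℂ)
      (contDiffAt_fsum Finset.univ fun i _ => contDiffAt_fsum Finset.univ fun j _ =>
        contDiffAt_csmul_const (lam i j : ℂ)
        (contDiffAt_fmul (contDiffAt_ιc (contDiffAt_fderiv_momentRep hμ (ζ j) hy))
        (contDiffAt_ιc (contDiffAt_fderiv_momentRep hμ (ζ i) hy))))) ?_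
    filter_upwards [(isOpen_extChartAt_target x₀).mem_nhds hy] with z hz using
      formRep_bField hμ lam ζ t hz
  closed x := by
    have hy := mem_extChartAt_target (I := 𝓘(ℝ, Cn n)) x
    have hd : ∀ i, DifferentiableAt ℝ (fderiv ℝ (momentRep μ x (ζ i))) (chartC (n := n) x x) :=
      fun i => (contDiffAt_fderiv_momentRep hμ (ζ i) hy).differentiableAt (by simp)
    have hd' : ∀ i, DifferentiableAt ℝ (fun z => ιc (fderiv ℝ (momentRep μ x (ζ i)) z))
        (chartC (n := n) x x) := fun i => differentiableAt_lin ιc (hd i)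
    have h0 : ∀ i, flatD (fun z => ιc (fderiv ℝ (momentRep μ x (ζ i)) z)) (chartC (n := n) x x) = 0 :=
      fun i => flatD_ιc_eq_zero (hd i) fun u v =>
        ((contDiffAt_momentRep hμ (ζ i) hy).isSymmSndFDerivAt (by simpa using (by norm_cast))) u v
    have hm : ∀ i j, DifferentiableAt ℝ (fun z => (lam i j : ℂ) •
        (ιc (fderiv ℝ (momentRep μ x (ζ j)) z) * ιc (fderiv ℝ (momentRep μ x (ζ i)) z)))
          (chartC (n := n) x x) := fun i j =>
      differentiableAt_csmul_const _ (differentiableAt_fmul (hd' j) (hd' i))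
    have hs : ∀ i, DifferentiableAt ℝ (fun z => ∑ j, (lam i j : ℂ) •
        (ιc (fderiv ℝ (momentRep μ x (ζ j)) z) * ιc (fderiv ℝ (momentRep μ x (ζ i)) z)))
          (chartC (n := n) x x) := fun i => DifferentiableAt.fun_sum fun j _ => hm i j
    have e : flatD (formRep x fun x => toC (bField ω₀ lam ζ t x)) (chartC (n := n) x x) = _ :=
      flatD_congr (by
        filter_upwards [eventually_mem_target x] with z hz using formRep_bField hμ lam ζ t hz)
    rw [dForm, e, flatD_csmul_const _ (DifferentiableAt.fun_sum fun i _ => hs i),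
      flatD_sum _ fun i _ => hs i]
    rw [Finset.sum_eq_zero, smul_zero]
    intro i _
    rw [flatD_sum _ fun j _ => hm i j]
    refine Finset.sum_eq_zero fun j _ => ?_
    rw [flatD_csmul_const _ (differentiableAt_fmul (hd' j) (hd' i)), flatD_mul (hd' j) (hd' i), h0,
      h0, zero_mul, mul_zero, add_zero, smul_zero]

theorem deformedPsi_eq (hT : IsKahlerTorusAction (m := m) ω₀) (hω : IsClosedTwoForm ω₀)
    (hμ : IsMomentMap ω₀ μ) (lam : Fin m → Fin m → ℝ) (ζ : Fin m → Fin m → ℝ) (t : ℝ) (x : M) :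
    deformedPsi ω₀ lam (fun i => fundField (ζ i)) t x =
      nexp n (cplx2 (bField ω₀ lam ζ t x) (ω₀ x)) :=
  expBiv_nexp (hω.degree x) (fun i j => isotropic hT hμ (ζ i) (ζ j) x) t

theorem isGenComplex_deformedJ (hT : IsKahlerTorusAction (m := m) ω₀) (lam : Fin m → Fin m → ℝ)
    (ζ : Fin m → Fin m → ℝ) (t : ℝ) :
    IsGenComplex (M := M) (deformedJ (n := n) lam (fun i => fundField (ζ i)) t) where
  smooth U hU a ha := smoothGT_adConj hT lam ζ t (𝒥 := fun _ => ofComplex (stdJ n)) hU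
    (fun a ha => smoothGT_ofComplex hU ha) ha
  sq x a := adConj_sq ofComplex_sq a
  orthogonal x a b := adConj_orth ofComplex_orth a b
  involutive U hU a₁ b₁ a₂ b₂ ha₁ hb₁ ha₂ hb₂ h₁ h₂ x hx := by
    refine involutive_of_spinor (φ := stdSpinor lam ζ t x) ?_
      ((contDiffAt_formRep_stdSpinor hT lam ζ t (mem_extChartAt_target x)).differentiableAt
        (by simp)) ?_ (dForm_stdSpinor hT lam ζ t (mem_extChartAt_source x)) hU ha₁ hb₁ ha₂ hb₂ h₁ h₂ hx
    · filter_upwards [(isOpen_extChartAt_source (I := 𝓘(ℝ, Cn n)) x).mem_nhds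
        (mem_extChartAt_source x)] with x' hx' using induces_stdSpinor lam ζ t hx'
    · refine expBiv_ne_zero ?_
      rw [dChart_self, pullC_id]
      exact hvol_ne_zero

theorem isGenComplex_symplectic (hT : IsKahlerTorusAction (m := m) ω₀) (hω : IsKahler ω₀)
    (hμ : IsMomentMap ω₀ μ) (lam : Fin m → Fin m → ℝ) (ζ : Fin m → Fin m → ℝ) (t : ℝ) :
    IsGenComplex (M := M) (fun x => adConj lam (fun i => fundField (ζ i) x) t (symplJ (ω₀ x))) where
  smooth U hU a ha := smoothGT_adConj hT lam ζ t hU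
    (fun a ha => smoothGT_symplJ hω.closed hω.pos hU ha) ha
  sq x a := adConj_sq (symplJ_sq (contrC_isInvertible (hω.pos x))) a
  orthogonal x a b :=
    adConj_orth (symplJ_orth (hω.closed.degree x) (contrC_isInvertible (hω.pos x))) a b
  involutive U hU a₁ b₁ a₂ b₂ ha₁ hb₁ ha₂ hb₂ h₁ h₂ x hx := by
    have hb := isClosedTwoForm_bField hμ lam ζ t
    refine involutive_of_spinor (φ := fun x => nexp n (cplx2 (bField ω₀ lam ζ t x) (ω₀ x))) (η := 0)
      (Filter.Eventually.of_forall fun x' => ?_)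
      ((contDiffAt_formRep_nexp hb hω.closed (mem_extChartAt_target x)).differentiableAt
        (by simp)) (nexp_ne_zero _ (isHom_cplx2 (hb.degree x) (hω.closed.degree x))) ?_
      hU ha₁ hb₁ ha₂ hb₂ h₁ h₂ hx
    · rw [← deformedPsi_eq hT hω.closed hμ]
      exact induces_deformedPsi hω lam ζ t x'
    · rw [dForm_nexp hb hω.closed, cliff_apply]
      simp [cint_zero]

theorem isGenKahler_deformed (hT : IsKahlerTorusAction (m := m) ω₀) (hω : IsKahler ω₀)
    (hμ : IsMomentMap ω₀ μ) (lam : Fin m → Fin m → ℝ) (ζ : Fin m → Fin m → ℝ) (t : ℝ) :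
    IsGenKahler (M := M) (deformedJ (n := n) lam (fun i => fundField (ζ i)) t)
      (fun x => adConj lam (fun i => fundField (ζ i) x) t (symplJ (ω₀ x))) where
  left := isGenComplex_deformedJ hT lam ζ t
  right := isGenComplex_symplectic hT hω hμ lam ζ t
  comm x a := by
    change adConj lam (fun i => fundField (ζ i) x) t _ _ =
      adConj lam _ t _ (adConj lam (fun i => fundField (ζ i) x) t _ _)
    simp only [adConj_apply, adBiv_cancel_neg]
    rw [symplJ_comm (contrC_isInvertible (hω.pos x)) (hω.invariant x)]
  pos x a ha := by
    change 0 < pair (-(adConj lam (fun i => fundField (ζ i) x) t _ _)) _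
    simp only [adConj_apply, adBiv_cancel_neg]
    have ha' : adBiv lam (fun i => fundField (ζ i) x) (-t) a ≠ 0 := fun h => ha (by
      rw [← adBiv_neg_cancel lam (fun i => fundField (ζ i) x) t a, h, map_zero])
    have := symplJ_pos (hω.closed.degree x) (contrC_isInvertible (hω.pos x)) (hω.pos x) ha'
    rw [← pair_adBiv lam (fun i => fundField (ζ i) x) t, adBiv_neg_cancel, map_neg] at this
    exact this

end

/-! ### The volume form of the Kähler metric -/

theorem eq_smul_hvol_of_annihilates {φ : CForm n}
    (h : ∀ c, cliff c φ + Complex.I • cliff (ofComplex (stdJ n) c) φ = 0) :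
    φ = hcoef φ • hvol n := by
  refine eq_hcoef_smul_hvol (fun j => ?_) (fun v => ?_)
  · have := h (0, dxCov j)
    simp only [cliff_apply, ofComplex_apply, map_zero, cint_zero, LinearMap.zero_apply,
      zero_add] at this
    rw [ιz_apply]
    rw [← smul_mul_assoc, ← add_mul] at this
    have e : Complex.imCLM.comp (dz j) = -(dxCov j).comp (stdJ n) := by
      ext v
      simp [dxCov, dz, stdJ_apply]
    rw [e]
    exact this
  · have := h (v, 0)
    simp only [cliff_apply, ofComplex_apply, ContinuousLinearMap.zero_comp, neg_zero, map_zero,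
      zero_mul, add_zero] at this
    simp only [cint01, LinearMap.smul_apply, LinearMap.add_apply, this, smul_zero]

theorem sigma_pullC (A : Cn n →L[ℝ] Cn n) (X : CForm n) :
    sigma (pullC A X) = pullC A (sigma X) := by
  induction X using cform_left_induction with
  | h1 => simp [sigma_one]
  | hadd X Y hX hY => simp only [map_add, hX, hY]
  | hsmul c X hX => simp only [map_smul, hX]
  | hmul ξ X hX => rw [map_mul, sigma_mul, hX, pullC_ιc, sigma_ιc, sigma_mul, map_mul, sigma_ιc,
      pullC_ιc]

theorem sigma_sigma (X : CForm n) : sigma (sigma X) = X := by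
  induction X using cform_left_induction with
  | h1 => simp [sigma_one]
  | hadd X Y hX hY => simp only [map_add, hX, hY]
  | hsmul c X hX => simp only [map_smul, hX]
  | hmul ξ X hX => rw [sigma_mul, sigma_mul, hX, sigma_ιc, sigma_ιc]

/-- The form `Ω ∧ σ(Ω̄)` of top degree for `Ω = dz_1 ∧ ⋯ ∧ dz_n`. -/
def topVol (n : ℕ) : CForm n := hvol n * sigma (conjF (hvol n))

theorem conjF_cint01 (v : Cn n) (X : CForm n) : conjF (cint01 v X) = cint10 v (conjF X) := by
  simp only [cint01, cint10, LinearMap.smul_apply, LinearMap.add_apply, LinearMap.sub_apply,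
    conjF_smul, map_add, conjF_cint, Complex.conj_I]
  rw [neg_smul, ← sub_eq_add_neg]
  congr 1
  simp [map_ofNat (starRingEnd ℂ) 2]

theorem topVol_ne_zero : topVol n ≠ 0 := by
  intro h
  set X := sigma (conjF (hvol n)) with hX
  have h1 : ∀ v : Cn n, cint10 v X = 0 := by
    intro v
    have h2 : cint10 v (conjF (hvol n)) = 0 := by rw [← conjF_cint01, cint01_hvol, map_zero]
    have h3 : eps (sigma (cint10 v (conjF (hvol n)))) = cint10 v X := by
      simp only [cint10, LinearMap.smul_apply, LinearMap.sub_apply, map_smul, map_sub, sigma_cint,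
        eps_eps, hX]
    rw [← h3, h2, map_zero, map_zero]
  have h4 := frameContr_frameProd_mul (fun j k X => cint10_dz_mul j k X) (List.nodup_finRange n)
    (φ := X) (fun k => h1 _)
  change frameContr _ _ (topVol n) = X at h4
  rw [h, map_zero] at h4
  have h5 := congrArg sigma h4
  rw [map_zero, hX, sigma_sigma] at h5
  have h6 := congrArg conjF h5
  rw [map_zero, conjF_conjF] at h6
  exact hvol_ne_zero h6.symm

theorem lieOp_topVol {A : Cn n →L[ℝ] Cn n} (hA : ∀ v, A (stdJ n v) = stdJ n (A v)) :
    lieOp A (topVol n) = ((2 * (cdiv A).re : ℝ) : ℂ) • topVol n := by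
  have h := lieOp_hvol hA
  rw [topVol, lieOp_mul, ← sigma_lieOp, ← conjF_lieOp, h, conjF_smul, map_smul, smul_mul_assoc,
    mul_smul_comm, ← add_smul]
  congr 1
  exact (Complex.add_conj (cdiv A)).trans (by push_cast; rfl)

theorem topPart_mukai (X Y : CForm n) : topPart (mukai X Y) = mukai X Y := by
  rw [mukai, topPart_eq, projC_projC, if_pos rfl]

theorem mukai_pullC_hvol (A : Cn n →L[ℝ] Cn n) :
    mukai (pullC A (hvol n)) (conjF (pullC A (hvol n))) = topPart (pullC A (topVol n)) := by
  rw [mukai, conjF_pullC, sigma_pullC, ← map_mul]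
  rfl

theorem lieOp_pow (A : Cn n →L[ℝ] Cn n) {X : CForm n} (hX : eps X = X) (k : ℕ) :
    lieOp A (X ^ (k + 1)) = ((k + 1 : ℕ) : ℂ) • (lieOp A X * X ^ k) := by
  induction k with
  | zero => simp
  | succ k ih =>
    have hc := (commute_of_eps hX (lieOp A X)).eq
    rw [pow_succ' X (k + 1), lieOp_mul, ih, mul_smul_comm, ← mul_assoc, hc, mul_assoc, ← pow_succ',
      Nat.cast_succ (k + 1), add_smul, one_smul, add_comm]

theorem fderiv_fpow {s : Cn n → CForm n} {y : Cn n} (hs : DifferentiableAt ℝ s y)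
    (he : eps (s y) = s y) (k : ℕ) (v : Cn n) : fderiv ℝ (fun z => s z ^ (k + 1)) y v =
      ((k + 1 : ℕ) : ℂ) • (fderiv ℝ s y v * s y ^ k) := by
  have hp : ∀ k : ℕ, DifferentiableAt ℝ (fun z => s z ^ k) y := fun k => by
    induction k with
    | zero => simp
    | succ k ih => simpa only [pow_succ] using differentiableAt_fmul ih hs
  induction k with
  | zero => simp
  | succ k ih =>
    have hc := (commute_of_eps he (fderiv ℝ s y v)).eq
    have := fderiv_fmul hs (hp (k + 1)) v
    simp only [pow_succ' _ (k + 1)]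
    rw [this, ih, mul_smul_comm, ← mul_assoc, hc, mul_assoc, ← pow_succ', Nat.cast_succ (k + 1),
      add_smul, one_smul]

section

variable {M : Type*} [TopologicalSpace M] [ChartedSpace (Cn n) M] {ω₀ : M → RForm n}

/-- The Kähler form in the chart at `x₀`. -/
def omegaRep (ω₀ : M → RForm n) (x₀ : M) (y : Cn n) : RForm n :=
  pullR (dChartSymm x₀ y) (ω₀ ((chartC x₀).symm y))

theorem toC_omegaRep (x₀ : M) (y : Cn n) :
    toC (omegaRep ω₀ x₀ y) = formRep x₀ (fun x => toC (ω₀ x)) y := (formRep_toC x₀ ω₀ y).symm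

theorem omegaRep_mem (hω : IsKahler ω₀) (x₀ : M) (y : Cn n) :
    omegaRep ω₀ x₀ y ∈ degreePart n 2 := pullR_mem (hω.closed.degree _) _

theorem eval2_omegaRep (hω : IsKahler ω₀) (x₀ : M) (y u v : Cn n) : eval2 (omegaRep ω₀ x₀ y) u v =
    eval2 (ω₀ ((chartC x₀).symm y)) (dChartSymm x₀ y u) (dChartSymm x₀ y v) :=
  eval2_pullR (hω.closed.degree _) _ _ _

theorem contDiffAt_omegaRep (hω : IsKahler ω₀) {x₀ : M} {y : Cn n} (hy : y ∈ (chartC x₀).target) :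
    ContDiffAt ℝ ∞ (fun z => toC (omegaRep ω₀ x₀ z)) y := by
  simp only [toC_omegaRep]
  exact (smoothForm_iff isOpen_univ).mp hω.closed.smooth x₀ y hy (Set.mem_univ _)

theorem toC_pullR_dChart [hM : IsManifold 𝓘(ℂ, Cn n) ∞ M] {x₀ x : M}
    (hx : x ∈ (chartC (n := n) x₀).source) :
    pullC (dChart x₀ x) (toC (omegaRep ω₀ x₀ (chartC x₀ x))) = toC (ω₀ x) := by
  rw [toC_omegaRep]
  exact pullC_dChart_formRep hx fun x => toC (ω₀ x)

variable [hM : IsManifold 𝓘(ℂ, Cn n) ∞ M]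

theorem omegaRep_inv (hω : IsKahler ω₀) {x₀ : M} {y : Cn n} (hy : y ∈ (chartC x₀).target)
    (u v : Cn n) : eval2 (omegaRep ω₀ x₀ y) (stdJ n u) (stdJ n v) = eval2 (omegaRep ω₀ x₀ y) u v := by
  rw [eval2_omegaRep hω, eval2_omegaRep hω, dChartSymm_stdJ hy, dChartSymm_stdJ hy, hω.invariant]

theorem omegaRep_pos (hω : IsKahler ω₀) {x₀ : M} {y : Cn n} (hy : y ∈ (chartC x₀).target)
    (u : Cn n) (hu : u ≠ 0) : 0 < eval2 (omegaRep ω₀ x₀ y) (stdJ n u) u :=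
  pullR_pos (hω.closed.degree _) (hω.pos _) _ (dChart x₀ _) (dChart_dChartSymm hy)
    (dChartSymm_stdJ hy) u hu

theorem hermMatrix_eq (hω : IsKahler ω₀) {x₀ : M} {y : Cn n} (hy : y ∈ (chartC x₀).target) :
    hermMatrix ω₀ x₀ y = hmat (omegaRep ω₀ x₀ y) := by
  ext j k
  simp only [hermMatrix, hmat, Matrix.of_apply, metric, eval2_omegaRep hω, dChartSymm_stdJ hy]

theorem det_hermMatrix_pos (hω : IsKahler ω₀) {x₀ : M} {y : Cn n} (hy : y ∈ (chartC x₀).target) :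
    0 < (hermMatrix ω₀ x₀ y).det.re ∧ (hermMatrix ω₀ x₀ y).det.im = 0 := by
  rw [hermMatrix_eq hω hy]
  exact hmat_det_pos (omegaRep_mem hω x₀ y) (omegaRep_inv hω hy) (omegaRep_pos hω hy)

theorem det_hermMatrix_re (hω : IsKahler ω₀) {x₀ : M} {y : Cn n} (hy : y ∈ (chartC x₀).target) :
    ((hermMatrix ω₀ x₀ y).det.re : ℂ) = (hermMatrix ω₀ x₀ y).det :=
  Complex.ext rfl (by rw [Complex.ofReal_im, (det_hermMatrix_pos hω hy).2])

/-- The volume formula `(2iω)ⁿ = n! det h · Ω ∧ σ(Ω̄)` in a chart. -/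
theorem omegaRep_pow (hω : IsKahler ω₀) {x₀ : M} {y : Cn n} (hy : y ∈ (chartC x₀).target) :
    ((n.factorial : ℂ)⁻¹) • ((2 * Complex.I) • toC (omegaRep ω₀ x₀ y)) ^ n =
      ((hermMatrix ω₀ x₀ y).det.re : ℂ) • topVol n := by
  have h0 : (n.factorial : ℂ) ≠ 0 := by exact_mod_cast n.factorial_ne_zero
  rw [two_I_omega_pow (omegaRep_mem hω x₀ y) (omegaRep_inv hω hy), ← hermMatrix_eq hω hy, smul_smul,
    inv_mul_cancel₀ h0, one_smul, det_hermMatrix_re hω hy]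
  rfl

theorem contDiffAt_det_hermMatrix (hω : IsKahler ω₀) {x₀ : M} {y : Cn n}
    (hy : y ∈ (chartC x₀).target) : ContDiffAt ℝ ∞ (fun z => (hermMatrix ω₀ x₀ z).det.re) y := by
  -- the determinant is a coordinate of the smooth form `(2iω)ⁿ`
  obtain ⟨j, hj⟩ : ∃ j, formCoords n (topVol n) j ≠ 0 := by
    by_contra! h
    exact topVol_ne_zero ((formCoords n).injective (by rw [map_zero]; exact funext h))
  have h1 : ContDiffAt ℝ ∞ (fun z => formCoords n (((n.factorial : ℂ)⁻¹) •
      ((2 * Complex.I) • toC (omegaRep ω₀ x₀ z)) ^ n) j) y :=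
    contDiffAt_coord (contDiffAt_csmul_const _ (contDiffAt_fpow
      (contDiffAt_csmul_const _ (contDiffAt_omegaRep hω hy)) n)) j
  have h2 : ContDiffAt ℝ ∞ (fun z => ((formCoords n (((n.factorial : ℂ)⁻¹) •
      ((2 * Complex.I) • toC (omegaRep ω₀ x₀ z)) ^ n) j) * (formCoords n (topVol n) j)⁻¹).re) y :=
    Complex.reCLM.contDiff.contDiffAt.comp y (h1.mul contDiffAt_const)
  refine h2.congr_of_eventuallyEq ?_
  filter_upwards [(isOpen_extChartAt_target x₀).mem_nhds hy] with z hz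
  rw [omegaRep_pow hω hz, map_smul, Pi.smul_apply, smul_eq_mul, mul_assoc, mul_inv_cancel₀ hj,
    mul_one, Complex.ofReal_re]

theorem contDiffAt_logDet (hω : IsKahler ω₀) {x₀ : M} {y : Cn n}
    (hy : y ∈ (chartC x₀).target) : ContDiffAt ℝ ∞ (logDet ω₀ x₀) y :=
  (contDiffAt_det_hermMatrix hω hy).log (det_hermMatrix_pos hω hy).1.ne'

variable [MulAction (Fin m → Circle) M]

/-- The flow of a fundamental vector field preserves the volume form; hence
`V (log det h) = -2 Re div V` in holomorphic coordinates. -/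
theorem fderiv_logDet_fieldRep (hT : IsKahlerTorusAction (m := m) ω₀) (hω : IsKahler ω₀)
    (ζ : Fin m → ℝ) {x₀ : M} {y : Cn n} (hy : y ∈ (chartC x₀).target) :
    fderiv ℝ (logDet ω₀ x₀) y (fieldRep x₀ ζ y) = -2 * (cdiv (fderiv ℝ (fieldRep x₀ ζ) y)).re := by
  set v := fieldRep x₀ ζ y
  set A := fderiv ℝ (fieldRep x₀ ζ) y
  set s : Cn n → CForm n := fun z => (2 * Complex.I) • toC (omegaRep ω₀ x₀ z) with hs
  set H : Cn n → ℝ := fun z => (hermMatrix ω₀ x₀ z).det.re with hH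
  have hws := (contDiffAt_omegaRep hω hy).differentiableAt (by simp : (∞ : WithTop ℕ∞) ≠ 0)
  have hsd : DifferentiableAt ℝ s y := differentiableAt_csmul_const _ hws
  have hse : eps (s y) = s y := by
    rw [hs]; simp only [map_smul]; rw [eps_two_form (omegaRep_mem hω x₀ y)]
  have hL : fderiv ℝ s y v + lieOp A (s y) = 0 := by
    have h := lie_form hT hω.closed ζ hy
    simp only [← toC_omegaRep] at h
    rw [fderiv_csmul_const _ hws, map_smul, ← smul_add]
    have e : (formRep x₀ fun x => toC (ω₀ x)) = fun z => toC (omegaRep ω₀ x₀ z) :=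
      funext fun z => (toC_omegaRep x₀ z).symm
    rw [e] at h
    rw [h, smul_zero]
  have hLn : fderiv ℝ (fun z => s z ^ n) y v + lieOp A (s y ^ n) = 0 := by
    rcases Nat.eq_zero_or_pos n with h0 | h0
    · have e : ∀ X : CForm n, X ^ n = 1 := fun X => by
        have : X ^ n = X ^ 0 := congrArg (fun k => X ^ k) h0
        rw [this, pow_zero]
      simp only [e, lieOp_one]
      simp
    · obtain ⟨k, hk⟩ := Nat.exists_eq_succ_of_ne_zero h0.ne'
      have e : ∀ X : CForm n, X ^ n = X ^ (k + 1) := fun X => congrArg (fun k => X ^ k) hk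
      simp only [e]
      rw [fderiv_fpow hsd hse, lieOp_pow A hse, ← smul_add, ← add_mul, hL, zero_mul, smul_zero]
  have hHd : DifferentiableAt ℝ H y := (contDiffAt_det_hermMatrix hω hy).differentiableAt (by simp)
  have hHd' : DifferentiableAt ℝ (fun z => (H z : ℂ)) y := Complex.ofRealCLM.differentiableAt.comp y hHd
  have hpow : ∀ z ∈ (chartC (n := n) x₀).target, s z ^ n =
      (n.factorial : ℂ) • (H z : ℂ) • topVol n := fun z hz => by
    have h0 : (n.factorial : ℂ) ≠ 0 := by exact_mod_cast n.factorial_ne_zero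
    rw [hH, ← omegaRep_pow hω hz, smul_smul, mul_inv_cancel₀ h0, one_smul]
  have hd1 : fderiv ℝ (fun z => s z ^ n) y v =
      (n.factorial : ℂ) • ((fderiv ℝ H y v : ℝ) : ℂ) • topVol n := by
    have e : (fun z => s z ^ n) =ᶠ[nhds y] fun z => (n.factorial : ℂ) • (H z : ℂ) • topVol n := by
      filter_upwards [(isOpen_extChartAt_target x₀).mem_nhds hy] with z hz using hpow z hz
    have hc : DifferentiableAt ℝ (fun z => (H z : ℂ) • topVol n) y :=
      differentiableAt_csmul hHd' (differentiableAt_const _)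
    rw [e.fderiv_eq, fderiv_csmul_const _ hc, fderiv_csmul hHd' (differentiableAt_const _)]
    have e3 : fderiv ℝ (fun z => (H z : ℂ)) y v = ((fderiv ℝ H y v : ℝ) : ℂ) := by
      have := (Complex.ofRealCLM.hasFDerivAt.comp y hHd.hasFDerivAt).fderiv
      exact congrArg (fun T => T v) this
    rw [e3]
    simp
  rw [hd1, hpow y hy, map_smul, map_smul, lieOp_topVol (fun w => fderiv_fieldRep_stdJ hT ζ hy w),
    ← smul_add, smul_smul, ← add_smul] at hLn
  have h0 : (n.factorial : ℂ) ≠ 0 := by exact_mod_cast n.factorial_ne_zero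
  have h1 := (smul_eq_zero.mp ((smul_eq_zero.mp hLn).resolve_left h0)).resolve_right topVol_ne_zero
  have h2 : fderiv ℝ H y v + H y * (2 * (cdiv A).re) = 0 := by exact_mod_cast h1
  have hpos : 0 < H y := (det_hermMatrix_pos hω hy).1
  have h3 : fderiv ℝ (logDet ω₀ x₀) y v = (H y)⁻¹ * fderiv ℝ H y v := by
    have := (hHd.hasFDerivAt.log hpos.ne').fderiv
    exact congrArg (fun T => T v) this
  rw [h3, eq_neg_of_add_eq_zero_left h2]
  field_simp

end

/-! ### Trivializations of the canonical bundle -/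

theorem adConj_neg_adConj (lam : Fin m → Fin m → ℝ) (v : Fin m → Cn n) (t : ℝ)
    (𝒥 : GT n →ₗ[ℝ] GT n) : adConj lam v (-t) (adConj lam v t 𝒥) = 𝒥 := by
  refine LinearMap.ext fun a => ?_
  rw [adConj_apply, adConj_apply, neg_neg, adBiv_cancel_neg, adBiv_cancel_neg]

/-- A smooth complex function that does not vanish at a point is, near that point, of the form
`C e^{a + i g}` with real functions `a` and `g` that are smooth there. -/
theorem exists_local_log {c : Cn n → ℂ} {y : Cn n} (hc : ContDiffAt ℝ ∞ c y) (h0 : c y ≠ 0) :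
    ∃ a g : Cn n → ℝ, ContDiffAt ℝ ∞ a y ∧ ContDiffAt ℝ ∞ g y ∧
      ∀ᶠ z in nhds y, c z = c y * Complex.exp (a z + g z * Complex.I) := by
  have h1 : ContDiffAt ℝ ∞ (fun z => c z / c y) y := by
    simp only [div_eq_mul_inv]; exact hc.mul contDiffAt_const
  have hs : c y / c y ∈ Complex.slitPlane := by rw [div_self h0]; exact Complex.one_mem_slitPlane
  have hl : ContDiffAt ℝ ∞ Complex.log (c y / c y) :=
    (Complex.contDiffAt_log hs).restrict_scalars ℝ
  have h2 : ContDiffAt ℝ ∞ (fun z => Complex.log (c z / c y)) y :=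
    ContDiffAt.comp (f := fun z => c z / c y) y hl h1
  refine ⟨fun z => (Complex.log (c z / c y)).re, fun z => (Complex.log (c z / c y)).im,
    Complex.reCLM.contDiff.contDiffAt.comp y h2, Complex.imCLM.contDiff.contDiffAt.comp y h2, ?_⟩
  filter_upwards [hc.continuousAt.eventually_ne h0] with z hz
  rw [Complex.re_add_im, Complex.exp_log (div_ne_zero hz h0), mul_div_cancel₀ _ h0]

/-- The derivative of `C e^{a + i g}`. -/
theorem fderiv_exp_local {c : Cn n → ℂ} {C : ℂ} {a g : Cn n → ℝ} {y : Cn n}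
    (ha : DifferentiableAt ℝ a y) (hg : DifferentiableAt ℝ g y)
    (hc : c =ᶠ[nhds y] fun z => C * Complex.exp (a z + g z * Complex.I)) (v : Cn n) :
    fderiv ℝ c y v = c y * (fderiv ℝ a y v + fderiv ℝ g y v * Complex.I) := by
  have h1 : HasFDerivAt (fun z => (a z : ℂ)) (Complex.ofRealCLM.comp (fderiv ℝ a y)) y :=
    Complex.ofRealCLM.hasFDerivAt.comp y ha.hasFDerivAt
  have h2 : HasFDerivAt (fun z => (g z : ℂ)) (Complex.ofRealCLM.comp (fderiv ℝ g y)) y :=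
    Complex.ofRealCLM.hasFDerivAt.comp y hg.hasFDerivAt
  have h3 := ((h1.add (h2.mul_const Complex.I)).cexp.const_mul C).fderiv
  rw [hc.fderiv_eq, hc.eq_of_nhds]
  refine (congrArg (fun T : Cn n →L[ℝ] ℂ => T v) h3).trans ?_
  simp
  ring

/-- Multiplying a generator of the canonical bundle by `c`, with `dc = c (α + i γ)`, changes `η` to
`η + α + 𝒥 γ`. -/
theorem eta_smul {𝒥 : GT n →ₗ[ℝ] GT n} (h𝒥 : ∀ a, 𝒥 (𝒥 a) = -a) {φ : CForm n} (hφ : Induces φ 𝒥)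
    {e η : GT n} {α γ : Cov n} (h : cliff η φ = (ιc α + Complex.I • ιc γ) * φ + cliff e φ) :
    η = e + (0, α) + 𝒥 (0, γ) := by
  have h1 := hφ.annihilates h𝒥 (𝒥 (0, γ))
  rw [h𝒥, cliff_neg] at h1
  have h2 : ∀ ξ : Cov n, cliff (0, ξ) φ = ιc ξ * φ := fun ξ => by
    rw [cliff_apply, cint_zero, LinearMap.zero_apply, zero_add]
  have h3 : cliff (η - (e + (0, α) + 𝒥 (0, γ))) φ + Complex.I • cliff 0 φ = 0 := by
    have h0 : cliff (0 : GT n) φ = 0 := by simp [cliff_apply, cint_zero]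
    rw [cliff_sub, cliff_add, cliff_add, h2, h, h0]
    rw [h2] at h1
    rw [eq_neg_of_add_eq_zero_left h1, add_mul, smul_mul_assoc]
    module
  have h4 := ((hφ _ _).mp h3).2
  rw [map_zero] at h4
  exact sub_eq_zero.mp (neg_eq_zero.mp h4.symm)

/-- The potential of the generalized Ricci form is a combination of the vectors `v_i` with real
coefficients, plus a covector, if the real parts of the divergences are `-½ v_i(log det h)`. -/
theorem potential_eq (lam : Fin m → Fin m → ℝ) (v : Fin m → Cn n) (t : ℝ) (c : Fin m → ℂ)
    (ℓ : Cov n) (hℓ : ∀ i, ℓ (v i) = -2 * (c i).re) :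
    -((2 : ℝ) • adConj lam v t (ofComplex (stdJ n)) (t • modVec lam v c, 0)) -
        adConj lam v t (ofComplex (stdJ n)) (0, ℓ) =
      (t • ∑ i, ∑ j, lam i j • ((2 * (c i).im - ℓ (stdJ n (v i))) • v j -
        (2 * (c j).im - ℓ (stdJ n (v j))) • v i), ℓ.comp (stdJ n)) := by
  have e1 : adConj lam v t (ofComplex (stdJ n)) (t • modVec lam v c, 0) =
      (t • stdJ n (modVec lam v c), 0) := by
    simp only [adConj_apply, adBiv_apply, ofComplex_apply, map_zero, smul_zero, add_zero,
      ContinuousLinearMap.zero_comp, neg_zero, map_smul]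
  have e2 : adConj lam v t (ofComplex (stdJ n)) (0, ℓ) =
      (-(t • stdJ n (bivSharp lam v ℓ)) - t • bivSharp lam v (ℓ.comp (stdJ n)),
        -(ℓ.comp (stdJ n))) := by
    simp only [adConj_apply, adBiv_apply, ofComplex_apply, zero_add, map_neg, map_smul, neg_smul,
      smul_neg, sub_eq_add_neg]
  rw [e1, e2]
  refine Prod.ext ?_ (by simp)
  change -((2 : ℝ) • t • stdJ n (modVec lam v c)) - (-(t • stdJ n (bivSharp lam v ℓ)) -
    t • bivSharp lam v (ℓ.comp (stdJ n))) = t • _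
  have e3 : -((2 : ℝ) • t • stdJ n (modVec lam v c)) - (-(t • stdJ n (bivSharp lam v ℓ)) -
      t • bivSharp lam v (ℓ.comp (stdJ n))) = t • (stdJ n (bivSharp lam v ℓ) -
        (2 : ℝ) • stdJ n (modVec lam v c) + bivSharp lam v (ℓ.comp (stdJ n))) := by module
  rw [e3]
  congr 1
  simp only [bivSharp_apply, modVec, map_sum, Finset.smul_sum, ← Finset.sum_sub_distrib,
    ← Finset.sum_add_distrib]
  refine Finset.sum_congr rfl fun i _ => Finset.sum_congr rfl fun j _ => ?_
  funext k
  rw [hℓ, hℓ]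
  simp only [stdJ_apply, ContinuousLinearMap.comp_apply, Pi.add_apply, Pi.sub_apply, Pi.smul_apply,
    smul_eq_mul, Complex.real_smul]
  have hi := Complex.re_add_im (c i)
  have hj := Complex.re_add_im (c j)
  conv_lhs => rw [← hi, ← hj]
  simp only [Complex.add_re, Complex.ofReal_re, Complex.mul_re, Complex.I_re, Complex.I_im,
    Complex.ofReal_im]
  push_cast
  linear_combination (2 * (lam i j : ℂ) * ((c j).im * v i k - (c i).im * v j k)) * Complex.I_mul_I

theorem contr_form_smul (r : ℝ) (α : RForm n) (u : Cn n) : contr (r • α) u = r • contr α u := by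
  refine ContinuousLinearMap.ext fun w => ?_
  change ExteriorAlgebra.algebraMapInv (rint w (rint u (r • α))) =
    r * ExteriorAlgebra.algebraMapInv (rint w (rint u α))
  simp

theorem contr_form_neg (α : RForm n) (u : Cn n) : contr (-α) u = -contr α u := by
  refine ContinuousLinearMap.ext fun w => ?_
  change ExteriorAlgebra.algebraMapInv (rint w (rint u (-α))) =
    -ExteriorAlgebra.algebraMapInv (rint w (rint u α))
  simp

section

variable {M : Type*} [TopologicalSpace M] [ChartedSpace (Cn n) M]

theorem gtRep_add (x₀ : M) (a b : M → GT n) (y : Cn n) :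
    gtRep x₀ (fun x => a x + b x) y = gtRep x₀ a y + gtRep x₀ b y := by
  simp only [gtRep, Prod.fst_add, Prod.snd_add, map_add, ContinuousLinearMap.add_comp]
  rfl

theorem gtRep_smul (x₀ : M) (r : ℝ) (a : M → GT n) (y : Cn n) :
    gtRep x₀ (fun x => r • a x) y = r • gtRep x₀ a y := by
  simp only [gtRep, Prod.smul_fst, Prod.smul_snd, map_smul, ContinuousLinearMap.smul_comp]
  rfl

theorem gtRep_neg (x₀ : M) (a : M → GT n) (y : Cn n) :
    gtRep x₀ (fun x => -a x) y = -gtRep x₀ a y := by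
  simp only [gtRep, Prod.fst_neg, Prod.snd_neg, map_neg, ContinuousLinearMap.neg_comp]
  rfl

theorem formRep_conjF (x₀ : M) (s : M → CForm n) (y : Cn n) :
    formRep x₀ (fun x => conjF (s x)) y = conjF (formRep x₀ s y) := by
  rw [formRep, formRep, conjF_pullC]

theorem fderiv_conjF {s : Cn n → CForm n} {y : Cn n} (hs : DifferentiableAt ℝ s y) (v : Cn n) :
    fderiv ℝ (fun z => conjF (s z)) y v = conjF (fderiv ℝ s y v) :=
  fderiv_lin conjF.toLinearMap hs v

theorem flatD_conjF {s : Cn n → CForm n} {y : Cn n} (hs : DifferentiableAt ℝ s y) :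
    flatD (fun z => conjF (s z)) y = conjF (flatD s y) := by
  rw [flatD_eq, flatD_eq, conjF_altD]
  congr 1
  funext v
  exact fderiv_conjF hs v

variable [hM : IsManifold 𝓘(ℂ, Cn n) ∞ M]

/-- The differential of a function in a chart. -/
theorem dReal_eq {f : M → ℝ} {x₀ x : M} (hx : x ∈ (chartC (n := n) x₀).source)
    (hf : DifferentiableAt ℝ (fun z => f ((chartC (n := n) x₀).symm z)) (chartC x₀ x)) :
    dReal (n := n) f x =
      (fderiv ℝ (fun z => f ((chartC (n := n) x₀).symm z)) (chartC x₀ x)).comp (dChart x₀ x) := by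
  have e : f =ᶠ[nhds x] (fun z => f ((chartC (n := n) x₀).symm z)) ∘ chartC (n := n) x₀ := by
    filter_upwards [(isOpen_extChartAt_source (I := 𝓘(ℝ, Cn n)) x₀).mem_nhds hx] with x' hx'
    rw [Function.comp_apply, (chartC (n := n) x₀).left_inv hx']
  have h := mfderiv_comp x hf.mdifferentiableAt (mdiff_chart hx)
  rw [mfderiv_eq_fderiv] at h
  rw [dReal, e.mfderiv_eq]
  exact h

theorem gtRep_dReal {f : M → ℝ} {x₀ : M} {y : Cn n} (hy : y ∈ (chartC x₀).target)
    (hf : DifferentiableAt ℝ (fun z => f ((chartC (n := n) x₀).symm z)) y) :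
    gtRep x₀ (fun x => ((0, dReal f x) : GT n)) y =
      (0, fderiv ℝ (fun z => f ((chartC (n := n) x₀).symm z)) y) := by
  have h1 : chartC (n := n) x₀ ((chartC x₀).symm y) = y := (chartC x₀).right_inv hy
  have h := dReal_eq ((chartC x₀).map_target hy) (by rwa [h1])
  rw [h1] at h
  simp only [gtRep, map_zero]
  rw [h]
  refine Prod.ext rfl (ContinuousLinearMap.ext fun v => ?_)
  exact congrArg _ (dChart_dChartSymm hy v)

variable [MulAction (Fin m → Circle) M] {ω₀ : M → RForm n}

theorem gtRep_deformedJ (hT : IsKahlerTorusAction (m := m) ω₀) (lam : Fin m → Fin m → ℝ)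
    (ζ : Fin m → Fin m → ℝ) (t : ℝ) {x₀ : M} {y : Cn n} (hy : y ∈ (chartC x₀).target)
    (a : M → GT n) : gtRep x₀ (fun x => deformedJ lam (fun i => fundField (ζ i)) t x (a x)) y =
      adConj lam (fun i => fieldRep x₀ (ζ i) y) t (ofComplex (stdJ n)) (gtRep x₀ a y) := by
  rw [adConj_apply, ← gtRep_adBiv hT lam ζ (-t) hy, ← gtRep_ofComplex hy, ← gtRep_adBiv hT lam ζ t hy]
  rfl

theorem symm_chart_fieldRep (hT : IsKahlerTorusAction (m := m) ω₀) (ζ : Fin m → ℝ) {x₀ : M}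
    {y : Cn n} (hy : y ∈ (chartC x₀).target) :
    dChartSymm x₀ y (fieldRep x₀ ζ y) = fundField ζ ((chartC x₀).symm y) := by
  rw [← dChart_fundField hT ζ hy, dChartSymm_dChart' hy]

end

section

variable {M : Type*} [TopologicalSpace M] [ChartedSpace (Cn n) M] [MulAction (Fin m → Circle) M]
  {ω₀ : M → RForm n} {μ : M → Module.Dual ℝ (Fin m → ℝ)}

/-- The coefficient `c` of a spinor `φ = c e^{tβ} · (dz_1 ∧ ⋯ ∧ dz_n)` in the chart at `x₀`. -/
def coefRep (lam : Fin m → Fin m → ℝ) (ζ : Fin m → Fin m → ℝ) (t : ℝ) (x₀ : M) (φ : M → CForm n)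
    (y : Cn n) : ℂ := hcoef (expBiv lam (fun i => fieldRep x₀ (ζ i) y) (-t) (formRep x₀ φ y))

variable [hM : IsManifold 𝓘(ℂ, Cn n) ∞ M]

theorem mukai_deformedPsi (hT : IsKahlerTorusAction (m := m) ω₀) (hω : IsKahler ω₀)
    (hμ : IsMomentMap ω₀ μ) (lam : Fin m → Fin m → ℝ) (ζ : Fin m → Fin m → ℝ) (t : ℝ) {x₀ x : M}
    (hx : x ∈ (chartC (n := n) x₀).source) :
    mukai (deformedPsi ω₀ lam (fun i => fundField (ζ i)) t x)
        (conjF (deformedPsi ω₀ lam (fun i => fundField (ζ i)) t x)) =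
      ((hermMatrix ω₀ x₀ (chartC x₀ x)).det.re : ℂ) • pullC (dChart x₀ x) (topVol n) := by
  rw [deformedPsi_eq hT hω.closed hμ, mukai_nexp (bField_mem ω₀ lam ζ t x) (hω.closed.degree x),
    ← toC_pullR_dChart hx, ← map_smul, ← map_pow, ← map_smul,
    omegaRep_pow hω ((chartC x₀).map_source hx), map_smul]

theorem mukai_deformedPsi_ne_zero (hT : IsKahlerTorusAction (m := m) ω₀) (hω : IsKahler ω₀)
    (hμ : IsMomentMap ω₀ μ) (lam : Fin m → Fin m → ℝ) (ζ : Fin m → Fin m → ℝ) (t : ℝ) (x : M) :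
    mukai (deformedPsi ω₀ lam (fun i => fundField (ζ i)) t x)
        (conjF (deformedPsi ω₀ lam (fun i => fundField (ζ i)) t x)) ≠ 0 := by
  rw [mukai_deformedPsi hT hω hμ lam ζ t (mem_extChartAt_source x), dChart_self, pullC_id]
  refine smul_ne_zero ?_ topVol_ne_zero
  exact_mod_cast (det_hermMatrix_pos hω (mem_extChartAt_target x)).1.ne'

theorem mukai_stdSpinor (hT : IsKahlerTorusAction (m := m) ω₀) (hω : IsKahler ω₀)
    (hμ : IsMomentMap ω₀ μ) (lam : Fin m → Fin m → ℝ) (ζ : Fin m → Fin m → ℝ) (t : ℝ) {x₀ x : M}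
    (hx : x ∈ (chartC (n := n) x₀).source) :
    mukai (stdSpinor lam ζ t x₀ x) (conjF (stdSpinor lam ζ t x₀ x)) =
      (((hermMatrix ω₀ x₀ (chartC x₀ x)).det.re)⁻¹ : ℝ) •
        mukai (deformedPsi ω₀ lam (fun i => fundField (ζ i)) t x)
          (conjF (deformedPsi ω₀ lam (fun i => fundField (ζ i)) t x)) := by
  have h0 : ((hermMatrix ω₀ x₀ (chartC x₀ x)).det.re : ℂ) ≠ 0 := by
    exact_mod_cast (det_hermMatrix_pos hω ((chartC x₀).map_source hx)).1.ne'
  have h1 := mukai_deformedPsi hT hω hμ lam ζ t hx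
  have h2 := congrArg topPart h1
  rw [topPart_mukai, h1, map_smul] at h2
  rw [stdSpinor, conjF_expBiv, mukai_expBiv, mukai_pullC_hvol, h1, real_smul_eq, smul_smul,
    Complex.ofReal_inv, inv_mul_cancel₀ h0, one_smul]
  exact (smul_right_injective _ h0 h2).symm

theorem isTrivialization_stdSpinor (hT : IsKahlerTorusAction (m := m) ω₀) (hω : IsKahler ω₀)
    (hμ : IsMomentMap ω₀ μ) (lam : Fin m → Fin m → ℝ) (ζ : Fin m → Fin m → ℝ) (t : ℝ) (x₀ : M) :
    IsTrivialization (deformedJ (n := n) lam (fun i => fundField (ζ i)) t)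
      (deformedPsi ω₀ lam (fun i => fundField (ζ i)) t) (chartC (n := n) x₀).source
      (stdSpinor lam ζ t x₀) (stdEta lam ζ t x₀)
      (fun x => ((hermMatrix ω₀ x₀ (chartC x₀ x)).det.re)⁻¹) where
  isOpen := isOpen_extChartAt_source x₀
  smooth := smoothForm_stdSpinor hT lam ζ t x₀
  induces x hx := induces_stdSpinor lam ζ t hx
  eta_smooth := smoothGT_stdEta hT lam ζ t x₀
  d_eq x hx := dForm_stdSpinor hT lam ζ t hx
  rho_pos x hx := inv_pos.mpr (det_hermMatrix_pos hω ((chartC x₀).map_source hx)).1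
  rho_eq x hx := by rw [mukai_stdSpinor hT hω hμ lam ζ t hx, real_smul_eq]

theorem formRep_eq_coefRep (hT : IsKahlerTorusAction (m := m) ω₀) (lam : Fin m → Fin m → ℝ)
    (ζ : Fin m → Fin m → ℝ) (t : ℝ) {x₀ : M} {y : Cn n} (hy : y ∈ (chartC x₀).target)
    {φ : M → CForm n} (hφ : Induces (φ ((chartC x₀).symm y))
      (deformedJ lam (fun i => fundField (ζ i)) t ((chartC x₀).symm y))) :
    formRep x₀ φ y = coefRep lam ζ t x₀ φ y •
      expBiv lam (fun i => fieldRep x₀ (ζ i) y) t (hvol n) := by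
  have h1 : Induces _ (adConj lam (fun i => fundField (ζ i) ((chartC x₀).symm y)) (-t)
      (adConj lam _ t (ofComplex (stdJ n)))) := induces_expBiv hφ
  rw [adConj_neg_adConj] at h1
  have h2 := eq_smul_hvol_of_annihilates (annihilates_pullC (dChartSymm_dChart' hy)
    (dChart_dChartSymm hy) (dChartSymm_stdJ hy) (h1.annihilates ofComplex_sq))
  have h3 : pullC (dChartSymm x₀ y) (expBiv lam (fun i => fundField (ζ i) ((chartC x₀).symm y)) (-t)
      (φ ((chartC x₀).symm y))) =
        expBiv lam (fun i => fieldRep x₀ (ζ i) y) (-t) (formRep x₀ φ y) := by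
    rw [formRep, pullC_expBiv]
    simp only [symm_chart_fieldRep hT _ hy]
  rw [h3] at h2
  rw [← expBiv_neg_cancel lam (fun i => fieldRep x₀ (ζ i) y) t (formRep x₀ φ y), h2, map_smul]
  rfl

theorem contDiffAt_coefRep (hT : IsKahlerTorusAction (m := m) ω₀) (lam : Fin m → Fin m → ℝ)
    (ζ : Fin m → Fin m → ℝ) (t : ℝ) {x₀ : M} {y : Cn n} (hy : y ∈ (chartC x₀).target)
    {φ : M → CForm n} (hφ : ContDiffAt ℝ ∞ (formRep x₀ φ) y) :
    ContDiffAt ℝ ∞ (coefRep lam ζ t x₀ φ) y :=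
  contDiffAt_lin (hcoef.restrictScalars ℝ)
    (contDiffAt_expBiv lam (-t) (fun i => contDiffAt_fieldRep hT (ζ i) hy) hφ)

theorem eq_coefRep_smul_stdSpinor (hT : IsKahlerTorusAction (m := m) ω₀) (lam : Fin m → Fin m → ℝ)
    (ζ : Fin m → Fin m → ℝ) (t : ℝ) {x₀ x : M} (hx : x ∈ (chartC (n := n) x₀).source)
    {φ : M → CForm n} (hφ : Induces (φ x) (deformedJ lam (fun i => fundField (ζ i)) t x)) :
    φ x = coefRep lam ζ t x₀ φ (chartC x₀ x) • stdSpinor lam ζ t x₀ x := by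
  have hy := (chartC (n := n) x₀).map_source hx
  have h := formRep_eq_coefRep hT lam ζ t hy (φ := φ) (by rwa [(chartC x₀).left_inv hx])
  rw [← formRep_stdSpinor hT lam ζ t hy] at h
  rw [← pullC_dChart_formRep hx φ, h, map_smul, pullC_dChart_formRep hx]

/-- Two generators of the canonical bundle differ by a function `c`, and their densities by
`|c|²`. -/
theorem rho_eq_normSq (hT : IsKahlerTorusAction (m := m) ω₀) (hω : IsKahler ω₀)
    (hμ : IsMomentMap ω₀ μ) (lam : Fin m → Fin m → ℝ) (ζ : Fin m → Fin m → ℝ) (t : ℝ) {U : Set M}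
    {φ : M → CForm n} {η : M → GT n} {ρ : M → ℝ}
    (h : IsTrivialization (deformedJ (n := n) lam (fun i => fundField (ζ i)) t)
      (deformedPsi ω₀ lam (fun i => fundField (ζ i)) t) U φ η ρ) {x₀ x : M}
    (hx : x ∈ (chartC (n := n) x₀).source) (hxU : x ∈ U) :
    ρ x = Complex.normSq (coefRep lam ζ t x₀ φ (chartC x₀ x)) *
      ((hermMatrix ω₀ x₀ (chartC x₀ x)).det.re)⁻¹ := by
  have h1 := h.rho_eq x hxU
  rw [eq_coefRep_smul_stdSpinor hT lam ζ t hx (h.induces x hxU), conjF_smul, mukai_smul_left,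
    mukai_smul_right, mukai_stdSpinor hT hω hμ lam ζ t hx, real_smul_eq, smul_smul, smul_smul,
    Complex.mul_conj] at h1
  have h2 := smul_left_injective ℂ (mukai_deformedPsi_ne_zero hT hω hμ lam ζ t x) h1
  exact_mod_cast h2.symm

end

/-! ### The generalized Ricci form -/

theorem ιz_polar (c : ℂ) (α γ : Cov n) {D : Cn n →L[ℝ] ℂ}
    (hD : ∀ v, D v = c * (α v + γ v * Complex.I)) :
    ιz D = c • (ιc α + Complex.I • ιc γ) := by
  rw [ιc_eq_ιz, ιc_eq_ιz, ← map_smul, ← map_add, ← map_smul]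
  congr 1
  ext v
  rw [hD]
  simp
  ring

theorem log_normSq_exp {C : ℂ} (hC : C ≠ 0) (a g : ℝ) :
    Real.log (Complex.normSq (C * Complex.exp (a + g * Complex.I))) =
      Real.log (Complex.normSq C) + 2 * a := by
  have h : Complex.normSq (Complex.exp (a + g * Complex.I)) = Real.exp (2 * a) := by
    rw [Complex.normSq_eq_norm_sq, Complex.norm_exp, ← Real.exp_nat_mul]
    simp
  rw [Complex.normSq_mul, h, Real.log_mul (Complex.normSq_pos.mpr hC).ne' (Real.exp_pos _).ne',
    Real.log_exp]

/-- The vector part of the potential of the generalized Ricci form, for the vectors `v_i`, their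
complex divergences `c_i`, and `ℓ = d log det h`. -/
def potVec (lam : Fin m → Fin m → ℝ) (v : Fin m → Cn n) (t : ℝ) (c : Fin m → ℂ) (ℓ : Cov n) :
    Cn n :=
  t • ∑ i, ∑ j, lam i j • ((2 * (c i).im - ℓ (stdJ n (v i))) • v j -
    (2 * (c j).im - ℓ (stdJ n (v j))) • v i)

theorem contr_potVec {b : RForm n} (lam : Fin m → Fin m → ℝ) {v : Fin m → Cn n}
    (hb : ∀ i, contr b (v i) = 0) (t : ℝ) (c : Fin m → ℂ) (ℓ : Cov n) :
    contr b (potVec lam v t c ℓ) = 0 := by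
  have hb' : ∀ i, contrL b (v i) = 0 := hb
  change contrL b (potVec lam v t c ℓ) = 0
  simp only [potVec, map_smul, map_sum, map_sub, hb', smul_zero, sub_zero, Finset.sum_const_zero]

section

variable {M : Type*} [TopologicalSpace M] [ChartedSpace (Cn n) M] [MulAction (Fin m → Circle) M]
  {ω₀ : M → RForm n} {μ : M → Module.Dual ℝ (Fin m → ℝ)}

variable [hM : IsManifold 𝓘(ℂ, Cn n) ∞ M]

theorem contr_pullR_bField (hT : IsKahlerTorusAction (m := m) ω₀) (hμ : IsMomentMap ω₀ μ)
    (lam : Fin m → Fin m → ℝ) (ζ : Fin m → Fin m → ℝ) (t : ℝ) {x₀ : M} {y : Cn n}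
    (hy : y ∈ (chartC x₀).target) (k : Fin m) :
    contr (pullR (dChartSymm x₀ y) (bField ω₀ lam ζ t ((chartC x₀).symm y)))
      (fieldRep x₀ (ζ k) y) = 0 := by
  rw [contr_pullR (bField_mem _ _ _ _ _) _ (pullR_mem (bField_mem _ _ _ _ _) _),
    symm_chart_fieldRep hT (ζ k) hy, bField, contr_form_smul,
    contr_bivForm (fun i j => isotropic hT hμ (ζ i) (ζ j) _), smul_zero]
  rfl

/-- The section `η` of a trivialization in the chart, when `φ = C e^{a + ig} e^{tβ} · Ω`. -/
theorem gtRep_eta (hT : IsKahlerTorusAction (m := m) ω₀) (lam : Fin m → Fin m → ℝ)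
    (ζ : Fin m → Fin m → ℝ) (t : ℝ) {U : Set M} {ψ φ : M → CForm n} {η : M → GT n} {ρ : M → ℝ}
    (h : IsTrivialization (deformedJ (n := n) lam (fun i => fundField (ζ i)) t) ψ U φ η ρ)
    {x₀ : M} {y : Cn n} (hy : y ∈ (chartC x₀).target) (hyU : (chartC x₀).symm y ∈ U) {C : ℂ}
    (hC : C ≠ 0) {a g : Cn n → ℝ} (ha : DifferentiableAt ℝ a y) (hg : DifferentiableAt ℝ g y)
    (hc : coefRep lam ζ t x₀ φ =ᶠ[nhds y] fun z => C * Complex.exp (a z + g z * Complex.I)) :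
    gtRep x₀ η y = (t • modVec lam (fun i => fieldRep x₀ (ζ i) y)
        (fun i => cdiv (fderiv ℝ (fieldRep x₀ (ζ i)) y)), 0) + (0, fderiv ℝ a y) +
      adConj lam (fun i => fieldRep x₀ (ζ i) y) t (ofComplex (stdJ n)) (0, fderiv ℝ g y) := by
  refine eta_smul (adConj_sq ofComplex_sq) (induces_expBiv induces_hvol) ?_
  have hs := (smoothForm_iff h.isOpen).mp h.smooth x₀ y hy hyU
  have hsd := hs.differentiableAt (by simp : (∞ : WithTop ℕ∞) ≠ 0)
  have h0 : coefRep lam ζ t x₀ φ y ≠ 0 := by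
    rw [hc.eq_of_nhds]; exact mul_ne_zero hC (Complex.exp_ne_zero _)
  have e1 : flatD (formRep x₀ φ) y = cliff (gtRep x₀ η y) (formRep x₀ φ y) := by
    rw [← formRep_dForm hy hsd, ← formRep_cliff hy, formRep, formRep, h.d_eq _ hyU]
  have e2 : formRep x₀ φ =ᶠ[nhds y] fun z => coefRep lam ζ t x₀ φ z •
      expBiv lam (fun i => fieldRep x₀ (ζ i) z) t (hvol n) := by
    filter_upwards [(isOpen_inter_preimage_symm x₀ h.isOpen).mem_nhds ⟨hy, hyU⟩] with z hz using
      formRep_eq_coefRep hT lam ζ t hz.1 (h.induces _ hz.2)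
  rw [flatD_congr e2, e2.eq_of_nhds, map_smul, flatD_smul
      ((contDiffAt_coefRep hT lam ζ t hy hs).differentiableAt (by simp))
      ((contDiffAt_expBiv lam t (fun i => contDiffAt_fieldRep hT (ζ i) hy)
        (contDiffAt_const (c := hvol n))).differentiableAt (by simp)),
    flatD_stdSpinor hT lam ζ t hy, ιz_polar _ _ _ (fderiv_exp_local ha hg hc), smul_mul_assoc,
    ← smul_add] at e1
  exact (smul_right_injective _ h0 e1).symm

/-- The section `-2 𝒥 η + 𝒥 d log ρ` in the chart, when `φ = C e^{a + ig} e^{tβ} · Ω`. -/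
theorem gtRep_potential (hT : IsKahlerTorusAction (m := m) ω₀) (hω : IsKahler ω₀)
    (hμ : IsMomentMap ω₀ μ) (lam : Fin m → Fin m → ℝ) (ζ : Fin m → Fin m → ℝ) (t : ℝ) {U : Set M}
    {φ : M → CForm n} {η : M → GT n} {ρ : M → ℝ}
    (h : IsTrivialization (deformedJ (n := n) lam (fun i => fundField (ζ i)) t)
      (deformedPsi ω₀ lam (fun i => fundField (ζ i)) t) U φ η ρ) {x₀ : M} {y : Cn n}
    (hy : y ∈ (chartC x₀).target) (hyU : (chartC x₀).symm y ∈ U) {C : ℂ}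
    (hC : C ≠ 0) {a g : Cn n → ℝ} (ha : DifferentiableAt ℝ a y) (hg : DifferentiableAt ℝ g y)
    (hc : coefRep lam ζ t x₀ φ =ᶠ[nhds y] fun z => C * Complex.exp (a z + g z * Complex.I)) :
    gtRep x₀ (fun x => -((2 : ℝ) • deformedJ lam (fun i => fundField (ζ i)) t x (η x)) +
        deformedJ lam (fun i => fundField (ζ i)) t x (0, dReal (fun y => Real.log (ρ y)) x)) y =
      (potVec lam (fun i => fieldRep x₀ (ζ i) y) t
          (fun i => cdiv (fderiv ℝ (fieldRep x₀ (ζ i)) y)) (fderiv ℝ (logDet ω₀ x₀) y),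
        (2 : ℝ) • fderiv ℝ g y + (fderiv ℝ (logDet ω₀ x₀) y).comp (stdJ n)) := by
  set v : Fin m → Cn n := fun i => fieldRep x₀ (ζ i) y with hv
  set ℓ := fderiv ℝ (logDet ω₀ x₀) y with hℓ
  have hL : DifferentiableAt ℝ (logDet ω₀ x₀) y :=
    (contDiffAt_logDet hω hy).differentiableAt (by simp)
  have e1 : (fun z => Real.log (ρ ((chartC x₀).symm z))) =ᶠ[nhds y] fun z =>
      Real.log (Complex.normSq C) + (2 * a z - logDet ω₀ x₀ z) := by
    filter_upwards [(isOpen_inter_preimage_symm x₀ h.isOpen).mem_nhds ⟨hy, hyU⟩, hc] with z hz hcz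
    have h1 := rho_eq_normSq hT hω hμ lam ζ t h ((chartC x₀).map_target hz.1) hz.2
    rw [(chartC x₀).right_inv hz.1, hcz] at h1
    rw [h1, Real.log_mul, log_normSq_exp hC, Real.log_inv, logDet]
    · ring
    · exact (Complex.normSq_pos.mpr (mul_ne_zero hC (Complex.exp_ne_zero _))).ne'
    · exact inv_ne_zero (det_hermMatrix_pos hω hz.1).1.ne'
  have hd : HasFDerivAt (fun z => Real.log (Complex.normSq C) + (2 * a z - logDet ω₀ x₀ z))
      ((2 : ℝ) • fderiv ℝ a y - ℓ) y :=
    ((ha.hasFDerivAt.const_mul 2).sub hL.hasFDerivAt).const_add _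
  have hd1 := hd.congr_of_eventuallyEq e1
  rw [gtRep_add, gtRep_neg, gtRep_smul, gtRep_deformedJ hT lam ζ t hy,
    gtRep_deformedJ hT lam ζ t hy, gtRep_dReal hy hd1.differentiableAt, hd1.fderiv,
    gtRep_eta hT lam ζ t h hy hyU hC ha hg hc, map_add, map_add, adConj_sq ofComplex_sq]
  have hp := potential_eq lam v t (fun i => cdiv (fderiv ℝ (fieldRep x₀ (ζ i)) y)) ℓ
    (fun i => fderiv_logDet_fieldRep hT hω (ζ i) hy)
  have e2 : ((0, (2 : ℝ) • fderiv ℝ a y - ℓ) : GT n) = (2 : ℝ) • (0, fderiv ℝ a y) - (0, ℓ) := by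
    refine Prod.ext ?_ rfl
    simp
  rw [e2, map_sub, map_smul]
  have e3 : ∀ (ξ ξ' : Cov n) (u : Cn n), ((u, (2 : ℝ) • ξ + ξ') : GT n) =
      (u, ξ') + (2 : ℝ) • (0, ξ) := fun ξ ξ' u => by
    refine Prod.ext ?_ (add_comm _ _)
    simp
  rw [e3, potVec, ← hp]
  module

end

section

variable {M : Type*} [TopologicalSpace M] [ChartedSpace (Cn n) M] {ω₀ : M → RForm n}

variable [hM : IsManifold 𝓘(ℂ, Cn n) ∞ M]

theorem contDiffAt_fderiv_logDet (hω : IsKahler ω₀) {x₀ : M} {y : Cn n}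
    (hy : y ∈ (chartC x₀).target) : ContDiffAt ℝ ∞ (fderiv ℝ (logDet ω₀ x₀)) y :=
  (contDiffAt_logDet hω hy).fderiv_right (by norm_cast)

theorem hessLogDet_eq (hω : IsKahler ω₀) (x : M) (u v : Cn n) : hessLogDet ω₀ x u v =
    fderiv ℝ (fderiv ℝ (logDet ω₀ x)) (chartC (n := n) x x) u v := by
  have hd := (contDiffAt_fderiv_logDet hω (mem_extChartAt_target x)).differentiableAt
    (by simp : (∞ : WithTop ℕ∞) ≠ 0)
  have h := (hd.hasFDerivAt.clm_apply (hasFDerivAt_const v (chartC (n := n) x x))).fderiv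
  rw [hessLogDet]
  refine (congrArg (fun T : Cn n →L[ℝ] ℝ => T u) h).trans ?_
  simp

/-- The Einstein equation in terms of the `2`-form `d (d log det h ∘ J)`. -/
theorem hess_eq_of_isEinstein (hω : IsKahler ω₀) {κ : ℝ} (hκ : IsEinstein ω₀ κ) (x : M)
    (u v : Cn n) :
    fderiv ℝ (fderiv ℝ (logDet ω₀ x)) (chartC (n := n) x x) u (stdJ n v) -
      fderiv ℝ (fderiv ℝ (logDet ω₀ x)) (chartC (n := n) x x) v (stdJ n u) =
        -(2 * κ) * eval2 (ω₀ x) u v := by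
  have h := hκ x u (stdJ n v)
  have hs : fderiv ℝ (fderiv ℝ (logDet ω₀ x)) (chartC (n := n) x x) v (stdJ n u) =
      fderiv ℝ (fderiv ℝ (logDet ω₀ x)) (chartC (n := n) x x) (stdJ n u) v :=
    ((contDiffAt_logDet hω (mem_extChartAt_target x)).isSymmSndFDerivAt (by simp; norm_cast)) _ _
  rw [ricci, hessLogDet_eq hω, hessLogDet_eq hω, metric, hω.invariant, stdJ_stdJ, map_neg] at h
  rw [hs]
  linarith

/-- If `θ` is `d log det h ∘ J` plus an exact form, then `dθ = -2κ ω`. -/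
theorem toC_altR_eq (hω : IsKahler ω₀) {κ : ℝ} (hκ : IsEinstein ω₀ κ) (x : M) {g : Cn n → ℝ}
    (hg : ContDiffAt ℝ ∞ g (chartC (n := n) x x)) :
    toC (altR (fderiv ℝ (fun y => (2 : ℝ) • fderiv ℝ g y + (fderiv ℝ (logDet ω₀ x) y).comp (stdJ n))
      (chartC (n := n) x x))) = toC (-((2 * κ) • ω₀ x)) := by
  have hd := (contDiffAt_fderiv_logDet hω (mem_extChartAt_target x)).differentiableAt
    (by simp : (∞ : WithTop ℕ∞) ≠ 0)
  have hg1 : ContDiffAt ℝ ∞ (fderiv ℝ g) (chartC (n := n) x x) := hg.fderiv_right (by norm_cast)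
  have hg2 := hg1.differentiableAt (by simp : (∞ : WithTop ℕ∞) ≠ 0)
  have hgs : ∀ u v, fderiv ℝ (fderiv ℝ g) (chartC (n := n) x x) u v =
      fderiv ℝ (fderiv ℝ g) (chartC (n := n) x x) v u :=
    hg.isSymmSndFDerivAt (by simp; norm_cast)
  have hD : ∀ u v, fderiv ℝ (fun y => (2 : ℝ) • fderiv ℝ g y +
      (fderiv ℝ (logDet ω₀ x) y).comp (stdJ n)) (chartC (n := n) x x) u v =
        2 * fderiv ℝ (fderiv ℝ g) (chartC (n := n) x x) u v +
          fderiv ℝ (fderiv ℝ (logDet ω₀ x)) (chartC (n := n) x x) u (stdJ n v) := by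
    intro u v
    have h := ((hg2.hasFDerivAt.const_smul (2 : ℝ)).add
      (hd.hasFDerivAt.clm_comp (hasFDerivAt_const (stdJ n) (chartC (n := n) x x)))).fderiv
    refine (congrArg (fun T : Cn n →L[ℝ] Cov n => T u v) h).trans ?_
    simp
  generalize fderiv ℝ (fun y => (2 : ℝ) • fderiv ℝ g y +
    (fderiv ℝ (logDet ω₀ x) y).comp (stdJ n)) (chartC (n := n) x x) = D at hD ⊢
  have hmem : -((2 * κ) • ω₀ x) ∈ degreePart n 2 :=
    Submodule.neg_mem _ (Submodule.smul_mem _ _ (hω.closed.degree x))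
  refine two_form_ext (isHom_toC (k := 2) (altR_mem _)) (isHom_toC (k := 2) hmem) fun u v => ?_
  refine (cint_altR (D : Cn n →ₗ[ℝ] Cov n) u v).trans ?_
  have h2 : D u v - D v u = -(2 * κ) * eval2 (ω₀ x) u v := by
    rw [← hess_eq_of_isEinstein hω hκ x u v, hD, hD, hgs v u]
    ring
  have h3 : eval2 (-((2 * κ) • ω₀ x)) u v = -(2 * κ) * eval2 (ω₀ x) u v := by
    rw [eval2, contr_form_neg, contr_form_smul, eval2]
    change -((2 * κ) * contr (ω₀ x) u v) = _
    ring
  rw [cint_cint_two_form hmem, h3, ← h2]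
  rfl

variable [MulAction (Fin m → Circle) M] {μ : M → Module.Dual ℝ (Fin m → ℝ)}

theorem contDiffAt_potVec (hT : IsKahlerTorusAction (m := m) ω₀) (hω : IsKahler ω₀)
    (lam : Fin m → Fin m → ℝ) (ζ : Fin m → Fin m → ℝ) (t : ℝ) {x₀ : M} {y : Cn n}
    (hy : y ∈ (chartC x₀).target) :
    ContDiffAt ℝ ∞ (fun z => potVec lam (fun i => fieldRep x₀ (ζ i) z) t
      (fun i => cdiv (fderiv ℝ (fieldRep x₀ (ζ i)) z)) (fderiv ℝ (logDet ω₀ x₀) z)) y := by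
  have hv := fun i => contDiffAt_fieldRep hT (ζ i) hy
  have hc : ∀ i, ContDiffAt ℝ ∞ (fun z => 2 * (cdiv (fderiv ℝ (fieldRep x₀ (ζ i)) z)).im -
      fderiv ℝ (logDet ω₀ x₀) z (stdJ n (fieldRep x₀ (ζ i) z))) y := by
    intro i
    have h1 : ContDiffAt ℝ ∞ (fderiv ℝ (fieldRep x₀ (ζ i))) y := (hv i).fderiv_right (by norm_cast)
    have h2 := contDiffAt_lin (Complex.imLm ∘ₗ cdivL n) h1
    refine (contDiffAt_const.mul h2).sub
      ((contDiffAt_fderiv_logDet hω hy).clm_apply (contDiffAt_const.clm_apply (hv i)))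
  exact (contDiffAt_const (c := t)).smul (ContDiffAt.sum fun i _ => ContDiffAt.sum fun j _ =>
    (contDiffAt_const (c := lam i j)).smul (((hc i).smul (hv j)).sub ((hc j).smul (hv i))))

/-- The defining equation of the generalized Ricci form, for an arbitrary trivialization. -/
theorem dForm_ricciPotential (hT : IsKahlerTorusAction (m := m) ω₀) (hω : IsKahler ω₀)
    (hμ : IsMomentMap ω₀ μ) {κ : ℝ} (hκ : IsEinstein ω₀ κ) (lam : Fin m → Fin m → ℝ)
    (ζ : Fin m → Fin m → ℝ) (t : ℝ) {U : Set M} {φ : M → CForm n} {η : M → GT n} {ρ : M → ℝ}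
    (h : IsTrivialization (deformedJ (n := n) lam (fun i => fundField (ζ i)) t)
      (deformedPsi ω₀ lam (fun i => fundField (ζ i)) t) U φ η ρ) {x : M} (hxU : x ∈ U) :
    ∃ Q ∈ degreePart n 2, dForm (ricciPotential (deformedJ (n := n) lam (fun i => fundField (ζ i)) t)
      (deformedPsi ω₀ lam (fun i => fundField (ζ i)) t) η ρ) x =
        (toC (-((2 * κ) • ω₀ x)) - Complex.I • toC Q) *
          conjF (deformedPsi ω₀ lam (fun i => fundField (ζ i)) t x) := by
  have hy := mem_extChartAt_target (I := 𝓘(ℝ, Cn n)) x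
  set y₀ := chartC (n := n) x x with hy₀
  have hxs : (chartC x).symm y₀ = x := extChartAt_to_inv x
  have hyU : (chartC x).symm y₀ ∈ U := by rwa [hxs]
  set b : M → RForm n := bField ω₀ lam ζ t with hb
  have hbc : IsClosedTwoForm b := isClosedTwoForm_bField hμ lam ζ t
  -- the coefficient of `φ` does not vanish, because `ρ` is positive
  have hc := contDiffAt_coefRep hT lam ζ t hy ((smoothForm_iff h.isOpen).mp h.smooth x y₀ hy hyU)
  have hC : coefRep lam ζ t x φ y₀ ≠ 0 := by
    intro h0
    have h1 := rho_eq_normSq hT hω hμ lam ζ t h (mem_extChartAt_source x) hxU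
    rw [h0, map_zero, zero_mul] at h1
    exact (h.rho_pos x hxU).ne' h1
  obtain ⟨a, g, ha, hg, hcag⟩ := exists_local_log hc hC
  have hE : ∀ᶠ y in nhds y₀, y ∈ (chartC x).target ∧ (chartC x).symm y ∈ U ∧
      DifferentiableAt ℝ a y ∧ DifferentiableAt ℝ g y ∧
      coefRep lam ζ t x φ =ᶠ[nhds y] fun z => coefRep lam ζ t x φ y₀ *
        Complex.exp (a z + g z * Complex.I) := by
    filter_upwards [(isOpen_inter_preimage_symm x h.isOpen).mem_nhds ⟨hy, hyU⟩,
      hcag.eventually_nhds, (ha.of_le (m := 1) (by norm_cast)).eventually (by simp),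
      (hg.of_le (m := 1) (by norm_cast)).eventually (by simp)] with y h1 h2 h3 h4
    exact ⟨h1.1, h1.2, h3.differentiableAt (by simp), h4.differentiableAt (by simp), h2⟩
  set X : Cn n → Cn n := fun z => potVec lam (fun i => fieldRep x (ζ i) z) t
      (fun i => cdiv (fderiv ℝ (fieldRep x (ζ i)) z)) (fderiv ℝ (logDet ω₀ x) z) with hX
  set θ : Cn n → Cov n := fun y => (2 : ℝ) • fderiv ℝ g y +
    (fderiv ℝ (logDet ω₀ x) y).comp (stdJ n) with hθ
  set S : Cn n → Cov n := fun y => contrLin n (toC (omegaRep ω₀ x y)) (X y) with hS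
  set Ψ : Cn n → CForm n := fun y => formRep x (fun x => conjF (nexp n (cplx2 (b x) (ω₀ x)))) y
    with hΨ
  have hΨs := contDiffAt_formRep_nexp hbc hω.closed hy
  have hΨd := hΨs.differentiableAt (by simp : (∞ : WithTop ℕ∞) ≠ 0)
  have hrep : formRep x (ricciPotential (deformedJ (n := n) lam (fun i => fundField (ζ i)) t)
      (deformedPsi ω₀ lam (fun i => fundField (ζ i)) t) η ρ) =ᶠ[nhds y₀]
      fun y => (ιc (θ y) + (-Complex.I) • ιc (S y)) * Ψ y := by
    filter_upwards [hE] with y hy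
    obtain ⟨hyt, hyU, hay, hgy, hcy⟩ := hy
    have hbm : pullR (dChartSymm x y) (b ((chartC x).symm y)) ∈ degreePart n 2 :=
      pullR_mem (hbc.degree _) _
    have hwm : omegaRep ω₀ x y ∈ degreePart n 2 := omegaRep_mem hω x y
    have e1 : Ψ y = nexp n (cplx2 (pullR (dChartSymm x y) (b ((chartC x).symm y)))
        (-omegaRep ω₀ x y)) := by
      simp only [hΨ]
      rw [formRep, conjF_nexp, conjF_cplx2, pullC_nexp, cplx2, cplx2, map_add, map_smul, map_neg,
        map_neg, map_neg, toC_omegaRep, formRep, pullC_toC]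
    have e2 : (fun x => conjF (deformedPsi ω₀ lam (fun i => fundField (ζ i)) t x)) =
        fun x => conjF (nexp n (cplx2 (b x) (ω₀ x))) := by
      funext x
      rw [deformedPsi_eq hT hω.closed hμ]
    have e3 := formRep_cliff hyt (fun x => -((2 : ℝ) • deformedJ lam (fun i => fundField (ζ i)) t x
      (η x)) + deformedJ lam (fun i => fundField (ζ i)) t x (0, dReal (fun y => Real.log (ρ y)) x))
      (fun x => conjF (deformedPsi ω₀ lam (fun i => fundField (ζ i)) t x))
    refine e3.trans ?_
    rw [gtRep_potential hT hω hμ lam ζ t h hyt hyU hC hay hgy hcy, e2]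
    change cliff (X y, θ y) (Ψ y) = _
    rw [e1, cliff_nexp hbm (Submodule.neg_mem _ hwm)]
    simp only [hX]
    rw [contr_potVec lam (fun k => contr_pullR_bField hT hμ lam ζ t hyt k), zero_add, contr_form_neg,
      map_neg]
    simp only [hS]
    rw [contrLin_toC hwm, contrC_apply, smul_neg, neg_smul]
  have hθd : DifferentiableAt ℝ θ y₀ := by
    have h1 : ContDiffAt ℝ ∞ (fderiv ℝ g) y₀ := hg.fderiv_right (by norm_cast)
    exact ((h1.differentiableAt (by simp)).const_smul (2 : ℝ)).add
      (((contDiffAt_fderiv_logDet hω hy).differentiableAt (by simp)).clm_comp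
        (differentiableAt_const _))
  have hw : DifferentiableAt ℝ (fun y => contrLin n (toC (omegaRep ω₀ x y))) y₀ :=
    differentiableAt_lin (G := Cn n →L[ℝ] Cov n) (contrLin n)
      ((contDiffAt_omegaRep hω hy).differentiableAt (by simp))
  have hSd : DifferentiableAt ℝ S y₀ := hw.clm_apply
      ((contDiffAt_potVec hT hω lam ζ t hy).differentiableAt (by simp))
  have hθ' : DifferentiableAt ℝ (fun z => ιc (θ z)) y₀ := differentiableAt_lin ιc hθd
  have hS' : DifferentiableAt ℝ (fun z => ιc (S z)) y₀ := differentiableAt_lin ιc hSd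
  have hΨe : Ψ = fun y => conjF (formRep x (fun x => nexp n (cplx2 (b x) (ω₀ x))) y) :=
    funext fun y => formRep_conjF x _ y
  have hΨd' : DifferentiableAt ℝ Ψ y₀ := by
    rw [hΨe]; exact differentiableAt_lin conjF.toLinearMap hΨd
  have hΨ0 : flatD Ψ y₀ = 0 := by
    have h1 : flatD (formRep x fun x => nexp n (cplx2 (b x) (ω₀ x))) y₀ = 0 :=
      dForm_nexp hbc hω.closed x
    rw [hΨe, flatD_conjF hΨd, h1, map_zero]
  refine ⟨altR (fderiv ℝ S y₀), altR_mem _, ?_⟩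
  rw [dForm, flatD_congr hrep, flatD_mul (hθ'.fun_add (differentiableAt_csmul_const _ hS')) hΨd', hΨ0,
    mul_zero, add_zero, flatD_add hθ' (differentiableAt_csmul_const _ hS'),
    flatD_csmul_const _ hS', flatD_ιc hθd, flatD_ιc hSd, toC_altR_eq hω hκ x hg,
    deformedPsi_eq hT hω.closed hμ, neg_smul, ← sub_eq_add_neg]
  congr 1
  exact formRep_self x _

theorem isGenKahlerEinstein_deformed (hT : IsKahlerTorusAction (m := m) ω₀) (hω : IsKahler ω₀)
    (hμ : IsMomentMap ω₀ μ) {κ : ℝ} (hκ : IsEinstein ω₀ κ) (lam : Fin m → Fin m → ℝ)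
    (ζ : Fin m → Fin m → ℝ) (t : ℝ) :
    IsGenKahlerEinstein (deformedJ (n := n) lam (fun i => fundField (ζ i)) t)
      (deformedPsi ω₀ lam (fun i => fundField (ζ i)) t) ω₀ (2 * κ) where
  exp_form := ⟨bField ω₀ lam ζ t, isClosedTwoForm_bField hμ lam ζ t,
    deformedPsi_eq hT hω.closed hμ lam ζ t⟩
  symplectic := hω.closed
  closed x := by
    have h : deformedPsi ω₀ lam (fun i => fundField (ζ i)) t = _ :=
      funext fun x => deformedPsi_eq hT hω.closed hμ lam ζ t x
    rw [h]
    exact dForm_nexp (isClosedTwoForm_bField hμ lam ζ t) hω.closed x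
  kahler := ⟨_, induces_deformedPsi hω lam ζ t, isGenKahler_deformed hT hω hμ lam ζ t⟩
  einstein :=
    { degree := fun x => Submodule.smul_mem _ _ (hω.closed.degree x)
      exists_trivialization := fun x => ⟨_, _, _, _, mem_extChartAt_source x,
        isTrivialization_stdSpinor hT hω hμ lam ζ t x⟩
      eq := fun U φ η ρ h => by
        classical
        refine ⟨fun x => if hx : x ∈ U then
          (dForm_ricciPotential hT hω hμ hκ lam ζ t h hx).choose else 0, fun x hx => ?_⟩
        simp only [dif_pos hx]
        exact (dForm_ricciPotential hT hω hμ hκ lam ζ t h hx).choose_spec }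

end

/-! ### Holomorphic functions of several variables -/

/-- A directional derivative of a holomorphic function of several variables is holomorphic: it is
given by Cauchy's integral over a circle in the direction `v`, and one differentiates under the
integral sign. -/
theorem differentiableAt_fderiv_apply {F : Cn n → ℂ} {S : Set (Cn n)} (hS : IsOpen S)
    (hF : DifferentiableOn ℂ F S) {y : Cn n} (hy : y ∈ S) (v : Cn n) :
    DifferentiableAt ℂ (fun z => fderiv ℂ F z v) y := by
  obtain ⟨R, hR, M, hball⟩ : ∃ R > 0, ∃ M : ℝ, ∀ z, dist z y < 3 * R → z ∈ S ∧ ‖F z‖ ≤ M := by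
    have h1 : ∀ᶠ z in nhds y, z ∈ S ∧ ‖F z‖ < ‖F y‖ + 1 :=
      Filter.Eventually.and (hS.mem_nhds hy)
        ((hF.differentiableAt (hS.mem_nhds hy)).continuousAt.norm.eventually
        (gt_mem_nhds (lt_add_one _)))
    obtain ⟨ε, hε, h⟩ := Metric.eventually_nhds_iff.mp h1
    refine ⟨ε / 3, by positivity, ‖F y‖ + 1, fun z hz => ?_⟩
    obtain ⟨h2, h3⟩ := h (by linarith : dist z y < ε)
    exact ⟨h2, h3.le⟩
  have hFd : ∀ z, dist z y < 3 * R → DifferentiableAt ℂ F z := fun z hz =>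
    hF.differentiableAt (hS.mem_nhds (hball z hz).1)
  -- Cauchy's estimate for the full derivative
  have hbound : ∀ w, dist w y < 2 * R → ‖fderiv ℂ F w‖ ≤ (2 * M) / R := by
    intro w hw
    have hb : ∀ z ∈ Metric.ball w R, dist z y < 3 * R := fun z hz => by
      have h1 := dist_triangle z w y
      have h2 := Metric.mem_ball.mp hz
      linarith
    refine Complex.norm_fderiv_le_div_of_mapsTo_ball
      (fun z hz => (hFd z (hb z hz)).differentiableWithinAt) (fun z hz => ?_) hR
    rw [Metric.mem_closedBall, dist_eq_norm]
    have h3 := norm_sub_le (F z) (F w)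
    have h4 := (hball z (hb z hz)).2
    have h5 := (hball w (hb w (Metric.mem_ball_self hR))).2
    linarith
  set r : ℝ := R / (‖v‖ + 1) with hr
  have hv1 : 0 < ‖v‖ + 1 := by positivity
  have hr0 : 0 < r := div_pos hR hv1
  have hrv : r * ‖v‖ ≤ R := by
    rw [hr, div_mul_eq_mul_div, div_le_iff₀ hv1]
    nlinarith [norm_nonneg v]
  have hdist : ∀ z ∈ Metric.ball y R, ∀ s : ℂ, ‖s‖ ≤ r → dist (z + s • v) y < 2 * R := by
    intro z hz s hs
    have h1 := dist_triangle (z + s • v) z y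
    have h2 : dist (z + s • v) z ≤ R := by
      rw [dist_eq_norm, add_sub_cancel_left, norm_smul]
      exact (mul_le_mul_of_nonneg_right hs (norm_nonneg v)).trans hrv
    have h3 := Metric.mem_ball.mp hz
    linarith
  have hc : ∀ θ, ‖circleMap 0 r θ‖ ≤ r := fun θ => by
    rw [norm_circleMap_zero, abs_of_pos hr0]
  set k : ℝ → ℂ := fun θ => deriv (circleMap 0 r) θ * (1 / (circleMap 0 r θ) ^ 2) with hk
  have hcirc : Continuous (circleMap 0 r) := continuous_circleMap 0 r
  have hkc : Continuous k := by
    refine Continuous.mul ?_ (continuous_const.div (hcirc.pow 2) fun θ =>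
      pow_ne_zero 2 (circleMap_ne_center hr0.ne'))
    rw [show deriv (circleMap 0 r) = fun θ => circleMap 0 r θ * Complex.I from
      funext fun θ => deriv_circleMap 0 r θ]
    exact (continuous_circleMap 0 r).mul continuous_const
  have hline : ∀ z, Continuous fun θ => z + circleMap 0 r θ • v := fun z =>
    continuous_const.add (hcirc.smul continuous_const)
  have hI := intervalIntegral.hasFDerivAt_integral_of_dominated_of_fderiv_le (𝕜 := ℂ)
    (μ := MeasureTheory.volume) (a := 0) (b := 2 * Real.pi)
    (F := fun z θ => k θ • F (z + circleMap 0 r θ • v))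
    (F' := fun z θ => k θ • fderiv ℂ F (z + circleMap 0 r θ • v)) (x₀ := y)
    (bound := fun θ => ‖k θ‖ * ((2 * M) / R)) (Metric.ball_mem_nhds y hR) ?_ ?_ ?_ ?_ ?_ ?_
  · have hCauchy : ∀ z ∈ Metric.ball y R, fderiv ℂ F z v = (2 * Real.pi * Complex.I)⁻¹ *
        ∫ θ in (0 : ℝ)..2 * Real.pi, k θ • F (z + circleMap 0 r θ • v) := by
      intro z hz
      have hl : ∀ s : ℂ, HasDerivAt (fun s : ℂ => z + s • v) v s := fun s => by
        simpa using ((hasDerivAt_id s).smul_const v).const_add z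
      have hd : ∀ s : ℂ, ‖s‖ ≤ r → HasDerivAt (fun s : ℂ => F (z + s • v))
          (fderiv ℂ F (z + s • v) v) s := fun s hs =>
        HasFDerivAt.comp_hasDerivAt s (hFd _ (by linarith [hdist z hz s hs])).hasFDerivAt (hl s)
      have h1 : ∮ s in C(0, r), (1 / (s - 0) ^ 2) • F (z + s • v) =
          (2 * Real.pi * Complex.I) • deriv (fun s : ℂ => F (z + s • v)) 0 :=
        DifferentiableOn.deriv_eq_smul_circleIntegral hr0 fun s hs =>
          (hd s (by simpa using hs)).differentiableAt.differentiableWithinAt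
      rw [(hd 0 (by simpa using hr0.le)).deriv, zero_smul, add_zero] at h1
      rw [eq_inv_mul_iff_mul_eq₀ Complex.two_pi_I_ne_zero, ← smul_eq_mul, ← h1, circleIntegral]
      refine intervalIntegral.integral_congr fun θ _ => ?_
      simp only [hk, sub_zero, smul_eq_mul, mul_assoc]
    have h2 := (hI.const_mul ((2 * Real.pi * Complex.I)⁻¹ : ℂ)).differentiableAt
    refine h2.congr_of_eventuallyEq ?_
    filter_upwards [Metric.ball_mem_nhds y hR] with z hz using hCauchy z hz
  · filter_upwards [Metric.ball_mem_nhds y hR] with z hz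
    refine (hkc.smul ?_).aestronglyMeasurable
    refine continuous_iff_continuousAt.mpr fun θ => ContinuousAt.comp (f := fun θ =>
      z + circleMap 0 r θ • v) ?_ (hline z).continuousAt
    exact (hFd _ (by linarith [hdist z hz _ (hc θ)])).continuousAt
  · refine (hkc.smul ?_).intervalIntegrable _ _
    refine continuous_iff_continuousAt.mpr fun θ => ContinuousAt.comp (f := fun θ =>
      y + circleMap 0 r θ • v) ?_ (hline y).continuousAt
    exact (hFd _ (by linarith [hdist y (Metric.mem_ball_self hR) _ (hc θ)])).continuousAt
  · exact (hkc.measurable.smul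
      ((measurable_fderiv ℂ F).comp (hline y).measurable)).aestronglyMeasurable
  · refine Filter.Eventually.of_forall fun θ _ z hz => ?_
    rw [norm_smul]
    exact mul_le_mul_of_nonneg_left (hbound _ (hdist z hz _ (hc θ))) (norm_nonneg _)
  · exact (hkc.norm.mul continuous_const).intervalIntegrable _ _
  · refine Filter.Eventually.of_forall fun θ _ z hz => ?_
    have h1 := (hFd _ (by linarith [hdist z hz _ (hc θ)])).hasFDerivAt
    exact ((HasFDerivAt.comp z h1 ((hasFDerivAt_id z).add_const _)).const_smul (k θ))

theorem differentiableAt_fderiv {F : Cn n → ℂ} {S : Set (Cn n)} (hS : IsOpen S)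
    (hF : DifferentiableOn ℂ F S) {y : Cn n} (hy : y ∈ S) : DifferentiableAt ℂ (fderiv ℂ F) y := by
  have h : fderiv ℂ F = fun z => ∑ j, (fderiv ℂ F z (Pi.single j 1)) •
      (ContinuousLinearMap.proj j : Cn n →L[ℂ] ℂ) := by
    funext z
    refine ContinuousLinearMap.ext fun v => ?_
    have h1 : ∀ i : Fin n, (fun j => if i = j then 1 else 0 : Cn n) = Pi.single i 1 := fun i => by
      funext j
      simp [Pi.single_apply, eq_comm]
    refine (LinearMap.pi_apply_eq_sum_univ (fderiv ℂ F z : Cn n →ₗ[ℂ] ℂ) v).trans ?_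
    simp [h1, mul_comm]
  rw [h]
  exact DifferentiableAt.fun_sum fun j _ =>
    (differentiableAt_fderiv_apply hS hF hy _).smul (differentiableAt_const _)

theorem fderiv_fderiv_symm {F : Cn n → ℂ} {S : Set (Cn n)} (hS : IsOpen S)
    (hF : DifferentiableOn ℂ F S) {y : Cn n} (hy : y ∈ S) (u v : Cn n) :
    fderiv ℂ (fderiv ℂ F) y u v = fderiv ℂ (fderiv ℂ F) y v u := by
  refine second_derivative_symmetric_of_eventually (f := F) ?_
    (differentiableAt_fderiv hS hF hy).hasFDerivAt u v
  filter_upwards [hS.mem_nhds hy] with z hz using (hF.differentiableAt (hS.mem_nhds hz)).hasFDerivAt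

/-! ### The holomorphic Poisson structure -/

/-- The skew-symmetric form `(x, y) ↦ ∑ λ_ij (x_i y_j - x_j y_i)` on `ℂᵐ`. -/
def skewForm (lam : Fin m → Fin m → ℝ) : (Fin m → ℂ) →ₗ[ℂ] (Fin m → ℂ) →ₗ[ℂ] ℂ :=
  LinearMap.mk₂ ℂ (fun x y => ∑ i, ∑ j, (lam i j : ℂ) * (x i * y j - x j * y i))
    (fun x x' y => by
      simp only [← Finset.sum_add_distrib]
      refine Finset.sum_congr rfl fun i _ => Finset.sum_congr rfl fun j _ => ?_
      simp only [Pi.add_apply]; ring)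
    (fun c x y => by
      simp only [Finset.smul_sum]
      refine Finset.sum_congr rfl fun i _ => Finset.sum_congr rfl fun j _ => ?_
      simp only [Pi.smul_apply, smul_eq_mul]; ring)
    (fun x y y' => by
      simp only [← Finset.sum_add_distrib]
      refine Finset.sum_congr rfl fun i _ => Finset.sum_congr rfl fun j _ => ?_
      simp only [Pi.add_apply]; ring)
    (fun c x y => by
      simp only [Finset.smul_sum]
      refine Finset.sum_congr rfl fun i _ => Finset.sum_congr rfl fun j _ => ?_
      simp only [Pi.smul_apply, smul_eq_mul]; ring)

theorem skewForm_apply (lam : Fin m → Fin m → ℝ) (x y : Fin m → ℂ) :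
    skewForm lam x y = ∑ i, ∑ j, (lam i j : ℂ) * (x i * y j - x j * y i) := rfl

theorem skewForm_skew (lam : Fin m → Fin m → ℝ) (x y : Fin m → ℂ) :
    skewForm lam x y = -skewForm lam y x := by
  simp only [skewForm_apply, ← Finset.sum_neg_distrib]
  refine Finset.sum_congr rfl fun i _ => Finset.sum_congr rfl fun j _ => ?_
  ring

theorem skewForm_expand (lam : Fin m → Fin m → ℝ) (x y : Fin m → ℂ) :
    skewForm lam x y = ∑ k, skewForm lam x (Pi.single k 1) * y k := by
  have h1 : ∀ i : Fin m, (fun j => if i = j then 1 else 0 : Fin m → ℂ) = Pi.single i 1 := fun i => by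
    funext j
    simp [Pi.single_apply, eq_comm]
  refine (LinearMap.pi_apply_eq_sum_univ (skewForm lam x) y).trans ?_
  simp only [h1, smul_eq_mul, mul_comm]

/-- The terms with second derivatives of one function cancel in the Jacobi identity for a Poisson
structure with constant coefficients. -/
theorem skewForm_jacobi (lam : Fin m → Fin m → ℝ) (x y : Fin m → ℂ) {G : Fin m → Fin m → ℂ}
    (hG : ∀ k l, G k l = G l k) :
    skewForm lam x (fun k => skewForm lam (G k) y) +
      skewForm lam y (fun k => skewForm lam x (G k)) = 0 := by
  have e1 : skewForm lam x (fun k => skewForm lam (G k) y) = -∑ k, ∑ l,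
      skewForm lam x (Pi.single k 1) * (skewForm lam y (Pi.single l 1) * G k l) := by
    rw [skewForm_expand, ← Finset.sum_neg_distrib]
    refine Finset.sum_congr rfl fun k _ => ?_
    rw [skewForm_skew lam (G k), skewForm_expand lam y, mul_neg, Finset.mul_sum]
  have e2 : skewForm lam y (fun k => skewForm lam x (G k)) = ∑ k, ∑ l,
      skewForm lam y (Pi.single k 1) * (skewForm lam x (Pi.single l 1) * G k l) := by
    rw [skewForm_expand]
    refine Finset.sum_congr rfl fun k _ => ?_
    rw [skewForm_expand lam x, Finset.mul_sum]
  rw [e1, e2, Finset.sum_comm, neg_add_eq_zero]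
  refine Finset.sum_congr rfl fun k _ => Finset.sum_congr rfl fun l _ => ?_
  rw [hG l k]
  ring

section Flat

variable {S : Set (Cn n)} {v : Fin m → Cn n → Cn n} {y : Cn n}

/-- The derivatives of `F` along the vector fields `v_i`. -/
def fieldDeriv (v : Fin m → Cn n → Cn n) (F : Cn n → ℂ) (y : Cn n) (i : Fin m) : ℂ :=
  fderiv ℂ F y (v i y)

theorem differentiableAt_fieldDeriv (hS : IsOpen S) {F : Cn n → ℂ} (hF : DifferentiableOn ℂ F S)
    (hy : y ∈ S) (hv : ∀ i, DifferentiableAt ℂ (v i) y) (i : Fin m) :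
    DifferentiableAt ℂ (fun z => fieldDeriv v F z i) y :=
  (differentiableAt_fderiv hS hF hy).clm_apply (hv i)

theorem differentiableAt_skewForm (lam : Fin m → Fin m → ℝ) {f g : Cn n → Fin m → ℂ}
    (hf : ∀ i, DifferentiableAt ℂ (fun z => f z i) y)
    (hg : ∀ i, DifferentiableAt ℂ (fun z => g z i) y) :
    DifferentiableAt ℂ (fun z => skewForm lam (f z) (g z)) y := by
  simp only [skewForm_apply]
  exact DifferentiableAt.fun_sum fun i _ => DifferentiableAt.fun_sum fun j _ =>
    (differentiableAt_const _).mul (((hf i).mul (hg j)).sub ((hf j).mul (hg i)))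

theorem fderiv_skewForm (lam : Fin m → Fin m → ℝ) {f g : Cn n → Fin m → ℂ}
    (hf : ∀ i, DifferentiableAt ℂ (fun z => f z i) y)
    (hg : ∀ i, DifferentiableAt ℂ (fun z => g z i) y) (w : Cn n) :
    fderiv ℂ (fun z => skewForm lam (f z) (g z)) y w =
      skewForm lam (fun i => fderiv ℂ (fun z => f z i) y w) (g y) +
        skewForm lam (f y) (fun i => fderiv ℂ (fun z => g z i) y w) := by
  simp only [skewForm_apply]
  have h : HasFDerivAt (fun z => ∑ i, ∑ j, (lam i j : ℂ) * (f z i * g z j - f z j * g z i)) _ y :=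
    HasFDerivAt.fun_sum fun i _ => HasFDerivAt.fun_sum fun j _ =>
      (((hf i).hasFDerivAt.mul (hg j).hasFDerivAt).sub
        ((hf j).hasFDerivAt.mul (hg i).hasFDerivAt)).const_mul (lam i j : ℂ)
  rw [h.fderiv, ← Finset.sum_add_distrib]
  simp only [sum_apply, ← Finset.sum_add_distrib]
  refine Finset.sum_congr rfl fun i _ => Finset.sum_congr rfl fun j _ => ?_
  simp only [smul_apply, sub_apply, add_apply, smul_eq_mul]
  ring

/-- The derivatives along commuting holomorphic vector fields commute. -/
theorem fieldDeriv_comm (hS : IsOpen S) {F : Cn n → ℂ} (hF : DifferentiableOn ℂ F S)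
    (hy : y ∈ S) (hv : ∀ i, DifferentiableAt ℂ (v i) y)
    (hcomm : ∀ i j, fderiv ℂ (v i) y (v j y) = fderiv ℂ (v j) y (v i y)) (i j : Fin m) :
    fderiv ℂ (fun z => fieldDeriv v F z i) y (v j y) =
      fderiv ℂ (fun z => fieldDeriv v F z j) y (v i y) := by
  have h : ∀ i w, fderiv ℂ (fun z => fieldDeriv v F z i) y w =
      fderiv ℂ F y (fderiv ℂ (v i) y w) + fderiv ℂ (fderiv ℂ F) y w (v i y) := fun i w => by
    have h1 := ((differentiableAt_fderiv hS hF hy).hasFDerivAt.clm_apply (hv i).hasFDerivAt).fderiv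
    refine (congrArg (fun T : Cn n →L[ℂ] ℂ => T w) h1).trans ?_
    simp
  rw [h, h, hcomm, fderiv_fderiv_symm hS hF hy]

/-- The Jacobi identity for the bracket defined by commuting holomorphic vector fields. -/
theorem jacobi_of_commute (hS : IsOpen S) (lam : Fin m → Fin m → ℝ)
    (hv : ∀ z ∈ S, ∀ i, DifferentiableAt ℂ (v i) z)
    (hcomm : ∀ z ∈ S, ∀ i j, fderiv ℂ (v i) z (v j z) = fderiv ℂ (v j) z (v i z))
    {F G H : Cn n → ℂ} (hF : DifferentiableOn ℂ F S) (hG : DifferentiableOn ℂ G S)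
    (hH : DifferentiableOn ℂ H S) (hy : y ∈ S) :
    skewForm lam (fieldDeriv v F y)
        (fieldDeriv v (fun z => skewForm lam (fieldDeriv v G z) (fieldDeriv v H z)) y) +
      skewForm lam (fieldDeriv v G y)
        (fieldDeriv v (fun z => skewForm lam (fieldDeriv v H z) (fieldDeriv v F z)) y) +
      skewForm lam (fieldDeriv v H y)
        (fieldDeriv v (fun z => skewForm lam (fieldDeriv v F z) (fieldDeriv v G z)) y) = 0 := by
  have hd : ∀ {F : Cn n → ℂ}, DifferentiableOn ℂ F S → ∀ i,
      DifferentiableAt ℂ (fun z => fieldDeriv v F z i) y := fun hF i =>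
    differentiableAt_fieldDeriv hS hF hy (hv y hy) i
  have e : ∀ {G H : Cn n → ℂ}, DifferentiableOn ℂ G S → DifferentiableOn ℂ H S →
      fieldDeriv v (fun z => skewForm lam (fieldDeriv v G z) (fieldDeriv v H z)) y =
        (fun k => skewForm lam (fun i => fderiv ℂ (fun z => fieldDeriv v G z i) y (v k y))
          (fieldDeriv v H y)) +
        fun k => skewForm lam (fieldDeriv v G y)
          (fun i => fderiv ℂ (fun z => fieldDeriv v H z i) y (v k y)) := fun hG hH =>
    funext fun k => fderiv_skewForm lam (hd hG) (hd hH) (v k y)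
  have hc : ∀ {F : Cn n → ℂ}, DifferentiableOn ℂ F S → ∀ k i,
      fderiv ℂ (fun z => fieldDeriv v F z i) y (v k y) =
        fderiv ℂ (fun z => fieldDeriv v F z k) y (v i y) := fun hF k i =>
    fieldDeriv_comm hS hF hy (hv y hy) (hcomm y hy) i k
  rw [e hG hH, e hH hF, e hF hG, map_add, map_add, map_add]
  have h1 := skewForm_jacobi lam (fieldDeriv v F y) (fieldDeriv v H y) (hc hG)
  have h2 := skewForm_jacobi lam (fieldDeriv v G y) (fieldDeriv v F y) (hc hH)
  have h3 := skewForm_jacobi lam (fieldDeriv v H y) (fieldDeriv v G y) (hc hF)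
  linear_combination h1 + h2 + h3

end Flat

section

variable {M : Type*} [TopologicalSpace M] [ChartedSpace (Cn n) M]

theorem dHol_self {f : M → ℂ} {x : M} (hf : MDifferentiableAt 𝓘(ℂ, Cn n) 𝓘(ℂ, ℂ) f x) :
    dHol (n := n) f x = fderiv ℂ (fun z => f ((chartC (n := n) x).symm z)) (chartC x x) := by
  have h := hf.mfderiv
  rw [dHol, h, modelWithCornersSelf_coe, Set.range_id, fderivWithin_univ]
  rfl

theorem differentiableAt_of_mdifferentiableAt {f : M → ℂ} {x : M}
    (hf : MDifferentiableAt 𝓘(ℂ, Cn n) 𝓘(ℂ, ℂ) f x) :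
    DifferentiableAt ℂ (fun z => f ((chartC (n := n) x).symm z)) (chartC x x) := by
  have h := ((mdifferentiableAt_iff f x).mp hf).2
  rw [modelWithCornersSelf_coe, Set.range_id, differentiableWithinAt_univ] at h
  exact h

theorem mdifferentiableAt_of_chart {f : M → ℂ} {x : M}
    (hf : DifferentiableAt ℂ (fun z => f ((chartC (n := n) x).symm z)) (chartC x x)) :
    MDifferentiableAt 𝓘(ℂ, Cn n) 𝓘(ℂ, ℂ) f x := by
  rw [mdifferentiableAt_iff]
  constructor
  · have h1 : ContinuousAt ((fun z => f ((chartC (n := n) x).symm z)) ∘ chartC (n := n) x) x :=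
      ContinuousAt.comp hf.continuousAt (continuousAt_extChartAt x)
    refine h1.congr ?_
    filter_upwards [(isOpen_extChartAt_source (I := 𝓘(ℝ, Cn n)) x).mem_nhds
      (mem_extChartAt_source x)] with x' hx'
    rw [Function.comp_apply, (chartC (n := n) x).left_inv hx']
  · rw [modelWithCornersSelf_coe, Set.range_id, differentiableWithinAt_univ]
    exact hf

variable [hM : IsManifold 𝓘(ℂ, Cn n) ∞ M]

theorem differentiableOn_chart {f : M → ℂ} {U : Set M}
    (hU : IsOpen U) (hf : MDifferentiableOn 𝓘(ℂ, Cn n) 𝓘(ℂ, ℂ) f U) (x₀ : M) :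
    DifferentiableOn ℂ (fun z => f ((chartC (n := n) x₀).symm z))
      ((chartC (n := n) x₀).target ∩ (chartC x₀).symm ⁻¹' U) := by
  intro y hy
  refine DifferentiableAt.differentiableWithinAt ?_
  set x := (chartC (n := n) x₀).symm y with hx
  have hyo : y ∈ overlap x₀ x := mem_overlap_self hy.1
  have h1 := differentiableAt_of_mdifferentiableAt ((hf x hy.2).mdifferentiableAt (hU.mem_nhds hy.2))
  have h2 := (contDiffAt_coordChange_complex hyo).differentiableAt (by simp : (∞ : WithTop ℕ∞) ≠ 0)
  refine (DifferentiableAt.comp (g := fun z => f ((chartC (n := n) x).symm z))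
    (f := coordChange x₀ x) y h1 h2).congr_of_eventuallyEq ?_
  filter_upwards [(isOpen_overlap x₀ x).mem_nhds hyo] with z hz
  rw [Function.comp_apply, symm_coordChange hz]

theorem dHol_chart {f : M → ℂ} {U : Set M} (hU : IsOpen U)
    (hf : MDifferentiableOn 𝓘(ℂ, Cn n) 𝓘(ℂ, ℂ) f U) {x₀ : M} {y : Cn n}
    (hy : y ∈ (chartC (n := n) x₀).target) (hyU : (chartC x₀).symm y ∈ U) (u : Cn n) :
    dHol (n := n) f ((chartC (n := n) x₀).symm y) u =
      fderiv ℂ (fun z => f ((chartC (n := n) x₀).symm z)) y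
        (dChart x₀ ((chartC (n := n) x₀).symm y) u) := by
  set x := (chartC (n := n) x₀).symm y with hx
  have hxs : x ∈ (chartC (n := n) x₀).source := (chartC x₀).map_target hy
  have hxo := mem_overlap_of_source hxs
  have hyx : coordChange x x₀ (chartC (n := n) x x) = y := by
    rw [coordChange, extChartAt_to_inv, hx, (chartC x₀).right_inv hy]
  have h1 := (differentiableOn_chart hU hf x₀).differentiableAt
    ((isOpen_inter_preimage_symm x₀ hU).mem_nhds ⟨hy, hyU⟩)
  have h2 := (contDiffAt_coordChange_complex hxo).differentiableAt (by simp : (∞ : WithTop ℕ∞) ≠ 0)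
  have h3 := (HasFDerivAt.comp (g := fun z => f ((chartC (n := n) x₀).symm z))
    (f := coordChange x x₀) (chartC (n := n) x x) (by rw [hyx]; exact h1.hasFDerivAt)
    h2.hasFDerivAt).fderiv
  have e : (fun z => f ((chartC (n := n) x).symm z)) =ᶠ[nhds (chartC (n := n) x x)]
      (fun z => f ((chartC (n := n) x₀).symm z)) ∘ coordChange x x₀ := by
    filter_upwards [(isOpen_overlap x x₀).mem_nhds hxo] with z hz
    rw [Function.comp_apply, symm_coordChange hz]
  rw [dHol_self ((hf x hyU).mdifferentiableAt (hU.mem_nhds hyU)), e.fderiv_eq, h3, dChart_eq hxs,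
    h2.fderiv_restrictScalars ℝ]
  rfl

variable [MulAction (Fin m → Circle) M] {ω₀ : M → RForm n}

theorem differentiableAt_complex_fieldRep (hT : IsKahlerTorusAction (m := m) ω₀) (ζ : Fin m → ℝ)
    {x₀ : M} {y : Cn n} (hy : y ∈ (chartC x₀).target) :
    DifferentiableAt ℂ (fieldRep x₀ ζ) y := by
  have hd := (contDiffAt_fieldRep hT ζ hy).differentiableAt (by simp : (∞ : WithTop ℕ∞) ≠ 0)
  refine (differentiableAt_iff_restrictScalars ℝ hd).mpr ⟨LinearMap.toContinuousLinearMap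
    { toFun := fderiv ℝ (fieldRep x₀ ζ) y
      map_add' := map_add _
      map_smul' := fun c w => ?_ }, ContinuousLinearMap.ext fun w => rfl⟩
  have h : c • w = c.re • w + c.im • stdJ n w := by
    rw [stdJ_apply]
    conv_lhs => rw [← Complex.re_add_im c]
    rw [add_smul, mul_smul]
    rfl
  rw [h, map_add, map_smul, map_smul, fderiv_fieldRep_stdJ hT ζ hy, stdJ_apply, RingHom.id_apply]
  conv_rhs => rw [← Complex.re_add_im c]
  rw [add_smul, mul_smul]
  rfl

theorem holBracket_chart (hT : IsKahlerTorusAction (m := m) ω₀) (lam : Fin m → Fin m → ℝ)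
    (ζ : Fin m → Fin m → ℝ) {f g : M → ℂ} {U : Set M} (hU : IsOpen U)
    (hf : MDifferentiableOn 𝓘(ℂ, Cn n) 𝓘(ℂ, ℂ) f U) (hg : MDifferentiableOn 𝓘(ℂ, Cn n) 𝓘(ℂ, ℂ) g U)
    {x₀ : M} {y : Cn n} (hy : y ∈ (chartC (n := n) x₀).target) (hyU : (chartC x₀).symm y ∈ U) :
    holBracket (n := n) lam (fun i => fundField (ζ i)) f g ((chartC (n := n) x₀).symm y) =
      skewForm lam
        (fieldDeriv (fun i => fieldRep x₀ (ζ i)) (fun z => f ((chartC (n := n) x₀).symm z)) y)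
        (fieldDeriv (fun i => fieldRep x₀ (ζ i)) (fun z => g ((chartC (n := n) x₀).symm z)) y) := by
  rw [holBracket, skewForm_apply]
  simp only [dHol_chart hU hf hy hyU, dHol_chart hU hg hy hyU, dChart_fundField hT _ hy, fieldDeriv]

theorem mdifferentiableOn_holBracket (hT : IsKahlerTorusAction (m := m) ω₀)
    (lam : Fin m → Fin m → ℝ) (ζ : Fin m → Fin m → ℝ) {f g : M → ℂ} {U : Set M} (hU : IsOpen U)
    (hf : MDifferentiableOn 𝓘(ℂ, Cn n) 𝓘(ℂ, ℂ) f U)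
    (hg : MDifferentiableOn 𝓘(ℂ, Cn n) 𝓘(ℂ, ℂ) g U) :
    MDifferentiableOn 𝓘(ℂ, Cn n) 𝓘(ℂ, ℂ)
      (holBracket (n := n) lam (fun i => fundField (ζ i)) f g) U := by
  intro x hxU
  refine (mdifferentiableAt_of_chart ?_).mdifferentiableWithinAt
  have hy := mem_extChartAt_target (I := 𝓘(ℝ, Cn n)) x
  have hyU : (chartC (n := n) x).symm (chartC x x) ∈ U := by rwa [extChartAt_to_inv]
  have hS := isOpen_inter_preimage_symm (n := n) x hU
  have hv := fun i => differentiableAt_complex_fieldRep hT (ζ i) hy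
  refine (differentiableAt_skewForm lam
    (differentiableAt_fieldDeriv hS (differentiableOn_chart hU hf x) ⟨hy, hyU⟩ hv)
    (differentiableAt_fieldDeriv hS (differentiableOn_chart hU hg x) ⟨hy, hyU⟩
      hv)).congr_of_eventuallyEq ?_
  filter_upwards [hS.mem_nhds ⟨hy, hyU⟩] with z hz using
    holBracket_chart hT lam ζ hU hf hg hz.1 hz.2

theorem isHolPoisson_fundField (hT : IsKahlerTorusAction (m := m) ω₀)
    (lam : Fin m → Fin m → ℝ) (ζ : Fin m → Fin m → ℝ) :
    IsHolPoisson (n := n) (M := M) lam (fun i => fundField (ζ i)) := by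
  intro U hU f g h hf hg hh
  refine ⟨mdifferentiableOn_holBracket hT lam ζ hU hf hg, fun x hxU => ?_⟩
  have hy := mem_extChartAt_target (I := 𝓘(ℝ, Cn n)) x
  have hxx : (chartC (n := n) x).symm (chartC x x) = x := extChartAt_to_inv x
  have hyU : (chartC (n := n) x).symm (chartC x x) ∈ U := by rwa [hxx]
  have hS := isOpen_inter_preimage_symm (n := n) x hU
  have hv : ∀ z ∈ (chartC (n := n) x).target ∩ (chartC x).symm ⁻¹' U, ∀ i,
      DifferentiableAt ℂ (fieldRep x (ζ i)) z := fun z hz i =>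
    differentiableAt_complex_fieldRep hT (ζ i) hz.1
  have hcomm : ∀ z ∈ (chartC (n := n) x).target ∩ (chartC x).symm ⁻¹' U, ∀ i j,
      fderiv ℂ (fieldRep x (ζ i)) z (fieldRep x (ζ j) z) =
        fderiv ℂ (fieldRep x (ζ j)) z (fieldRep x (ζ i) z) := fun z hz i j => by
    have h1 := fderiv_fieldRep_comm hT (ζ i) (ζ j) hz.1
    rw [(hv z hz i).fderiv_restrictScalars ℝ, (hv z hz j).fderiv_restrictScalars ℝ] at h1
    exact h1
  have e : ∀ {f g h : M → ℂ}, MDifferentiableOn 𝓘(ℂ, Cn n) 𝓘(ℂ, ℂ) f U →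
      MDifferentiableOn 𝓘(ℂ, Cn n) 𝓘(ℂ, ℂ) g U → MDifferentiableOn 𝓘(ℂ, Cn n) 𝓘(ℂ, ℂ) h U →
      holBracket (n := n) lam (fun i => fundField (ζ i)) f
          (holBracket (n := n) lam (fun i => fundField (ζ i)) g h) x =
        skewForm lam
          (fieldDeriv (fun i => fieldRep x (ζ i)) (fun z => f ((chartC (n := n) x).symm z))
            (chartC x x))
          (fieldDeriv (fun i => fieldRep x (ζ i)) (fun z => skewForm lam
            (fieldDeriv (fun i => fieldRep x (ζ i)) (fun z => g ((chartC (n := n) x).symm z)) z)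
            (fieldDeriv (fun i => fieldRep x (ζ i)) (fun z => h ((chartC (n := n) x).symm z)) z))
            (chartC x x)) := by
    intro f g h hf hg hh
    have h1 := holBracket_chart hT lam ζ hU hf (mdifferentiableOn_holBracket hT lam ζ hU hg hh) hy hyU
    rw [hxx] at h1
    rw [h1]
    congr 1
    funext i
    have h2 : (fun z => holBracket (n := n) lam (fun i => fundField (ζ i)) g h
        ((chartC (n := n) x).symm z)) =ᶠ[nhds (chartC x x)] fun z => skewForm lam
          (fieldDeriv (fun i => fieldRep x (ζ i)) (fun z => g ((chartC (n := n) x).symm z)) z)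
          (fieldDeriv (fun i => fieldRep x (ζ i)) (fun z => h ((chartC (n := n) x).symm z)) z) := by
      filter_upwards [hS.mem_nhds ⟨hy, hyU⟩] with z hz using
        holBracket_chart hT lam ζ hU hg hh hz.1 hz.2
    exact congrArg (fun T : Cn n →L[ℂ] ℂ => T _) h2.fderiv_eq
  rw [e hf hg hh, e hg hh hf, e hh hf hg]
  exact jacobi_of_commute hS lam hv hcomm (differentiableOn_chart hU hf x)
    (differentiableOn_chart hU hg x) (differentiableOn_chart hU hh x) ⟨hy, hyU⟩

end

/-! ### Nontriviality of the deformation -/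

theorem deformedJ_zero {M : Type*} (lam : Fin m → Fin m → ℝ) (V : Fin m → M → Cn n) (x : M) :
    deformedJ lam V 0 x = ofComplex (stdJ n) := by
  have h : ∀ a : GT n, adBiv lam (fun i => V i x) 0 a = a := fun a => by
    rw [adBiv_apply, zero_smul, add_zero]
  refine LinearMap.ext fun a => ?_
  change adBiv lam _ 0 (ofComplex (stdJ n) (adBiv lam _ (-0) a)) = _
  rw [neg_zero, h, h]

theorem deformedPsi_zero {M : Type*} (ω₀ : M → RForm n) (lam : Fin m → Fin m → ℝ)
    (V : Fin m → M → Cn n) (x : M) :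
    deformedPsi ω₀ lam V 0 x = nexp n (Complex.I • toC (ω₀ x)) := by
  rw [deformedPsi, Complex.ofReal_zero, zero_smul, nexp_zero, Module.End.one_apply]

/-- The vector part of `𝒥_{βt}` on covectors is `-t (J β + β J*)`. -/
theorem adConj_ofComplex_cov (lam : Fin m → Fin m → ℝ) (v : Fin m → Cn n) (t : ℝ) (ξ : Cov n) :
    (adConj lam v t (ofComplex (stdJ n)) (0, ξ)).1 =
      -(t • (stdJ n (bivSharp lam v ξ) + bivSharp lam v (ξ.comp (stdJ n)))) := by
  simp only [adConj_apply, adBiv_apply, ofComplex_apply, zero_add, map_neg, map_smul, neg_smul,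
    smul_neg, smul_add, neg_add]

/-- The span of the `v_i` is isotropic, hence contains no complex line; so a bivector in the `v_i`
does not commute with `J`, unless it vanishes. -/
theorem bivSharp_eq_zero_of_anticomm {ω₀ : RForm n}
    (hpos : ∀ u, u ≠ 0 → 0 < eval2 ω₀ (stdJ n u) u) {v : Fin m → Cn n}
    (hiso : ∀ i j, eval2 ω₀ (v i) (v j) = 0) {lam : Fin m → Fin m → ℝ}
    (h : ∀ ξ : Cov n, stdJ n (bivSharp lam v ξ) + bivSharp lam v (ξ.comp (stdJ n)) = 0) :
    bivSharp lam v = 0 := by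
  have h1 : ∀ ξ η : Cov n, eval2 ω₀ (bivSharp lam v ξ) (bivSharp lam v η) = 0 := by
    intro ξ η
    have hiso' : ∀ i j, contrL ω₀ (v i) (v j) = 0 := hiso
    change contrL ω₀ (bivSharp lam v ξ) (bivSharp lam v η) = 0
    simp only [bivSharp_apply, map_sum, map_smul, map_sub, sum_apply,
      smul_apply, sub_apply, hiso', smul_zero, sub_zero,
      Finset.sum_const_zero]
  refine LinearMap.ext fun ξ => ?_
  by_contra h0
  have h2 := hpos _ h0
  rw [eq_neg_of_add_eq_zero_left (h ξ), eval2_neg_left, h1, neg_zero] at h2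
  exact lt_irrefl _ h2

section

variable {M : Type*} [TopologicalSpace M] [ChartedSpace (Cn n) M]

theorem mfderiv_diffeo_injective (F : M ≃ₘ^∞⟮𝓘(ℝ, Cn n), 𝓘(ℝ, Cn n)⟯ M) (x : M) :
    Function.Injective (mfderiv 𝓘(ℝ, Cn n) 𝓘(ℝ, Cn n) F x : Cn n →L[ℝ] Cn n) :=
  (F.mfderivToContinuousLinearEquiv (by simp) x).injective

theorem not_genEquivalent [hM : IsManifold 𝓘(ℂ, Cn n) ∞ M] [MulAction (Fin m → Circle) M]
    {ω₀ : M → RForm n} {μ : M → Module.Dual ℝ (Fin m → ℝ)}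
    (hT : IsKahlerTorusAction (m := m) ω₀) (hω : IsKahler ω₀) (hμ : IsMomentMap ω₀ μ)
    (lam : Fin m → Fin m → ℝ) (ζ : Fin m → Fin m → ℝ)
    (hβ : ∃ x, bivSharp lam (fun i => fundField (n := n) (M := M) (ζ i) x) ≠ 0) {t : ℝ} (ht : t ≠ 0)
    (J' : M → Cn n →L[ℝ] Cn n) :
    ¬ GenEquivalent (deformedJ (n := n) lam (fun i => fundField (ζ i)) t)
      (fun x => ofComplex (J' x)) := by
  rintro ⟨F, b, -, h⟩
  obtain ⟨x, hx⟩ := hβ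
  refine hx (bivSharp_eq_zero_of_anticomm (hω.pos x)
    (fun i j => isotropic hT hμ (ζ i) (ζ j) x) fun ξ => ?_)
  -- `𝒥_{J'}` preserves the covectors, and so does the equivalence
  have h1 := congrArg Prod.fst (h x (0, ξ))
  have h2 : (mfderiv 𝓘(ℝ, Cn n) 𝓘(ℝ, Cn n) F x : Cn n →L[ℝ] Cn n)
      (deformedJ lam (fun i => fundField (ζ i)) t x (0, ξ)).1 = 0 := by
    refine h1.symm.trans ?_
    change J' (F x) ((mfderiv 𝓘(ℝ, Cn n) 𝓘(ℝ, Cn n) F x : Cn n →L[ℝ] Cn n) 0) = 0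
    exact (congrArg (J' (F x)) (map_zero _)).trans (map_zero (J' (F x)))
  have h3 : (deformedJ lam (fun i => fundField (ζ i)) t x (0, ξ)).1 = 0 :=
    mfderiv_diffeo_injective F x (h2.trans (map_zero _).symm)
  have h4 := (adConj_ofComplex_cov lam (fun i => fundField (ζ i) x) t ξ).symm.trans h3
  exact (smul_eq_zero.mp (neg_eq_zero.mp h4)).resolve_left ht

end

end GKE

end

theorem mainTheorem5 (n m : ℕ) (hm : 2 ≤ m) {M : Type*} [TopologicalSpace M] [T2Space M]
    [SecondCountableTopology M] [ChartedSpace (Cn n) M] [IsManifold 𝓘(ℂ, Cn n) ∞ M]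
    (ω₀ : M → RForm n) (hω : IsKahler ω₀) (κ : ℝ) (hκ : IsEinstein ω₀ κ)
    [MulAction (Fin m → Circle) M] (hT : IsKahlerTorusAction (m := m) ω₀)
    (μ : M → Module.Dual ℝ (Fin m → ℝ)) (hμ : IsMomentMap ω₀ μ)
    (ξ : Module.Basis (Fin m) ℝ (Fin m → ℝ)) (lam : Fin m → Fin m → ℝ)
    (V : Fin m → M → Cn n) (hV : ∀ i x, V i x = fundField (ξ i) x)
    (hβ : ∃ x, bivSharp lam (fun i => V i x) ≠ 0) :
    IsHolPoisson lam V ∧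
    (∀ x, deformedJ lam V 0 x = ofComplex (stdJ n) ∧
      deformedPsi ω₀ lam V 0 x = nexp n (Complex.I • toC (ω₀ x))) ∧
    (∀ t : ℝ, IsPoissonDeformation lam V t (deformedJ lam V t) ∧
      IsGenKahlerEinstein (deformedJ lam V t) (deformedPsi ω₀ lam V t) ω₀ (2 * κ)) ∧
    (∀ t : ℝ, t ≠ 0 → ∀ J' : M → Cn n →L[ℝ] Cn n, (∀ x u, J' x (J' x u) = -u) →
      ¬ GenEquivalent (deformedJ lam V t) (fun x => ofComplex (J' x))) := by
  obtain rfl : V = fun i => fundField (ξ i) := funext fun i => funext (hV i)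
  exact ⟨isHolPoisson_fundField hT lam ξ,
    fun x => ⟨deformedJ_zero lam _ x, deformedPsi_zero ω₀ lam _ x⟩,
    fun t => ⟨isPoissonDeformation_deformedJ lam ξ t,
      isGenKahlerEinstein_deformed hT hω hμ hκ lam ξ t⟩,
    fun t ht J' _ => not_genEquivalent hT hω hμ lam ξ hβ ht J'⟩
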